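/- Let $n\ge 2$, let $(y^0,y^1,\dots,y^n)$ be the coordinates of $\mathbf R^{n+1}$, $r^2=\sum_{i\ge1}(y^i)^2$, and $C_O=\{y^0=r\}$ the cone with vertex $O=0$; for $0<T\le\infty$ let $C_O^T$ be its part $0<r<T$, parametrised by $y\in\mathbf R^n$, $0<|y|<T$. Let $\eta=-(dy^0)^2+\sum_i (dy^i)^2$ be the Minkowski metric. Use the coordinates $x^0=r-y^0$, $x^1=r$ and $x^A$ ($A=1,\dots,n-1$) arbitrary local coordinates on $S^{n-1}$; $s_{AB}$ is the round metric of $S^{n-1}$, and $\hat S^A_{BC}$ are its Christoffel symbols. An overline denotes restriction to the cone. **Gauge.** For a metric $g$, $H^\lambda=g^{\alpha\beta}(\Gamma^\lambda_{\alpha\beta}-\hat\Gamma^\lambda_{\alpha\beta})$, with $\Gamma,\hat\Gamma$ the Christoffel symbols of $g,\eta$. $D$ is the covariant derivative of $\eta$. The reduced Ricci tensor is $R^{(H)}_{\alpha\beta}=R_{\alpha\beta}-\frac12(g_{\alpha\lambda}D_\beta H^\lambda+g_{\beta\lambda}D_\alpha H^\lambda)$, and $S_{\alpha\beta}=R_{\alpha\beta}-\frac12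 R\,g_{\alpha\beta}$. The traces on the cone are written $$\bar g=\bar g_{00}(dx^0)^2+2\nu_0dx^0dx^1+2\nu_Adx^0dx^A+\tilde g,\qquad \tilde g=\bar g_{AB}dx^Adx^B,$$ with $\tilde g$ positive definite on the spheres, $\nu_0>0$ and $\nu^0=1/\nu_0$; indices $A,B,\dots$ are moved with $\tilde g$, whose Christoffel symbols, covariant derivative and scalar curvature are $\tilde\Gamma,\tilde\nabla,\tilde R$. **Constraint operators.** Put $\chi_A{}^B=\frac12\bar g^{BC}\partial_1\bar g_{AC}$, $\tau=\chi_A{}^A$, $\sigma_A{}^B=\chi_A{}^B-\frac{\tau}{n-1}\delta_A^B$, $|\sigma|^2=\sigma_A{}^B\sigma_B{}^A$ (so $\sigma$ depends only on the conformal class of $\tilde g$), $\bar W^0=\bar W^1=-r\bar g^{AB}s_{AB}$, $\bar W_1=\nu_0\bar W^0$, $\kappa=\nu^0\partial_1\nu_0-\frac12(\bar W_1+\tau)$, $\bar g^{11}=(\nu^0)^2(\nu^A\nu_A-\bar g_{00})$, $$\xi_A=-2\nu^0\partial_1\nu_A+4\nu^0\nu_B\chi_A{}^B+\Big(\bar W^0-\frac{2\nu^0}{r}\Big)\nu_A+\bar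 g_{AB}\bar g^{CE}(\hat S^B_{CE}-\tilde\Gamma^B_{CE}),\qquad \zeta=2\partial_1\bar g^{11}+(2\kappa+\tau)\bar g^{11}+2\bar W^1 .$$ Then $$\mathcal C_1=-\partial_1\tau-\frac{\tau^2}{n-1}+\tau\kappa-|\sigma|^2,\qquad \mathcal C_A=-\tfrac12(\partial_1\xi_A+\tau\xi_A)+\tilde\nabla_B\chi_A{}^B-\partial_A(\tau+\kappa),$$ $$\mathcal C_0=-\tfrac12\nu_0\Big(\partial_1\zeta+(\tau+\kappa)\zeta+\tilde R-\tfrac12\xi_A\xi^A+\tilde\nabla_A\xi^A\Big).$$ **Free data** on $C_O^T$: a smooth field of quadratic forms $\gamma=\gamma_{AB}dx^Adx^B$, positive definite on the spheres, which in polar coordinates is smooth up to the vertex and agrees there with the Minkowski cone: $\gamma_{AB}=r^2f_{AB}(r,x)$, where $f$ (equivalently, the Cartesian components of $\gamma$ as functions of $r\ge0$ and of the direction) is smooth for $r\ge0$ and $f_{AB}(0,x)=s_{AB}$. A **solution of the constraints on $C_O^{T}$ with free data $\gamma$** consists of functions $\tau,\varphi,\nu_0,\bar g_{00}$ and a covector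 field $\nu_Adx^A$, all smooth on $C_O^T$, such that, with $|\sigma|^2$ that of $\gamma$: * $\tau>0$, $\partial_1\tau+\frac{\tau^2}{n-1}+|\sigma|^2=0$ and $\frac{n-1}r-\tau\to0$ at $O$; * $\varphi>0$, $\partial_1\log\varphi=\frac1{n-1}\big(\tau-\partial_1\log\sqrt{\det\gamma}\big)$ and $\varphi\to1$ at $O$; $\tilde g=\varphi^2\gamma$; * $\nu_0>0$, $\nu^0\partial_1\nu_0-\frac12(\bar W_1+\tau)=0$ and $\nu_0\to1$ at $O$; * at $O$, the Cartesian components (on $C_O$ parametrised by $y\in\mathbf R^n$) of the covector field $\nu=\nu_Adx^A$ and of $r\partial_1\nu$ tend to $0$, and so do $\bar g_{00}+1$ and $r\,\partial_1\bar g_{00}$; * $\mathcal C_1=0$, $\mathcal C_A=0$, $\mathcal C_0=0$, and $\bar g$ is Lorentzian on $C_O^T$. **Claims.** 1. For all free data $\gamma$ on $C_O^T$ ($0<T\le\infty$) there is $T_0\in(0,T]$ such that the constraints have a solution on $C_O^{T_0}$. 2. The solution is global if $\int_0^\infty r^2|\sigma|^2dr$ is small: for all $K$ and $r_0>0$ there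 is $\varepsilon>0$, depending only on $n,K,r_0$, such that for all free data on $C_O$ with $|\sigma|^2\le K$ for $0<r<r_0$ and $\int_0^\infty r^2|\sigma|^2dr\le\varepsilon$ along every generator, the constraints have a solution on all of $C_O\setminus\{O\}$. 3. The equations after the one for $\tau$ are solvable as long as $\tau>0$: if $\gamma$ is free data on $C_O^T$, $T'\le T$, and $\tau$ is as in the first item on $C_O^{T'}$, then $\varphi,\nu_0,\nu_A,\bar g_{00}$ exist on $C_O^{T'}$ such that all items hold. Moreover the smooth nowhere zero solution $\nu_0$ of its equation with $\nu_0\to1$ at $O$ is unique. 4. Let $g$ be a smooth metric on a neighbourhood of $C_O^T$ with a trace $\bar g$ of the above form. Then $\bar S_{11}=\mathcal C_1-\frac12\tau\bar H_1$; if $\bar H_1=0$, then $\bar S_{1A}=\mathcal C_A-\frac12(\partial_1\bar H_A+\tau\bar H_A)$; if moreover $\bar H_A=0$, $\mathcal C_1=0$, $\mathcal C_A=0$, then $\bar S_{01}=\mathcal C_0-\partial_1\bar H_0+\frac12(\bar W_1-\tau)\bar H_0$. If in addition $R^{(H)}_{\alpha\beta}=0$ on $C_O^T$, then $\bar H$ satisfies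 in turn homogeneous linear transport equations: if $\mathcal C_1=0$, then $D_1\bar H^0+\frac12\tau\bar H^0=0$; if $\bar H_1=0$ and $\mathcal C_A=0$, then $2\partial_1\bar H_A-2\chi_A{}^B\bar H_B+(\tau+\frac1r)\bar H_A-r\nu_0s_{AB}\bar g^{BC}\bar H_C=0$; if $\bar H_1=0$, $\bar H_A=0$, $\mathcal C_1=0$, $\mathcal C_A=0$, $\mathcal C_0=0$, then $\partial_1\bar H_0=\frac12(\bar W_1-\tau+\frac{n-1}r)\bar H_0$. 5. If, moreover, $g$ is smooth in a neighbourhood of $C_O^T\cup\{O\}$, $g(O)=\eta$, $\bar g$ satisfies $\mathcal C_1=0$, $\mathcal C_A=0$, $\mathcal C_0=0$ on $C_O^T$, and $R^{(H)}_{\alpha\beta}=0$ on $C_O^T$, then $\bar H=0$ on $C_O^T$. -/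

import Mathlib

open scoped ContDiff Topology ENNReal

noncomputable section

namespace NullCone

/-! ### Pseudo-Riemannian geometry in coordinates -/

section Coordinates

variable {ι : Type} [Fintype ι] [DecidableEq ι]

/-- Partial derivative `∂_i f`. -/
def pd (i : ι) (f : (ι → ℝ) → ℝ) (x : ι → ℝ) : ℝ :=
  fderiv ℝ f x (Pi.single i 1)

/-- Christoffel symbols `Γ^l_{ab}` of the metric `g`. -/
def christoffel (g : (ι → ℝ) → Matrix ι ι ℝ) (l a b : ι) (x : ι → ℝ) : ℝ :=
  (1 / 2) * ∑ k, (g x)⁻¹ l k *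
    (pd a (fun z => g z k b) x + pd b (fun z => g z k a) x - pd k (fun z => g z a b) x)

/-- Ricci tensor
`R_{ab} = ∂_l Γ^l_{ab} - ∂_b Γ^l_{al} + Γ^l_{lk} Γ^k_{ab} - Γ^l_{bk} Γ^k_{al}`. -/
def ricci (g : (ι → ℝ) → Matrix ι ι ℝ) (a b : ι) (x : ι → ℝ) : ℝ :=
  ∑ l, (pd l (christoffel g l a b) x - pd b (christoffel g l a l) x)
    + ∑ l, ∑ k, (christoffel g l l k x * christoffel g k a b x
        - christoffel g l b k x * christoffel g k a l x)

/-- Scalar curvature. -/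
def scalarCurv (g : (ι → ℝ) → Matrix ι ι ℝ) (x : ι → ℝ) : ℝ :=
  ∑ a, ∑ b, (g x)⁻¹ a b * ricci g a b x

/-- Einstein tensor `S_{ab} = R_{ab} - R g_{ab} / 2`. -/
def einstein (g : (ι → ℝ) → Matrix ι ι ℝ) (a b : ι) (x : ι → ℝ) : ℝ :=
  ricci g a b x - (1 / 2) * g x a b * scalarCurv g x

/-- Wave-gauge vector `H^l = g^{ab} (Γ^l_{ab} - Γ̂^l_{ab})` of `g` relative to the target `ĝ`. -/
def waveGauge (g ghat : (ι → ℝ) → Matrix ι ι ℝ) (l : ι) (x : ι → ℝ) : ℝ :=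
  ∑ a, ∑ b, (g x)⁻¹ a b * (christoffel g l a b x - christoffel ghat l a b x)

/-- The wave-gauge vector with its index lowered by `g`. -/
def waveGaugeLow (g ghat : (ι → ℝ) → Matrix ι ι ℝ) (l : ι) (x : ι → ℝ) : ℝ :=
  ∑ k, g x l k * waveGauge g ghat k x

/-- `D̂_b H^l = ∂_b H^l + Γ̂^l_{bk} H^k`, the covariant derivative in the target metric `ĝ`. -/
def covGauge (g ghat : (ι → ℝ) → Matrix ι ι ℝ) (b l : ι) (x : ι → ℝ) : ℝ :=
  pd b (waveGauge g ghat l) x + ∑ k, christoffel ghat l b k x * waveGauge g ghat k x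

/-- Reduced Ricci tensor
`R^{(H)}_{ab} = R_{ab} - (g_{al} D̂_b H^l + g_{bl} D̂_a H^l) / 2`. -/
def reducedRicci (g ghat : (ι → ℝ) → Matrix ι ι ℝ) (a b : ι) (x : ι → ℝ) : ℝ :=
  ricci g a b x
    - (1 / 2) * ∑ l, (g x a l * covGauge g ghat b l x + g x b l * covGauge g ghat a l x)

end Coordinates

/-! ### The cone, charts of the sphere, and adapted null coordinates -/

/-- Space `ℝ^n`, `n = m + 1`. The punctured cone `C_O \ {O}` is parametrised by
`y ∈ ℝ^n \ {0}`, through `y ↦ (‖y‖, y)`. -/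
abbrev Space (m : ℕ) : Type := EuclideanSpace ℝ (Fin (m + 1))

/-- Spacetime `ℝ^{n+1}`, with points `(y⁰, (y¹, …, yⁿ))`. -/
abbrev Spacetime (m : ℕ) : Type := ℝ × Space m

/-- Bilinear forms. -/
abbrev Form (V : Type) [NormedAddCommGroup V] [NormedSpace ℝ V] : Type := V →L[ℝ] V →L[ℝ] ℝ

/-- Euclidean inner product as a bilinear form. -/
def euclid (m : ℕ) : Form (Space m) := innerSL ℝ

/-- Minkowski metric `-(dy⁰)² + ∑ (dyⁱ)²`. -/
def minkowski (m : ℕ) : Form (Spacetime m) :=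
  (euclid m).bilinearComp (ContinuousLinearMap.snd ℝ ℝ (Space m))
      (ContinuousLinearMap.snd ℝ ℝ (Space m))
    - (ContinuousLinearMap.mul ℝ ℝ).bilinearComp (ContinuousLinearMap.fst ℝ ℝ (Space m))
      (ContinuousLinearMap.fst ℝ ℝ (Space m))

theorem minkowski_apply (m : ℕ) (X Y : Spacetime m) :
    minkowski m X Y = inner ℝ X.2 Y.2 - X.1 * Y.1 := by
  simp only [minkowski, euclid, sub_apply,
    ContinuousLinearMap.bilinearComp_apply, ContinuousLinearMap.mul_apply']
  rfl

/-- A symmetric bilinear form has signature `(-, +, …, +)`. -/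
def IsLorentz {V : Type} [Zero V] (B : V → V → ℝ) : Prop :=
  ∃ u, B u u < 0 ∧ ∀ v, v ≠ 0 → B u v = 0 → 0 < B v v

/-- The part `0 < r < T` of the cone (`T = ∞` is allowed). -/
def cone (m : ℕ) (T : ℝ≥0∞) : Set (Space m) := {y | y ≠ 0 ∧ ENNReal.ofReal ‖y‖ < T}

/-- Local coordinates `x^A`, `A = 1, …, m`, on the unit sphere `S^{n-1}` of `ℝ^n`, `n = m + 1`,
given by the inverse `θ` of the coordinate map. -/
structure SphereChart (m : ℕ) where
  dom : Set (Fin m → ℝ)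
  isOpen_dom : IsOpen dom
  θ : (Fin m → ℝ) → Space m
  smooth : ContDiffOn ℝ ∞ θ dom
  norm_eq : ∀ x ∈ dom, ‖θ x‖ = 1
  injOn : Set.InjOn θ dom
  immersion : ∀ x ∈ dom, Function.Injective (fderiv ℝ θ x)

/-- Coordinates `(x⁰, x¹, x^A)`: `Sum.inl 0`, `Sum.inl 1`, `Sum.inr A`. -/
abbrev Idx (m : ℕ) : Type := Fin 2 ⊕ Fin m

/-- The index `0` of the adapted coordinates. -/
abbrev i0 {m : ℕ} : Idx m := Sum.inl 0

/-- The index `1` of the adapted coordinates. -/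
abbrev i1 {m : ℕ} : Idx m := Sum.inl 1

namespace SphereChart

variable {m : ℕ} (c : SphereChart m)

/-- The vector `∂θ/∂x^A`. -/
def frame (x : Fin m → ℝ) (A : Fin m) : Space m := fderiv ℝ c.θ x (Pi.single A 1)

/-- Round metric `s_{AB}` of the unit sphere. -/
def round (x : Fin m → ℝ) : Matrix (Fin m) (Fin m) ℝ :=
  Matrix.of fun A B => inner ℝ (c.frame x A) (c.frame x B)

/-- Components `h_{AB}(r, x)` of a field of bilinear forms on the cone, in the coordinates
`(r, x^A) ↦ y = r θ(x)`. -/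
def comp2 (h : Space m → Form (Space m)) (r : ℝ) (x : Fin m → ℝ) : Matrix (Fin m) (Fin m) ℝ :=
  Matrix.of fun A B => h (r • c.θ x) (r • c.frame x A) (r • c.frame x B)

/-- Components `w_A(r, x)` of a field of covectors on the cone. -/
def comp1 (w : Space m → (Space m →L[ℝ] ℝ)) (r : ℝ) (x : Fin m → ℝ) (A : Fin m) : ℝ :=
  w (r • c.θ x) (r • c.frame x A)

/-- A function on the cone in the coordinates `(r, x^A)`. -/
def comp0 (f : Space m → ℝ) (r : ℝ) (x : Fin m → ℝ) : ℝ := f (r • c.θ x)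

/-- The adapted coordinates `x⁰ = r - y⁰`, `x¹ = r`, `x^A`; this is the map `x ↦ y`. -/
def adapted (X : Idx m → ℝ) : Spacetime m :=
  (X i1 - X i0, X i1 • c.θ (fun A => X (Sum.inr A)))

/-- Components of a spacetime metric in the adapted coordinates. -/
def metric (g : Spacetime m → Form (Spacetime m)) (X : Idx m → ℝ) : Matrix (Idx m) (Idx m) ℝ :=
  Matrix.of fun μ ν => g (c.adapted X)
    (fderiv ℝ c.adapted X (Pi.single μ 1)) (fderiv ℝ c.adapted X (Pi.single ν 1))

/-- Components of the Minkowski target metric in the adapted coordinates. -/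
def eta (X : Idx m → ℝ) : Matrix (Idx m) (Idx m) ℝ := c.metric (fun _ => minkowski m) X

/-- A statement holds at all points `(r, x^A)` of the part of the cone `0 < r < T` covered by the
chart. -/
def OnCone (T : ℝ≥0∞) (P : ℝ → (Fin m → ℝ) → Prop) : Prop :=
  ∀ x ∈ c.dom, ∀ r : ℝ, 0 < r → ENNReal.ofReal r < T → P r x

end SphereChart

/-- The point `(x⁰, x¹, x^A) = (0, r, x^A)` of the cone. -/
def onC {m : ℕ} (r : ℝ) (x : Fin m → ℝ) : Idx m → ℝ := Sum.elim ![0, r] x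

/-! ### Extrinsic geometry of the cone

Here `h` stands for the components `h_{AB}(r, x)` of a family of Riemannian metrics. -/

section Extrinsic

variable {m : ℕ} (h : ℝ → (Fin m → ℝ) → Matrix (Fin m) (Fin m) ℝ)

/-- `χ_A^B = h^{BC} ∂₁ h_{AC} / 2`. -/
def chi (r : ℝ) (x : Fin m → ℝ) (A B : Fin m) : ℝ :=
  (1 / 2) * ∑ C, (h r x)⁻¹ B C * deriv (fun s => h s x A C) r

/-- `τ = χ_A^A = h^{AB} ∂₁ h_{AB} / 2`. -/
def meanCurv (r : ℝ) (x : Fin m → ℝ) : ℝ := ∑ A, chi h r x A A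

/-- `σ_A^B`, the traceless part of `χ_A^B`. It depends only on the conformal class of `h`. -/
def shear (r : ℝ) (x : Fin m → ℝ) (A B : Fin m) : ℝ :=
  chi h r x A B - if A = B then meanCurv h r x / m else 0

/-- `|σ|² = σ_A^B σ_B^A`. -/
def shearSq (r : ℝ) (x : Fin m → ℝ) : ℝ := ∑ A, ∑ B, shear h r x A B * shear h r x B A

end Extrinsic

/-! ### The trace of the metric on the cone and the constraint operators -/

/-- The trace
`ḡ = g₀₀ (dx⁰)² + 2 ν₀ dx⁰ dx¹ + 2 ν_A dx⁰ dx^A + g̃_{AB} dx^A dx^B`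
on the cone of a spacetime metric. -/
structure ConeMetric (m : ℕ) where
  gt : Space m → Form (Space m)
  nu0 : Space m → ℝ
  nu : Space m → (Space m →L[ℝ] ℝ)
  g00 : Space m → ℝ

namespace ConeMetric

variable {m : ℕ} (D : ConeMetric m)

/-- `dx¹ = dr` at the point `(‖y‖, y)`. -/
def dx1 (y : Space m) (X : Spacetime m) : ℝ := inner ℝ y X.2 / ‖y‖

/-- `dx⁰ = dr - dy⁰` at the point `(‖y‖, y)`. -/
def dx0 (y : Space m) (X : Spacetime m) : ℝ := dx1 y X - X.1

/-- `ḡ` as a bilinear form on spacetime vectors at the point `(‖y‖, y)`. -/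
def form (y : Space m) (X Y : Spacetime m) : ℝ :=
  D.g00 y * (dx0 y X * dx0 y Y) + D.nu0 y * (dx0 y X * dx1 y Y + dx1 y X * dx0 y Y)
    + (dx0 y X * D.nu y Y.2 + dx0 y Y * D.nu y X.2) + D.gt y X.2 Y.2

/-- Algebraic conditions: `g̃` and `ν_A dx^A` are tensors on the spheres (they annihilate the radial
direction), `g̃` is symmetric and positive on tangent vectors of the spheres, `ν₀ > 0`. -/
structure IsMetric (T : ℝ≥0∞) : Prop where
  symm : ∀ y ∈ cone m T, ∀ v w, D.gt y v w = D.gt y w v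
  radial : ∀ y ∈ cone m T, D.gt y y = 0
  pos : ∀ y ∈ cone m T, ∀ v, v ≠ 0 → inner ℝ y v = 0 → 0 < D.gt y v v
  nu0_pos : ∀ y ∈ cone m T, 0 < D.nu0 y
  nu_radial : ∀ y ∈ cone m T, D.nu y y = 0

variable (c : SphereChart m)

/-- `W̄⁰ = -r g^{AB} s_{AB}` for the Minkowski target; also `W̄¹ = W̄⁰` and `W̄₁ = ν₀ W̄⁰`. -/
def W0 (r : ℝ) (x : Fin m → ℝ) : ℝ :=
  -r * ∑ A, ∑ B, (c.comp2 D.gt r x)⁻¹ A B * c.round x A B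

/-- `W̄₁ = ν₀ W̄⁰`. -/
def W1 (r : ℝ) (x : Fin m → ℝ) : ℝ := c.comp0 D.nu0 r x * D.W0 c r x

/-- `τ` of the metric `g̃`. -/
def tau (r : ℝ) (x : Fin m → ℝ) : ℝ := meanCurv (c.comp2 D.gt) r x

/-- `κ = ν⁰ ∂₁ ν₀ - (W̄₁ + τ) / 2`, where `ν⁰ = 1 / ν₀`. -/
def kappa (r : ℝ) (x : Fin m → ℝ) : ℝ :=
  (c.comp0 D.nu0 r x)⁻¹ * deriv (fun s => c.comp0 D.nu0 s x) r
    - (1 / 2) * (D.W1 c r x + D.tau c r x)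

/-- `𝒞₁ = -∂₁τ - τ²/(n-1) + τ (ν⁰ ∂₁ ν₀ - (W̄₁ + τ)/2) - |σ|²`. -/
def C1 (r : ℝ) (x : Fin m → ℝ) : ℝ :=
  -deriv (fun s => D.tau c s x) r - D.tau c r x ^ 2 / m + D.tau c r x * D.kappa c r x
    - shearSq (c.comp2 D.gt) r x

/-- `ξ_A = -2 ν⁰ ∂₁ν_A + 4 ν⁰ ν_B χ_A^B + (W̄⁰ - 2 ν⁰ / r) ν_A
  + g_{AB} g^{CE} (Ŝ^B_{CE} - Γ̃^B_{CE})`,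
with `Ŝ` and `Γ̃` the Christoffel symbols of the round metric and of `g̃`. -/
def xi (r : ℝ) (x : Fin m → ℝ) (A : Fin m) : ℝ :=
  -2 * (c.comp0 D.nu0 r x)⁻¹ * deriv (fun s => c.comp1 D.nu s x A) r
    + 4 * (c.comp0 D.nu0 r x)⁻¹ * ∑ B, c.comp1 D.nu r x B * chi (c.comp2 D.gt) r x A B
    + (D.W0 c r x - 2 / r * (c.comp0 D.nu0 r x)⁻¹) * c.comp1 D.nu r x A
    + ∑ B, ∑ C, ∑ E, c.comp2 D.gt r x A B * (c.comp2 D.gt r x)⁻¹ C E *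
        (christoffel c.round B C E x - christoffel (c.comp2 D.gt r) B C E x)

/-- `𝒞_A = -(∂₁ ξ_A + τ ξ_A)/2 + ∇̃_B χ_A^B - ∂_A (τ + κ)`. -/
def CA (r : ℝ) (x : Fin m → ℝ) (A : Fin m) : ℝ :=
  -(1 / 2) * (deriv (fun s => D.xi c s x A) r + D.tau c r x * D.xi c r x A)
    + (∑ B, pd B (fun z => chi (c.comp2 D.gt) r z A B) x
      + ∑ B, ∑ C, (christoffel (c.comp2 D.gt r) B B C x * chi (c.comp2 D.gt) r x A C
          - christoffel (c.comp2 D.gt r) C B A x * chi (c.comp2 D.gt) r x C B))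
    - pd A (fun z => D.tau c r z + D.kappa c r z) x

/-- `ξ^A = g^{AB} ξ_B`. -/
def xiUp (r : ℝ) (x : Fin m → ℝ) (A : Fin m) : ℝ :=
  ∑ B, (c.comp2 D.gt r x)⁻¹ A B * D.xi c r x B

/-- `ḡ¹¹ = (ν⁰)² (ν^A ν_A - ḡ₀₀)`. -/
def g11 (r : ℝ) (x : Fin m → ℝ) : ℝ :=
  (c.comp0 D.nu0 r x)⁻¹ ^ 2 *
    (∑ A, ∑ B, (c.comp2 D.gt r x)⁻¹ A B * c.comp1 D.nu r x A * c.comp1 D.nu r x B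
      - c.comp0 D.g00 r x)

/-- `ζ = 2 ∂₁ḡ¹¹ + (2 κ + τ) ḡ¹¹ + 2 W̄¹`. -/
def zeta (r : ℝ) (x : Fin m → ℝ) : ℝ :=
  2 * deriv (fun s => D.g11 c s x) r
    + (2 * D.kappa c r x + D.tau c r x) * D.g11 c r x + 2 * D.W0 c r x

/-- `𝒞₀ = -ν₀ (∂₁ζ + (τ + κ) ζ + R̃ - ξ_A ξ^A / 2 + ∇̃_A ξ^A) / 2`. -/
def C0 (r : ℝ) (x : Fin m → ℝ) : ℝ :=
  -(1 / 2) * c.comp0 D.nu0 r x *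
    (deriv (fun s => D.zeta c s x) r + (D.tau c r x + D.kappa c r x) * D.zeta c r x
      + scalarCurv (c.comp2 D.gt r) x
      - (1 / 2) * ∑ A, D.xi c r x A * D.xiUp c r x A
      + (∑ A, pd A (fun z => D.xiUp c r z A) x
        + ∑ A, ∑ B, christoffel (c.comp2 D.gt r) A A B x * D.xiUp c r x B))

/-- `ḡ` satisfies the wave-map-gauge constraints `𝒞₁ = 0`, `𝒞_A = 0`, `𝒞₀ = 0`. -/
def SatisfiesConstraints (T : ℝ≥0∞) : Prop :=
  ∀ c : SphereChart m,
    c.OnCone T (fun r x => D.C1 c r x = 0) ∧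
    c.OnCone T (fun r x => ∀ A, D.CA c r x A = 0) ∧
    c.OnCone T (fun r x => D.C0 c r x = 0)

end ConeMetric

/-! ### Free data and solutions of the hierarchy -/

/-- Free data on the part `0 < r < T` of the cone: a smooth field `γ = γ_{AB} dx^A dx^B` of
degenerate quadratic forms, with kernel the radial direction and positive on the spheres, which in
polar coordinates is smooth up to the vertex, where it agrees with the Minkowski
cone: `γ_{AB}(r, x) = r² f_{AB}(r, x)`, `f` smooth for `r ≥ 0`, `f_{AB}(0, x) = s_{AB}(x)`. -/
structure IsFreeData {m : ℕ} (T : ℝ≥0∞) (γ : Space m → Form (Space m)) : Prop where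
  smooth : ContDiffOn ℝ ∞ γ (cone m T)
  symm : ∀ y ∈ cone m T, ∀ v w, γ y v w = γ y w v
  radial : ∀ y ∈ cone m T, γ y y = 0
  pos : ∀ y ∈ cone m T, ∀ v, v ≠ 0 → inner ℝ y v = 0 → 0 < γ y v v
  vertex : ∃ F : ℝ × Space m → Form (Space m),
    ContDiffOn ℝ ∞ F {p | 0 ≤ p.1 ∧ p.2 ≠ 0 ∧ ENNReal.ofReal (p.1 * ‖p.2‖) < T} ∧
    (∀ r v, 0 < r → r • v ∈ cone m T → F (r, v) = γ (r • v)) ∧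
    ∀ v, v ≠ 0 → ∀ w w', inner ℝ v w = 0 → inner ℝ v w' = 0 → F (0, v) w w' = inner ℝ w w'

section Hierarchy

variable {m : ℕ} (T : ℝ≥0∞)

/-- `τ` is a smooth positive solution of `∂₁τ + τ²/(n-1) + |σ|² = 0` such that
`(n-1)/r - τ` tends to zero at the vertex. -/
structure IsExpansion (γ : Space m → Form (Space m)) (τ : Space m → ℝ) : Prop where
  smooth : ContDiffOn ℝ ∞ τ (cone m T)
  pos : ∀ y ∈ cone m T, 0 < τ y
  vertex : Filter.Tendsto (fun y => (m : ℝ) / ‖y‖ - τ y) (𝓝[≠] 0) (𝓝 0)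
  eqn : ∀ c : SphereChart m, c.OnCone T fun r x =>
    deriv (fun s => c.comp0 τ s x) r + c.comp0 τ r x ^ 2 / m + shearSq (c.comp2 γ) r x = 0

/-- `φ` is a smooth positive solution of `∂₁ log φ = (τ - ∂₁ log √(det γ)) / (n-1)`, with value `1`
at the vertex. -/
structure IsConformalFactor (γ : Space m → Form (Space m)) (τ φ : Space m → ℝ) : Prop where
  smooth : ContDiffOn ℝ ∞ φ (cone m T)
  pos : ∀ y ∈ cone m T, 0 < φ y
  vertex : Filter.Tendsto φ (𝓝[≠] 0) (𝓝 1)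
  eqn : ∀ c : SphereChart m, c.OnCone T fun r x =>
    deriv (fun s => Real.log (c.comp0 φ s x)) r =
      (1 / (m : ℝ)) * (c.comp0 τ r x
        - deriv (fun s => Real.log (Real.sqrt (c.comp2 γ s x).det)) r)

/-- `ν₀ = D.nu0` is a smooth solution of `ν⁰ ∂₁ν₀ - (W̄₁ + τ)/2 = 0`, with value `1` at the
vertex. -/
structure IsNuZero (τ : Space m → ℝ) (D : ConeMetric m) : Prop where
  smooth : ContDiffOn ℝ ∞ D.nu0 (cone m T)
  ne_zero : ∀ y ∈ cone m T, D.nu0 y ≠ 0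
  vertex : Filter.Tendsto D.nu0 (𝓝[≠] 0) (𝓝 1)
  eqn : ∀ c : SphereChart m, c.OnCone T fun r x =>
    (c.comp0 D.nu0 r x)⁻¹ * deriv (fun s => c.comp0 D.nu0 s x) r
      - (1 / 2) * (D.W1 c r x + c.comp0 τ r x) = 0

/-- `τ`, `φ` and `D = (g̃, ν₀, ν_A, ḡ₀₀)` solve on `0 < r < T` the hierarchy of
constraints with free data `γ`, with the regular behaviour at the vertex; the trace `ḡ` so
obtained is Lorentzian and satisfies the constraints.

`fderiv ℝ f y y` is the radial derivative `r ∂₁ f` at `y`. -/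
structure IsSolution (γ : Space m → Form (Space m)) (τ φ : Space m → ℝ) (D : ConeMetric m) :
    Prop where
  expansion : IsExpansion T γ τ
  conformal : IsConformalFactor T γ τ φ
  gt_eq : ∀ y ∈ cone m T, D.gt y = φ y ^ 2 • γ y
  nuZero : IsNuZero T τ D
  nu_smooth : ContDiffOn ℝ ∞ D.nu (cone m T)
  nu_vertex : Filter.Tendsto D.nu (𝓝[≠] 0) (𝓝 0)
  nu_vertex' : Filter.Tendsto (fun y => fderiv ℝ D.nu y y) (𝓝[≠] 0) (𝓝 0)
  g00_smooth : ContDiffOn ℝ ∞ D.g00 (cone m T)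
  g00_vertex : Filter.Tendsto (fun y => D.g00 y + 1) (𝓝[≠] 0) (𝓝 0)
  g00_vertex' : Filter.Tendsto (fun y => fderiv ℝ D.g00 y y) (𝓝[≠] 0) (𝓝 0)
  isMetric : D.IsMetric T
  lorentz : ∀ y ∈ cone m T, IsLorentz (D.form y)
  constraints : D.SatisfiesConstraints T

end Hierarchy

/-! ### Spacetime metrics with a given trace on the cone -/

section Spacetime

variable {m : ℕ} (T : ℝ≥0∞) (U : Set (Spacetime m)) (g : Spacetime m → Form (Spacetime m))
  (D : ConeMetric m) (c : SphereChart m)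

/-- `g` is a smooth metric on the neighbourhood `U` of the part `0 < r < T` of the
cone `y⁰ = r`, with trace `ḡ` on it. -/
structure HasTrace : Prop where
  isMetric : D.IsMetric T
  isOpen : IsOpen U
  subset : ∀ y ∈ cone m T, (‖y‖, y) ∈ U
  smooth : ContDiffOn ℝ ∞ g U
  symm : ∀ p ∈ U, ∀ X Y, g p X Y = g p Y X
  trace : ∀ y ∈ cone m T, ∀ X Y, g (‖y‖, y) X Y = D.form y X Y

/-- The reduced vacuum Einstein equations `R^{(H)}_{αβ} = 0` on the cone, in the adapted
coordinates of `c`. -/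
def ReducedEinsteinOnCone : Prop :=
  c.OnCone T fun r x => ∀ α β, reducedRicci (c.metric g) c.eta α β (onC r x) = 0

/-- `H̄_α` on the cone in the adapted coordinates. -/
def Hlow (α : Idx m) (r : ℝ) (x : Fin m → ℝ) : ℝ :=
  waveGaugeLow (c.metric g) c.eta α (onC r x)

/-- `𝓛₁ = -τ H̄₁ / 2`. -/
def L1 (r : ℝ) (x : Fin m → ℝ) : ℝ := -(1 / 2) * D.tau c r x * Hlow g c i1 r x

/-- `𝓛_A = -(∂₁H̄_A + τ H̄_A)/2`. -/
def LA (r : ℝ) (x : Fin m → ℝ) (A : Fin m) : ℝ :=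
  -(1 / 2) * (deriv (fun s => Hlow g c (Sum.inr A) s x) r
    + D.tau c r x * Hlow g c (Sum.inr A) r x)

/-- `𝓛₀ = -∂₁H̄₀ + (W̄₁ - τ) H̄₀ / 2`. -/
def L0 (r : ℝ) (x : Fin m → ℝ) : ℝ :=
  -deriv (fun s => Hlow g c i0 s x) r
    + (1 / 2) * (D.W1 c r x - D.tau c r x) * Hlow g c i0 r x

/-- The component `S̄_{α1} = S̄_{αβ} ℓ^β` on the cone of the Einstein tensor, `ℓ = ∂/∂x¹`. -/
def S1 (α : Idx m) (r : ℝ) (x : Fin m → ℝ) : ℝ := einstein (c.metric g) α i1 (onC r x)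

/-- The decomposition `S̄_{α1} = 𝒞_α + 𝓛_α`, component after component, in the chart `c`. -/
def Decomposition : Prop :=
  c.OnCone T (fun r x => S1 g c i1 r x = D.C1 c r x + L1 g D c r x) ∧
  (c.OnCone T (fun r x => Hlow g c i1 r x = 0) →
    c.OnCone T (fun r x => ∀ A, S1 g c (Sum.inr A) r x = D.CA c r x A + LA g D c r x A)) ∧
  (c.OnCone T (fun r x => Hlow g c i1 r x = 0) →
    c.OnCone T (fun r x => ∀ A, Hlow g c (Sum.inr A) r x = 0) →
    c.OnCone T (fun r x => D.C1 c r x = 0) →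
    c.OnCone T (fun r x => ∀ A, D.CA c r x A = 0) →
    c.OnCone T (fun r x => S1 g c i0 r x = D.C0 c r x + L0 g D c r x))

/-- The homogeneous linear transport equations for `H̄`, in turn:
`D₁H̄⁰ + τ H̄⁰ / 2 = 0`, then (when `H̄₁ = 0`)
`2 ∂₁H̄_A - 2 χ_A^B H̄_B + (τ + 1/r) H̄_A - r ν₀ s_{AB} g^{BC} H̄_C = 0`, then
(when `H̄₁ = 0`, `H̄_A = 0`) `∂₁H̄₀ = (W̄₁ - τ + (n-1)/r) H̄₀ / 2`. -/
def Transport : Prop :=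
  (c.OnCone T (fun r x => D.C1 c r x = 0) →
    c.OnCone T (fun r x => covGauge (c.metric g) c.eta i1 i0 (onC r x)
      + (1 / 2) * D.tau c r x * waveGauge (c.metric g) c.eta i0 (onC r x) = 0)) ∧
  (c.OnCone T (fun r x => Hlow g c i1 r x = 0) →
    c.OnCone T (fun r x => ∀ A, D.CA c r x A = 0) →
    c.OnCone T (fun r x => ∀ A,
      2 * deriv (fun s => Hlow g c (Sum.inr A) s x) r
        - 2 * ∑ B, chi (c.comp2 D.gt) r x A B * Hlow g c (Sum.inr B) r x
        + (D.tau c r x + 1 / r) * Hlow g c (Sum.inr A) r x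
        - r * c.comp0 D.nu0 r x * ∑ B, ∑ C, c.round x A B * (c.comp2 D.gt r x)⁻¹ B C *
            Hlow g c (Sum.inr C) r x = 0)) ∧
  (c.OnCone T (fun r x => Hlow g c i1 r x = 0) →
    c.OnCone T (fun r x => ∀ A, Hlow g c (Sum.inr A) r x = 0) →
    c.OnCone T (fun r x => D.C1 c r x = 0) →
    c.OnCone T (fun r x => ∀ A, D.CA c r x A = 0) →
    c.OnCone T (fun r x => D.C0 c r x = 0) →
    c.OnCone T (fun r x => deriv (fun s => Hlow g c i0 s x) r
      = (1 / 2) * (D.W1 c r x - D.tau c r x + m / r) * Hlow g c i0 r x))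

end Spacetime

end NullCone

end

open NullCone

/-!
The proof has a geometric and an analytic half; here `m = n - 1`.

The curvature of any metric for which `x⁰ = 0` is a null hypersurface is computed on it. After a
change of coordinates which is the identity on the cone (`transMap`) the transversal vector `∂₀` is
null and orthogonal to the spheres, and `R₁₁`, `R_{A1}` and `g^{AB} R_{AB}` become the equations of
Raychaudhuri, of Damour–Navier–Stokes, and of the transversal expansion; the remaining components
follow from tensoriality of the Ricci tensor. The gauge vector expresses `Γ¹₁₁`, `Γ¹_{1A}` and
`g^{AB} Γ¹_{AB}` through `κ`, `ξ_A`, `ζ` and `H`, which turns these equations into the constraint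
operators plus terms linear in `H` (`HasTrace.decomposition`). With `R^{(H)} = 0` the same identities
are transport equations for `H` (`HasTrace.transport`). They are singular linear systems
`w' = N w - m w / 2r` with bounded `N`, where `w` has a limit at the vertex because `g` is smooth
there, so that `r^m |w|²` satisfies a Gronwall inequality and vanishes
(`eq_zero_of_linear`, `HasTrace.waveGauge_eq_zero`).

In the converse direction the constraints, with `κ = 0`, are linear equations
`r y' + (k + 1) / 2 y + l r t y = F` along the generators, to be solved in turn for `1 / ν₀`, `ξ_A`,
`ν^A / ν₀`, `ζ`, `g¹¹` (`IsExpansion.exists_solution`). A function is smooth up to the vertex if it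
extends smoothly to `r = ρ²`, `ρ` real (`VSmooth`); the regular solutions are the integrals
`∫₀¹ 2 s^k f(s² r) ds` (`euler`), which preserve this class, and solutions in charts are glued over
the graph charts of half-spheres (`exists_scalarField`). The limit of `ζ` at the vertex needs the
scalar curvature of the round sphere, which is read off from the flatness of Minkowski space
(`scalarCurv_round`). The expansion is `τ = m u' / u` with `u'' = -|σ|² u / m`, solved by a Volterra
series (`radialSol`). Since `u' ≥ 1 - ∫ r |σ|² / m`, it is positive near the vertex, and globally if
`|σ|²` is bounded near the vertex and `∫ r² |σ|²` is small (`radialSol_pos`,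
`IsVMetric.exists_expansion_local`, `exists_expansion_global`).
-/

namespace NullCone

noncomputable section

set_option linter.unusedSectionVars false
open SphereChart
open Sum (inr)
open Filter (Tendsto eventually_all)
open Set (Ioc Icc)
open Finset (mul_sum sum_mul sum_comm sum_add_distrib sum_sub_distrib univ mem_univ sum_const_zero
  smul_sum sum_neg_distrib sum_ite_eq)
open Matrix (of of_apply mul_apply one_apply mulVec_mulVec det_mul mul_nonsing_inv nonsing_inv_mul
  transpose_apply)
open ENNReal (ofReal)
local notation "Γ" => christoffel
variable {m : ℕ} {T : ℝ≥0∞} {c : SphereChart m} {r : ℝ} {x : Fin m → ℝ}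
-- The current point of the cone, and the statement that it lies over the chart.
local notation "𝔭" => onC r x
local notation "onCone" => (r, x) ∈ c.coneDom T
local notation "ConeFn" m:max => ℝ → (Fin m → ℝ) → ℝ
local notation "ConePt" m:max => ℝ × (Fin m → ℝ)
local notation "SForm" m:max => Space m → Form (Space m)
local notation "𝕄" ι:max => (ι → ℝ) → Matrix ι ι ℝ

/-! ### Partial derivatives of functions and matrices -/

lemma sum_ext {ι M : Type} [Fintype ι] [AddCommMonoid M] {f g : ι → M} (h : ∀ i, f i = g i) :
    ∑ i, f i = ∑ i, g i := Fintype.sum_congr _ _ h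

lemma sum_ext₂ {ι κ M : Type} [Fintype ι] [Fintype κ] [AddCommMonoid M] {f g : ι → κ → M}
    (h : ∀ i j, f i j = g i j) : ∑ i, ∑ j, f i j = ∑ i, ∑ j, g i j := sum_ext fun i => sum_ext (h i)

lemma sum_swap {ι κ M : Type} [Fintype ι] [Fintype κ] [AddCommMonoid M] {f : ι → κ → M} {g : κ → M}
    (h : ∀ j, ∑ i, f i j = g j) : ∑ i, ∑ j, f i j = ∑ j, g j := sum_comm.trans (sum_ext h)

section CoordinateCalculus

variable {ι κ l o : Type} [Fintype ι] [DecidableEq ι] [Fintype κ] [Fintype l] [Fintype o]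

/-- `f` is smooth on a neighbourhood of `x`. -/
def SmoothNear (f : (ι → ℝ) → ℝ) (x : ι → ℝ) : Prop := ∀ᶠ y in 𝓝 x, ContDiffAt ℝ ∞ f y

/-- All entries of a matrix-valued function are smooth on a neighbourhood of `x`. -/
def MatSmoothNear (M : (ι → ℝ) → Matrix κ l ℝ) (x : ι → ℝ) : Prop :=
  ∀ i j, SmoothNear (fun y => M y i j) x

/-- Entrywise partial derivative of a matrix-valued function. -/
def pdMat (a : ι) (M : (ι → ℝ) → Matrix κ l ℝ) (x : ι → ℝ) : Matrix κ l ℝ :=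
  of fun i j => pd a (fun y => M y i j) x

namespace SmoothNear

variable {f g : (ι → ℝ) → ℝ} {x : ι → ℝ}

lemma contDiffAt (h : SmoothNear f x) : ContDiffAt ℝ ∞ f x := h.self_of_nhds

lemma differentiableAt (h : SmoothNear f x) : DifferentiableAt ℝ f x :=
  h.contDiffAt.differentiableAt (by simp)

lemma eventually (h : SmoothNear f x) : ∀ᶠ y in 𝓝 x, SmoothNear f y := eventually_eventually_nhds.2 h

lemma const (a : ℝ) : SmoothNear (fun _ : ι → ℝ => a) x := .of_forall fun _ => contDiffAt_const

lemma add (hf : SmoothNear f x) (hg : SmoothNear g x) : SmoothNear (fun y => f y + g y) x := by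
  filter_upwards [hf, hg] with y h1 h2 using h1.add h2

lemma sub (hf : SmoothNear f x) (hg : SmoothNear g x) : SmoothNear (fun y => f y - g y) x := by
  filter_upwards [hf, hg] with y h1 h2 using h1.sub h2

lemma mul (hf : SmoothNear f x) (hg : SmoothNear g x) : SmoothNear (fun y => f y * g y) x := by
  filter_upwards [hf, hg] with y h1 h2 using h1.mul h2

lemma inv (hf : SmoothNear f x) (h0 : f x ≠ 0) : SmoothNear (fun y => (f y)⁻¹) x := by
  filter_upwards [hf, hf.contDiffAt.continuousAt.eventually_ne h0] with y h1 h2 using h1.inv h2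

lemma sum {α : Type} [Fintype α] {F : α → (ι → ℝ) → ℝ} (h : ∀ i, SmoothNear (F i) x) :
    SmoothNear (fun y => ∑ i, F i y) x := by
  filter_upwards [Filter.eventually_all.2 h] with y hy using ContDiffAt.sum fun i _ => hy i

lemma prod {α : Type} [Fintype α] {F : α → (ι → ℝ) → ℝ} (h : ∀ i, SmoothNear (F i) x) :
    SmoothNear (fun y => ∏ i, F i y) x := by
  filter_upwards [Filter.eventually_all.2 h] with y hy using contDiffAt_prod fun i _ => hy i

lemma congr (hf : SmoothNear f x) (h : g =ᶠ[𝓝 x] f) : SmoothNear g x := by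
  filter_upwards [hf, h.eventuallyEq_nhds] with y h1 h2 using h1.congr_of_eventuallyEq h2

lemma pd (hf : SmoothNear f x) (a : ι) : SmoothNear (pd a f) x := by
  filter_upwards [hf] with y h1
  have : ContDiffAt ℝ ∞ (fderiv ℝ f) y := h1.fderiv_right (by simp)
  exact this.clm_apply contDiffAt_const

lemma comp {Φ : (κ → ℝ) → ι → ℝ} {x : κ → ℝ} (hf : SmoothNear f (Φ x)) [DecidableEq κ]
    (hΦ : ∀ i, SmoothNear (fun y => Φ y i) x) : SmoothNear (fun y => f (Φ y)) x := by
  have h2 : ∀ᶠ y in 𝓝 x, ContDiffAt ℝ ∞ Φ y := by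
    filter_upwards [Filter.eventually_all.2 hΦ] with y hy using contDiffAt_pi.2 hy
  have hc : Tendsto Φ (𝓝 x) (𝓝 (Φ x)) := h2.self_of_nhds.continuousAt
  filter_upwards [h2, hc.eventually hf] with y h3 h4 using h4.comp y h3

end SmoothNear

section pd

variable {f g : (ι → ℝ) → ℝ} {x : ι → ℝ} (a : ι)

lemma pd_congr (h : f =ᶠ[𝓝 x] g) : pd a f x = pd a g x := by simp only [pd, h.fderiv_eq]

lemma pd_congr_eventually (h : f =ᶠ[𝓝 x] g) : pd a f =ᶠ[𝓝 x] pd a g := by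
  filter_upwards [h.eventuallyEq_nhds] with y hy using pd_congr a hy

lemma pd_const (b : ℝ) : pd a (fun _ : ι → ℝ => b) x = 0 := by simp [pd]

lemma pd_add (hf : SmoothNear f x) (hg : SmoothNear g x) :
    pd a (fun y => f y + g y) x = pd a f x + pd a g x := by
  simp only [pd, fderiv_fun_add hf.differentiableAt hg.differentiableAt, add_apply]

lemma pd_sub (hf : SmoothNear f x) (hg : SmoothNear g x) :
    pd a (fun y => f y - g y) x = pd a f x - pd a g x := by
  simp only [pd, fderiv_fun_sub hf.differentiableAt hg.differentiableAt, sub_apply]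

lemma pd_mul (hf : SmoothNear f x) (hg : SmoothNear g x) :
    pd a (fun y => f y * g y) x = pd a f x * g x + f x * pd a g x := by
  simp only [pd, fderiv_fun_mul hf.differentiableAt hg.differentiableAt, add_apply, smul_apply,
    smul_eq_mul]
  ring

lemma pd_const_mul (b : ℝ) (hf : SmoothNear f x) : pd a (fun y => b * f y) x = b * pd a f x := by
  rw [pd_mul a (SmoothNear.const b) hf, pd_const]; ring

lemma pd_sum {α : Type} [Fintype α] {F : α → (ι → ℝ) → ℝ} (h : ∀ i, SmoothNear (F i) x) :
    pd a (fun y => ∑ i, F i y) x = ∑ i, pd a (F i) x := by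
  simp only [pd]
  rw [fderiv_fun_sum fun i _ => (h i).differentiableAt]
  simp

lemma pd_comm (hf : SmoothNear f x) (b : ι) : pd a (pd b f) x = pd b (pd a f) x := by
  have h2 : ContDiffAt ℝ 2 f x := hf.contDiffAt.of_le (WithTop.coe_le_coe.2 le_top)
  have hs := h2.isSymmSndFDerivAt (by simp)
  have hd : DifferentiableAt ℝ (fderiv ℝ f) x :=
    (h2.fderiv_right (m := 1) (by norm_num)).differentiableAt (by norm_num)
  have key : ∀ c e : ι, pd c (pd e f) x = fderiv ℝ (fderiv ℝ f) x (Pi.single c 1) (Pi.single e 1) := by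
    intro c e
    have : pd e f = fun y => fderiv ℝ f y (Pi.single e 1) := rfl
    rw [this, pd, fderiv_clm_apply hd (differentiableAt_const _)]
    simp
  rw [key, key]
  exact hs _ _

lemma pd_comp {Φ : (ι → ℝ) → κ → ℝ} [DecidableEq κ] {f : (κ → ℝ) → ℝ} (hf : SmoothNear f (Φ x))
    (hΦ : ∀ i, SmoothNear (fun y => Φ y i) x) :
    pd a (fun y => f (Φ y)) x = ∑ j, pd j f (Φ x) * pd a (fun y => Φ y j) x := by
  have hd : DifferentiableAt ℝ Φ x := differentiableAt_pi.2 fun i => (hΦ i).differentiableAt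
  simp only [pd]
  rw [show (fun y => f (Φ y)) = f ∘ Φ from rfl, fderiv_comp x hf.differentiableAt hd,
    ContinuousLinearMap.comp_apply]
  set v := fderiv ℝ Φ x (Pi.single a 1) with hv
  have hvj : ∀ j, fderiv ℝ (fun y => Φ y j) x (Pi.single a 1) = v j := by
    intro j
    rw [hv, fderiv_pi fun i => (hΦ i).differentiableAt]
    simp
  conv_lhs => rw [pi_eq_sum_univ' v]
  simp only [map_sum, map_smul, smul_eq_mul, hvj]
  refine sum_ext fun j => ?_
  rw [mul_comm]

lemma pd_coord (i : ι) : pd a (fun y : ι → ℝ => y i) x = if i = a then 1 else 0 := by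
  have : (fun y : ι → ℝ => y i) = ContinuousLinearMap.proj (R := ℝ) (φ := fun _ : ι => ℝ) i := rfl
  rw [pd, this, ContinuousLinearMap.fderiv]
  simp [Pi.single_apply]

end pd

lemma SmoothNear.coord {x : ι → ℝ} (i : ι) : SmoothNear (fun y : ι → ℝ => y i) x :=
  .of_forall fun _ => (contDiff_apply ℝ ℝ i).contDiffAt

section Matrices

variable {M : (ι → ℝ) → Matrix κ l ℝ} {N : (ι → ℝ) → Matrix l o ℝ} {x : ι → ℝ}

lemma MatSmoothNear.mul (hM : MatSmoothNear M x) (hN : MatSmoothNear N x) :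
    MatSmoothNear (fun y => M y * N y) x := fun i j => by
  simp only [mul_apply]
  exact SmoothNear.sum fun k => (hM i k).mul (hN k j)

lemma MatSmoothNear.transpose (hM : MatSmoothNear M x) :
    MatSmoothNear (fun y => (M y).transpose) x := fun i j => hM j i

lemma MatSmoothNear.congr {N : (ι → ℝ) → Matrix κ l ℝ} (hM : MatSmoothNear M x) (h : N =ᶠ[𝓝 x] M) :
    MatSmoothNear N x := fun i j => (hM i j).congr (h.mono fun y hy => by simp only [hy])

lemma MatSmoothNear.eventually (hM : MatSmoothNear M x) : ∀ᶠ y in 𝓝 x, MatSmoothNear M y :=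
  Filter.eventually_all.2 fun i => Filter.eventually_all.2 fun j => (hM i j).eventually

lemma MatSmoothNear.pdMat (hM : MatSmoothNear M x) (a : ι) : MatSmoothNear (pdMat a M) x :=
  fun i j => (hM i j).pd a

lemma MatSmoothNear.sum_smul {α : Type} [Fintype α] {c : α → (ι → ℝ) → ℝ}
    {F : α → (ι → ℝ) → Matrix κ l ℝ} (hc : ∀ k, SmoothNear (c k) x)
    (h : ∀ k, MatSmoothNear (F k) x) :
    MatSmoothNear (fun y => ∑ k, c k y • F k y) x := fun i j => by
  simp only [Matrix.sum_apply, Matrix.smul_apply, smul_eq_mul]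
  exact SmoothNear.sum fun k => (hc k).mul (h k i j)

lemma SmoothNear.det [DecidableEq κ] {M : (ι → ℝ) → Matrix κ κ ℝ} (hM : MatSmoothNear M x) :
    SmoothNear (fun y => (M y).det) x := by
  simp only [Matrix.det_apply']
  exact SmoothNear.sum fun s => (SmoothNear.const _).mul (SmoothNear.prod fun i => hM _ _)

lemma MatSmoothNear.inv [DecidableEq κ] {M : (ι → ℝ) → Matrix κ κ ℝ} (hM : MatSmoothNear M x)
    (h : IsUnit (M x).det) : MatSmoothNear (fun y => (M y)⁻¹) x := fun i j => by
  simp only [Matrix.inv_def, Ring.inverse_eq_inv', Matrix.smul_apply, smul_eq_mul]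
  refine ((SmoothNear.det hM).inv h.ne_zero).mul ?_
  simp only [Matrix.adjugate_apply]
  refine SmoothNear.det fun p q => ?_
  by_cases hp : p = j
  · subst hp; simpa [Matrix.updateRow_self] using SmoothNear.const _
  · simpa [Matrix.updateRow_ne hp] using hM p q

lemma MatSmoothNear.eventually_isUnit [DecidableEq κ] {M : (ι → ℝ) → Matrix κ κ ℝ}
    (hM : MatSmoothNear M x) (h : IsUnit (M x).det) : ∀ᶠ y in 𝓝 x, IsUnit (M y).det := by
  filter_upwards [(SmoothNear.det hM).contDiffAt.continuousAt.eventually_ne h.ne_zero] with y hy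
    using isUnit_iff_ne_zero.2 hy

lemma pdMat_congr (a : ι) {N : (ι → ℝ) → Matrix κ l ℝ} (h : M =ᶠ[𝓝 x] N) :
    pdMat a M x = pdMat a N x := by
  ext i j
  exact pd_congr a (h.mono fun y hy => by simp only [hy])

lemma pdMat_mul (a : ι) (hM : MatSmoothNear M x) (hN : MatSmoothNear N x) :
    pdMat a (fun y => M y * N y) x = pdMat a M x * N x + M x * pdMat a N x := by
  ext i j
  simp only [pdMat, of_apply, mul_apply, Matrix.add_apply]
  rw [pd_sum a fun k => (hM i k).mul (hN k j), ← sum_add_distrib]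
  exact sum_ext fun k => pd_mul a (hM i k) (hN k j)

lemma pdMat_add (a : ι) {N : (ι → ℝ) → Matrix κ l ℝ} (hM : MatSmoothNear M x)
    (hN : MatSmoothNear N x) : pdMat a (fun y => M y + N y) x = pdMat a M x + pdMat a N x := by
  ext i j
  exact pd_add a (hM i j) (hN i j)

lemma pdMat_comm (a b : ι) (hM : MatSmoothNear M x) :
    pdMat a (pdMat b M) x = pdMat b (pdMat a M) x := by
  ext i j
  exact pd_comm a (hM i j) b

lemma pdMat_inv [DecidableEq κ] {M : (ι → ℝ) → Matrix κ κ ℝ} (hM : MatSmoothNear M x)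
    (h : IsUnit (M x).det) (a : ι) :
    pdMat a (fun y => (M y)⁻¹) x = -((M x)⁻¹ * pdMat a M x * (M x)⁻¹) := by
  have h1 : pdMat a (fun y => M y * (M y)⁻¹) x = 0 := by
    rw [pdMat_congr (N := fun _ => (1 : Matrix κ κ ℝ)) a]
    · ext i j; exact pd_const a _
    · filter_upwards [hM.eventually_isUnit h] with y hy using mul_nonsing_inv _ hy
  rw [pdMat_mul a hM (hM.inv h)] at h1
  have := congrArg (fun N => (M x)⁻¹ * N) h1
  simp only [mul_add, ← mul_assoc, nonsing_inv_mul _ h, one_mul, mul_zero] at this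
  exact eq_neg_of_add_eq_zero_right this

lemma pdMat_sum_smul (a : ι) {α : Type} [Fintype α] {c : α → (ι → ℝ) → ℝ}
    {F : α → (ι → ℝ) → Matrix κ l ℝ} (hc : ∀ k, SmoothNear (c k) x)
    (h : ∀ k, MatSmoothNear (F k) x) :
    pdMat a (fun y => ∑ k, c k y • F k y) x
      = ∑ k, (pd a (c k) x • F k x + c k x • pdMat a (F k) x) := by
  ext i j
  simp only [pdMat, of_apply, Matrix.sum_apply, Matrix.add_apply, Matrix.smul_apply, smul_eq_mul]
  rw [pd_sum a fun k => (hc k).mul (h k i j)]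
  exact sum_ext fun k => pd_mul a (hc k) (h k i j)

end Matrices

end CoordinateCalculus

/-! ### Curvature and its transformation law -/

section Curvature

variable {ι : Type} [Fintype ι] [DecidableEq ι]

/-- `g` is, near `x`, a smooth field of symmetric invertible matrices. -/
structure IsMetricNear (g : 𝕄 ι) (x : ι → ℝ) : Prop where
  smooth : MatSmoothNear g x
  symm : ∀ᶠ y in 𝓝 x, ∀ a b, g y a b = g y b a
  isUnit : IsUnit (g x).det

/-- Christoffel symbols of the first kind, `Γ_{k,ab}`. -/
def christoffelLow (g : 𝕄 ι) (k a b : ι) (x : ι → ℝ) : ℝ :=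
  (1 / 2) * (pd a (fun z => g z k b) x + pd b (fun z => g z k a) x - pd k (fun z => g z a b) x)

/-- Riemann tensor `R^l_{acb} = ∂_c Γ^l_{ab} - ∂_b Γ^l_{ac} + Γ^l_{ck} Γ^k_{ab} - Γ^l_{bk} Γ^k_{ac}`,
so that `R_{ab} = R^l_{alb}`. -/
def riem (g : 𝕄 ι) (l a c b : ι) (x : ι → ℝ) : ℝ := pd c (Γ g l a b) x - pd b (Γ g l a c) x
    + ∑ k, (Γ g l c k x * Γ g k a b x - Γ g l b k x * Γ g k a c x)

/-- Riemann tensor with its first index lowered. -/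
def riemLow (g : 𝕄 ι) (d a c b : ι) (x : ι → ℝ) : ℝ := ∑ l, g x d l * riem g l a c b x

/-- The matrix `(Γ^l_{ck})_{lk}` of the Levi-Civita connection in the direction `∂_c`. -/
def connMat (g : 𝕄 ι) (c : ι) (x : ι → ℝ) : Matrix ι ι ℝ := of fun l k => Γ g l c k x

/-- The curvature `∂_c A_b - ∂_b A_c + [A_c, A_b]` of the connection matrices. -/
def curvMat (g : 𝕄 ι) (c b : ι) (x : ι → ℝ) : Matrix ι ι ℝ :=
  pdMat c (connMat g b) x - pdMat b (connMat g c) x + connMat g c x * connMat g b x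
    - connMat g b x * connMat g c x

variable {g : 𝕄 ι} {x : ι → ℝ}

lemma christoffel_eq (l a b : ι) (x : ι → ℝ) :
    Γ g l a b x = ∑ k, (g x)⁻¹ l k * christoffelLow g k a b x := by
  simp only [christoffel, christoffelLow, mul_sum]
  exact sum_ext fun k => by ring

lemma ricci_eq_sum_riem (a b : ι) (x : ι → ℝ) : ricci g a b x = ∑ l, riem g l a l b x := by
  simp only [ricci, riem, sum_add_distrib]

lemma riem_self (l a c : ι) (x : ι → ℝ) : riem g l a c c x = 0 := by simp [riem]

namespace IsMetricNear

variable (h : IsMetricNear g x)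
include h

lemma eventually : ∀ᶠ y in 𝓝 x, IsMetricNear g y := by
  filter_upwards [h.smooth.eventually, h.symm.eventually_nhds, h.smooth.eventually_isUnit h.isUnit]
    with y h1 h2 h3 using ⟨h1, h2, h3⟩

lemma symm_at (a b : ι) : g x a b = g x b a := h.symm.self_of_nhds a b

lemma inv_symm (a b : ι) : (g x)⁻¹ a b = (g x)⁻¹ b a := by
  have : (g x).transpose = g x := by ext i j; exact h.symm_at j i
  calc (g x)⁻¹ a b = ((g x)⁻¹).transpose b a := rfl
    _ = (g x)⁻¹ b a := by rw [Matrix.transpose_nonsing_inv, this]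

lemma sum_mul_inv (a b : ι) : ∑ k, g x a k * (g x)⁻¹ k b = if a = b then 1 else 0 := by
  rw [← mul_apply, mul_nonsing_inv _ h.isUnit, one_apply]

lemma sum_inv_mul (a b : ι) : ∑ k, (g x)⁻¹ a k * g x k b = if a = b then 1 else 0 := by
  rw [← mul_apply, nonsing_inv_mul _ h.isUnit, one_apply]

lemma pd_symm (c a b : ι) : pd c (fun z => g z a b) x = pd c (fun z => g z b a) x :=
  pd_congr c (h.symm.mono fun _ hy => hy a b)

lemma smoothNear_inv : MatSmoothNear (fun y => (g y)⁻¹) x := h.smooth.inv h.isUnit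

lemma smoothNear_christoffelLow (k a b : ι) : SmoothNear (christoffelLow g k a b) x :=
  (SmoothNear.const _).mul ((((h.smooth k b).pd a).add ((h.smooth k a).pd b)).sub
    ((h.smooth a b).pd k))

lemma smoothNear_christoffel (l a b : ι) : SmoothNear (Γ g l a b) x := by
  rw [show Γ g l a b = fun x => ∑ k, (g x)⁻¹ l k * christoffelLow g k a b x from
    funext fun x => christoffel_eq l a b x]
  exact SmoothNear.sum fun k => (h.smoothNear_inv l k).mul (h.smoothNear_christoffelLow k a b)

lemma christoffelLow_symm (k a b : ι) : christoffelLow g k a b x = christoffelLow g k b a x := by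
  simp only [christoffelLow, h.pd_symm k a b]
  ring

lemma christoffel_symm (l a b : ι) : Γ g l a b x = Γ g l b a x := by
  simp only [christoffel_eq, h.christoffelLow_symm _ a b]

lemma sum_mul_christoffel (d a b : ι) : ∑ l, g x d l * Γ g l a b x = christoffelLow g d a b x := by
  simp only [christoffel_eq, mul_sum]
  rw [sum_comm]
  simp only [← mul_assoc, ← sum_mul, h.sum_mul_inv]
  simp

lemma pd_metric (c a b : ι) :
    pd c (fun z => g z a b) x = christoffelLow g a c b x + christoffelLow g b c a x := by
  simp only [christoffelLow, h.pd_symm c b a, h.pd_symm b c a, h.pd_symm a c b]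
  ring

/-- `∇g⁻¹ = 0`. -/
lemma pd_inv (c a b : ι) :
    pd c (fun z => (g z)⁻¹ a b) x
      = -∑ k, (Γ g a c k x * (g x)⁻¹ k b + Γ g b c k x * (g x)⁻¹ a k) := by
  have h3 : pdMat c g x = of (fun i j => christoffelLow g i c j x)
      + of (fun i j => christoffelLow g j c i x) := by ext i j; exact h.pd_metric c i j
  have h4 : (g x)⁻¹ * of (fun i j => christoffelLow g i c j x) = connMat g c x := by
    ext i j
    simp only [mul_apply, of_apply, connMat, christoffel_eq]
  have h5 : of (fun i j => christoffelLow g j c i x) * (g x)⁻¹ = (connMat g c x).transpose := by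
    ext i j
    simp only [mul_apply, of_apply, connMat, christoffel_eq, transpose_apply]
    exact sum_ext fun k => by rw [h.inv_symm j k, mul_comm]
  have h6 := congrFun (congrFun (pdMat_inv h.smooth h.isUnit c) a) b
  rw [h3, mul_add, add_mul, h4, mul_assoc (g x)⁻¹ _ (g x)⁻¹, h5] at h6
  simp only [pdMat, of_apply, Matrix.neg_apply, Matrix.add_apply, mul_apply, connMat,
    transpose_apply] at h6
  rw [h6, sum_add_distrib]
  congr 2
  exact sum_ext fun k => mul_comm _ _

lemma riemLow_eq (d a c b : ι) :
    riemLow g d a c b x = (1 / 2) * (pd c (pd a fun z => g z d b) x - pd c (pd d fun z => g z a b) x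
        - pd b (pd a fun z => g z d c) x + pd b (pd d fun z => g z a c) x)
      - ∑ k, ∑ l, g x k l * (Γ g k c d x * Γ g l a b x - Γ g k b d x * Γ g l a c x) := by
  have key : ∀ p q : ι, ∑ l, g x d l * pd p (Γ g l a q) x = pd p (christoffelLow g d a q) x
        - ∑ l, (christoffelLow g d p l x + christoffelLow g l p d x) * Γ g l a q x := by
    intro p q
    have e : pd p (christoffelLow g d a q) x = pd p (fun y => ∑ l, g y d l * Γ g l a q y) x := by
      refine pd_congr p ?_
      filter_upwards [h.eventually] with y hy using (hy.sum_mul_christoffel d a q).symm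
    rw [e, pd_sum p fun l => (h.smooth d l).mul (h.smoothNear_christoffel l a q)]
    rw [eq_sub_iff_add_eq, ← sum_add_distrib]
    refine sum_ext fun l => ?_
    rw [pd_mul p (h.smooth d l) (h.smoothNear_christoffel l a q), ← h.pd_metric p d l]
    ring
  have quad : ∀ p q : ι, ∑ l, g x d l * ∑ k, Γ g l p k x * Γ g k a q x
      = ∑ l, christoffelLow g d p l x * Γ g l a q x := by
    intro p q
    simp only [mul_sum]
    refine sum_swap fun k => ?_
    rw [← h.sum_mul_christoffel d p k, sum_mul]
    exact sum_ext fun l => by ring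
  have pair : ∀ p q : ι, ∑ k, ∑ l, g x k l * (Γ g k p d x * Γ g l a q x)
      = ∑ l, christoffelLow g l p d x * Γ g l a q x := by
    intro p q
    refine sum_swap fun l => ?_
    rw [← h.sum_mul_christoffel l p d, sum_mul]
    exact sum_ext fun k => by rw [h.symm_at k l]; ring
  have low : ∀ p q : ι, pd p (christoffelLow g d a q) x = (1 / 2) *
      (pd p (pd a fun z => g z d q) x + pd p (pd q fun z => g z d a) x
        - pd p (pd d fun z => g z a q) x) := by
    intro p q
    have s1 := (h.smooth d q).pd a
    have s2 := (h.smooth d a).pd q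
    have s3 := (h.smooth a q).pd d
    rw [show christoffelLow g d a q = fun y => (1 / 2) * (pd a (fun z => g z d q) y
      + pd q (fun z => g z d a) y - pd d (fun z => g z a q) y) from rfl,
      pd_const_mul p _ ((s1.add s2).sub s3), pd_sub p (s1.add s2) s3, pd_add p s1 s2]
  have expand : riemLow g d a c b x
      = (∑ l, g x d l * pd c (Γ g l a b) x - ∑ l, g x d l * pd b (Γ g l a c) x)
        + (∑ l, g x d l * ∑ k, Γ g l c k x * Γ g k a b x
          - ∑ l, g x d l * ∑ k, Γ g l b k x * Γ g k a c x) := by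
    simp only [riemLow, riem, sum_sub_distrib, mul_add, mul_sub, sum_add_distrib]
  rw [expand, key, key, quad, quad, low, low, pd_comm c (h.smooth d a) b]
  simp only [mul_sub, sum_sub_distrib, pair, add_mul, sum_add_distrib]
  ring

lemma riemLow_antisymm (d a c b : ι) : riemLow g d a c b x = -riemLow g a d c b x := by
  have key : ∀ p q : ι, ∑ k, ∑ l, g x k l * (Γ g k p d x * Γ g l a q x)
      = ∑ k, ∑ l, g x k l * (Γ g k q a x * Γ g l d p x) := by
    intro p q
    rw [sum_comm]
    refine sum_ext₂ fun k l => ?_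
    rw [h.symm_at k l, h.christoffel_symm l p d, h.christoffel_symm k q a]
    ring
  rw [h.riemLow_eq, h.riemLow_eq]
  simp only [mul_sub, sum_sub_distrib]
  rw [key c b, key b c]
  ring

lemma riemLow_pair (d a c b : ι) : riemLow g d a c b x = riemLow g c b d a x := by
  have key : ∀ p q : ι, ∑ k, ∑ l, g x k l * (Γ g k p d x * Γ g l a q x)
      = ∑ k, ∑ l, g x k l * (Γ g k d p x * Γ g l q a x) := by
    intro p q
    refine sum_ext₂ fun k l => ?_
    rw [h.christoffel_symm k p d, h.christoffel_symm l a q]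
  have key2 : ∀ p q : ι, ∑ k, ∑ l, g x k l * (Γ g k b p x * Γ g l a q x)
      = ∑ k, ∑ l, g x k l * (Γ g k a q x * Γ g l b p x) := by
    intro p q
    rw [sum_comm]
    refine sum_ext₂ fun k l => ?_
    rw [h.symm_at k l]
    ring
  have key' : ∑ k, ∑ l, g x k l * (Γ g k b d x * Γ g l a c x)
      = ∑ k, ∑ l, g x k l * (Γ g k a c x * Γ g l b d x) := key2 d c
  rw [h.riemLow_eq, h.riemLow_eq]
  simp only [mul_sub, sum_sub_distrib]
  rw [key c b, key', pd_comm c (h.smooth d b) a, pd_comm c (h.smooth a b) d,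
    pd_comm b (h.smooth d c) a, pd_comm b (h.smooth a c) d]
  have e : ∀ p q i j, pd p (pd q fun z => g z i j) x = pd p (pd q fun z => g z j i) x :=
    fun p q i j => pd_congr p (pd_congr_eventually q (h.symm.mono fun _ hy => hy i j))
  rw [e a c d b, e d c a b, e a b d c, e d b a c]
  ring

lemma riem_eq_sum (l a c b : ι) : riem g l a c b x = ∑ d, (g x)⁻¹ l d * riemLow g d a c b x := by
  simp only [riemLow, mul_sum]
  rw [sum_comm]
  simp only [← mul_assoc, ← sum_mul, h.sum_inv_mul]
  simp

lemma smoothNear_connMat (c : ι) : MatSmoothNear (connMat g c) x :=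
  fun l k => h.smoothNear_christoffel l c k

lemma curvMat_apply (l a c b : ι) : curvMat g c b x l a = riem g l a c b x := by
  simp only [curvMat, pdMat, connMat, Matrix.sub_apply, Matrix.add_apply, of_apply,
    mul_apply, riem, sum_sub_distrib]
  have e : ∀ p q : ι, pd p (fun y => Γ g l q a y) x = pd p (Γ g l a q) x :=
    fun p q => pd_congr p (h.eventually.mono fun y hy => hy.christoffel_symm l q a)
  rw [e, e]
  simp only [h.christoffel_symm _ b a, h.christoffel_symm _ c a]
  ring

end IsMetricNear

end Curvature

section Pullback

variable {ι : Type} [Fintype ι] [DecidableEq ι]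

/-- Jacobian matrix `J^i_a = ∂_a Φ^i`. -/
def jac (Φ : (ι → ℝ) → ι → ℝ) (x : ι → ℝ) : Matrix ι ι ℝ := of fun i a => pd a (fun y => Φ y i) x

/-- Near `x`, `g'` is the pullback of the metric `g` under the local diffeomorphism `Φ`. -/
structure IsPullbackNear (g' g : 𝕄 ι) (Φ : (ι → ℝ) → ι → ℝ) (x : ι → ℝ) :
    Prop where
  metric : IsMetricNear g (Φ x)
  smooth : ∀ i, SmoothNear (fun y => Φ y i) x
  isUnit : IsUnit (jac Φ x).det
  eq : ∀ᶠ y in 𝓝 x, g' y = (jac Φ y).transpose * g (Φ y) * jac Φ y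

/-- The pullback `B_c = ∑_j J^j_c A_j` of the connection matrices of `g`. -/
def pullConn (g : 𝕄 ι) (Φ : (ι → ℝ) → ι → ℝ) (c : ι)
    (x : ι → ℝ) : Matrix ι ι ℝ := ∑ j, jac Φ x j c • connMat g j (Φ x)

namespace IsPullbackNear

variable {g' g : 𝕄 ι} {Φ : (ι → ℝ) → ι → ℝ} {x : ι → ℝ}

variable (h : IsPullbackNear g' g Φ x)
include h

local notation "J" => jac Φ x

lemma smoothNear_jac : MatSmoothNear (jac Φ) x := fun i a => (h.smooth i).pd a

lemma tendsto : Tendsto Φ (𝓝 x) (𝓝 (Φ x)) :=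
  tendsto_pi_nhds.2 fun i => (h.smooth i).contDiffAt.continuousAt

lemma eventually : ∀ᶠ y in 𝓝 x, IsPullbackNear g' g Φ y := by
  filter_upwards [h.tendsto.eventually h.metric.eventually,
    Filter.eventually_all.2 fun i => (h.smooth i).eventually,
    h.smoothNear_jac.eventually_isUnit h.isUnit, h.eq.eventually_nhds] with y h1 h2 h3 h4
    using ⟨h1, h2, h3, h4⟩

lemma matSmoothNear_comp {κ l : Type} [Fintype κ] [Fintype l]
    {M : (ι → ℝ) → Matrix κ l ℝ} (hM : MatSmoothNear M (Φ x)) :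
    MatSmoothNear (fun y => M (Φ y)) x := fun i j => (hM i j).comp h.smooth

lemma pdMat_comp {κ l : Type} [Fintype κ] [Fintype l] {M : (ι → ℝ) → Matrix κ l ℝ}
    (hM : MatSmoothNear M (Φ x)) (c : ι) :
    pdMat c (fun y => M (Φ y)) x = ∑ j, J j c • pdMat j M (Φ x) := by
  ext i k
  simp only [pdMat, of_apply, Matrix.sum_apply, Matrix.smul_apply, smul_eq_mul, jac]
  rw [pd_comp c (hM i k) h.smooth]
  exact sum_ext fun j => mul_comm _ _

lemma eq_at :
    g' x = (J).transpose * g (Φ x) * J := h.eq.self_of_nhds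

lemma apply_eq (a b : ι) : g' x a b = ∑ i, ∑ j, J i a * J j b * g (Φ x) i j := by
  rw [h.eq_at]
  simp only [mul_apply, transpose_apply, sum_mul]
  rw [sum_comm]
  exact sum_ext₂ fun i j => by ring

lemma pull_metric : IsMetricNear g' x where
  smooth := ((h.smoothNear_jac.transpose.mul (h.matSmoothNear_comp h.metric.smooth)).mul
    h.smoothNear_jac).congr h.eq
  symm := by
    filter_upwards [h.eventually] with y hy a b
    rw [hy.apply_eq, hy.apply_eq, sum_comm]
    refine sum_ext₂ fun i j => ?_
    rw [hy.metric.symm_at j i]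
    ring
  isUnit := by
    rw [h.eq_at, det_mul, det_mul, Matrix.det_transpose]
    exact (h.isUnit.mul h.metric.isUnit).mul h.isUnit

lemma pd_jac_comm (i a b : ι) :
    pd a (fun y => jac Φ y i b) x = pd b (fun y => jac Φ y i a) x := pd_comm a (h.smooth i) b

lemma pd_metric (c a b : ι) :
    pd c (fun z => g' z a b) x = ∑ i, ∑ j, pd c (fun y => jac Φ y i a) x * J j b * g (Φ x) i j
        + ∑ i, ∑ j, pd c (fun y => jac Φ y i b) x * J j a * g (Φ x) i j
        + ∑ i, ∑ j, ∑ k, J i a * J j b * J k c * pd k (fun z => g z i j) (Φ x) := by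
  have e : pd c (fun z => g' z a b) x
      = pd c (fun y => ∑ i, ∑ j, jac Φ y i a * jac Φ y j b * g (Φ y) i j) x :=
    pd_congr c (h.eventually.mono fun y hy => hy.apply_eq a b)
  have s := h.smoothNear_jac
  have sg := h.matSmoothNear_comp h.metric.smooth
  rw [e, pd_sum c fun i => SmoothNear.sum fun j => ((s i a).mul (s j b)).mul (sg i j)]
  have e2 : ∑ i, ∑ j, pd c (fun y => jac Φ y i b) x * J j a * g (Φ x) i j
      = ∑ i, ∑ j, pd c (fun y => jac Φ y j b) x * J i a * g (Φ x) i j := by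
    rw [sum_comm]
    exact sum_ext₂ fun i j => by rw [h.metric.symm_at j i]
  rw [e2, ← sum_add_distrib, ← sum_add_distrib]
  refine sum_ext fun i => ?_
  rw [pd_sum c fun j => ((s i a).mul (s j b)).mul (sg i j), ← sum_add_distrib, ← sum_add_distrib]
  refine sum_ext fun j => ?_
  rw [pd_mul c ((s i a).mul (s j b)) (sg i j), pd_mul c (s i a) (s j b),
    pd_comp c (h.metric.smooth i j) h.smooth, mul_sum]
  have : ∀ k, J i a * J j b * (pd k (fun z => g z i j) (Φ x) * pd c (fun y => Φ y k) x)
      = J i a * J j b * J k c * pd k (fun z => g z i j) (Φ x) := fun k => by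
    simp only [jac, of_apply]; ring
  simp only [this]
  ring

lemma christoffelLow_eq (k a b : ι) :
    christoffelLow g' k a b x = ∑ i, ∑ j, ∑ l, J i k * J j a * J l b * christoffelLow g i j l (Φ x)
      + ∑ i, ∑ j, pd a (fun y => jac Φ y i b) x * J j k * g (Φ x) i j := by
  simp only [christoffelLow, h.pd_metric]
  simp only [fun i => h.pd_jac_comm i b a, fun i => h.pd_jac_comm i k a,
    fun i => h.pd_jac_comm i k b]
  have t : ∑ i, ∑ j, ∑ l, J i k * J j a * J l b * (1 / 2 *
        (pd j (fun z => g z i l) (Φ x) + pd l (fun z => g z i j) (Φ x)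
          - pd i (fun z => g z j l) (Φ x))) = 1 / 2 * (∑ i, ∑ j, ∑ l, J i k * J j b * J l a
            * pd l (fun z => g z i j) (Φ x)
        + ∑ i, ∑ j, ∑ l, J i k * J j a * J l b * pd l (fun z => g z i j) (Φ x)
        - ∑ i, ∑ j, ∑ l, J i a * J j b * J l k * pd l (fun z => g z i j) (Φ x)) := by
    have c1 : ∑ i, ∑ j, ∑ l, J i k * J j b * J l a * pd l (fun z => g z i j) (Φ x)
        = ∑ i, ∑ j, ∑ l, J i k * J l b * J j a * pd j (fun z => g z i l) (Φ x) :=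
      sum_ext fun i => sum_comm
    have c2 : ∑ i, ∑ j, ∑ l, J i a * J j b * J l k * pd l (fun z => g z i j) (Φ x)
        = ∑ i, ∑ j, ∑ l, J j a * J l b * J i k * pd i (fun z => g z j l) (Φ x) := by
      rw [sum_ext fun i => sum_comm, sum_comm]
    rw [c1, c2, ← sum_add_distrib, ← sum_sub_distrib, mul_sum]
    refine sum_ext fun i => ?_
    rw [← sum_add_distrib, ← sum_sub_distrib, mul_sum]
    refine sum_ext fun j => ?_
    rw [← sum_add_distrib, ← sum_sub_distrib, mul_sum]
    exact sum_ext fun l => by ring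
  rw [t]
  ring

/-- Transformation law of the Christoffel symbols:
`J^i_l Γ'^l_{ab} = Γ^i_{jk} J^j_a J^k_b + ∂_a J^i_b`. -/
lemma sum_jac_mul_christoffel (i a b : ι) :
    ∑ l, J i l * Γ g' l a b x = ∑ j, ∑ k, Γ g i j k (Φ x) * J j a * J k b
        + pd a (fun y => jac Φ y i b) x := by
  -- compare the images of both sides under the invertible matrix `Jᵀ g`
  set u : ι → ℝ := fun i => ∑ l, J i l * Γ g' l a b x with hu
  set v : ι → ℝ := fun i => ∑ j, ∑ k, Γ g i j k (Φ x) * J j a * J k b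
        + pd a (fun y => jac Φ y i b) x with hv
  have hJ := h.isUnit
  have hU : IsUnit ((J).transpose * g (Φ x)) := by
    rw [Matrix.isUnit_iff_isUnit_det, det_mul, Matrix.det_transpose]
    exact hJ.mul h.metric.isUnit
  suffices hs : ((J).transpose * g (Φ x)).mulVec u = ((J).transpose * g (Φ x)).mulVec v from
    congrFun (Matrix.mulVec_injective_of_isUnit hU hs) i
  ext k
  have e1 : ((J).transpose * g (Φ x)).mulVec u k = christoffelLow g' k a b x := by
    rw [← h.pull_metric.sum_mul_christoffel k a b, hu]
    have : (fun i => ∑ l, J i l * Γ g' l a b x) = (J).mulVec fun l => Γ g' l a b x := rfl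
    rw [this, mulVec_mulVec, ← h.eq_at]
    rfl
  rw [e1, h.christoffelLow_eq]
  simp only [Matrix.mulVec, dotProduct, hv, mul_apply, transpose_apply, mul_add,
    sum_add_distrib]
  congr 1
  · simp only [sum_mul]
    rw [sum_comm (f := fun p i => J i k * g (Φ x) i p * ∑ j, ∑ l, Γ g p j l (Φ x) * J j a * J l b)]
    refine sum_ext fun i => ?_
    calc _ = ∑ j, ∑ l, ∑ p, J i k * g (Φ x) i p *
          (Γ g p j l (Φ x) * J j a * J l b) := by
          refine sum_ext₂ fun j l => ?_
          rw [← h.metric.sum_mul_christoffel, mul_sum]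
          exact sum_ext fun p => by ring
      _ = ∑ p, ∑ j, ∑ l, J i k * g (Φ x) i p *
          (Γ g p j l (Φ x) * J j a * J l b) := by rw [sum_ext fun j => sum_comm, sum_comm]
      _ = _ := by simp only [mul_sum]
  · refine sum_ext fun p => ?_
    rw [sum_mul]
    exact sum_ext fun q => by rw [h.metric.symm_at p q]; ring

/-- Transformation law of the connection matrices: `J A'_c = B_c J + ∂_c J`. -/
lemma jac_mul_connMat (c : ι) : J * connMat g' c x = pullConn g Φ c x * J + pdMat c (jac Φ) x := by
  ext i b
  simp only [mul_apply, Matrix.add_apply, pdMat, pullConn, connMat, of_apply,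
    Matrix.sum_apply, Matrix.smul_apply, smul_eq_mul, h.sum_jac_mul_christoffel, sum_mul]
  congr 1
  exact sum_ext₂ fun j k => by ring

lemma smoothNear_pullConn (c : ι) : MatSmoothNear (pullConn g Φ c) x :=
  MatSmoothNear.sum_smul (fun j => h.smoothNear_jac j c) fun j =>
    h.matSmoothNear_comp (h.metric.smoothNear_connMat j)

/-- The curvature of the pulled back connection is the pulled back curvature. -/
lemma curv_pullConn (c b : ι) :
    pdMat c (pullConn g Φ b) x - pdMat b (pullConn g Φ c) x
        + pullConn g Φ c x * pullConn g Φ b x - pullConn g Φ b x * pullConn g Φ c x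
      = ∑ j, ∑ k, (J j c * J k b) • curvMat g j k (Φ x) := by
  have e : ∀ p q : ι, pdMat p (pullConn g Φ q) x
      = ∑ k, (pd p (fun y => jac Φ y k q) x • connMat g k (Φ x)
        + J k q • ∑ j, J j p • pdMat j (connMat g k) (Φ x)) := by
    intro p q
    rw [show pullConn g Φ q = fun y => ∑ k, jac Φ y k q • connMat g k (Φ y) from rfl,
      pdMat_sum_smul p (fun k => h.smoothNear_jac k q) fun k =>
        h.matSmoothNear_comp (h.metric.smoothNear_connMat k)]
    exact sum_ext fun k => by rw [h.pdMat_comp (h.metric.smoothNear_connMat k)]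
  have m : ∀ p q : ι, pullConn g Φ p x * pullConn g Φ q x
      = ∑ j, ∑ k, (J j p * J k q) • (connMat g j (Φ x) * connMat g k (Φ x)) := by
    intro p q
    simp only [pullConn, sum_mul, mul_sum, smul_mul_assoc, mul_smul_comm, smul_sum, smul_smul]
    rw [sum_comm]
    exact sum_ext₂ fun j k => by rw [mul_comm]
  have d : ∀ p q : ι, ∑ k, J k q • ∑ j, J j p • pdMat j (connMat g k) (Φ x)
      = ∑ j, ∑ k, (J j p * J k q) • pdMat j (connMat g k) (Φ x) := by
    intro p q
    simp only [smul_sum, smul_smul]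
    rw [sum_comm]
    exact sum_ext₂ fun j k => by rw [mul_comm]
  rw [e c b, e b c, m c b, m b c, sum_add_distrib, sum_add_distrib, d, d,
    sum_ext fun k => by rw [h.pd_jac_comm k c b]]
  rw [sum_comm (f := fun j k => (J j b * J k c) • pdMat j (connMat g k) (Φ x)),
    sum_comm (f := fun j k => (J j b * J k c) •
      (connMat g j (Φ x) * connMat g k (Φ x))), add_sub_add_left_eq_sub]
  simp only [← sum_sub_distrib, ← sum_add_distrib, curvMat]
  refine sum_ext₂ fun j k => ?_
  rw [mul_comm (J k b) (J j c)]
  module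

/-- Transformation law of the curvature. -/
lemma jac_mul_curvMat (c b : ι) :
    J * curvMat g' c b x = (∑ j, ∑ k, (J j c * J k b) • curvMat g j k (Φ x)) * J := by
  have key : ∀ p q : ι, J * (pdMat p (connMat g' q) x + connMat g' p x * connMat g' q x)
      = (pdMat p (pullConn g Φ q) x + pullConn g Φ p x * pullConn g Φ q x) * J
        + pullConn g Φ q x * pdMat p (jac Φ) x + pullConn g Φ p x * pdMat q (jac Φ) x
        + pdMat p (pdMat q (jac Φ)) x := by
    intro p q
    have s := h.smoothNear_jac
    have h1 : pdMat p (fun y => jac Φ y * connMat g' q y) x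
        = pdMat p (fun y => pullConn g Φ q y * jac Φ y + pdMat q (jac Φ) y) x :=
      pdMat_congr p (h.eventually.mono fun y hy => hy.jac_mul_connMat q)
    rw [pdMat_mul p s (h.pull_metric.smoothNear_connMat q),
      pdMat_add p ((h.smoothNear_pullConn q).mul s) (s.pdMat q),
      pdMat_mul p (h.smoothNear_pullConn q) s] at h1
    have h2 : pdMat p (jac Φ) x = J * connMat g' p x - pullConn g Φ p x * J := by
      rw [h.jac_mul_connMat p]; abel
    have h3 : J * pdMat p (connMat g' q) x = pdMat p (pullConn g Φ q) x * J
        + pullConn g Φ q x * pdMat p (jac Φ) x + pdMat p (pdMat q (jac Φ)) x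
        - (J * connMat g' p x - pullConn g Φ p x * J) * connMat g' q x := by rw [← h2, ← h1]; abel
    have h4 : pullConn g Φ p x * J * connMat g' q x
        = pullConn g Φ p x * (pullConn g Φ q x * J + pdMat q (jac Φ) x) := by
      rw [mul_assoc, h.jac_mul_connMat q]
    rw [mul_add, h3, sub_mul, h4]
    noncomm_ring
  rw [← h.curv_pullConn]
  have e : curvMat g' c b x = (pdMat c (connMat g' b) x + connMat g' c x * connMat g' b x)
      - (pdMat b (connMat g' c) x + connMat g' b x * connMat g' c x) := by simp only [curvMat]; abel
  rw [e, mul_sub, key, key, pdMat_comm c b h.smoothNear_jac]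
  noncomm_ring

lemma sum_jac_mul_riem (i a c b : ι) :
    ∑ l, J i l * riem g' l a c b x
      = ∑ j, ∑ k, ∑ l, J j c * J k b * J l a * riem g i l j k (Φ x) := by
  have := congrFun (congrFun (h.jac_mul_curvMat c b) i) a
  simp only [mul_apply, Matrix.sum_apply, Matrix.smul_apply, smul_eq_mul,
    h.pull_metric.curvMat_apply, h.metric.curvMat_apply, sum_mul] at this
  rw [this]
  refine sum_swap fun j => ?_
  rw [sum_comm]
  exact sum_ext₂ fun k l => by ring

lemma sum_inv_jac_mul (a b : ι) : ∑ i, J⁻¹ a i * J i b = if a = b then 1 else 0 := by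
  rw [← mul_apply, nonsing_inv_mul _ h.isUnit, one_apply]

lemma sum_jac_mul_inv (a b : ι) : ∑ i, J a i * J⁻¹ i b = if a = b then 1 else 0 := by
  rw [← mul_apply, mul_nonsing_inv _ h.isUnit, one_apply]

/-- The Ricci tensor is a tensor. -/
lemma ricci_eq (a b : ι) : ricci g' a b x = ∑ k, ∑ l, J k b * J l a * ricci g l k (Φ x) := by
  have h1 : ∀ p c : ι, riem g' p a c b x = ∑ i, J⁻¹ p i *
      ∑ j, ∑ k, ∑ l, J j c * J k b * J l a * riem g i l j k (Φ x) := by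
    intro p c
    simp only [← h.sum_jac_mul_riem, mul_sum]
    rw [sum_comm]
    simp only [← mul_assoc, ← sum_mul, h.sum_inv_jac_mul]
    simp
  simp only [ricci_eq_sum_riem, h1]
  rw [sum_comm]
  have h2 : ∀ i, ∑ p, J⁻¹ p i * ∑ j, ∑ k, ∑ l, J j p * J k b * J l a * riem g i l j k (Φ x)
      = ∑ k, ∑ l, J k b * J l a * riem g i l i k (Φ x) := by
    intro i
    have h3 : ∀ p, J⁻¹ p i * ∑ j, ∑ k, ∑ l, J j p * J k b * J l a * riem g i l j k (Φ x)
        = ∑ j, (J j p * J⁻¹ p i) * ∑ k, ∑ l, J k b * J l a * riem g i l j k (Φ x) := by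
      intro p
      simp only [mul_sum]
      exact sum_ext₂ fun j k => sum_ext fun l => by ring
    simp only [h3]
    rw [sum_comm]
    simp only [← sum_mul, h.sum_jac_mul_inv]
    simp
  simp only [h2]
  refine sum_swap fun k => ?_
  exact sum_swap fun l => by rw [mul_sum]

lemma inv_eq : (g' x)⁻¹ = J⁻¹ * (g (Φ x))⁻¹ * (J⁻¹).transpose := by
  rw [h.eq_at, Matrix.mul_inv_rev, Matrix.mul_inv_rev, Matrix.transpose_nonsing_inv, mul_assoc]

lemma jac_inv_jac : J * (g' x)⁻¹ * (J).transpose = (g (Φ x))⁻¹ := by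
  have h1 := mul_nonsing_inv _ h.isUnit
  have h2 : (J⁻¹).transpose * (J).transpose = 1 := by
    rw [← Matrix.transpose_mul, h1, Matrix.transpose_one]
  rw [h.inv_eq]
  calc _ = (J * J⁻¹) * (g (Φ x))⁻¹ * ((J⁻¹).transpose * (J).transpose) := by noncomm_ring
    _ = _ := by rw [h1, h2, one_mul, mul_one]

/-- Contraction of a covariant 2-tensor is invariant. -/
lemma sum_inv_mul_tensor {t' t : ι → ι → ℝ} (ht : ∀ a b, t' a b = ∑ i, ∑ j, J i a * J j b * t i j) :
    ∑ a, ∑ b, (g' x)⁻¹ a b * t' a b = ∑ i, ∑ j, (g (Φ x))⁻¹ i j * t i j := by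
  have e : ∀ i j, (g (Φ x))⁻¹ i j = ∑ a, ∑ b, J i a * (g' x)⁻¹ a b * J j b := by
    intro i j
    rw [← h.jac_inv_jac]
    simp only [mul_apply, transpose_apply, sum_mul]
    rw [sum_comm]
  have r : ∑ i, ∑ j, (g (Φ x))⁻¹ i j * t i j = ∑ i, ∑ j, ∑ a, ∑ b,
      (g' x)⁻¹ a b * (J i a * J j b * t i j) := by
    refine sum_ext₂ fun i j => ?_
    rw [e, sum_mul]
    refine sum_ext fun a => ?_
    rw [sum_mul]
    exact sum_ext fun b => by ring
  simp only [ht, mul_sum]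
  rw [r]
  calc _ = ∑ a, ∑ i, ∑ j, ∑ b, (g' x)⁻¹ a b * (J i a * J j b * t i j) :=
        sum_ext fun a => by exact sum_swap fun i => sum_comm
    _ = ∑ i, ∑ a, ∑ j, ∑ b, (g' x)⁻¹ a b * (J i a * J j b * t i j) := sum_comm
    _ = _ := sum_ext fun i => sum_comm

/-- The scalar curvature is invariant. -/
lemma scalarCurv_eq : scalarCurv g' x = scalarCurv g (Φ x) := by
  simp only [scalarCurv]
  refine h.sum_inv_mul_tensor fun a b => ?_
  rw [h.ricci_eq, sum_comm]
  exact sum_ext₂ fun i j => by ring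

/-- The wave-gauge vector is a vector. -/
lemma sum_jac_mul_waveGauge {ghat' ghat : 𝕄 ι}
    (hh : IsPullbackNear ghat' ghat Φ x) (i : ι) :
    ∑ l, J i l * waveGauge g' ghat' l x = waveGauge g ghat i (Φ x) := by
  have e : ∑ l, J i l * waveGauge g' ghat' l x = ∑ a, ∑ b, (g' x)⁻¹ a b * (∑ l, J i l * Γ g' l a b x
        - ∑ l, J i l * Γ ghat' l a b x) := by
    simp only [waveGauge, mul_sum]
    refine sum_swap fun a => ?_
    refine sum_swap fun b => ?_
    rw [← sum_sub_distrib, mul_sum]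
    exact sum_ext fun l => by ring
  rw [e]
  simp only [waveGauge]
  refine h.sum_inv_mul_tensor fun a b => ?_
  rw [h.sum_jac_mul_christoffel, hh.sum_jac_mul_christoffel, add_sub_add_right_eq_sub,
    ← sum_sub_distrib]
  refine sum_ext fun j => ?_
  rw [← sum_sub_distrib]
  exact sum_ext fun k => by ring

/-- The covariant derivative of a field of endomorphisms, `∇_c M = ∂_c M + [A_c, M]`, is a
tensor. -/
lemma jac_mul_covDeriv {M' M : 𝕄 ι} (hM' : MatSmoothNear M' x)
    (hM : MatSmoothNear M (Φ x)) (hMM : ∀ᶠ y in 𝓝 x, jac Φ y * M' y = M (Φ y) * jac Φ y) (c : ι) :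
    J * (pdMat c M' x + connMat g' c x * M' x - M' x * connMat g' c x)
      = (∑ j, J j c • (pdMat j M (Φ x) + connMat g j (Φ x) * M (Φ x)
          - M (Φ x) * connMat g j (Φ x))) * J := by
  have s := h.smoothNear_jac
  have h1 := pdMat_congr c hMM
  rw [pdMat_mul c s hM', pdMat_mul c (h.matSmoothNear_comp hM) s, h.pdMat_comp hM] at h1
  have h2 := h.jac_mul_connMat c
  have h3 := hMM.self_of_nhds
  have e : ∑ j, J j c • (pdMat j M (Φ x) + connMat g j (Φ x) * M (Φ x)
          - M (Φ x) * connMat g j (Φ x)) = ∑ j, J j c • pdMat j M (Φ x) + pullConn g Φ c x * M (Φ x)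
          - M (Φ x) * pullConn g Φ c x := by
    simp only [pullConn, sum_mul, mul_sum, smul_mul_assoc, mul_smul_comm, smul_add, smul_sub,
      sum_add_distrib, sum_sub_distrib]
  rw [e]
  calc _ = J * pdMat c M' x + (J * connMat g' c x) * M' x
        - (J * M' x) * connMat g' c x := by noncomm_ring
    _ = J * pdMat c M' x + pullConn g Φ c x * (J * M' x) + pdMat c (jac Φ) x * M' x
        - M (Φ x) * (J * connMat g' c x) := by
      rw [h2, add_mul, mul_assoc (pullConn g Φ c x), h3, mul_assoc (M (Φ x)) J, h2]
      noncomm_ring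
    _ = (pdMat c (jac Φ) x * M' x + J * pdMat c M' x) + pullConn g Φ c x * (M (Φ x) * J)
        - M (Φ x) * (pullConn g Φ c x * J + pdMat c (jac Φ) x) := by rw [h2, h3]; abel
    _ = _ := by rw [h1]; noncomm_ring

end IsPullbackNear

end Pullback

/-! ### Null hypersurfaces -/

section NullGeometry

lemma onC_one (r : ℝ) (x : Fin m → ℝ) : onC r x i1 = r := rfl

lemma onC_inr (r : ℝ) (x : Fin m → ℝ) (A : Fin m) : onC r x (inr A) = x A := rfl

lemma contDiff_onC : ContDiff ℝ ∞ fun q : ConePt m => onC q.1 q.2 := by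
  refine contDiff_pi.2 fun i => ?_
  rcases i with i | A
  · fin_cases i
    · exact contDiff_const
    · exact contDiff_fst
  · exact (contDiff_apply ℝ ℝ A).comp contDiff_snd

lemma tendsto_onC (r : ℝ) (x : Fin m → ℝ) :
    Tendsto (fun q : ConePt m => onC q.1 q.2) (𝓝 (r, x)) (𝓝 (onC r x)) :=
  contDiff_onC.continuous.tendsto (r, x)

lemma eventually_fst {P : ConePt m → Prop} (h : ∀ᶠ q in 𝓝 (r, x), P q) : ∀ᶠ s in 𝓝 r, P (s, x) :=
  (Continuous.prodMk_left x).tendsto r |>.eventually h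

lemma eventually_snd {P : ConePt m → Prop} (h : ∀ᶠ q in 𝓝 (r, x), P q) : ∀ᶠ z in 𝓝 x, P (r, z) :=
  (Continuous.prodMk_right r).tendsto x |>.eventually h

lemma SmoothNear.hasDerivAt_onC {f : (Idx m → ℝ) → ℝ} (hf : SmoothNear f 𝔭) :
    HasDerivAt (fun s => f (onC s x)) (NullCone.pd i1 f 𝔭) r := by
  have h1 : HasDerivAt (fun s => onC s x) (Pi.single i1 1) r := by
    refine hasDerivAt_pi.2 fun i => ?_
    rcases i with i | A
    · fin_cases i
      · simpa [onC, Pi.single_apply] using hasDerivAt_const r (0 : ℝ)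
      · simpa [onC, Pi.single_apply] using hasDerivAt_id' r
    · simpa [onC, Pi.single_apply] using hasDerivAt_const r (x A)
  exact hf.differentiableAt.hasFDerivAt.comp_hasDerivAt r h1

lemma SmoothNear.deriv_onC {f : (Idx m → ℝ) → ℝ}
    (hf : SmoothNear f 𝔭) :
    deriv (fun s => f (onC s x)) r = NullCone.pd i1 f 𝔭 := hf.hasDerivAt_onC.deriv

lemma SmoothNear.onC_right {f : (Idx m → ℝ) → ℝ} (hf : SmoothNear f 𝔭) :
    SmoothNear (fun z => f (onC r z)) x := by
  have h := eventually_snd ((tendsto_onC r x).eventually hf)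
  filter_upwards [h] with z hz
  exact hz.comp z (contDiff_onC.comp (contDiff_prodMk_right r)).contDiffAt

lemma SmoothNear.pd_onC {f : (Idx m → ℝ) → ℝ} (hf : SmoothNear f 𝔭) (A : Fin m) :
    NullCone.pd A (fun z => f (onC r z)) x = NullCone.pd (inr A) f 𝔭 := by
  have h1 : ∀ i, SmoothNear (fun z : Fin m → ℝ => onC r z i) x := fun i =>
    .of_forall fun z => (contDiff_pi.1 (contDiff_onC.comp (contDiff_prodMk_right r)) i).contDiffAt
  rw [pd_comp A hf h1, Fintype.sum_sum_type, Fin.sum_univ_two]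
  have h2 : ∀ B : Fin m, NullCone.pd A (fun z : Fin m → ℝ => onC r z (inr B)) x
      = if B = A then 1 else 0 := fun B => pd_coord A B
  have h3 : NullCone.pd A (fun z : Fin m → ℝ => onC r z (Sum.inl 0)) x = 0 := pd_const A 0
  have h4 : NullCone.pd A (fun z : Fin m → ℝ => onC r z (Sum.inl 1)) x = 0 := pd_const A r
  simp [h2, h3, h4]

/-- The family of metrics induced on the spheres `r = const` of the cone. -/
def sph (G : 𝕄 (Idx m)) (r : ℝ) (x : Fin m → ℝ) :
    Matrix (Fin m) (Fin m) ℝ := of fun A B => G (onC r x) (inr A) (inr B)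

/-- Near the point `(r, x)` of the cone `x⁰ = 0`, the metric `G` is smooth, the cone is a null
hypersurface generated by `∂₁`, and the induced metrics on the spheres are invertible. -/
structure IsNullNear (G : 𝕄 (Idx m)) (r : ℝ) (x : Fin m → ℝ) :
    Prop where
  metric : IsMetricNear G (onC r x)
  null : ∀ᶠ q in 𝓝 (r, x), G (onC q.1 q.2) i1 i1 = 0
  null' : ∀ᶠ q in 𝓝 (r, x), ∀ A, G (onC q.1 q.2) i1 (inr A) = 0
  nu : G (onC r x) i0 i1 ≠ 0
  isUnit : IsUnit (sph G r x).det

/-- In addition `∂₀` is null and orthogonal to the spheres. -/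
structure IsNullAdaptedNear (G : 𝕄 (Idx m)) (r : ℝ) (x : Fin m → ℝ) :
    Prop extends IsNullNear G r x where
  cross : ∀ᶠ q in 𝓝 (r, x), ∀ A, G (onC q.1 q.2) i0 (inr A) = 0
  cross' : ∀ᶠ q in 𝓝 (r, x), G (onC q.1 q.2) i0 i0 = 0

/-- The matrix of the inverse of
`g₀₀ (dx⁰)² + 2 ν₀ dx⁰ dx¹ + 2 ν_A dx⁰ dx^A + h_{AB} dx^A dx^B`. -/
def nullInverse (h : Matrix (Fin m) (Fin m) ℝ) (n0 : ℝ) (n : Fin m → ℝ) (g00 : ℝ) :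
    Matrix (Idx m) (Idx m) ℝ := of fun α β => match α, β with
    | Sum.inl 0, Sum.inl 0 => 0
    | Sum.inl 0, Sum.inl 1 => n0⁻¹
    | Sum.inl 1, Sum.inl 0 => n0⁻¹
    | Sum.inl 1, Sum.inl 1 => n0⁻¹ ^ 2 * (∑ A, ∑ B, h⁻¹ A B * n A * n B - g00)
    | Sum.inl 0, inr _ => 0
    | inr _, Sum.inl 0 => 0
    | Sum.inl 1, inr A => -n0⁻¹ * ∑ B, h⁻¹ A B * n B
    | inr A, Sum.inl 1 => -n0⁻¹ * ∑ B, h⁻¹ A B * n B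
    | inr A, inr B => h⁻¹ A B

lemma mul_nullInverse {g : Matrix (Idx m) (Idx m) ℝ} (hs : ∀ a b, g a b = g b a) (h11 : g i1 i1 = 0)
    (h1A : ∀ A, g i1 (inr A) = 0) (h01 : g i0 i1 ≠ 0) {h : Matrix (Fin m) (Fin m) ℝ}
    (hh : ∀ A B, g (inr A) (inr B) = h A B) (hu : IsUnit h.det) :
    g * nullInverse h (g i0 i1) (fun A => g i0 (inr A)) (g i0 i0) = 1 := by
  have hA1 : ∀ A, g (inr A) i1 = 0 := fun A => by rw [hs, h1A]
  have h10 : g i1 i0 = g i0 i1 := hs _ _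
  have hA0 : ∀ A, g (inr A) i0 = g i0 (inr A) := fun A => hs _ _
  have hinv : ∀ A B, ∑ C, h A C * h⁻¹ C B = if A = B then 1 else 0 := fun A B => by
    rw [← mul_apply, mul_nonsing_inv _ hu, one_apply]
  have hsymm : h.transpose = h := by
    ext A B
    rw [transpose_apply, ← hh, ← hh, hs]
  have hisymm : ∀ A B, h⁻¹ A B = h⁻¹ B A := fun A B => by
    calc h⁻¹ A B = h⁻¹.transpose B A := rfl
      _ = h⁻¹ B A := by rw [Matrix.transpose_nonsing_inv, hsymm]
  have hn : ∀ A, ∑ B, h A B * ∑ C, h⁻¹ B C * g i0 (inr C) = g i0 (inr A) := by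
    intro A
    simp only [mul_sum]
    rw [sum_comm]
    simp only [← mul_assoc, ← sum_mul, hinv]
    simp
  ext α β
  rw [mul_apply, Fintype.sum_sum_type, Fin.sum_univ_two]
  rcases α with α | A <;> rcases β with β | B
  · fin_cases α <;> fin_cases β
    · simp [nullInverse, h01]
    · simp only [Fin.zero_eta, Fin.mk_one, nullInverse, of_apply, one_apply]
      have e : ∑ A, g i0 (inr A) * (-(g i0 i1)⁻¹ * ∑ B, h⁻¹ A B * g i0 (inr B))
          = -(g i0 i1)⁻¹ * ∑ A, ∑ B, h⁻¹ A B * g i0 (inr A) * g i0 (inr B) := by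
        simp only [mul_sum]
        exact sum_ext₂ fun A B => by ring
      rw [e]
      simp
      field_simp
      ring
    · simp [nullInverse, h11, h1A]
    · simp [nullInverse, h11, h1A, h10, h01]
  · fin_cases α
    · simp only [Fin.zero_eta, nullInverse, of_apply, one_apply]
      have e : ∑ A, g i0 (inr A) * h⁻¹ A B = ∑ A, h⁻¹ B A * g i0 (inr A) :=
        sum_ext fun A => by rw [hisymm A B, mul_comm]
      rw [e]
      simp [h01]
    · simp [nullInverse, h11, h1A]
  · fin_cases β
    · simp [nullInverse, hA1]
    · have e : ∑ B, h A B * (-(g i0 i1)⁻¹ * ∑ C, h⁻¹ B C * g i0 (inr C))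
          = -(g i0 i1)⁻¹ * g i0 (inr A) := by
        rw [← hn A, mul_sum]
        exact sum_ext fun B => by ring
      simp only [Fin.mk_one, nullInverse, of_apply, one_apply, hA0, hA1, hh]
      rw [e]
      simp
      ring
  · simp only [nullInverse, of_apply, hA1, hh, hinv]
    simp [one_apply]

lemma inv_eq_nullInverse {g : Matrix (Idx m) (Idx m) ℝ} (hs : ∀ a b, g a b = g b a)
    (h11 : g i1 i1 = 0) (h1A : ∀ A, g i1 (inr A) = 0) (h01 : g i0 i1 ≠ 0)
    {h : Matrix (Fin m) (Fin m) ℝ} (hh : ∀ A B, g (inr A) (inr B) = h A B) (hu : IsUnit h.det) :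
    g⁻¹ = nullInverse h (g i0 i1) (fun A => g i0 (inr A)) (g i0 i0) :=
  Matrix.inv_eq_right_inv (mul_nullInverse hs h11 h1A h01 hh hu)

lemma sum_idx {f : Idx m → ℝ} : ∑ k, f k = f i0 + f i1 + ∑ A, f (inr A) := by
  rw [Fintype.sum_sum_type, Fin.sum_univ_two]

namespace IsNullNear

variable {G : 𝕄 (Idx m)}
local notation "χ" => chi (sph G) r x
local notation "𝔫" => G 𝔭 i0 i1

variable (h : IsNullNear G r x)
include h

lemma eventually : ∀ᶠ q in 𝓝 (r, x), IsNullNear G q.1 q.2 := by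
  have hs : SmoothNear (fun y => (of fun A B : Fin m => G y (inr A) (inr B)).det)
      𝔭 := SmoothNear.det fun A B => h.metric.smooth _ _
  filter_upwards [(tendsto_onC r x).eventually h.metric.eventually, h.null.eventually_nhds,
    h.null'.eventually_nhds, ((h.metric.smooth i0 i1).contDiffAt.continuousAt.comp_of_eq
      (tendsto_onC r x) rfl).eventually_ne h.nu,
    (hs.contDiffAt.continuousAt.comp_of_eq (tendsto_onC r x) rfl).eventually_ne h.isUnit.ne_zero]
    with q h1 h2 h3 h4 h5 using ⟨h1, h2, h3, h4, isUnit_iff_ne_zero.2 h5⟩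

lemma null_at : G 𝔭 i1 i1 = 0 := h.null.self_of_nhds

lemma null'_at (A : Fin m) : G 𝔭 i1 (inr A) = 0 := h.null'.self_of_nhds A

lemma inv_eq :
    (G 𝔭)⁻¹ = nullInverse (sph G r x) 𝔫 (fun A => G 𝔭 i0 (inr A)) (G 𝔭 i0 i0) :=
  inv_eq_nullInverse h.metric.symm_at h.null_at h.null'_at h.nu (fun _ _ => rfl) h.isUnit

lemma inv00 : (G 𝔭)⁻¹ i0 i0 = 0 := by rw [h.inv_eq]; rfl

lemma inv01 : (G 𝔭)⁻¹ i0 i1 = 𝔫⁻¹ := by rw [h.inv_eq]; rfl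

lemma inv10 : (G 𝔭)⁻¹ i1 i0 = 𝔫⁻¹ := by rw [h.inv_eq]; rfl

lemma inv0A (A : Fin m) : (G 𝔭)⁻¹ i0 (inr A) = 0 := by rw [h.inv_eq]; rfl

lemma invA0 (A : Fin m) : (G 𝔭)⁻¹ (inr A) i0 = 0 := by rw [h.inv_eq]; rfl

lemma invAB (A B : Fin m) : (G 𝔭)⁻¹ (inr A) (inr B) = (sph G r x)⁻¹ A B := by rw [h.inv_eq]; rfl

lemma pd_null : pd i1 (fun z => G z i1 i1) 𝔭 = 0 := by
  rw [← (h.metric.smooth i1 i1).deriv_onC, Filter.EventuallyEq.deriv_eq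
    (f := fun _ => (0 : ℝ)) (eventually_fst h.null)]
  simp

lemma pdA_null (A : Fin m) : pd (inr A) (fun z => G z i1 i1) 𝔭 = 0 := by
  rw [← (h.metric.smooth i1 i1).pd_onC, pd_congr (g := fun _ => (0 : ℝ)) A (eventually_snd h.null),
    pd_const]

lemma pd_null' (B : Fin m) : pd i1 (fun z => G z i1 (inr B)) 𝔭 = 0 := by
  rw [← (h.metric.smooth i1 (inr B)).deriv_onC, Filter.EventuallyEq.deriv_eq
    (f := fun _ => (0 : ℝ)) ((eventually_fst h.null').mono fun s hs => hs B)]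
  simp

lemma pdA_null' (A B : Fin m) : pd (inr A) (fun z => G z i1 (inr B)) 𝔭 = 0 := by
  rw [← (h.metric.smooth i1 (inr B)).pd_onC, pd_congr (g := fun _ => (0 : ℝ)) A
    ((eventually_snd h.null').mono fun s hs => hs B), pd_const]

lemma deriv_sph (A B : Fin m) :
    deriv (fun s => sph G s x A B) r = pd i1 (fun z => G z (inr A) (inr B)) 𝔭 :=
  (h.metric.smooth (inr A) (inr B)).deriv_onC

lemma pd_sph (A B C : Fin m) :
    pd C (fun z => sph G r z A B) x = pd (inr C) (fun z => G z (inr A) (inr B)) 𝔭 :=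
  (h.metric.smooth (inr A) (inr B)).pd_onC C

lemma sphere_metric : IsMetricNear (sph G r) x where
  smooth A B := (h.metric.smooth (inr A) (inr B)).onC_right
  symm := by
    filter_upwards [eventually_snd h.eventually] with z hz A B
    exact hz.metric.symm_at _ _
  isUnit := h.isUnit

/-- Lowered components `Γ_{1,ab}` on the cone. -/
lemma low_1_11 : christoffelLow G i1 i1 i1 𝔭 = 0 := by simp [christoffelLow, h.pd_null]

lemma low_1_1A (A : Fin m) : christoffelLow G i1 i1 (inr A) 𝔭 = 0 := by
  simp [christoffelLow, h.pdA_null, h.pd_null']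

lemma low_1_AB (A B : Fin m) :
    christoffelLow G i1 (inr A) (inr B) 𝔭 = -(1 / 2) * deriv (fun s => sph G s x A B) r := by
  simp only [christoffelLow, h.pdA_null', h.deriv_sph]
  ring

lemma low_A_11 (A : Fin m) : christoffelLow G (inr A) i1 i1 𝔭 = 0 := by
  have : ∀ c, pd c (fun z => G z (inr A) i1) 𝔭
      = pd c (fun z => G z i1 (inr A)) 𝔭 := fun c => h.metric.pd_symm c _ _
  simp [christoffelLow, this, h.pdA_null, h.pd_null']

lemma low_A_1B (A B : Fin m) :
    christoffelLow G (inr A) i1 (inr B) 𝔭 = (1 / 2) * deriv (fun s => sph G s x A B) r := by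
  have : ∀ c, pd c (fun z => G z (inr A) i1) 𝔭
      = pd c (fun z => G z i1 (inr A)) 𝔭 := fun c => h.metric.pd_symm c _ _
  simp [christoffelLow, this, h.pdA_null', h.deriv_sph]

lemma low_A_BC (A B C : Fin m) :
    christoffelLow G (inr A) (inr B) (inr C) 𝔭 = christoffelLow (sph G r) A B C x := by
  simp only [christoffelLow, h.pd_sph]

lemma chris_0 (a b : Idx m) : Γ G i0 a b 𝔭 = 𝔫⁻¹ * christoffelLow G i1 a b 𝔭 := by
  rw [christoffel_eq, sum_idx]
  simp [h.inv00, h.inv01, h.inv0A]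

lemma chris_0_11 : Γ G i0 i1 i1 𝔭 = 0 := by rw [h.chris_0, h.low_1_11, mul_zero]

lemma chris_0_1A (A : Fin m) : Γ G i0 i1 (inr A) 𝔭 = 0 := by rw [h.chris_0, h.low_1_1A, mul_zero]

lemma chris_0_AB (A B : Fin m) :
    Γ G i0 (inr A) (inr B) 𝔭 = -𝔫⁻¹ * ((1 / 2) * deriv (fun s => sph G s x A B) r) := by
  rw [h.chris_0, h.low_1_AB]; ring

lemma chris_A_11 (A : Fin m) : Γ G (inr A) i1 i1 𝔭 = 0 := by
  rw [christoffel_eq, sum_idx]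
  simp [h.invA0, h.low_1_11, h.low_A_11]

lemma chris_A_1B (A B : Fin m) : Γ G (inr A) i1 (inr B) 𝔭 = χ B A := by
  rw [christoffel_eq, sum_idx]
  simp only [h.invA0, h.low_1_1A, h.low_A_1B, h.invAB, chi, mul_sum, mul_zero, zero_mul, zero_add]
  refine sum_ext fun C => ?_
  have : (fun s => sph G s x C B) =ᶠ[𝓝 r] fun s => sph G s x B C := by
    filter_upwards [eventually_fst h.eventually] with s hs using hs.metric.symm_at _ _
  rw [this.deriv_eq]
  ring

lemma chris_A_BC (A B C : Fin m) :
    Γ G (inr A) (inr B) (inr C) 𝔭 = Γ (sph G r) A B C x - (G 𝔭)⁻¹ (inr A) i1 *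
          ((1 / 2) * deriv (fun s => sph G s x B C) r) := by
  rw [christoffel_eq, sum_idx, christoffel_eq]
  simp only [h.invA0, h.low_1_AB, h.low_A_BC, h.invAB]
  ring

/-- `g^{AB} ∂₁g_{AC} / 2` summed against the metric lowers the index of `χ`. -/
lemma sum_chi_mul (A B : Fin m) :
    ∑ C, χ A C * sph G r x C B = (1 / 2) * deriv (fun s => sph G s x A B) r := by
  have hm := h.sphere_metric
  simp only [chi, mul_sum, sum_mul]
  rw [sum_comm]
  have : ∀ D C : Fin m, 1 / 2 * ((sph G r x)⁻¹ C D * deriv (fun s => sph G s x A D) r)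
      * sph G r x C B = (sph G r x)⁻¹ D C * sph G r x C B
        * (1 / 2 * deriv (fun s => sph G s x A D) r) := fun D C => by rw [hm.inv_symm C D]; ring
  simp only [this, ← sum_mul, hm.sum_inv_mul]
  simp

lemma smoothNear_chi (A B : Fin m) : SmoothNear (fun z => chi (sph G) r z A B) x := by
  refine SmoothNear.congr (h.metric.smoothNear_christoffel (inr B) i1 (inr A)).onC_right ?_
  filter_upwards [eventually_snd h.eventually] with z hz using (hz.chris_A_1B B A).symm

lemma pd_chris_A_1B (A B C : Fin m) :
    pd (inr C) (Γ G (inr A) i1 (inr B)) 𝔭 = pd C (fun z => chi (sph G) r z B A) x := by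
  rw [← (h.metric.smoothNear_christoffel _ _ _).pd_onC]
  refine pd_congr C ?_
  filter_upwards [eventually_snd h.eventually] with z hz using hz.chris_A_1B A B

lemma hasDerivAt_chi (A B : Fin m) :
    HasDerivAt (fun s => chi (sph G) s x A B) (pd i1 (Γ G (inr B) i1 (inr A)) 𝔭) r := by
  refine (h.metric.smoothNear_christoffel _ _ _).hasDerivAt_onC.congr_of_eventuallyEq ?_
  filter_upwards [eventually_fst h.eventually] with s hs using (hs.chris_A_1B B A).symm

/-- The component `R_{11}` on a null hypersurface (Raychaudhuri). -/
lemma ricci_11 : ricci G i1 i1 𝔭 = -deriv (fun s => meanCurv (sph G) s x) r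
      + Γ G i1 i1 i1 𝔭 * meanCurv (sph G) r x - ∑ A, ∑ B, χ A B * χ B A := by
  have h0 : riem G i0 i1 i0 i1 𝔭 = 0 := by
    have e1 : riemLow G i1 i1 i0 i1 𝔭 = 0 := by
      have := h.metric.riemLow_antisymm i1 i1 i0 i1
      linarith
    rw [riemLow, sum_idx] at e1
    simp only [h.null_at, h.null'_at, h.metric.symm_at i1 i0] at e1
    simpa [h.nu] using e1
  have hτ : deriv (fun s => meanCurv (sph G) s x) r = ∑ A, pd i1 (Γ G (inr A) i1 (inr A)) 𝔭 := by
    simp only [meanCurv]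
    exact (HasDerivAt.fun_sum fun A _ => h.hasDerivAt_chi A A).deriv
  have hpd : ∀ A : Fin m, pd (inr A) (Γ G (inr A) i1 i1) 𝔭 = 0 := by
    intro A
    rw [← (h.metric.smoothNear_christoffel _ _ _).pd_onC, pd_congr (g := fun _ => (0 : ℝ)) A,
      pd_const]
    filter_upwards [eventually_snd h.eventually] with z hz using hz.chris_A_11 A
  have hB : ∀ B : Fin m, riem G (inr B) i1 (inr B) i1 𝔭 = -pd i1 (Γ G (inr B) i1 (inr B)) 𝔭
        + χ B B * Γ G i1 i1 i1 𝔭 - ∑ A, χ A B * χ B A := by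
    intro B
    rw [riem, sum_idx, hpd]
    simp only [h.chris_0_11, h.chris_0_1A, h.chris_A_11, h.chris_A_1B,
      h.metric.christoffel_symm (inr B) (inr B) i1]
    simp only [mul_zero, zero_mul, zero_sub, sub_zero, zero_add, sum_neg_distrib]
    ring
  rw [ricci_eq_sum_riem, sum_idx, h0, riem_self, hτ]
  simp only [hB, sum_add_distrib, sum_sub_distrib, sum_neg_distrib, meanCurv, ← sum_mul]
  rw [sum_comm (f := fun A B => χ A B * χ B A)]
  ring

end IsNullNear

end NullGeometry

/-! ### The Ricci tensor on a null hypersurface -/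

section Divergence

variable {ι κ : Type} [Fintype ι] [DecidableEq ι] [Fintype κ] [DecidableEq κ]

/-- The one-form `tr (M⁻¹ dM)` is closed. -/
lemma pd_trace_inv_mul_comm {M : (ι → ℝ) → Matrix κ κ ℝ} {x : ι → ℝ} (hM : MatSmoothNear M x)
    (h : IsUnit (M x).det) (a b : ι) :
    pd a (fun y => ((M y)⁻¹ * pdMat b M y).trace) x
      = pd b (fun y => ((M y)⁻¹ * pdMat a M y).trace) x := by
  have key : ∀ p q : ι, pd p (fun y => ((M y)⁻¹ * pdMat q M y).trace) x
      = (-((M x)⁻¹ * pdMat p M x * (M x)⁻¹) * pdMat q M x + (M x)⁻¹ * pdMat p (pdMat q M) x).trace := by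
    intro p q
    rw [← pdMat_inv hM h, ← pdMat_mul p (hM.inv h) (hM.pdMat q)]
    exact pd_sum p fun i => ((hM.inv h).mul (hM.pdMat q)) i i
  rw [key, key, pdMat_comm a b hM, Matrix.trace_add, Matrix.trace_add]
  congr 1
  rw [neg_mul, neg_mul, Matrix.trace_neg, Matrix.trace_neg, mul_assoc ((M x)⁻¹ * pdMat a M x),
    Matrix.trace_mul_comm, ← mul_assoc]

/-- Divergence of a vector in terms of the covariant derivative of the associated covector. -/
lemma IsMetricNear.div_eq {g : 𝕄 ι} {x : ι → ℝ} (h : IsMetricNear g x)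
    {w : ι → (ι → ℝ) → ℝ} (hw : ∀ a, SmoothNear (w a) x) :
    ∑ a, pd a (fun z => ∑ b, (g z)⁻¹ a b * w b z) x
        + ∑ a, ∑ b, Γ g a a b x * ∑ c, (g x)⁻¹ b c * w c x
      = ∑ a, ∑ b, (g x)⁻¹ a b * (pd a (w b) x - ∑ c, Γ g c a b x * w c x) := by
  have e : ∀ a, pd a (fun z => ∑ b, (g z)⁻¹ a b * w b z) x = ∑ b, (g x)⁻¹ a b * pd a (w b) x
        - ∑ b, ∑ k, Γ g a a k x * (g x)⁻¹ k b * w b x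
        - ∑ b, ∑ k, Γ g b a k x * (g x)⁻¹ a k * w b x := by
    intro a
    rw [pd_sum a fun b => (h.smoothNear_inv a b).mul (hw b), ← sum_sub_distrib, ← sum_sub_distrib]
    refine sum_ext fun b => ?_
    rw [pd_mul a (h.smoothNear_inv a b) (hw b), h.pd_inv, sum_add_distrib]
    simp only [← sum_mul]
    ring
  have c1 : ∀ a, ∑ b, Γ g a a b x * ∑ c, (g x)⁻¹ b c * w c x
      = ∑ b, ∑ k, Γ g a a k x * (g x)⁻¹ k b * w b x := by
    intro a
    simp only [mul_sum, mul_assoc]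
    exact sum_comm
  have c2 : ∀ a, ∑ b, (g x)⁻¹ a b * ∑ c, Γ g c a b x * w c x
      = ∑ b, ∑ k, Γ g b a k x * (g x)⁻¹ a k * w b x := by
    intro a
    simp only [mul_sum]
    rw [sum_comm]
    exact sum_ext₂ fun b k => by ring
  simp only [e, c1, mul_sub, sum_sub_distrib, c2]
  ring

lemma IsMetricNear.sum_christoffel_self {g : 𝕄 ι} {x : ι → ℝ}
    (h : IsMetricNear g x) (a : ι) :
    ∑ b, Γ g b a b x = (1 / 2) * ((g x)⁻¹ * pdMat a g x).trace := by
  have e : ∑ b, ∑ k, (g x)⁻¹ b k * pd b (fun z => g z k a) x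
      = ∑ b, ∑ k, (g x)⁻¹ b k * pd k (fun z => g z a b) x := by
    rw [sum_comm]
    exact sum_ext₂ fun k b => by rw [h.inv_symm, h.pd_symm]
  simp only [christoffel, ← mul_sum, mul_sub, mul_add, sum_sub_distrib, sum_add_distrib, e,
    Matrix.trace, Matrix.diag, mul_apply, pdMat, of_apply]
  ring

end Divergence

section NullGeometry

variable {G : 𝕄 (Idx m)}
local notation "χ" => chi (sph G) r x
local notation "𝔦" => (sph G r x)⁻¹
local notation "𝔱" => meanCurv (sph G) r x
local notation "𝔵" A:max B:max => 1 / 2 * deriv (fun s => sph G s x A B) r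
local notation "𝔢" A:max => Γ G i1 i1 (inr A) 𝔭
local notation "𝔟" A:max B:max => Γ G i1 (inr A) (inr B) 𝔭
local notation "𝔫" => G 𝔭 i0 i1

namespace IsNullNear

variable (h : IsNullNear G r x)
include h

lemma meanCurv_eq_trace : 𝔱 = (1 / 2) * (((of fun A B : Fin m => G 𝔭 (inr A) (inr B)))⁻¹
      * pdMat i1 (fun y => of fun A B : Fin m => G y (inr A) (inr B))
          𝔭).trace := by
  simp only [meanCurv, chi, ← mul_sum, Matrix.trace, Matrix.diag, mul_apply, pdMat, of_apply,
    h.deriv_sph]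
  congr 1
  refine sum_ext₂ fun A C => ?_
  rw [h.metric.pd_symm]
  rfl

lemma sum_christoffel_eq_trace (A : Fin m) :
    ∑ B, Γ (sph G r) B A B x = (1 / 2) * (((of fun A B : Fin m => G 𝔭 (inr A) (inr B)))⁻¹
      * pdMat (inr A) (fun y => of fun A B : Fin m => G y (inr A) (inr B))
          𝔭).trace := by
  rw [h.sphere_metric.sum_christoffel_self]
  simp only [Matrix.trace, Matrix.diag, mul_apply, pdMat, of_apply, h.pd_sph]
  rfl

lemma smoothNear_meanCurv : SmoothNear (fun z => meanCurv (sph G) r z) x :=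
  SmoothNear.sum fun A => h.smoothNear_chi A A

/-- `∂₁ Γ̃^B_{AB} = ∂_A τ`. -/
lemma hasDerivAt_sum_christoffel (A : Fin m) :
    HasDerivAt (fun s => ∑ B, Γ (sph G s) B A B x) (pd A (fun z => meanCurv (sph G) r z) x) r := by
  set M : (Idx m → ℝ) → Matrix (Fin m) (Fin m) ℝ :=
    fun y => of fun A B : Fin m => G y (inr A) (inr B) with hM
  have sM : MatSmoothNear M 𝔭 := fun A B => h.metric.smooth _ _
  have hu : IsUnit (M 𝔭).det := h.isUnit
  have st : ∀ a : Idx m, SmoothNear (fun y => (1 / 2) * ((M y)⁻¹ * pdMat a M y).trace) 𝔭 :=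
    fun a => (SmoothNear.const _).mul
      (SmoothNear.sum fun i => ((sM.inv hu).mul (sM.pdMat a)) i i)
  have e1 : pd A (fun z => meanCurv (sph G) r z) x
      = pd (inr A) (fun y => (1 / 2) * ((M y)⁻¹ * pdMat i1 M y).trace) 𝔭 := by
    rw [← (st i1).pd_onC]
    exact pd_congr A ((eventually_snd h.eventually).mono fun z hz => hz.meanCurv_eq_trace)
  have st' : ∀ a : Idx m, SmoothNear (fun y => ((M y)⁻¹ * pdMat a M y).trace) 𝔭 :=
    fun a => SmoothNear.sum fun i => ((sM.inv hu).mul (sM.pdMat a)) i i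
  rw [e1, pd_const_mul _ _ (st' i1), pd_trace_inv_mul_comm sM hu, ← pd_const_mul _ _ (st' _)]
  refine (st (inr A)).hasDerivAt_onC.congr_of_eventuallyEq ?_
  exact (eventually_fst h.eventually).mono fun s hs => hs.sum_christoffel_eq_trace A

end IsNullNear

namespace IsNullAdaptedNear

variable (h : IsNullAdaptedNear G r x)
include h

lemma eventually_adapted : ∀ᶠ q in 𝓝 (r, x), IsNullAdaptedNear G q.1 q.2 := by
  filter_upwards [h.toIsNullNear.eventually, h.cross.eventually_nhds, h.cross'.eventually_nhds]
    with q h1 h2 h3 using ⟨h1, h2, h3⟩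

lemma cross_at (A : Fin m) : G 𝔭 i0 (inr A) = 0 := h.cross.self_of_nhds A

lemma cross'_at : G 𝔭 i0 i0 = 0 := h.cross'.self_of_nhds

lemma inv11 : (G 𝔭)⁻¹ i1 i1 = 0 := by rw [h.inv_eq]; simp [nullInverse, h.cross_at, h.cross'_at]

lemma invA1 (A : Fin m) : (G 𝔭)⁻¹ (inr A) i1 = 0 := by rw [h.inv_eq]; simp [nullInverse, h.cross_at]

lemma inv1A (A : Fin m) : (G 𝔭)⁻¹ i1 (inr A) = 0 := by rw [h.inv_eq]; simp [nullInverse, h.cross_at]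

lemma chris_A_BC' (A B C : Fin m) : Γ G (inr A) (inr B) (inr C) 𝔭 = Γ (sph G r) A B C x := by
  rw [h.chris_A_BC, h.invA1]; ring

lemma chris_1_10 : Γ G i1 i1 i0 𝔭 = 0 := by
  have e := h.metric.pd_inv i1 i1 i1
  rw [← (h.metric.smoothNear_inv i1 i1).deriv_onC, Filter.EventuallyEq.deriv_eq
    (f := fun _ => (0 : ℝ)) ((eventually_fst h.eventually_adapted).mono fun s hs => hs.inv11),
    sum_idx] at e
  simp only [h.inv11, h.inv1A, h.invA1, h.inv10, h.inv01, mul_zero, sum_const_zero, add_zero,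
    deriv_const] at e
  have h1 : 𝔫⁻¹ ≠ 0 := inv_ne_zero h.nu
  have : Γ G i1 i1 i0 𝔭 * 𝔫⁻¹ = 0 := by linarith
  simpa [h.nu] using this

lemma chris_C_10 (C : Fin m) :
    Γ G (inr C) i1 i0 𝔭 = -𝔫 * ∑ B, 𝔦 B C * 𝔢 B := by
  have e := h.metric.pd_inv i1 (inr C) i1
  rw [← (h.metric.smoothNear_inv (inr C) i1).deriv_onC, Filter.EventuallyEq.deriv_eq
    (f := fun _ => (0 : ℝ)) ((eventually_fst h.eventually_adapted).mono fun s hs => hs.invA1 C),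
    sum_idx] at e
  simp only [h.inv11, h.invA1, h.inv01, h.invA0, h.invAB, mul_zero, add_zero, zero_add,
    deriv_const] at e
  have h1 := h.nu
  have e2 : Γ G (inr C) i1 i0 𝔭 * 𝔫⁻¹ = -∑ B, 𝔦 B C * 𝔢 B := by
    rw [sum_ext fun B => by rw [h.sphere_metric.inv_symm B C, mul_comm]]
    linarith
  rw [neg_mul, ← mul_neg, ← e2]
  field_simp

lemma chris_C_D0 (C D : Fin m) :
    Γ G (inr C) (inr D) i0 𝔭 = -𝔫 * ∑ B, 𝔦 B C * 𝔟 D B := by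
  have e := h.metric.pd_inv (inr D) (inr C) i1
  rw [← (h.metric.smoothNear_inv (inr C) i1).pd_onC, pd_congr
    (g := fun _ => (0 : ℝ)) D ((eventually_snd h.eventually_adapted).mono fun s hs => hs.invA1 C),
    sum_idx] at e
  simp only [h.inv11, h.invA1, h.inv01, h.invA0, h.invAB, mul_zero, add_zero, zero_add,
    pd_const] at e
  have h1 := h.nu
  have e2 : Γ G (inr C) (inr D) i0 𝔭 * 𝔫⁻¹ = -∑ B, 𝔦 B C * 𝔟 D B := by
    rw [sum_ext fun B => by rw [h.sphere_metric.inv_symm B C, mul_comm]]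
    linarith
  rw [neg_mul, ← mul_neg, ← e2]
  field_simp

omit h in
/-- `χ_A^C = g^{CB} ∂₁g_{AB} / 2`. -/
lemma chi_eq (A C : Fin m) :
    χ A C = ∑ B, 𝔦 C B * 𝔵 A B := by
  rw [chi, mul_sum]
  exact sum_ext fun B => by ring

lemma pd_chris_A_BC (A B C D : Fin m) :
    pd (inr D) (Γ G (inr A) (inr B) (inr C)) 𝔭 = pd D (Γ (sph G r) A B C) x := by
  rw [← (h.metric.smoothNear_christoffel _ _ _).pd_onC]
  exact pd_congr D ((eventually_snd h.eventually_adapted).mono fun z hz => hz.chris_A_BC' A B C)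

/-- `R^0_{a0b} = R^1_{b1a}` for tangential `a`, `b`, by the pair symmetry of the curvature. -/
lemma riem_0 (a b : Idx m) : riem G i0 a i0 b 𝔭 = riem G i1 b i1 a 𝔭 := by
  have e := h.metric.riemLow_pair i1 a i0 b
  simp only [riemLow, sum_idx, h.metric.symm_at i1 i0, h.null_at, h.null'_at, h.cross_at,
    h.cross'_at, zero_mul, sum_const_zero, add_zero, zero_add] at e
  exact mul_left_cancel₀ h.nu e

lemma riem_1 (A B : Fin m) :
    riem G i1 (inr A) i1 (inr B) 𝔭 = pd i1 (Γ G i1 (inr A) (inr B)) 𝔭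
        - pd (inr B) (Γ G i1 i1 (inr A)) 𝔭 + Γ G i1 i1 i1 𝔭 * 𝔟 A B - 𝔢 A * 𝔢 B
        + ∑ C, Γ (sph G r) C A B x * 𝔢 C - ∑ C, 𝔟 B C * χ A C := by
  have e1 : pd (inr B) (Γ G i1 (inr A) i1) 𝔭 = pd (inr B) (Γ G i1 i1 (inr A)) 𝔭 :=
    pd_congr _ (h.metric.eventually.mono fun y hy => hy.christoffel_symm _ _ _)
  simp only [riem, sum_idx, e1, h.chris_1_10, h.metric.christoffel_symm i0 (inr A) i1,
    h.metric.christoffel_symm i1 (inr A) i1, h.metric.christoffel_symm i1 (inr B) i1,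
    h.metric.christoffel_symm (inr _) (inr A) i1, h.chris_0_1A, h.chris_A_1B, h.chris_A_BC',
    sum_sub_distrib]
  simp only [fun C => mul_comm (𝔢 C)
    (Γ (sph G r) C A B x)]
  ring

/-- The components `R_{A1}` on a null hypersurface (Damour–Navier–Stokes). -/
lemma ricci_A1 (A : Fin m) :
    ricci G (inr A) i1 𝔭 = pd i1 (Γ G i1 i1 (inr A)) 𝔭 + 𝔱 * 𝔢 A
        + (∑ B, pd B (fun z => chi (sph G) r z A B) x + ∑ B, ∑ C, (Γ (sph G r) B B C x * χ A C
            - Γ (sph G r) C B A x * χ C B))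
        - pd A (fun z => meanCurv (sph G) r z + Γ G i1 i1 i1 (onC r z)) x := by
  have hm := h.metric
  have e0 : riem G i0 (inr A) i0 i1 𝔭 = pd i1 (Γ G i1 i1 (inr A)) 𝔭 - pd (inr A) (Γ G i1 i1 i1) 𝔭
        + ∑ C, 𝔢 C * χ A C := by
    rw [h.riem_0]
    simp only [riem, sum_idx, h.chris_0_11, h.chris_0_1A, h.chris_A_11, h.chris_A_1B,
      hm.christoffel_symm i1 (inr A) i1, mul_zero, sub_zero]
    ring
  have e1 : ∀ B : Fin m, riem G (inr B) (inr A) (inr B) i1 𝔭 = pd B (fun z => chi (sph G) r z A B) x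
        - pd i1 (Γ G (inr B) (inr A) (inr B)) 𝔭 + χ B B * 𝔢 A + ∑ C, (Γ (sph G r) B B C x * χ A C
            - Γ (sph G r) C B A x * χ C B) - ∑ C, 𝔢 C * (𝔦 C B * 𝔵 A B) := by
    intro B
    have hp : pd (inr B) (Γ G (inr B) (inr A) i1) 𝔭 = pd B (fun z => chi (sph G) r z A B) x := by
      rw [← h.pd_chris_A_1B]
      exact pd_congr _ (hm.eventually.mono fun y hy => hy.christoffel_symm _ _ _)
    have h0 : Γ G (inr B) i1 i0 𝔭 * Γ G i0 (inr A) (inr B) 𝔭 = ∑ C, 𝔢 C * (𝔦 C B * 𝔵 A B) := by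
      rw [h.chris_C_10, h.chris_0_AB]
      have : ∀ u : ℝ, -𝔫 * u * (-𝔫⁻¹ * 𝔵 A B) = u * 𝔵 A B := fun u => by
        have := h.nu
        field_simp
      rw [this, sum_mul]
      exact sum_ext fun C => by ring
    simp only [riem, sum_idx, hp, hm.christoffel_symm i0 (inr A) i1,
      hm.christoffel_symm i1 (inr A) i1, hm.christoffel_symm (inr _) (inr A) i1,
      hm.christoffel_symm (inr B) (inr B) i1, h0,
      h.chris_0_1A, h.chris_A_11, h.chris_A_1B, h.chris_A_BC', sum_sub_distrib,
      h.sphere_metric.christoffel_symm _ B A, mul_comm (χ _ B)]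
    ring
  have e2 : ∑ B, pd i1 (Γ G (inr B) (inr A) (inr B)) 𝔭
      = pd A (fun z => meanCurv (sph G) r z) x := by
    rw [← (h.hasDerivAt_sum_christoffel A).deriv]
    symm
    refine HasDerivAt.deriv ?_
    refine (HasDerivAt.fun_sum fun B _ =>
      (hm.smoothNear_christoffel (inr B) (inr A) (inr B)).hasDerivAt_onC
      ).congr_of_eventuallyEq ?_
    filter_upwards [eventually_fst h.eventually_adapted] with s hs
    exact sum_ext fun B => (hs.chris_A_BC' B A B).symm
  have e3 : ∑ B, ∑ C, 𝔢 C * (𝔦 C B * 𝔵 A B) = ∑ C, 𝔢 C * χ A C := by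
    exact sum_swap fun C => by rw [chi_eq, mul_sum]
  rw [ricci_eq_sum_riem, sum_idx, e0, riem_self,
    pd_add A h.smoothNear_meanCurv (hm.smoothNear_christoffel _ _ _).onC_right,
    (hm.smoothNear_christoffel _ _ _).pd_onC]
  simp only [e1, sum_add_distrib, sum_sub_distrib, e2, e3, ← sum_mul, meanCurv]
  ring

omit h in
/-- The transversal expansion `ζ = 2 g^{AB} Γ^1_{AB}` of the spheres, when `∂₀` is null and
orthogonal to them. -/
def transExp (G : 𝕄 (Idx m)) (r : ℝ) (x : Fin m → ℝ) : ℝ :=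
  2 * ∑ A, ∑ B, (sph G r x)⁻¹ A B * Γ G i1 (inr A) (inr B) (onC r x)

lemma ricci_AB (A B : Fin m) :
    ricci G (inr A) (inr B) 𝔭 = riem G i1 (inr A) i1 (inr B) 𝔭 + riem G i1 (inr B) i1 (inr A) 𝔭
        + (ricci (sph G r) A B x + 𝔱 * 𝔟 A B - ∑ C, 𝔟 A C * χ B C + ((∑ C, ∑ E, 𝔦 C E * 𝔟 C E)
              * 𝔵 A B - ∑ E, 𝔟 B E * χ A E)) := by
  have hm := h.metric
  have h0 : ∀ C D E F : Fin m, Γ G (inr C) (inr D) i0 𝔭 * Γ G i0 (inr E) (inr F) 𝔭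
      = ∑ B, 𝔦 C B * 𝔟 D B * 𝔵 E F := by
    intro C D E F
    rw [h.chris_C_D0, h.chris_0_AB]
    have : ∀ u : ℝ, -𝔫 * u * (-𝔫⁻¹ * 𝔵 E F) = u * 𝔵 E F := fun u => by
      have := h.nu
      field_simp
    rw [this, sum_mul]
    exact sum_ext fun B => by rw [h.sphere_metric.inv_symm B C]
  have e1 : ∑ C, riem G (inr C) (inr A) (inr C) (inr B) 𝔭 = ricci (sph G r) A B x
        + ∑ C, (χ C C * 𝔟 A B - 𝔟 A C * χ B C) + ∑ C, (∑ E, 𝔦 C E * 𝔟 C E * 𝔵 A B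
          - ∑ E, 𝔦 C E * 𝔟 B E * 𝔵 A C) := by
    rw [ricci_eq_sum_riem, ← sum_add_distrib, ← sum_add_distrib]
    refine sum_ext fun C => ?_
    simp only [riem, sum_idx, h0, h.pd_chris_A_BC, h.chris_A_BC', h.chris_A_1B,
      hm.christoffel_symm (inr _) (inr _) i1]
    ring
  have e2 : ∑ C, ∑ E, 𝔦 C E * 𝔟 B E * 𝔵 A C = ∑ E, 𝔟 B E * χ A E := by
    refine sum_swap fun E => ?_
    rw [chi_eq, mul_sum]
    exact sum_ext fun C => by rw [h.sphere_metric.inv_symm C E]; ring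
  rw [ricci_eq_sum_riem, sum_idx, h.riem_0, e1, sum_sub_distrib, sum_sub_distrib, e2]
  simp only [← sum_mul, meanCurv]
  ring

/-- The trace `g^{AB} R_{AB}` on a null hypersurface. -/
lemma sum_inv_mul_ricci :
    ∑ A, ∑ B, 𝔦 A B * ricci G (inr A) (inr B) 𝔭 = deriv (fun s => transExp G s x) r
        + (𝔱 + Γ G i1 i1 i1 𝔭) * transExp G r x + scalarCurv (sph G r) x
        - 2 * ∑ A, ∑ B, 𝔦 A B * (𝔢 A * 𝔢 B) - 2 * (∑ A, pd A (fun z => ∑ B, (sph G r z)⁻¹ A B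
              * Γ G i1 i1 (inr B) (onC r z)) x + ∑ A, ∑ B, Γ (sph G r) A A B x * ∑ C, 𝔦 B C
              * 𝔢 C) := by
  have hm := h.metric
  have hs := h.sphere_metric
  set I := 𝔦 with hI
  set b : Fin m → Fin m → ℝ := fun A B => 𝔟 A B with hb
  set η : Fin m → ℝ := fun A => 𝔢 A with hη
  set X : Fin m → Fin m → ℝ := fun A B => 1 / 2 * deriv (fun s => sph G s x A B) r with hX
  set k := Γ G i1 i1 i1 𝔭 with hk
  set t := 𝔱 with ht
  set P : ℝ := ∑ A, ∑ B, I A B * ∑ C, b B C * χ A C with hP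
  have hbs : ∀ A B, b A B = b B A := fun A B => hm.christoffel_symm _ _ _
  have hIs : ∀ A B, I A B = I B A := hs.inv_symm
  have hXt : ∑ A, ∑ B, I A B * X A B = t := by simp only [ht, meanCurv, chi_eq, hX, hI]
  have hP' : ∑ A, ∑ B, I A B * ∑ C, b A C * χ B C = P := by
    rw [hP, sum_comm]
    exact sum_ext₂ fun A B => by rw [hIs]
  -- the derivative of `g^{AB} Γ^1_{AB}` along the generators
  have hZ : deriv (fun s => transExp G s x) r
      = 2 * (∑ A, ∑ B, I A B * pd i1 (Γ G i1 (inr A) (inr B)) 𝔭 - 2 * P) := by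
    have h1 : HasDerivAt (fun s => transExp G s x) (2 * ∑ A, ∑ B,
        (pd i1 (fun y => (G y)⁻¹ (inr A) (inr B)) 𝔭 * b A B
          + I A B * pd i1 (Γ G i1 (inr A) (inr B)) 𝔭)) r := by
      refine HasDerivAt.const_mul 2 (HasDerivAt.fun_sum fun A _ => HasDerivAt.fun_sum fun B _ => ?_)
      refine HasDerivAt.mul ?_ (hm.smoothNear_christoffel _ _ _).hasDerivAt_onC
      refine (hm.smoothNear_inv (inr A) (inr B)).hasDerivAt_onC.congr_of_eventuallyEq ?_
      filter_upwards [eventually_fst h.eventually_adapted] with s hs using (hs.invAB A B).symm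
    have h2 : ∀ A B : Fin m, pd i1 (fun y => (G y)⁻¹ (inr A) (inr B)) 𝔭
        = -(∑ C, χ C A * I C B) - ∑ C, χ C B * I A C := by
      intro A B
      rw [hm.pd_inv, sum_idx]
      simp only [h.invA0, h.invA1, h.chris_A_1B, h.chris_A_11, h.invAB, h.inv0A, h.inv1A, mul_zero,
        add_zero, zero_add, sum_add_distrib]
      ring
    have h3 : ∑ A, ∑ B, (∑ C, χ C A * I C B) * b A B = P := by
      calc _ = ∑ C, ∑ B, ∑ A, I C B * (b B A * χ C A) := by
            simp only [sum_mul]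
            calc _ = ∑ A, ∑ C, ∑ B, χ C A * I C B * b A B :=
                  sum_ext fun A => sum_comm
              _ = ∑ C, ∑ A, ∑ B, χ C A * I C B * b A B := sum_comm
              _ = ∑ C, ∑ B, ∑ A, χ C A * I C B * b A B :=
                  sum_ext fun C => sum_comm
              _ = _ := sum_ext₂ fun C B =>
                  sum_ext fun A => by rw [hbs A B]; ring
        _ = P := by simp only [hP, mul_sum]
    have h4 : ∑ A, ∑ B, (∑ C, χ C B * I A C) * b A B = P := by
      rw [← h3, sum_comm]
      refine sum_ext₂ fun B A => ?_
      rw [hbs A B]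
      congr 1
      exact sum_ext fun C => by rw [hIs]
    rw [h1.deriv]
    simp only [h2, sum_add_distrib, sub_mul, neg_mul, sum_sub_distrib, sum_neg_distrib, h3, h4]
    ring
  have hdiv := hs.div_eq (w := fun A z => Γ G i1 i1 (inr A) (onC r z))
    fun A => (hm.smoothNear_christoffel _ _ _).onC_right
  rw [hdiv, hZ]
  have hpd : ∀ A B : Fin m, pd A (fun z => Γ G i1 i1 (inr B) (onC r z)) x
      = pd (inr A) (Γ G i1 i1 (inr B)) 𝔭 := fun A B => (hm.smoothNear_christoffel _ _ _).pd_onC A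
  have hR : ∑ A, ∑ B, I A B * riem G i1 (inr A) i1 (inr B) 𝔭
      = ∑ A, ∑ B, I A B * pd i1 (Γ G i1 (inr A) (inr B)) 𝔭
        + k * (∑ A, ∑ B, I A B * b A B) - ∑ A, ∑ B, I A B * (η A * η B)
        - ∑ A, ∑ B, I A B * (pd (inr A) (Γ G i1 i1 (inr B)) 𝔭
          - ∑ C, Γ (sph G r) C A B x * η C) - P := by
    have hsw : ∑ A, ∑ B, I A B * pd (inr B) (Γ G i1 i1 (inr A)) 𝔭
        = ∑ A, ∑ B, I A B * pd (inr A) (Γ G i1 i1 (inr B)) 𝔭 := by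
      rw [sum_comm]
      exact sum_ext₂ fun A B => by rw [hIs]
    simp only [h.riem_1, mul_add, mul_sub, sum_add_distrib, sum_sub_distrib, hsw]
    rw [hP, mul_sum]
    have : ∀ A, k * ∑ B, I A B * b A B = ∑ B, I A B * (k * b A B) := fun A => by
      rw [mul_sum]; exact sum_ext fun B => by ring
    simp only [this]
    ring
  have hR' : ∑ A, ∑ B, I A B * riem G i1 (inr B) i1 (inr A) 𝔭
      = ∑ A, ∑ B, I A B * riem G i1 (inr A) i1 (inr B) 𝔭 := by
    rw [sum_comm]
    exact sum_ext₂ fun A B => by rw [hIs]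
  have hT1 : ∑ A, ∑ B, I A B * (t * b A B) = t * ∑ A, ∑ B, I A B * b A B := by
    simp only [mul_sum]
    exact sum_ext₂ fun A B => by ring
  have hT2 : ∀ u : ℝ, ∑ A, ∑ B, I A B * (u * X A B) = u * t := by
    intro u
    rw [← hXt]
    simp only [mul_sum]
    exact sum_ext₂ fun A B => by ring
  have hsum : ∑ A, ∑ B, I A B * ricci G (inr A) (inr B) 𝔭
      = ∑ A, ∑ B, I A B * riem G i1 (inr A) i1 (inr B) 𝔭
        + ∑ A, ∑ B, I A B * riem G i1 (inr B) i1 (inr A) 𝔭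
        + (∑ A, ∑ B, I A B * ricci (sph G r) A B x + ∑ A, ∑ B, I A B * (t * b A B) - P
          + (∑ A, ∑ B, I A B * ((∑ C, ∑ E, I C E * b C E) * X A B) - P)) := by
    simp only [h.ricci_AB, mul_add, mul_sub, sum_add_distrib, sum_sub_distrib]
    rw [hP', ← hP]
  rw [hsum, hR', hR, hT1, hT2]
  simp only [transExp, scalarCurv, hpd]
  ring

end IsNullAdaptedNear

end NullGeometry

/-! ### Adapting the transversal vector -/

lemma IsMetricNear.ricci_symm {ι : Type} [Fintype ι] [DecidableEq ι] {g : 𝕄 ι}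
    {x : ι → ℝ} (h : IsMetricNear g x) (a b : ι) : ricci g a b x = ricci g b a x := by
  simp only [ricci_eq_sum_riem, h.riem_eq_sum]
  rw [sum_comm]
  exact sum_ext₂ fun l d => by rw [h.inv_symm, h.riemLow_pair]

section Transversal

variable {G : 𝕄 (Idx m)}
local notation "𝔫" => G 𝔭 i0 i1

/-- The projection `(x⁰, x¹, x^A) ↦ (0, x¹, x^A)` on the cone. -/
def toCone (X : Idx m → ℝ) : Idx m → ℝ := onC (X i1) fun A => X (inr A)

/-- Components of the null vector `∂₀ + (ν₀ g^{11} / 2) ∂₁ + ν₀ g^{1A} ∂_A`, which is orthogonal to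
the spheres. -/
def transVec (G : 𝕄 (Idx m)) (i : Idx m)
    (Y : Idx m → ℝ) : ℝ := match i with
  | Sum.inl 0 => 1
  | Sum.inl 1 => (1 / 2) * (G Y i0 i1 * (G Y)⁻¹ i1 i1)
  | inr A => G Y i0 i1 * (G Y)⁻¹ i1 (inr A)

/-- A change of coordinates which is the identity on the cone `x⁰ = 0` and changes `∂₀` there into
the null vector orthogonal to the spheres. -/
def transMap (G : 𝕄 (Idx m)) (X : Idx m → ℝ) :
    Idx m → ℝ := fun i => toCone X i + X i0 * transVec G i (toCone X)

/-- The metric `G` in the coordinates given by `transMap G`. -/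
def transMetric (G : 𝕄 (Idx m)) (X : Idx m → ℝ) :
    Matrix (Idx m) (Idx m) ℝ :=
  (jac (transMap G) X).transpose * G (transMap G X) * jac (transMap G) X

lemma transMap_onC (r : ℝ) (x : Fin m → ℝ) : transMap G (onC r x) = onC r x := by
  ext i; simp [transMap, toCone, onC]

lemma smoothNear_toCone (Y : Idx m → ℝ) (i : Idx m) : SmoothNear (fun X => toCone X i) Y := by
  rcases i with i | A
  · fin_cases i
    · exact SmoothNear.const 0
    · exact SmoothNear.coord i1
  · exact SmoothNear.coord (inr A)

lemma IsMetricNear.smoothNear_transVec {Y : Idx m → ℝ} (h : IsMetricNear G Y) (i : Idx m) :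
    SmoothNear (transVec G i) Y := by
  rcases i with i | A
  · fin_cases i
    · exact SmoothNear.const 1
    · exact (SmoothNear.const _).mul ((h.smooth i0 i1).mul (h.smoothNear_inv i1 i1))
  · exact (h.smooth i0 i1).mul (h.smoothNear_inv i1 (inr A))

lemma IsMetricNear.smoothNear_transMap (h : IsMetricNear G 𝔭) (i : Idx m) :
    SmoothNear (fun X => transMap G X i) 𝔭 := by
  have h1 : IsMetricNear G (toCone 𝔭) := h
  exact (smoothNear_toCone _ i).add ((SmoothNear.coord i0).mul
    ((h1.smoothNear_transVec i).comp fun j => smoothNear_toCone _ j))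

lemma pd_toCone (Y : Idx m → ℝ) (i j : Idx m) :
    pd j (fun X => toCone X i) Y = if i = j ∧ j ≠ i0 then 1 else 0 := by
  rcases i with i | A
  · fin_cases i
    · have : pd j (fun X : Idx m → ℝ => toCone X (Sum.inl 0)) Y = 0 := pd_const j 0
      simp only [Fin.zero_eta, this]
      rw [if_neg]
      rintro ⟨h1, h2⟩
      exact h2 h1.symm
    · have : pd j (fun X : Idx m → ℝ => toCone X (Sum.inl 1)) Y = if i1 = j then 1 else 0 :=
        pd_coord j i1
      simp only [Fin.mk_one, this]
      by_cases hj : i1 = j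
      · subst hj; simp
      · simp [hj]
  · have : pd j (fun X : Idx m → ℝ => toCone X (inr A)) Y = if inr A = j then 1 else 0 :=
      pd_coord j (inr A)
    rw [this]
    by_cases hj : inr A = j
    · subst hj; simp
    · simp [hj]

lemma IsMetricNear.jac_transMap (h : IsMetricNear G 𝔭) (i j : Idx m) :
    jac (transMap G) 𝔭 i j = if j = i0 then transVec G i 𝔭 else if i = j then 1 else 0 := by
  have h1 : IsMetricNear G (toCone 𝔭) := h
  have hs : SmoothNear (fun X => transVec G i (toCone X)) 𝔭 :=
    (h1.smoothNear_transVec i).comp fun j => smoothNear_toCone _ j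
  have e : jac (transMap G) 𝔭 i j = pd j (fun X => toCone X i) 𝔭
      + (pd j (fun X : Idx m → ℝ => X i0) 𝔭 * transVec G i 𝔭
        + 0 * pd j (fun X => transVec G i (toCone X)) 𝔭) := by
    simp only [jac, of_apply, transMap]
    rw [pd_add j (smoothNear_toCone _ i) ((SmoothNear.coord i0).mul hs),
      pd_mul j (SmoothNear.coord i0) hs]
    rfl
  rw [e, pd_toCone, pd_coord]
  by_cases hj : j = i0
  · subst hj; simp
  · simp [hj, Ne.symm hj]

lemma IsMetricNear.isUnit_jac_transMap (h : IsMetricNear G 𝔭) :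
    IsUnit (jac (transMap G) 𝔭).det := by
  refine Matrix.isUnit_det_of_right_inverse (B := of fun i j : Idx m =>
    if j = i0 then (if i = i0 then 1 else -transVec G i 𝔭) else if i = j then 1 else 0) ?_
  ext i j
  rw [mul_apply, sum_idx]
  simp only [h.jac_transMap, of_apply, one_apply]
  rcases i with i | A <;> rcases j with j | B
  · fin_cases i <;> fin_cases j <;> simp [transVec]
  · fin_cases i <;> simp
  · fin_cases j <;> simp
  · simp

lemma IsMetricNear.isPullbackNear_transMetric (h : IsMetricNear G 𝔭) :
    IsPullbackNear (transMetric G) G (transMap G) 𝔭 where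
  metric := by rw [transMap_onC]; exact h
  smooth := h.smoothNear_transMap
  isUnit := h.isUnit_jac_transMap
  eq := .of_forall fun _ => rfl

lemma IsMetricNear.transMetric_tangent (h : IsMetricNear G 𝔭) {a b : Idx m} (ha : a ≠ i0)
    (hb : b ≠ i0) : transMetric G 𝔭 a b = G 𝔭 a b := by
  rw [h.isPullbackNear_transMetric.apply_eq, transMap_onC]
  simp [h.jac_transMap, ha, hb]

namespace IsNullNear

variable (h : IsNullNear G r x)
include h

omit h in
lemma transVec_zero : transVec G i0 = fun _ => 1 := rfl

lemma sum_transVec_mul_1 : ∑ i, transVec G i 𝔭 * G 𝔭 i i1 = 𝔫 := by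
  rw [sum_idx, h.null_at, transVec_zero]
  have : ∀ A : Fin m, G 𝔭 (inr A) i1 = 0 := fun A => by rw [h.metric.symm_at, h.null'_at]
  simp [this]

lemma sum_transVec_mul_A (A : Fin m) : ∑ i, transVec G i 𝔭 * G 𝔭 i (inr A) = 0 := by
  have e := h.metric.sum_inv_mul i1 (inr A)
  rw [sum_idx, h.null'_at, h.inv10] at e
  rw [sum_idx, h.null'_at, transVec_zero]
  simp only [transVec, mul_assoc, ← mul_sum]
  have h1 := h.nu
  have e2 : ∑ B, (G 𝔭)⁻¹ i1 (inr B) * G 𝔭 (inr B) (inr A) = -(𝔫⁻¹ * G 𝔭 i0 (inr A)) := by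
    simp at e
    linarith
  rw [e2]
  field_simp
  ring

lemma sum_transVec_mul_0 :
    ∑ i, transVec G i 𝔭 * G 𝔭 i i0 = -((1 / 2) * (𝔫 ^ 2 * (G 𝔭)⁻¹ i1 i1)) := by
  have e := h.metric.sum_inv_mul i1 i0
  rw [sum_idx, h.metric.symm_at i1 i0, h.inv10] at e
  rw [sum_idx, h.metric.symm_at i1 i0, transVec_zero]
  simp only [transVec, mul_assoc, ← mul_sum]
  have h1 := h.nu
  have e2 : ∑ B, (G 𝔭)⁻¹ i1 (inr B) * G 𝔭 (inr B) i0 = -(𝔫⁻¹ * G 𝔭 i0 i0) - (G 𝔭)⁻¹ i1 i1 * 𝔫 := by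
    simp at e
    linarith
  rw [e2]
  field_simp
  ring

lemma transMetric_0 (b : Idx m) : transMetric G 𝔭 i0 b = if b = i1 then 𝔫 else 0 := by
  have hp := h.metric.isPullbackNear_transMetric
  have e : ∀ b : Idx m, b ≠ i0 → transMetric G 𝔭 i0 b = ∑ i, transVec G i 𝔭 * G 𝔭 i b := by
    intro b hb
    rw [hp.apply_eq, transMap_onC]
    simp [h.metric.jac_transMap, hb]
  rcases b with b | A
  · fin_cases b
    · have e0 : transMetric G 𝔭 i0 i0 = ∑ j, transVec G j 𝔭 * ∑ i, transVec G i 𝔭 * G 𝔭 i j := by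
        rw [hp.apply_eq, transMap_onC]
        refine sum_swap fun j => ?_
        rw [mul_sum]
        refine sum_ext fun i => ?_
        rw [h.metric.jac_transMap, h.metric.jac_transMap, if_pos rfl, if_pos rfl]
        ring
      rw [Fin.zero_eta, e0, sum_idx]
      simp only [h.sum_transVec_mul_0, h.sum_transVec_mul_1, h.sum_transVec_mul_A]
      simp [transVec]
      ring
    · rw [Fin.mk_one, e _ (by simp), h.sum_transVec_mul_1, if_pos rfl]
  · rw [e _ (by simp), h.sum_transVec_mul_A, if_neg (by simp)]

lemma sph_trans : sph (transMetric G) r x = sph G r x := by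
  ext A B
  exact h.metric.transMetric_tangent (by simp) (by simp)

lemma isNullAdaptedNear : IsNullAdaptedNear (transMetric G) r x where
  metric := h.metric.isPullbackNear_transMetric.pull_metric
  null := h.eventually.mono fun q hq => by
    rw [hq.metric.transMetric_tangent (by simp) (by simp), hq.null_at]
  null' := h.eventually.mono fun q hq A => by
    rw [hq.metric.transMetric_tangent (by simp) (by simp), hq.null'_at]
  nu := by rw [h.transMetric_0, if_pos rfl]; exact h.nu
  isUnit := by rw [h.sph_trans]; exact h.isUnit
  cross := h.eventually.mono fun q hq A => by rw [hq.transMetric_0, if_neg (by simp)]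
  cross' := h.eventually.mono fun q hq => by rw [hq.transMetric_0, if_neg (by simp)]

lemma pd_jac_transMap (i : Idx m) {a b : Idx m} (ha : a ≠ i0) (hb : b ≠ i0) :
    pd a (fun y => jac (transMap G) y i b) 𝔭 = 0 := by
  have hs : SmoothNear (fun y => jac (transMap G) y i b) 𝔭 :=
    h.metric.isPullbackNear_transMetric.smoothNear_jac i b
  rcases a with a | A
  · fin_cases a
    · simp at ha
    · have : (fun s => jac (transMap G) (onC s x) i b) =ᶠ[𝓝 r] fun _ => if i = b then 1 else 0 := by
        filter_upwards [eventually_fst h.eventually] with s hs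
        rw [hs.metric.jac_transMap, if_neg hb]
      rw [Fin.mk_one, ← hs.deriv_onC, this.deriv_eq, deriv_const]
  · have : (fun z => jac (transMap G) (onC r z) i b) =ᶠ[𝓝 x] fun _ => if i = b then 1 else 0 := by
      filter_upwards [eventually_snd h.eventually] with s hs
      rw [hs.metric.jac_transMap, if_neg hb]
    rw [← hs.pd_onC, pd_congr A this, pd_const]

lemma chris_1_trans {a b : Idx m} (ha : a ≠ i0) (hb : b ≠ i0) :
    Γ (transMetric G) i1 a b 𝔭 = Γ G i1 a b 𝔭 - transVec G i1 𝔭 * Γ G i0 a b 𝔭 := by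
  have hp := h.metric.isPullbackNear_transMetric
  have rhs : ∀ i : Idx m, ∑ l, jac (transMap G) 𝔭 i l
      * Γ (transMetric G) l a b 𝔭 = Γ G i a b 𝔭 := by
    intro i
    rw [hp.sum_jac_mul_christoffel, transMap_onC, h.pd_jac_transMap _ ha hb]
    simp [h.metric.jac_transMap, ha, hb]
  rw [← rhs i0, ← rhs i1, sum_idx, sum_idx]
  simp [h.metric.jac_transMap, transVec_zero]

lemma ricci_trans {a b : Idx m} (ha : a ≠ i0) (hb : b ≠ i0) :
    ricci (transMetric G) a b 𝔭 = ricci G a b 𝔭 := by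
  rw [h.metric.isPullbackNear_transMetric.ricci_eq, transMap_onC]
  simp [h.metric.jac_transMap, ha, hb]

lemma eventually_trans_fst {a b : Idx m} (ha : a ≠ i0) (hb : b ≠ i0)
    (h0 : ∀ᶠ q in 𝓝 (r, x), Γ G i0 a b (onC q.1 q.2) = 0) :
    ∀ᶠ q in 𝓝 (r, x), Γ (transMetric G) i1 a b (onC q.1 q.2) = Γ G i1 a b (onC q.1 q.2) := by
  filter_upwards [h.eventually, h0] with q hq h0q
  rw [hq.chris_1_trans ha hb, h0q]
  ring

lemma eventually_sph_trans : ∀ᶠ q in 𝓝 (r, x), sph (transMetric G) q.1 q.2 = sph G q.1 q.2 :=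
  h.eventually.mono fun _ hq => hq.sph_trans

end IsNullNear

end Transversal

section Congruence

variable {h h' : ℝ → 𝕄 (Fin m)}

lemma chi_congr (e : ∀ᶠ q in 𝓝 (r, x), h q.1 q.2 = h' q.1 q.2) (A B : Fin m) :
    chi h r x A B = chi h' r x A B := by
  have e1 : ∀ A C : Fin m, (fun s => h s x A C) =ᶠ[𝓝 r] fun s => h' s x A C := fun A C =>
    (eventually_fst e).mono fun s hs => by simp only [hs]
  have e2 : h r x = h' r x := e.self_of_nhds
  simp only [chi, e2, (e1 _ _).deriv_eq]

lemma meanCurv_congr (e : ∀ᶠ q in 𝓝 (r, x), h q.1 q.2 = h' q.1 q.2) :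
    meanCurv h r x = meanCurv h' r x := by simp only [meanCurv, chi_congr e]

lemma shearSq_congr (e : ∀ᶠ q in 𝓝 (r, x), h q.1 q.2 = h' q.1 q.2) :
    shearSq h r x = shearSq h' r x := by simp only [shearSq, shear, chi_congr e, meanCurv_congr e]

section

variable {ι : Type} [Fintype ι] [DecidableEq ι] {g g' : 𝕄 ι} {x : ι → ℝ}

lemma christoffel_congr (e : g =ᶠ[𝓝 x] g') (l a b : ι) : Γ g l a b x = Γ g' l a b x := by
  have e1 : ∀ i j k : ι, pd k (fun z => g z i j) x = pd k (fun z => g' z i j) x := fun i j k =>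
    pd_congr k (e.mono fun y hy => by simp only [hy])
  simp only [christoffel, e1, e.self_of_nhds]

lemma christoffel_eventuallyEq (e : g =ᶠ[𝓝 x] g') (l a b : ι) : Γ g l a b =ᶠ[𝓝 x] Γ g' l a b :=
  e.eventuallyEq_nhds.mono fun _ hy => christoffel_congr hy l a b

lemma ricci_congr (e : g =ᶠ[𝓝 x] g') (a b : ι) : ricci g a b x = ricci g' a b x := by
  have e1 := christoffel_congr e
  have e2 : ∀ k l a b : ι, pd k (Γ g l a b) x = pd k (Γ g' l a b) x :=
    fun k l a b => pd_congr k (christoffel_eventuallyEq e l a b)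
  simp only [ricci, e1, e2]

lemma scalarCurv_congr (e : g =ᶠ[𝓝 x] g') : scalarCurv g x = scalarCurv g' x := by
  simp only [scalarCurv, ricci_congr e, e.self_of_nhds]

end

end Congruence

section NullGeometry

variable {G : 𝕄 (Idx m)}
local notation "𝔦" => (sph G r x)⁻¹
local notation "𝔱" => meanCurv (sph G) r x
local notation "𝔢" A:max => Γ G i1 i1 (inr A) 𝔭

namespace IsNullNear

variable (h : IsNullNear G r x)
include h

lemma ricci_A1 (A : Fin m) :
    ricci G (inr A) i1 𝔭 = deriv (fun s => Γ G i1 i1 (inr A) (onC s x)) r + 𝔱 * 𝔢 A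
        + (∑ B, pd B (fun z => chi (sph G) r z A B) x
          + ∑ B, ∑ C, (Γ (sph G r) B B C x * chi (sph G) r x A C
            - Γ (sph G r) C B A x * chi (sph G) r x C B))
        - pd A (fun z => meanCurv (sph G) r z + Γ G i1 i1 i1 (onC r z)) x := by
  have ha := h.isNullAdaptedNear
  have e := h.eventually_sph_trans
  have e1 : ∀ B : Fin m, ∀ᶠ q in 𝓝 (r, x), Γ (transMetric G) i1 i1 (inr B)
      (onC q.1 q.2) = Γ G i1 i1 (inr B) (onC q.1 q.2) := fun B =>
    h.eventually_trans_fst (by simp) (by simp) (h.eventually.mono fun q hq => hq.chris_0_1A B)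
  have e2 : ∀ᶠ q in 𝓝 (r, x), Γ (transMetric G) i1 i1 i1
      (onC q.1 q.2) = Γ G i1 i1 i1 (onC q.1 q.2) :=
    h.eventually_trans_fst (by simp) (by simp) (h.eventually.mono fun q hq => hq.chris_0_11)
  have ec : ∀ᶠ z in 𝓝 x, ∀ C D : Fin m, chi (sph (transMetric G)) r z C D
      = chi (sph G) r z C D := by
    filter_upwards [eventually_snd e.eventually_nhds] with z hz C D using chi_congr hz C D
  have em : ∀ᶠ z in 𝓝 x, meanCurv (sph (transMetric G)) r z = meanCurv (sph G) r z := by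
    filter_upwards [eventually_snd e.eventually_nhds] with z hz using meanCurv_congr hz
  have eg : sph (transMetric G) r =ᶠ[𝓝 x] sph G r := eventually_snd e
  rw [← h.ricci_trans (by simp) (by simp), ha.ricci_A1,
    ← (ha.metric.smoothNear_christoffel _ _ _).deriv_onC,
    (show (fun s => Γ (transMetric G) i1 i1 (inr A) (onC s x)) =ᶠ[𝓝 r]
      fun s => Γ G i1 i1 (inr A) (onC s x) from eventually_fst (e1 A)).deriv_eq,
    (e1 A).self_of_nhds, pd_congr A (f := fun z => meanCurv (sph (transMetric G)) r z
      + Γ (transMetric G) i1 i1 i1 (onC r z))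
      (g := fun z => meanCurv (sph G) r z + Γ G i1 i1 i1 (onC r z))
      (by filter_upwards [em, eventually_snd e2] with z h1 h2; rw [h1, h2]), em.self_of_nhds,
    sum_ext fun B => pd_congr B (ec.mono fun z hz => hz A B)]
  simp only [christoffel_congr eg, ec.self_of_nhds]

omit h in
/-- The transversal expansion `ζ = 2 g^{AB} Γ^1_{AB} + τ g^{11}`. -/
def transExpansion (G : 𝕄 (Idx m)) (r : ℝ)
    (x : Fin m → ℝ) : ℝ := 2 * ∑ A, ∑ B, (sph G r x)⁻¹ A B * Γ G i1 (inr A) (inr B) (onC r x)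
    + meanCurv (sph G) r x * (G (onC r x))⁻¹ i1 i1

lemma transExp_trans : IsNullAdaptedNear.transExp (transMetric G) r x = transExpansion G r x := by
  have e : ∀ A B : Fin m, Γ (transMetric G) i1 (inr A) (inr B) 𝔭
      = Γ G i1 (inr A) (inr B) 𝔭 + (1 / 2) * (G 𝔭)⁻¹ i1 i1
        * (1 / 2 * deriv (fun s => sph G s x A B) r) := by
    intro A B
    rw [h.chris_1_trans (by simp) (by simp), h.chris_0_AB]
    simp only [transVec]
    have := h.nu
    field_simp
    ring
  have t : ∑ A, ∑ B, 𝔦 A B * (1 / 2 * deriv (fun s => sph G s x A B) r) = 𝔱 := by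
    simp only [meanCurv, IsNullAdaptedNear.chi_eq]
  have t2 : ∀ u : ℝ, ∑ A, ∑ B, 𝔦 A B
      * (u * (1 / 2 * deriv (fun s => sph G s x A B) r)) = u * 𝔱 := by
    intro u
    rw [← t]
    simp only [mul_sum]
    exact sum_ext₂ fun A B => by ring
  simp only [IsNullAdaptedNear.transExp, transExpansion, h.sph_trans, e, mul_add, sum_add_distrib,
    t2]
  ring

lemma sum_inv_mul_ricci :
    ∑ A, ∑ B, 𝔦 A B * ricci (transMetric G) (inr A) (inr B) 𝔭
      = deriv (fun s => transExpansion G s x) r + (𝔱 + Γ G i1 i1 i1 𝔭) * transExpansion G r x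
        + scalarCurv (sph G r) x - 2 * ∑ A, ∑ B, 𝔦 A B * (𝔢 A * 𝔢 B)
        - 2 * (∑ A, pd A (fun z => ∑ B, (sph G r z)⁻¹ A B * Γ G i1 i1 (inr B) (onC r z)) x
          + ∑ A, ∑ B, Γ (sph G r) A A B x * ∑ C, 𝔦 B C * 𝔢 C) := by
  have ha := h.isNullAdaptedNear
  have e := h.eventually_sph_trans
  have e1 : ∀ᶠ q in 𝓝 (r, x), ∀ B : Fin m, Γ (transMetric G) i1 i1 (inr B)
      (onC q.1 q.2) = Γ G i1 i1 (inr B) (onC q.1 q.2) :=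
    Filter.eventually_all.2 fun B => h.eventually_trans_fst (by simp) (by simp)
      (h.eventually.mono fun q hq => hq.chris_0_1A B)
  have e2 : Γ (transMetric G) i1 i1 i1
      𝔭 = Γ G i1 i1 i1 𝔭 := (h.eventually_trans_fst (by simp) (by simp)
      (h.eventually.mono fun q hq => hq.chris_0_11)).self_of_nhds
  have eg : sph (transMetric G) r =ᶠ[𝓝 x] sph G r := eventually_snd e
  have et : (fun s => IsNullAdaptedNear.transExp (transMetric G) s x) =ᶠ[𝓝 r]
      fun s => transExpansion G s x := by
    filter_upwards [eventually_fst h.eventually] with s hs using hs.transExp_trans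
  have ew : ∀ A : Fin m, pd A (fun z => ∑ B, (sph (transMetric G) r z)⁻¹ A B
              * Γ (transMetric G) i1 i1 (inr B) (onC r z)) x = pd A (fun z => ∑ B, (sph G r z)⁻¹ A B
              * Γ G i1 i1 (inr B) (onC r z)) x := fun A => by
    refine pd_congr A ?_
    filter_upwards [eg, eventually_snd e1] with z h1 h2
    simp only [h1, h2]
  have := ha.sum_inv_mul_ricci
  rw [et.deriv_eq, h.transExp_trans, meanCurv_congr e, e2, scalarCurv_congr eg] at this
  simp only [christoffel_congr eg, e1.self_of_nhds, h.sph_trans, ew] at this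
  exact this

/-- When `R_{11}` and `R_{1A}` vanish, `S_{01}` is given by the trace of the angular part of the
Ricci tensor in the coordinates adapted to the spheres. -/
lemma einstein_01 (h11 : ricci G i1 i1 𝔭 = 0) (hA1 : ∀ A : Fin m, ricci G (inr A) i1 𝔭 = 0) :
    einstein G i0 i1 𝔭 = -(1 / 2) * G 𝔭 i0 i1 * ∑ A, ∑ B, 𝔦 A B
        * ricci (transMetric G) (inr A) (inr B) 𝔭 := by
  have h1A : ∀ A : Fin m, ricci G i1 (inr A) 𝔭 = 0 := fun A => by rw [h.metric.ricci_symm, hA1]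
  have e : ∀ A B : Fin m, ricci (transMetric G) (inr A) (inr B) 𝔭
      = ricci G (inr A) (inr B) 𝔭 := fun A B => h.ricci_trans (by simp) (by simp)
  simp only [einstein, scalarCurv, sum_idx, h.inv00, h.inv01, h.inv10, h.inv0A, h.invA0, h.invAB, h11,
    hA1, h1A, h.metric.ricci_symm i1 i0, e]
  have := h.nu
  simp only [zero_mul, mul_zero, add_zero, zero_add, sum_const_zero]
  field_simp
  ring

end IsNullNear

end NullGeometry

/-! ### Adapted coordinates of the cone -/

namespace SphereChart

variable (c : SphereChart m)

/-- The points `(r, x^A)` with `0 < r < T` and `x` in the domain of the chart. -/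
def coneDom (T : ℝ≥0∞) : Set (ConePt m) := {q | q.2 ∈ c.dom ∧ 0 < q.1 ∧ ofReal q.1 < T}

variable {c}

lemma isOpen_coneDom : IsOpen (c.coneDom T) :=
  (c.isOpen_dom.preimage continuous_snd).inter ((isOpen_lt continuous_const continuous_fst).inter
    (isOpen_lt (ENNReal.continuous_ofReal.comp continuous_fst) continuous_const))

lemma eventually_coneDom {q : ConePt m} (hq : q ∈ c.coneDom T) :
    ∀ᶠ p in 𝓝 q, p ∈ c.coneDom T := isOpen_coneDom.mem_nhds hq

lemma contDiffAt_θ (hx : x ∈ c.dom) : ContDiffAt ℝ ∞ c.θ x :=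
  c.smooth.contDiffAt (c.isOpen_dom.mem_nhds hx)

lemma hasFDerivAt_θ (hx : x ∈ c.dom) : HasFDerivAt c.θ (fderiv ℝ c.θ x) x :=
  ((contDiffAt_θ hx).differentiableAt (by simp)).hasFDerivAt

lemma inner_θ_frame (hx : x ∈ c.dom) (A : Fin m) : inner ℝ (c.θ x) (c.frame x A) = 0 := by
  have h1 : HasFDerivAt (fun z => inner ℝ (c.θ z) (c.θ z)) _ x :=
    (hasFDerivAt_θ hx).inner ℝ (hasFDerivAt_θ hx)
  have h2 : (fun z => inner ℝ (c.θ z) (c.θ z)) =ᶠ[𝓝 x] fun _ => (1 : ℝ) := by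
    filter_upwards [c.isOpen_dom.mem_nhds hx] with z hz
    rw [real_inner_self_eq_norm_sq, c.norm_eq z hz, one_pow]
  have h3 := h1.fderiv.symm.trans (h2.fderiv_eq.trans (by simp : _ = (0 : _ →L[ℝ] ℝ)))
  have h4 := congrArg (fun L : (Fin m → ℝ) →L[ℝ] ℝ => L (Pi.single A 1)) h3
  simp only [ContinuousLinearMap.comp_apply, ContinuousLinearMap.prod_apply, fderivInnerCLM_apply,
    zero_apply] at h4
  rw [real_inner_comm (c.θ x)] at h4
  simp only [frame]
  have := real_inner_comm (c.θ x) (fderiv ℝ c.θ x (Pi.single A 1))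
  linarith

lemma mem_cone {q : ConePt m} (hq : q ∈ c.coneDom T) : q.1 • c.θ q.2 ∈ cone m T := by
  have h1 : ‖q.1 • c.θ q.2‖ = q.1 := by
    rw [norm_smul, c.norm_eq _ hq.1, mul_one, Real.norm_of_nonneg hq.2.1.le]
  refine ⟨fun h => ?_, by rw [h1]; exact hq.2.2⟩
  rw [h, norm_zero] at h1
  exact hq.2.1.ne h1

lemma norm_smul_θ {q : ConePt m} (hq : q ∈ c.coneDom T) : ‖q.1 • c.θ q.2‖ = q.1 := by
  rw [norm_smul, c.norm_eq _ hq.1, mul_one, Real.norm_of_nonneg hq.2.1.le]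

lemma sum_smul_frame (x : Fin m → ℝ) (v : Fin m → ℝ) :
    ∑ A, v A • c.frame x A = fderiv ℝ c.θ x v := by
  conv_rhs => rw [pi_eq_sum_univ' v]
  simp only [map_sum, map_smul]
  exact sum_ext fun i => rfl

section adapted

variable {X : Idx m → ℝ} (hX : (fun A => X (inr A)) ∈ c.dom)
include hX

lemma fderiv_adapted (v : Idx m → ℝ) :
    fderiv ℝ c.adapted X v = (v i1 - v i0, X i1 • fderiv ℝ c.θ (fun A => X (inr A))
      (fun A => v (inr A)) + v i1 • c.θ fun A => X (inr A)) := by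
  have h1 : ∀ i : Idx m, HasFDerivAt (fun X : Idx m → ℝ => X i)
      (ContinuousLinearMap.proj (R := ℝ) (φ := fun _ : Idx m => ℝ) i) X := fun i =>
    (ContinuousLinearMap.proj (R := ℝ) (φ := fun _ : Idx m => ℝ) i).hasFDerivAt
  have h2 : HasFDerivAt (fun (X : Idx m → ℝ) (A : Fin m) => X (inr A))
      (ContinuousLinearMap.pi fun A : Fin m =>
        ContinuousLinearMap.proj (R := ℝ) (φ := fun _ : Idx m => ℝ) (inr A)) X :=
    hasFDerivAt_pi.2 fun A => h1 (inr A)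
  have h3 : HasFDerivAt c.adapted _ X := ((h1 i1).sub (h1 i0)).prodMk ((h1 i1).smul
      (HasFDerivAt.comp (g := c.θ) X (hasFDerivAt_θ hX) h2))
  rw [h3.fderiv]
  rfl

lemma fderiv_adapted_0 : fderiv ℝ c.adapted X (Pi.single i0 1) = (-1, 0) := by
  have : (fun A : Fin m => (Pi.single i0 1 : Idx m → ℝ) (inr A)) = 0 := by ext; simp
  rw [fderiv_adapted hX, this]
  simp

lemma fderiv_adapted_1 : fderiv ℝ c.adapted X (Pi.single i1 1) = (1, c.θ fun A => X (inr A)) := by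
  have : (fun A : Fin m => (Pi.single i1 1 : Idx m → ℝ) (inr A)) = 0 := by ext; simp
  rw [fderiv_adapted hX, this]
  simp

lemma fderiv_adapted_A (A : Fin m) :
    fderiv ℝ c.adapted X (Pi.single (inr A) 1) = (0, X i1 • c.frame (fun A => X (inr A)) A) := by
  have : (fun B : Fin m => (Pi.single (inr A) 1 : Idx m → ℝ) (inr B)) = Pi.single A 1 := by
    ext B
    simp [Pi.single_apply]
  rw [fderiv_adapted hX, this]
  simp [frame]

lemma contDiffAt_adapted : ContDiffAt ℝ ∞ c.adapted X := by
  have h1 : ∀ i : Idx m, ContDiffAt ℝ ∞ (fun X : Idx m → ℝ => X i) X := fun i =>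
    (contDiff_apply ℝ ℝ i).contDiffAt
  have h2 : ContDiffAt ℝ ∞ (fun (X : Idx m → ℝ) (A : Fin m) => X (inr A)) X :=
    contDiffAt_pi.2 fun A => h1 (inr A)
  exact ((h1 i1).sub (h1 i0)).prodMk ((h1 i1).smul ((contDiffAt_θ hX).comp X h2))

lemma eventually_dom : ∀ᶠ Y in 𝓝 X, (fun A => Y (inr A)) ∈ c.dom :=
  (continuous_pi fun A => continuous_apply (inr A)).continuousAt.eventually
    (c.isOpen_dom.mem_nhds hX)

end adapted

lemma smoothNear_metric {g : Spacetime m → Form (Spacetime m)} {X : Idx m → ℝ}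
    (hX : (fun A => X (inr A)) ∈ c.dom) (hg : ∀ᶠ p in 𝓝 (c.adapted X), ContDiffAt ℝ ∞ g p)
    (a b : Idx m) : SmoothNear (fun X => c.metric g X a b) X := by
  filter_upwards [eventually_dom hX, (contDiffAt_adapted hX).continuousAt.eventually hg]
    with Y h1 h2
  have h3 : ContDiffAt ℝ ∞ (fderiv ℝ c.adapted) Y := (contDiffAt_adapted h1).fderiv_right (by simp)
  have h4 : ContDiffAt ℝ ∞ (fun Y => g (c.adapted Y)) Y := h2.comp Y (contDiffAt_adapted h1)
  exact (h4.clm_apply (h3.clm_apply contDiffAt_const)).clm_apply (h3.clm_apply contDiffAt_const)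

lemma round_symm (x : Fin m → ℝ) (A B : Fin m) : c.round x A B = c.round x B A :=
  (real_inner_comm (c.frame x A) (c.frame x B)).symm

lemma smoothNear_round (hx : x ∈ c.dom) (A B : Fin m) : SmoothNear (fun z => c.round z A B) x := by
  filter_upwards [c.isOpen_dom.mem_nhds hx] with z hz
  have h3 : ContDiffAt ℝ ∞ (fderiv ℝ c.θ) z := (contDiffAt_θ hz).fderiv_right (by simp)
  exact (h3.clm_apply contDiffAt_const).inner ℝ (h3.clm_apply contDiffAt_const)

/-- A positive quadratic form on the tangent space of the sphere has positive definite components. -/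
lemma posDef_of_pos {B : Form (Space m)} (hx : x ∈ c.dom) {t : ℝ} (ht : t ≠ 0)
    (hs : ∀ v w, B v w = B w v) (hp : ∀ v, v ≠ 0 → inner ℝ (c.θ x) v = 0 → 0 < B v v) :
    (of fun A C => B (t • c.frame x A) (t • c.frame x C)).PosDef := by
  refine Matrix.PosDef.of_dotProduct_mulVec_pos ?_ fun v hv => ?_
  · ext A C
    simp only [Matrix.conjTranspose_apply, of_apply, star_trivial]
    exact hs _ _
  · set u := ∑ A, v A • (t • c.frame x A) with hu
    have hu' : u = t • fderiv ℝ c.θ x v := by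
      rw [hu, ← sum_smul_frame, smul_sum]
      exact sum_ext fun A => smul_comm _ _ _
    have h1 : u ≠ 0 := by
      rw [hu']
      refine smul_ne_zero ht fun h => hv (c.immersion x hx ?_)
      rw [h, map_zero]
    have h2 : inner ℝ (c.θ x) u = 0 := by
      rw [hu, inner_sum]
      refine Finset.sum_eq_zero fun A _ => ?_
      rw [inner_smul_right, inner_smul_right, inner_θ_frame hx]
      simp
    have h3 := hp u h1 h2
    have h4 : B u u = star v ⬝ᵥ (of fun A C => B (t • c.frame x A) (t • c.frame x C)).mulVec v := by
      rw [hu]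
      simp only [map_sum, dotProduct, Matrix.mulVec, star_trivial, of_apply, mul_sum, map_smul,
        sum_apply, smul_apply, smul_eq_mul]
      exact sum_ext₂ fun A C => by rw [hs (c.frame x A)]; ring
    rw [← h4]
    exact h3

lemma posDef_round (hx : x ∈ c.dom) : (c.round x).PosDef := by
  have := posDef_of_pos (c := c) (B := euclid m) hx one_ne_zero
    (fun v w => real_inner_comm w v) (fun v hv _ => real_inner_self_pos.2 hv)
  simp only [one_smul] at this
  exact this

/-! Components of the Minkowski metric in adapted coordinates. -/

section eta

variable {X : Idx m → ℝ} (hX : (fun A => X (inr A)) ∈ c.dom)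
include hX

lemma eta_00 : c.eta X i0 i0 = -1 := by simp [eta, metric, fderiv_adapted_0 hX, minkowski_apply]

lemma eta_01 : c.eta X i0 i1 = 1 := by
  simp [eta, metric, fderiv_adapted_0 hX, fderiv_adapted_1 hX, minkowski_apply]

lemma eta_0A (A : Fin m) : c.eta X i0 (inr A) = 0 := by
  simp [eta, metric, fderiv_adapted_0 hX, fderiv_adapted_A hX, minkowski_apply]

lemma eta_11 : c.eta X i1 i1 = 0 := by
  simp [eta, metric, fderiv_adapted_1 hX, minkowski_apply, c.norm_eq _ hX]

lemma eta_1A (A : Fin m) : c.eta X i1 (inr A) = 0 := by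
  simp [eta, metric, fderiv_adapted_1 hX, fderiv_adapted_A hX, minkowski_apply, inner_smul_right,
    inner_θ_frame hX]

lemma eta_AB (A B : Fin m) :
    c.eta X (inr A) (inr B) = X i1 ^ 2 * c.round (fun A => X (inr A)) A B := by
  simp [eta, metric, fderiv_adapted_A hX, minkowski_apply, inner_smul_right, inner_smul_left, round]
  ring

lemma eta_symm (a b : Idx m) : c.eta X a b = c.eta X b a := by
  simp only [eta, metric, of_apply, minkowski_apply, real_inner_comm, mul_comm]

end eta

lemma smoothNear_eta {X : Idx m → ℝ} (hX : (fun A => X (inr A)) ∈ c.dom) (a b : Idx m) :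
    SmoothNear (fun X => c.eta X a b) X :=
  smoothNear_metric hX (.of_forall fun _ => contDiffAt_const) a b

lemma sph_eta (hx : x ∈ c.dom) : sph c.eta r x = r ^ 2 • c.round x := by
  ext A B
  exact eta_AB (X := onC r x) hx A B

/-- The conditions which make a null hypersurface out of the cone, from the components of the
metric on it. -/
lemma isNullNear_of {G : 𝕄 (Idx m)}
    (hs : ∀ a b, SmoothNear (fun X => G X a b) 𝔭)
    (symm : ∀ᶠ X in 𝓝 𝔭, ∀ a b, G X a b = G X b a)
    (h11 : ∀ᶠ q in 𝓝 (r, x), G (onC q.1 q.2) i1 i1 = 0)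
    (h1A : ∀ᶠ q in 𝓝 (r, x), ∀ A, G (onC q.1 q.2) i1 (inr A) = 0)
    (nu : G 𝔭 i0 i1 ≠ 0) (hu : IsUnit (sph G r x).det) : IsNullNear G r x where
  metric := ⟨hs, symm, Matrix.isUnit_det_of_right_inverse (mul_nullInverse symm.self_of_nhds
    h11.self_of_nhds h1A.self_of_nhds nu (fun _ _ => rfl) hu)⟩
  null := h11
  null' := h1A
  nu := nu
  isUnit := hu

lemma isNullNear_eta (hx : x ∈ c.dom) (hr : r ≠ 0) : IsNullNear c.eta r x := by
  have hd : ∀ᶠ q in 𝓝 (r, x), q.2 ∈ c.dom :=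
    continuous_snd.continuousAt.eventually (c.isOpen_dom.mem_nhds hx)
  refine isNullNear_of (smoothNear_eta (X := onC r x) hx) ?_ ?_ ?_ ?_ ?_
  · filter_upwards [eventually_dom (X := onC r x) hx] with Y hY using eta_symm hY
  · filter_upwards [hd] with q hq using eta_11 (X := onC q.1 q.2) hq
  · filter_upwards [hd] with q hq using eta_1A (X := onC q.1 q.2) hq
  · rw [eta_01 (X := onC r x) hx]; exact one_ne_zero
  · rw [sph_eta hx, Matrix.det_smul, isUnit_iff_ne_zero]
    exact mul_ne_zero (pow_ne_zero _ (pow_ne_zero _ hr)) (posDef_round hx).det_pos.ne'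

section TargetChristoffel

variable (hx : x ∈ c.dom) (hr : r ≠ 0)
include hx

lemma pd_eta_cross (k b : Idx m) : pd k (fun z => c.eta z i0 b) 𝔭 = 0 := by
  have hd := eventually_dom (X := onC r x) hx
  rcases b with b | A
  · fin_cases b
    · exact (pd_congr (g := fun _ => -1) k (hd.mono fun z hz => eta_00 hz)).trans (pd_const k _)
    · exact (pd_congr (g := fun _ => 1) k (hd.mono fun z hz => eta_01 hz)).trans (pd_const k _)
  · exact (pd_congr (g := fun _ => 0) k (hd.mono fun z hz => eta_0A hz A)).trans (pd_const k _)

lemma pd_eta_time (a b : Idx m) : pd i0 (fun z => c.eta z a b) 𝔭 = 0 := by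
  rw [pd, ← ((smoothNear_eta (X := onC r x) hx a b).differentiableAt).lineDeriv_eq_fderiv,
    lineDeriv]
  have hd : ∀ t : ℝ, (fun A => (onC r x + t • (Pi.single i0 1 : Idx m → ℝ)) (inr A)) ∈ c.dom := by
    intro t
    have : (fun A => (onC r x + t • (Pi.single i0 1 : Idx m → ℝ)) (inr A)) = x := by
      ext A; simp [onC]
    rwa [this]
  have e : ∀ t : ℝ, c.eta (onC r x + t • (Pi.single i0 1 : Idx m → ℝ)) a b = c.eta 𝔭 a b := by
    intro t
    have h1 := hd t
    have h2 : (fun A => onC r x (inr A)) ∈ c.dom := hx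
    rcases a with a | A <;> rcases b with b | B
    · fin_cases a <;> fin_cases b
      · exact (eta_00 h1).trans (eta_00 h2).symm
      · exact (eta_01 h1).trans (eta_01 h2).symm
      · exact ((eta_symm h1 _ _).trans (eta_01 h1)).trans ((eta_symm h2 _ _).trans (eta_01 h2)).symm
      · exact (eta_11 h1).trans (eta_11 h2).symm
    · fin_cases a
      · exact (eta_0A h1 B).trans (eta_0A h2 B).symm
      · exact (eta_1A h1 B).trans (eta_1A h2 B).symm
    · rw [eta_symm h1, eta_symm h2]
      fin_cases b
      · exact (eta_0A h1 A).trans (eta_0A h2 A).symm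
      · exact (eta_1A h1 A).trans (eta_1A h2 A).symm
    · rw [eta_AB h1, eta_AB h2]
      simp [onC]
  simp only [e]
  exact deriv_const _ _

lemma etaLow_0 (a b : Idx m) : christoffelLow c.eta i0 a b 𝔭 = 0 := by
  simp [christoffelLow, pd_eta_cross hx, pd_eta_time hx]

include hr

lemma eta_chris_time (l b : Idx m) : Γ c.eta l i0 b 𝔭 = 0 := by
  have h := (isNullNear_eta hx hr).metric
  rw [christoffel_eq]
  refine Finset.sum_eq_zero fun k _ => ?_
  have e : pd b (fun z => c.eta z k i0) 𝔭 = 0 := by rw [h.pd_symm, pd_eta_cross hx]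
  simp [christoffelLow, pd_eta_cross hx, pd_eta_time hx, e]

lemma eta_chris_1 (a b : Idx m) : Γ c.eta i1 a b 𝔭 = Γ c.eta i0 a b 𝔭 := by
  have h := isNullNear_eta hx hr
  have hX : (fun A => onC r x (inr A)) ∈ c.dom := hx
  rw [h.chris_0, christoffel_eq, sum_idx, etaLow_0 hx, h.inv_eq]
  simp [nullInverse, eta_00 hX, eta_01 hX, eta_0A hX]

lemma eta_chris_0_AB (A B : Fin m) : Γ c.eta i0 (inr A) (inr B) 𝔭 = -r * c.round x A B := by
  have h := isNullNear_eta hx hr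
  have hX : (fun A => onC r x (inr A)) ∈ c.dom := hx
  rw [h.chris_0_AB, eta_01 hX]
  simp only [sph_eta hx, Matrix.smul_apply, smul_eq_mul]
  rw [deriv_mul_const_field, deriv_pow_field]
  simp
  ring

lemma eta_chris_A_1B (A B : Fin m) : Γ c.eta (inr A) i1 (inr B) 𝔭 = if A = B then 1 / r else 0 := by
  have h := isNullNear_eta hx hr
  rw [h.chris_A_1B]
  have e := h.sphere_metric.sum_inv_mul A B
  have e2 : chi (sph c.eta) r x B A = (1 / r) * ∑ C, (sph c.eta r x)⁻¹ A C * sph c.eta r x C B := by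
    simp only [chi, mul_sum]
    refine sum_ext fun C => ?_
    simp only [sph_eta hx, Matrix.smul_apply, smul_eq_mul]
    rw [deriv_mul_const_field, deriv_pow_field, round_symm x C B]
    simp
    field_simp
  rw [e2, e]
  simp

lemma eta_chris_A_BC (A B C : Fin m) : Γ c.eta (inr A) (inr B) (inr C) 𝔭 = Γ c.round A B C x := by
  have h := isNullNear_eta hx hr
  have hX : (fun A => onC r x (inr A)) ∈ c.dom := hx
  have e0 : (c.eta 𝔭)⁻¹ (inr A) i1 = 0 := by
    rw [h.inv_eq]
    simp [nullInverse, eta_0A hX]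
  have hd : ∀ᶠ z in 𝓝 x, z ∈ c.dom := c.isOpen_dom.mem_nhds hx
  rw [h.chris_A_BC, e0, zero_mul, sub_zero]
  have e1 : ∀ i j k : Fin m, pd k (fun z => sph c.eta r z i j) x
      = r ^ 2 * pd k (fun z => c.round z i j) x := by
    intro i j k
    rw [← pd_const_mul k _ (smoothNear_round hx i j)]
    refine pd_congr k ?_
    filter_upwards [hd] with z hz
    rw [sph_eta hz, Matrix.smul_apply, smul_eq_mul]
  have hu : IsUnit (c.round x).det := isUnit_iff_ne_zero.2 (posDef_round hx).det_pos.ne'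
  have e2 : (sph c.eta r x)⁻¹ = (r ^ 2)⁻¹ • (c.round x)⁻¹ := by
    rw [sph_eta hx]
    refine Matrix.inv_eq_right_inv ?_
    rw [smul_mul_smul_comm, mul_nonsing_inv _ hu, mul_inv_cancel₀ (pow_ne_zero 2 hr), one_smul]
  simp only [christoffel, e1, e2, Matrix.smul_apply, smul_eq_mul]
  congr 1
  refine sum_ext fun k => ?_
  field_simp

end TargetChristoffel

end SphereChart

/-! ### Components of the metric on the cone -/

section Trace

variable {U : Set (Spacetime m)} {g : Spacetime m → Form (Spacetime m)} {D : ConeMetric m}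
local notation "𝔤" => c.metric g
local notation "𝓗" => waveGauge 𝔤 c.eta
local notation "𝔥" => c.comp2 D.gt r x
local notation "ν₀" => c.comp0 D.nu0 r x
local notation "𝔤⁻" => (𝔤 𝔭)⁻¹

namespace HasTrace

variable (h : HasTrace T U g D) (hq : (r, x) ∈ c.coneDom T)
include h hq

lemma adapted_onC : c.adapted 𝔭 = (‖r • c.θ x‖, r • c.θ x) := by
  rw [norm_smul_θ hq]
  simp [SphereChart.adapted, onC]

lemma metric_apply (a b : Idx m) : 𝔤 𝔭 a b = D.form (r • c.θ x)
    (fderiv ℝ c.adapted 𝔭 (Pi.single a 1)) (fderiv ℝ c.adapted 𝔭 (Pi.single b 1)) := by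
  rw [SphereChart.metric, of_apply, h.adapted_onC hq, h.trace _ (mem_cone hq)]

lemma dx_1 : ConeMetric.dx1 (r • c.θ x) (1, c.θ x) = 1 ∧ ConeMetric.dx0 (r • c.θ x) (1, c.θ x) = 0 := by
  have h1 := norm_smul_θ hq
  have h2 : inner ℝ (c.θ x) (c.θ x) = (1 : ℝ) := by
    rw [real_inner_self_eq_norm_sq, c.norm_eq _ hq.1, one_pow]
  have h3 : r ≠ 0 := hq.2.1.ne'
  simp only at h1
  have : ConeMetric.dx1 (r • c.θ x) (1, c.θ x) = 1 := by
    simp [ConeMetric.dx1, h1, inner_smul_left, c.norm_eq _ hq.1, h3]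
  exact ⟨this, by rw [ConeMetric.dx0, this]; simp⟩

lemma dx_A (A : Fin m) : ConeMetric.dx1 (r • c.θ x) (0, r • c.frame x A) = 0 ∧
    ConeMetric.dx0 (r • c.θ x) (0, r • c.frame x A) = 0 := by
  have : ConeMetric.dx1 (r • c.θ x) (0, r • c.frame x A) = 0 := by
    simp [ConeMetric.dx1, inner_smul_left, inner_smul_right, inner_θ_frame hq.1]
  exact ⟨this, by rw [ConeMetric.dx0, this]; simp⟩

lemma nu_θ : D.nu (r • c.θ x) (c.θ x) = 0 := by
  have := h.isMetric.nu_radial _ (mem_cone hq)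
  rw [map_smul, smul_eq_mul] at this
  exact (mul_eq_zero.1 this).resolve_left hq.2.1.ne'

lemma gt_θ (v : Space m) : D.gt (r • c.θ x) (c.θ x) v = 0 ∧ D.gt (r • c.θ x) v (c.θ x) = 0 := by
  have h1 : D.gt (r • c.θ x) (c.θ x) = 0 := by
    have := h.isMetric.radial _ (mem_cone hq)
    rw [map_smul] at this
    exact (smul_eq_zero.1 this).resolve_left hq.2.1.ne'
  have h2 : D.gt (r • c.θ x) (c.θ x) v = 0 := by rw [h1]; rfl
  exact ⟨h2, by rw [h.isMetric.symm _ (mem_cone hq), h2]⟩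

lemma metric_00 : 𝔤 𝔭 i0 i0 = c.comp0 D.g00 r x := by
  rw [h.metric_apply hq, fderiv_adapted_0 (X := onC r x) hq.1]
  simp [ConeMetric.form, ConeMetric.dx0, ConeMetric.dx1, SphereChart.comp0]

lemma metric_01 : 𝔤 𝔭 i0 i1 = ν₀ := by
  rw [h.metric_apply hq, fderiv_adapted_0 (X := onC r x) hq.1, fderiv_adapted_1 (X := onC r x) hq.1]
  have := h.dx_1 hq
  simp only [ConeMetric.form, onC_inr, this.1, this.2]
  simp [ConeMetric.dx0, ConeMetric.dx1, SphereChart.comp0, h.nu_θ hq]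

lemma metric_0A (A : Fin m) : 𝔤 𝔭 i0 (inr A) = c.comp1 D.nu r x A := by
  rw [h.metric_apply hq, fderiv_adapted_0 (X := onC r x) hq.1, fderiv_adapted_A (X := onC r x) hq.1]
  have := h.dx_A hq A
  simp only [ConeMetric.form, onC_inr, onC_one, this.1, this.2]
  simp [ConeMetric.dx0, ConeMetric.dx1, SphereChart.comp1]

lemma metric_11 : 𝔤 𝔭 i1 i1 = 0 := by
  rw [h.metric_apply hq, fderiv_adapted_1 (X := onC r x) hq.1]
  have := h.dx_1 hq
  simp only [ConeMetric.form, onC_inr, this.1, this.2, (h.gt_θ hq (c.θ x)).1]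
  simp

lemma metric_1A (A : Fin m) : 𝔤 𝔭 i1 (inr A) = 0 := by
  rw [h.metric_apply hq, fderiv_adapted_1 (X := onC r x) hq.1, fderiv_adapted_A (X := onC r x) hq.1]
  have h1 := h.dx_A hq A
  have h2 := h.dx_1 hq
  simp only [ConeMetric.form, onC_inr, onC_one, h1.1, h1.2, h2.1, h2.2, (h.gt_θ hq _).1]
  simp

lemma sph_eq : sph 𝔤 r x = 𝔥 := by
  ext A B
  simp only [sph, of_apply]
  rw [h.metric_apply hq, fderiv_adapted_A (X := onC r x) hq.1, fderiv_adapted_A (X := onC r x) hq.1]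
  have h1 := h.dx_A hq A
  have h2 := h.dx_A hq B
  simp only [ConeMetric.form, onC_inr, onC_one, h1.1, h1.2, h2.1, h2.2, SphereChart.comp2, of_apply]
  simp

omit h in
lemma _root_.NullCone.ConeMetric.IsMetric.posDef_gt (h : D.IsMetric T) : (𝔥).PosDef := by
  have hy := mem_cone hq
  refine posDef_of_pos hq.1 hq.2.1.ne' (h.symm _ hy) fun v hv hi => h.pos _ hy v hv ?_
  rw [inner_smul_left, hi, mul_zero]

lemma isNullNear : IsNullNear 𝔤 r x := by
  have hU : (onC r x |> c.adapted) ∈ U := by rw [h.adapted_onC hq]; exact h.subset _ (mem_cone hq)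
  have hUe : ∀ᶠ p in 𝓝 (c.adapted 𝔭), p ∈ U := h.isOpen.mem_nhds hU
  have he := eventually_coneDom hq
  refine SphereChart.isNullNear_of (SphereChart.smoothNear_metric (X := onC r x) hq.1 ?_) ?_ ?_ ?_ ?_ ?_
  · filter_upwards [hUe] with p hp using h.smooth.contDiffAt (h.isOpen.mem_nhds hp)
  · filter_upwards [(contDiffAt_adapted (X := onC r x) hq.1).continuousAt.eventually hUe]
      with Y hY a b using h.symm _ hY _ _
  · filter_upwards [he] with q hq using h.metric_11 hq
  · filter_upwards [he] with q hq using h.metric_1A hq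
  · rw [h.metric_01 hq]; exact (h.isMetric.nu0_pos _ (mem_cone hq)).ne'
  · rw [h.sph_eq hq]
    exact isUnit_iff_ne_zero.2 (h.isMetric.posDef_gt hq).det_pos.ne'

lemma eventually_sph : ∀ᶠ q in 𝓝 (r, x), sph 𝔤 q.1 q.2 = c.comp2 D.gt q.1 q.2 := by
  filter_upwards [eventually_coneDom hq] with q hq using h.sph_eq hq

lemma chi_eq (A B : Fin m) : chi (sph 𝔤) r x A B = chi (c.comp2 D.gt) r x A B :=
  chi_congr (h.eventually_sph hq) A B

lemma tau_eq : meanCurv (sph 𝔤) r x = D.tau c r x := meanCurv_congr (h.eventually_sph hq)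

lemma eventuallyEq_sphere : sph 𝔤 r =ᶠ[𝓝 x] c.comp2 D.gt r := eventually_snd (h.eventually_sph hq)

omit h in
/-- An identity between functions which holds on the cone holds eventually along a generator. -/
lemma _root_.NullCone.SphereChart.eventuallyEq_fst {P Q : ConeFn m}
    (e : ∀ q ∈ c.coneDom T, P q.1 q.2 = Q q.1 q.2) : (fun s => P s x) =ᶠ[𝓝 r] fun s => Q s x :=
  eventually_fst ((eventually_coneDom hq).mono e)

omit h in
lemma _root_.NullCone.SphereChart.eventuallyEq_snd {P Q : ConeFn m}
    (e : ∀ q ∈ c.coneDom T, P q.1 q.2 = Q q.1 q.2) : P r =ᶠ[𝓝 x] Q r :=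
  eventually_snd ((eventually_coneDom hq).mono e)

lemma deriv_nu0 :
    deriv (fun s => c.comp0 D.nu0 s x) r = pd i1 (fun z => c.metric g z i0 i1) (onC r x) := by
  rw [← ((h.isNullNear hq).metric.smooth i0 i1).deriv_onC]
  exact (eventuallyEq_fst (P := c.comp0 D.nu0)
    (Q := fun s x => c.metric g (onC s x) i0 i1) hq fun q hq => (h.metric_01 hq).symm).deriv_eq

lemma inv_A1 (A : Fin m) : 𝔤⁻ (inr A) i1 = 𝔤⁻ i1 (inr A) := (h.isNullNear hq).metric.inv_symm _ _

lemma inv_11 : 𝔤⁻ i1 i1 = D.g11 c r x := by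
  rw [(h.isNullNear hq).inv_eq]
  simp only [nullInverse, of_apply, h.metric_01 hq, h.metric_0A hq, h.sph_eq hq, h.metric_00 hq,
    ConeMetric.g11]

lemma nu0_ne : ν₀ ≠ 0 := (h.isMetric.nu0_pos _ (mem_cone hq)).ne'

/-- `ν^A`-contractions: `g_{AB} g^{1B} = -ν⁰ ν_A`. -/
lemma sum_gt_inv_1A (A : Fin m) :
    ∑ B, 𝔥 A B * 𝔤⁻ i1 (inr B) = -ν₀⁻¹ * c.comp1 D.nu r x A := by
  have hn := h.isNullNear hq
  have e := hn.metric.sum_inv_mul i1 (inr A)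
  rw [sum_idx, hn.inv10, h.metric_01 hq, h.metric_0A hq, h.metric_1A hq] at e
  simp only [mul_zero, add_zero] at e
  have e2 : ∀ B, 𝔤 𝔭 (inr B) (inr A) = 𝔥 A B := fun B => by
    rw [hn.metric.symm_at, ← h.sph_eq hq]; rfl
  simp only [e2] at e
  simp only [mul_comm (𝔥 A _)]
  simp at e
  linarith

end HasTrace

/-! ### The wave-gauge vector on the cone -/

namespace HasTrace

lemma smoothNear_waveGauge (h : HasTrace T U g D) (hq : onCone) (l : Idx m) :
    SmoothNear (𝓗 l) 𝔭 := by
  have hn := h.isNullNear hq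
  have he := isNullNear_eta (c := c) hq.1 hq.2.1.ne'
  exact SmoothNear.sum fun a => SmoothNear.sum fun b => (hn.metric.smoothNear_inv a b).mul
    ((hn.metric.smoothNear_christoffel _ _ _).sub (he.metric.smoothNear_christoffel _ _ _))

variable (h : HasTrace T U g D) (hq : (r, x) ∈ c.coneDom T)
include h hq

lemma chris_0_01 : Γ 𝔤 i0 i1 i0 𝔭 = ν₀⁻¹ * deriv (fun s => c.comp0 D.nu0 s x) r
      - Γ 𝔤 i1 i1 i1 𝔭 := by
  have hn := h.isNullNear hq
  have e := hn.metric.pd_metric i1 i0 i1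
  rw [← h.deriv_nu0 hq, ← hn.metric.sum_mul_christoffel, ← hn.metric.sum_mul_christoffel] at e
  simp only [sum_idx, hn.chris_0_11, hn.chris_A_11, h.metric_01 hq, hn.metric.symm_at i1 i0,
    h.metric_1A hq, h.metric_11 hq] at e
  have h1 := h.nu0_ne hq
  simp at e
  rw [e]
  field_simp
  ring

/-- Contraction with the inverse of a metric whose cone is null. -/
lemma sum_inv_mul (Y : Idx m → Idx m → ℝ) (hY : ∀ a b, Y a b = Y b a) :
    ∑ a, ∑ b, 𝔤⁻ a b * Y a b = 2 * ν₀⁻¹ * Y i1 i0 + D.g11 c r x * Y i1 i1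
        + 2 * ∑ A, 𝔤⁻ i1 (inr A) * Y i1 (inr A) + ∑ A, ∑ B, 𝔥⁻¹ A B * Y (inr A) (inr B) := by
  have hn := h.isNullNear hq
  simp only [sum_idx, hn.inv00, hn.inv01, hn.inv10, hn.inv0A, hn.invA0, hn.invAB, h.inv_11 hq,
    h.metric_01 hq, h.sph_eq hq, h.inv_A1 hq, sum_add_distrib, hY i0 i1, hY (inr _) i1]
  simp
  ring

lemma sum_inv_mul_half_deriv :
    ∑ A, ∑ B, 𝔥⁻¹ A B * (1 / 2 * deriv (fun s => sph 𝔤 s x A B) r) = D.tau c r x := by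
  rw [← h.tau_eq hq, ← h.sph_eq hq]
  simp only [meanCurv, IsNullAdaptedNear.chi_eq]

lemma gauge_0 : 𝓗 i0 𝔭 = 2 * ν₀⁻¹ * (ν₀⁻¹ * deriv (fun s => c.comp0 D.nu0 s x) r
      - Γ 𝔤 i1 i1 i1 𝔭) - ν₀⁻¹ * D.tau c r x - D.W0 c r x := by
  have hn := h.isNullNear hq
  have he := isNullNear_eta (c := c) hq.1 hq.2.1.ne'
  have hr := hq.2.1.ne'
  rw [waveGauge, h.sum_inv_mul hq (fun a b => Γ 𝔤 i0 a b 𝔭 - Γ c.eta i0 a b 𝔭)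
    fun a b => by rw [hn.metric.christoffel_symm, he.metric.christoffel_symm]]
  rw [h.chris_0_01 hq, he.metric.christoffel_symm i0 i1 i0, eta_chris_time (r := r) hq.1 hr]
  simp only [hn.chris_0_11, he.chris_0_11, hn.chris_0_1A, he.chris_0_1A, hn.chris_0_AB,
    eta_chris_0_AB hq.1 hr, h.metric_01 hq]
  have e : ∑ A, ∑ B, 𝔥⁻¹ A B * (-ν₀⁻¹
      * (1 / 2 * deriv (fun s => sph 𝔤 s x A B) r) - -r * c.round x A B)
      = -ν₀⁻¹ * D.tau c r x - D.W0 c r x := by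
    rw [← h.sum_inv_mul_half_deriv hq, ConeMetric.W0]
    simp only [mul_sum, ← sum_sub_distrib]
    exact sum_ext₂ fun A B => by ring
  rw [e]
  simp
  ring

/-- `Γ^1_{11} = κ - ν₀ H⁰ / 2`. -/
lemma chris_1_11 : Γ 𝔤 i1 i1 i1 𝔭 = D.kappa c r x - 1 / 2 * ν₀ * 𝓗 i0 𝔭 := by
  have h1 := h.nu0_ne hq
  rw [h.gauge_0 hq, ConeMetric.kappa, ConeMetric.W1]
  field_simp
  ring

lemma Hlow_1 : Hlow g c i1 r x = ν₀ * 𝓗 i0 𝔭 := by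
  have hn := h.isNullNear hq
  simp [Hlow, waveGaugeLow, hn.metric.symm_at i1 i0, h.metric_01 hq, h.metric_11 hq, h.metric_1A hq]

lemma Hlow_A (A : Fin m) :
    Hlow g c (inr A) r x = c.comp1 D.nu r x A * 𝓗 i0 𝔭 + ∑ B, 𝔥 A B * 𝓗 (inr B) 𝔭 := by
  have hn := h.isNullNear hq
  rw [Hlow, waveGaugeLow, sum_idx]
  have e2 : ∀ B, 𝔤 𝔭 (inr A) (inr B) = 𝔥 A B := fun B => by rw [← h.sph_eq hq]; rfl
  simp only [hn.metric.symm_at (inr A) i0, h.metric_0A hq, hn.metric.symm_at (inr A) i1,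
    h.metric_1A hq, e2]
  simp

lemma Hlow_0 : Hlow g c i0 r x = c.comp0 D.g00 r x * 𝓗 i0 𝔭 + ν₀ * 𝓗 i1 𝔭
      + ∑ B, c.comp1 D.nu r x B * 𝓗 (inr B) 𝔭 := by
  simp only [Hlow, waveGaugeLow, sum_idx, h.metric_00 hq, h.metric_01 hq, h.metric_0A hq]

lemma gauge_A (A : Fin m) : 𝓗 (inr A) 𝔭
    = -2 * deriv (fun s => (c.metric g (onC s x))⁻¹ i1 (inr A)) r
      - (2 * Γ 𝔤 i1 i1 i1 𝔭 + 2 / r + D.tau c r x) * 𝔤⁻ i1 (inr A)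
      - 2 * ∑ B, 𝔥⁻¹ A B * Γ 𝔤 i1 i1 (inr B) 𝔭 - ∑ C, ∑ E, 𝔥⁻¹ C E *
        (Γ c.round A C E x - Γ (c.comp2 D.gt r) A C E x) := by
  have hn := h.isNullNear hq
  have he := isNullNear_eta (c := c) hq.1 hq.2.1.ne'
  have hr := hq.2.1.ne'
  have e1 : ν₀⁻¹ * Γ 𝔤 (inr A) i1 i0 𝔭 = -deriv (fun s => (c.metric g (onC s x))⁻¹ i1 (inr A)) r
        - ∑ B, chi (c.comp2 D.gt) r x B A * 𝔤⁻ i1 (inr B) - Γ 𝔤 i1 i1 i1 𝔭 * 𝔤⁻ i1 (inr A)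
        - ∑ B, 𝔥⁻¹ A B * Γ 𝔤 i1 i1 (inr B) 𝔭 := by
    have e := hn.metric.pd_inv i1 i1 (inr A)
    rw [← (hn.metric.smoothNear_inv i1 (inr A)).deriv_onC] at e
    simp only [sum_idx, hn.inv0A, hn.inv10, hn.invAB, h.metric_01 hq, hn.chris_A_11, hn.chris_A_1B,
      h.sph_eq hq, h.chi_eq hq] at e
    rw [e]
    have s1 : ∀ B, 𝔥⁻¹ B A = 𝔥⁻¹ A B := fun B => by
      rw [← h.sph_eq hq]; exact hn.sphere_metric.inv_symm _ _
    simp only [s1, mul_comm (Γ 𝔤 i1 i1 _ 𝔭), sum_add_distrib]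
    simp
    ring
  rw [waveGauge, h.sum_inv_mul hq (fun a b => Γ 𝔤 (inr A) a b 𝔭 - Γ c.eta (inr A) a b 𝔭)
    fun a b => by rw [hn.metric.christoffel_symm, he.metric.christoffel_symm]]
  simp only [he.metric.christoffel_symm (inr A) i1 i0, eta_chris_time hq.1 hr, hn.chris_A_11,
    he.chris_A_11, hn.chris_A_1B, eta_chris_A_1B hq.1 hr,
    hn.chris_A_BC, SphereChart.eta_chris_A_BC hq.1 hr, h.chi_eq hq, h.inv_A1 hq,
    christoffel_congr (h.eventuallyEq_sphere hq)]
  rw [sub_zero, mul_assoc, e1]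
  have e2 : ∑ B, 𝔤⁻ i1 (inr B) * (chi (c.comp2 D.gt) r x B A - if A = B then 1 / r else 0)
      = ∑ B, chi (c.comp2 D.gt) r x B A * 𝔤⁻ i1 (inr B) - 1 / r * 𝔤⁻ i1 (inr A) := by
    simp only [mul_sub, sum_sub_distrib]
    simp [mul_comm]
  have e3 : ∑ B, ∑ C, 𝔥⁻¹ B C * (Γ (c.comp2 D.gt r) A B C x - 𝔤⁻ i1 (inr A)
        * (1 / 2 * deriv (fun s => sph 𝔤 s x B C) r) - Γ c.round A B C x) = -(∑ C, ∑ E, 𝔥⁻¹ C E *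
        (Γ c.round A C E x - Γ (c.comp2 D.gt r) A C E x)) - 𝔤⁻ i1 (inr A) * D.tau c r x := by
    rw [← h.sum_inv_mul_half_deriv hq]
    simp only [mul_sum, ← sum_sub_distrib, ← sum_neg_distrib]
    exact sum_ext₂ fun A B => by ring
  rw [e2, e3]
  ring

end HasTrace

end Trace

section Gauge

variable {U : Set (Spacetime m)} {g : Spacetime m → Form (Spacetime m)} {D : ConeMetric m}
local notation "𝔤" => c.metric g
local notation "𝓗" => waveGauge 𝔤 c.eta
local notation "𝔥" => c.comp2 D.gt r x
local notation "χ" => chi (c.comp2 D.gt) r x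
local notation "𝔢" A:max => Γ 𝔤 i1 i1 (inr A) 𝔭
local notation "H1Zero" => SphereChart.OnCone c T fun r x => Hlow g c i1 r x = 0

namespace HasTrace

variable (h : HasTrace T U g D) (hq : (r, x) ∈ c.coneDom T)
include h hq

lemma hasDerivAt_inv_1A (A : Fin m) :
    HasDerivAt (fun s => (c.metric g (onC s x))⁻¹ i1 (inr A))
      (deriv (fun s => (c.metric g (onC s x))⁻¹ i1 (inr A)) r) r :=
  ((h.isNullNear hq).metric.smoothNear_inv i1 (inr A)).hasDerivAt_onC.differentiableAt.hasDerivAt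

lemma hasDerivAt_nu0 :
    HasDerivAt (fun s => c.comp0 D.nu0 s x) (deriv (fun s => c.comp0 D.nu0 s x) r) r := by
  have e := eventuallyEq_fst (P := c.comp0 D.nu0)
    (Q := fun s x => c.metric g (onC s x) i0 i1) hq fun q hq => (h.metric_01 hq).symm
  exact (((h.isNullNear hq).metric.smooth i0 i1).hasDerivAt_onC.congr_of_eventuallyEq
    e).differentiableAt.hasDerivAt

lemma hasDerivAt_nu (A : Fin m) :
    HasDerivAt (fun s => c.comp1 D.nu s x A) (deriv (fun s => c.comp1 D.nu s x A) r) r := by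
  have e := eventuallyEq_fst (P := fun s x => c.comp1 D.nu s x A)
    (Q := fun s x => c.metric g (onC s x) i0 (inr A)) hq fun q hq => (h.metric_0A hq A).symm
  exact (((h.isNullNear hq).metric.smooth i0 (inr A)).hasDerivAt_onC.congr_of_eventuallyEq
    e).differentiableAt.hasDerivAt

lemma hasDerivAt_gt (A B : Fin m) :
    HasDerivAt (fun s => c.comp2 D.gt s x A B) (deriv (fun s => c.comp2 D.gt s x A B) r) r := by
  have e := eventuallyEq_fst (P := fun s x => c.comp2 D.gt s x A B)
    (Q := fun s x => c.metric g (onC s x) (inr A) (inr B)) hq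
    fun q hq => by rw [← h.sph_eq hq]; rfl
  exact (((h.isNullNear hq).metric.smooth (inr A) (inr B)).hasDerivAt_onC.congr_of_eventuallyEq
    e).differentiableAt.hasDerivAt

lemma half_deriv_gt (A B : Fin m) : deriv (fun s => c.comp2 D.gt s x A B) r
    = 2 * ∑ C, chi (c.comp2 D.gt) r x A C * c.comp2 D.gt r x C B := by
  have e := (h.isNullNear hq).sum_chi_mul A B
  simp only [h.chi_eq hq, h.sph_eq hq] at e
  rw [e]
  have e2 := eventuallyEq_fst (P := fun s x => sph 𝔤 s x A B)
    (Q := fun s x => c.comp2 D.gt s x A B) hq fun q hq => by rw [h.sph_eq hq]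
  rw [e2.deriv_eq]
  ring

/-- If a vector field along the cone has lowered components `w_A = g_{AB} w^B`, then
`g_{AB} ∂₁w^B = ∂₁w_A - 2 χ_A^B w_B`. -/
lemma sum_gt_mul_deriv {w wl : ℝ → Fin m → ℝ} (hw : ∀ B, DifferentiableAt ℝ (fun s => w s B) r)
    (e : ∀ᶠ s in 𝓝 r, ∀ A, ∑ B, c.comp2 D.gt s x A B * w s B = wl s A) (A : Fin m) :
    ∑ B, 𝔥 A B * deriv (fun s => w s B) r
      = deriv (fun s => wl s A) r - 2 * ∑ C, χ A C * wl r C := by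
  have e1 : (fun s => wl s A) =ᶠ[𝓝 r] fun s => ∑ B, c.comp2 D.gt s x A B * w s B := by
    filter_upwards [e] with s hs using (hs A).symm
  have e2 : HasDerivAt (fun s => ∑ B, c.comp2 D.gt s x A B * w s B)
      (∑ B, (deriv (fun s => c.comp2 D.gt s x A B) r * w r B
        + 𝔥 A B * deriv (fun s => w s B) r)) r :=
    HasDerivAt.fun_sum fun B _ => (h.hasDerivAt_gt hq A B).mul (hw B).hasDerivAt
  rw [e1.deriv_eq, e2.deriv, sum_add_distrib]
  simp only [h.half_deriv_gt hq, ← e.self_of_nhds]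
  have e3 : ∑ B, (2 * ∑ C, χ A C * 𝔥 C B) * w r B = 2 * ∑ C, χ A C * ∑ B, 𝔥 C B * w r B := by
    simp only [mul_sum, sum_mul]
    rw [sum_comm]
    exact sum_ext₂ fun C B => by ring
  rw [e3]
  ring

/-- `H_A = -ξ_A - 2 Γ^1_{1A}` when `H⁰ = 0`. -/
lemma Hlow_A_eq (h0 : 𝓗 i0 𝔭 = 0) (A : Fin m) :
    Hlow g c (inr A) r x = -D.xi c r x A - 2 * 𝔢 A := by
  have hn := h.isNullNear hq
  have hν := h.nu0_ne hq
  have hκ := h.chris_1_11 hq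
  rw [h0, mul_zero, sub_zero] at hκ
  rw [h.Hlow_A hq, h0]
  simp only [h.gauge_A hq]
  have d1 : deriv (fun s => -(c.comp0 D.nu0 s x)⁻¹ * c.comp1 D.nu s x A) r
      = (c.comp0 D.nu0 r x)⁻¹ ^ 2 * deriv (fun s => c.comp0 D.nu0 s x) r * c.comp1 D.nu r x A
        - (c.comp0 D.nu0 r x)⁻¹ * deriv (fun s => c.comp1 D.nu s x A) r := by
    rw [(((h.hasDerivAt_nu0 hq).fun_inv hν).fun_neg.fun_mul (h.hasDerivAt_nu hq A)).deriv]
    field_simp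
    ring
  have d2 := h.sum_gt_mul_deriv hq (w := fun s B => (c.metric g (onC s x))⁻¹ i1 (inr B))
    (wl := fun s B => -(c.comp0 D.nu0 s x)⁻¹ * c.comp1 D.nu s x B)
    (fun B => (h.hasDerivAt_inv_1A hq B).differentiableAt) (by
      filter_upwards [eventually_fst (eventually_coneDom hq)] with s hs B
      exact h.sum_gt_inv_1A hs B) A
  rw [d1] at d2
  have e1 : ∑ B, 𝔥 A B * ∑ C, 𝔥⁻¹ B C * 𝔢 C = 𝔢 A := by
    simp only [mul_sum]
    rw [sum_comm]
    have : ∀ A C, ∑ B, 𝔥 A B * 𝔥⁻¹ B C = if A = C then 1 else 0 := by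
      intro A C
      rw [← h.sph_eq hq]
      exact hn.sphere_metric.sum_mul_inv A C
    simp only [← mul_assoc, ← sum_mul, this]
    simp
  have e2 : ∑ B, 𝔥 A B * (-2 * deriv (fun s => (c.metric g (onC s x))⁻¹ i1 (inr B)) r
      - (2 * Γ 𝔤 i1 i1 i1 𝔭 + 2 / r + D.tau c r x) * (𝔤 𝔭)⁻¹ i1 (inr B) - 2 * ∑ C, 𝔥⁻¹ B C * 𝔢 C
      - ∑ C, ∑ E, 𝔥⁻¹ C E * (Γ c.round B C E x - Γ (c.comp2 D.gt r) B C E x))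
      = -2 * ∑ B, 𝔥 A B * deriv (fun s => (c.metric g (onC s x))⁻¹ i1 (inr B)) r
        - (2 * Γ 𝔤 i1 i1 i1 𝔭 + 2 / r + D.tau c r x) * ∑ B, 𝔥 A B * (𝔤 𝔭)⁻¹ i1 (inr B)
        - 2 * ∑ B, 𝔥 A B * ∑ C, 𝔥⁻¹ B C * 𝔢 C - ∑ B, ∑ C, ∑ E, 𝔥 A B * 𝔥⁻¹ C E *
        (Γ c.round B C E x - Γ (c.comp2 D.gt r) B C E x) := by
    simp only [mul_sum, ← sum_sub_distrib]
    refine sum_ext fun B => ?_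
    simp only [mul_sub, mul_sum, mul_assoc]
    ring_nf
  have e4 : ∑ C, χ A C * (-(c.comp0 D.nu0 r x)⁻¹ * c.comp1 D.nu r x C)
      = -(c.comp0 D.nu0 r x)⁻¹ * ∑ B, c.comp1 D.nu r x B * χ A B := by
    rw [mul_sum]
    exact sum_ext fun C => by ring
  rw [e2, d2, e1, h.sum_gt_inv_1A hq, e4, hκ, ConeMetric.xi, ConeMetric.kappa, ConeMetric.W1]
  field_simp
  ring

lemma hasDerivAt_g11 :
    HasDerivAt (fun s => D.g11 c s x) (pd i1 (fun z => (c.metric g z)⁻¹ i1 i1) (onC r x)) r :=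
  ((h.isNullNear hq).metric.smoothNear_inv i1 i1).hasDerivAt_onC.congr_of_eventuallyEq
    (eventuallyEq_fst (P := D.g11 c)
      (Q := fun s x => (c.metric g (onC s x))⁻¹ i1 i1) hq fun _ hq => (h.inv_11 hq).symm)

/-- The transversal expansion is `ζ + 2 H¹` when `H⁰ = 0`. -/
lemma transExpansion_eq (h0 : 𝓗 i0 𝔭 = 0) :
    IsNullNear.transExpansion 𝔤 r x = D.zeta c r x + 2 * 𝓗 i1 𝔭 := by
  have hn := h.isNullNear hq
  have he := isNullNear_eta (c := c) hq.1 hq.2.1.ne'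
  have hr := hq.2.1.ne'
  have hν := h.nu0_ne hq
  have hκ := h.chris_1_11 hq
  rw [h0, mul_zero, sub_zero] at hκ
  have e := hn.metric.pd_inv i1 i1 i1
  rw [← (h.hasDerivAt_g11 hq).deriv, sum_idx, hn.inv01, hn.inv10, h.metric_01 hq, h.inv_11 hq, hκ] at e
  simp only [h.inv_A1 hq] at e
  have e1 : ∑ A, (𝔢 A * (𝔤 𝔭)⁻¹ i1 (inr A) + 𝔢 A * (𝔤 𝔭)⁻¹ i1 (inr A)) = 2 * ∑ A, (𝔤 𝔭)⁻¹ i1 (inr A)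
        * 𝔢 A := by
    rw [mul_sum]
    exact sum_ext fun A => by ring
  rw [e1] at e
  have e2 : ∑ A, ∑ B, 𝔥⁻¹ A B * (Γ 𝔤 i1 (inr A) (inr B)
      𝔭 - -r * c.round x A B) = ∑ A, ∑ B, 𝔥⁻¹ A B * Γ 𝔤 i1 (inr A) (inr B)
      𝔭 - D.W0 c r x := by
    rw [ConeMetric.W0]
    simp only [mul_sum, ← sum_sub_distrib]
    exact sum_ext₂ fun A B => by ring
  have e3 : 𝓗 i1 𝔭 = -deriv (fun s => D.g11 c s x) r - D.kappa c r x * D.g11 c r x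
        + ∑ A, ∑ B, 𝔥⁻¹ A B * Γ 𝔤 i1 (inr A) (inr B)
          𝔭 - D.W0 c r x := by
    rw [waveGauge, h.sum_inv_mul hq (fun a b => Γ 𝔤 i1 a b 𝔭 - Γ c.eta i1 a b 𝔭)
      fun a b => by rw [hn.metric.christoffel_symm, he.metric.christoffel_symm]]
    simp only [he.metric.christoffel_symm i1 i1 i0, eta_chris_time hq.1 hr,
      SphereChart.eta_chris_1 hq.1 hr, he.chris_0_11, he.chris_0_1A,
      eta_chris_0_AB hq.1 hr, sub_zero]
    rw [e2, e, hκ]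
    ring
  rw [IsNullNear.transExpansion, e3, h.tau_eq hq, h.sph_eq hq, h.inv_11 hq, ConeMetric.zeta]
  ring

end HasTrace

/-! ### The decomposition of the Einstein tensor -/

namespace HasTrace

lemma sum_chi_sq {k : ℝ → 𝕄 (Fin m)} :
    ∑ A, ∑ B, chi k r x A B * chi k r x B A = shearSq k r x + meanCurv k r x ^ 2 / m := by
  rcases Nat.eq_zero_or_pos m with rfl | hm
  · simp [shearSq, meanCurv]
  have hm' : (m : ℝ) ≠ 0 := by positivity
  have e : ∀ A B, shear k r x A B * shear k r x B A = chi k r x A B * chi k r x B A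
      - (if A = B then meanCurv k r x / m * (2 * chi k r x A A - meanCurv k r x / m) else 0) := by
    intro A B
    by_cases hAB : A = B
    · subst hAB; simp [shear]; ring
    · simp [shear, hAB, Ne.symm hAB]
  simp only [shearSq, e, sum_sub_distrib, sum_ite_eq, mem_univ, if_true]
  have : ∑ A : Fin m, meanCurv k r x / m * (2 * chi k r x A A - meanCurv k r x / m)
      = meanCurv k r x ^ 2 / m := by
    rw [← mul_sum, sum_sub_distrib, ← mul_sum, show ∑ A, chi k r x A A = meanCurv k r x from rfl]
    simp
    field_simp
    ring
  rw [this]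
  ring

variable (h : HasTrace T U g D) (hq : (r, x) ∈ c.coneDom T)
include h hq

lemma ricci_11 : ricci 𝔤 i1 i1 𝔭 = D.C1 c r x - 1 / 2 * D.tau c r x * Hlow g c i1 r x := by
  have hn := h.isNullNear hq
  have e1 : (fun s => meanCurv (sph 𝔤) s x) =ᶠ[𝓝 r] fun s => D.tau c s x :=
    eventuallyEq_fst (P := meanCurv (sph 𝔤))
      (Q := D.tau c) hq fun q hq => h.tau_eq hq
  have e2 : ∑ A, ∑ B, χ A B * χ B A = shearSq (c.comp2 D.gt) r x + D.tau c r x ^ 2 / m := sum_chi_sq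
  rw [hn.ricci_11, e1.deriv_eq, h.tau_eq hq, h.chris_1_11 hq, h.Hlow_1 hq, ConeMetric.C1]
  simp only [h.chi_eq hq, e2]
  ring

lemma S1_11 : S1 g c i1 r x = ricci 𝔤 i1 i1 𝔭 := by rw [S1, einstein, h.metric_11 hq]; ring

lemma S1_A1 (A : Fin m) : S1 g c (inr A) r x = ricci 𝔤 (inr A) i1 𝔭 := by
  rw [S1, einstein, (h.isNullNear hq).metric.symm_at, h.metric_1A hq]; ring

end HasTrace

namespace HasTrace

variable (h : HasTrace T U g D)
include h

lemma gauge_0_eq_zero (h1 : H1Zero) (hq : onCone) :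
    𝓗 i0 𝔭 = 0 := by
  have := (h.Hlow_1 hq).symm.trans (h1 x hq.1 r hq.2.1 hq.2.2)
  exact (mul_eq_zero.1 this).resolve_left (h.nu0_ne hq)

lemma gauge_A_eq_zero (h1 : H1Zero)
    (hA : c.OnCone T fun r x => ∀ A, Hlow g c (inr A) r x = 0) (hq : onCone)
    (A : Fin m) : 𝓗 (inr A) 𝔭 = 0 := by
  have h2 := hA x hq.1 r hq.2.1 hq.2.2
  simp only [h.Hlow_A hq, h.gauge_0_eq_zero h1 hq, mul_zero, zero_add] at h2
  have h3 : (c.comp2 D.gt r x).mulVec (fun B => 𝓗 (inr B) 𝔭) = 0 := funext h2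
  exact congrFun (Matrix.eq_zero_of_mulVec_eq_zero (h.isMetric.posDef_gt hq).det_pos.ne' h3) A

lemma hasDerivAt_Hlow (hq : onCone) (a : Idx m) :
    HasDerivAt (fun s => Hlow g c a s x) (deriv (fun s => Hlow g c a s x) r) r := by
  have : SmoothNear (waveGaugeLow 𝔤 c.eta a) 𝔭 :=
    SmoothNear.sum fun k => ((h.isNullNear hq).metric.smooth a k).mul (h.smoothNear_waveGauge hq k)
  exact this.hasDerivAt_onC.differentiableAt.hasDerivAt

lemma chris_1_1A (h1 : H1Zero) {q : ConePt m}
    (hq : q ∈ c.coneDom T) (A : Fin m) :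
    Γ 𝔤 i1 i1 (inr A) (onC q.1 q.2) = -(1 / 2) * (D.xi c q.1 q.2 A + Hlow g c (inr A) q.1 q.2) := by
  rw [h.Hlow_A_eq hq (h.gauge_0_eq_zero h1 hq) A]
  ring

/-- `ξ_A` contains derivatives of the trace, but equals `-2 Γ¹_{1A} - H_A` and is smooth. -/
lemma hasDerivAt_xi (h1 : H1Zero) (hq : (r, x) ∈ c.coneDom T)
    (A : Fin m) : HasDerivAt (fun s => D.xi c s x A) (deriv (fun s => D.xi c s x A) r) r := by
  have e := eventuallyEq_fst (P := fun s x => D.xi c s x A)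
    (Q := fun s x => -2 * Γ 𝔤 i1 i1 (inr A) (onC s x)
      - Hlow g c (inr A) s x) hq fun _ hq => by rw [h.chris_1_1A h1 hq]; ring
  exact (((((h.isNullNear hq).metric.smoothNear_christoffel _ _ _).hasDerivAt_onC.const_mul
    (-2)).sub (h.hasDerivAt_Hlow hq _)).congr_of_eventuallyEq e).differentiableAt.hasDerivAt

lemma ricci_A1 (h1 : H1Zero) (hq : (r, x) ∈ c.coneDom T)
    (A : Fin m) : ricci 𝔤 (inr A) i1 (onC r x) = D.CA c r x A + LA g D c r x A := by
  have hn := h.isNullNear hq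
  have e1 := eventuallyEq_fst
    (P := fun s x => Γ 𝔤 i1 i1 (inr A) (onC s x))
    (Q := fun s x => -(1 / 2) * (D.xi c s x A + Hlow g c (inr A) s x)) hq
    fun q hq => h.chris_1_1A h1 hq A
  have e2 := eventuallyEq_snd (P := fun r z => meanCurv (sph 𝔤) r z + Γ 𝔤 i1 i1 i1 (onC r z))
    (Q := fun r z => D.tau c r z + D.kappa c r z) hq fun q hq => by
      rw [h.tau_eq hq, h.chris_1_11 hq, h.gauge_0_eq_zero h1 hq]; ring
  have e3 : ∀ B, pd B (fun z => chi (sph 𝔤) r z A B) x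
      = pd B (fun z => chi (c.comp2 D.gt) r z A B) x := fun B =>
    pd_congr B (eventuallyEq_snd (P := fun r z => chi (sph 𝔤) r z A B)
      (Q := fun r z => chi (c.comp2 D.gt) r z A B) hq fun q hq => h.chi_eq hq A B)
  rw [hn.ricci_A1, e1.deriv_eq, pd_congr A e2, h.tau_eq hq, h.chris_1_1A h1 hq,
    (((h.hasDerivAt_xi h1 hq A).fun_add (h.hasDerivAt_Hlow hq _)).const_mul (-(1 / 2))).deriv]
  simp only [e3, h.chi_eq hq, christoffel_congr (h.eventuallyEq_sphere hq)]
  rw [ConeMetric.CA, LA]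
  ring

/-- The trace of the angular part of the Ricci tensor, when `H⁰ = H^A = 0`. -/
lemma einstein_01 (h1 : H1Zero)
    (hA : c.OnCone T fun r x => ∀ A, Hlow g c (inr A) r x = 0)
    (hC1 : c.OnCone T fun r x => D.C1 c r x = 0) (hCA : c.OnCone T fun r x => ∀ A, D.CA c r x A = 0)
    (hq : (r, x) ∈ c.coneDom T) : S1 g c i0 r x = D.C0 c r x + L0 g D c r x := by
  have hn := h.isNullNear hq
  have hν := h.nu0_ne hq
  have r11 : ricci 𝔤 i1 i1 (onC r x) = 0 := by
    rw [h.ricci_11 hq, hC1 x hq.1 r hq.2.1 hq.2.2, h1 x hq.1 r hq.2.1 hq.2.2]; ring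
  have LA0 : ∀ A, LA g D c r x A = 0 := fun A => by
    have e := eventuallyEq_fst (P := Hlow g c (inr A))
      (Q := fun _ _ => 0) hq fun _ hq => hA _ hq.1 _ hq.2.1 hq.2.2 A
    rw [LA, e.deriv_eq, hA x hq.1 r hq.2.1 hq.2.2 A]
    simp
  have rA1 : ∀ A : Fin m, ricci 𝔤 (inr A) i1 (onC r x) = 0 := fun A => by
    rw [h.ricci_A1 h1 hq, hCA x hq.1 r hq.2.1 hq.2.2, LA0]; ring
  have cA : ∀ q ∈ c.coneDom T, ∀ A : Fin m, Γ 𝔤 i1 i1 (inr A) (onC q.1 q.2)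
      = -(1 / 2) * D.xi c q.1 q.2 A := fun q hq A => by
    rw [h.chris_1_1A h1 hq, hA q.2 hq.1 q.1 hq.2.1 hq.2.2 A]; ring
  have c1 : Γ 𝔤 i1 i1 i1 (onC r x) = D.kappa c r x := by
    rw [h.chris_1_11 hq, h.gauge_0_eq_zero h1 hq]; ring
  have H0 : ∀ q ∈ c.coneDom T, Hlow g c i0 q.1 q.2
      = c.comp0 D.nu0 q.1 q.2 * 𝓗 i1 (onC q.1 q.2) := fun q hq => by
    rw [h.Hlow_0 hq, h.gauge_0_eq_zero h1 hq]
    simp [h.gauge_A_eq_zero h1 hA hq]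
  have eζ := eventuallyEq_fst (P := IsNullNear.transExpansion 𝔤)
    (Q := fun s x => D.zeta c s x + 2 * 𝓗 i1 (onC s x)) hq
    fun q hq => h.transExpansion_eq hq (h.gauge_0_eq_zero h1 hq)
  have dH1 := (h.smoothNear_waveGauge hq i1).hasDerivAt_onC
  have dζ : DifferentiableAt ℝ (fun s => D.zeta c s x) r := by
    have s1 : SmoothNear (fun X => (c.metric g X)⁻¹ i1 i1) (onC r x) := hn.metric.smoothNear_inv i1 i1
    have e := eventuallyEq_fst (P := D.zeta c)
      (Q := fun s x => (2 * ∑ A, ∑ B, (of fun A B : Fin m =>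
          c.metric g (onC s x) (inr A) (inr B))⁻¹ A B * Γ 𝔤 i1 (inr A) (inr B) (onC s x)
        + (∑ A : Fin m, Γ 𝔤 (inr A) i1 (inr A) (onC s x)) * (c.metric g (onC s x))⁻¹ i1 i1)
          - 2 * 𝓗 i1 (onC s x)) hq fun q hq => by
        have e1 := h.transExpansion_eq hq (h.gauge_0_eq_zero h1 hq)
        have e2 : meanCurv (sph 𝔤) q.1 q.2 = ∑ A : Fin m, Γ 𝔤 (inr A) i1 (inr A) (onC q.1 q.2) := by
          simp only [(h.isNullNear hq).chris_A_1B]; rfl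
        rw [IsNullNear.transExpansion, e2] at e1
        exact eq_sub_of_add_eq e1.symm
    refine DifferentiableAt.congr_of_eventuallyEq ?_ e
    have hM : MatSmoothNear (fun X => of fun A B : Fin m =>
        c.metric g X (inr A) (inr B)) (onC r x) := fun A B => hn.metric.smooth _ _
    have hs : SmoothNear (fun X => (2 * ∑ A, ∑ B, (of fun A B : Fin m =>
          c.metric g X (inr A) (inr B))⁻¹ A B * Γ 𝔤 i1 (inr A) (inr B) X
        + (∑ A : Fin m, Γ 𝔤 (inr A) i1 (inr A) X)
          * (c.metric g X)⁻¹ i1 i1) - 2 * 𝓗 i1 X) (onC r x) :=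
      ((((SmoothNear.const 2).mul (SmoothNear.sum fun A => SmoothNear.sum fun B =>
        (hM.inv hn.isUnit A B).mul (hn.metric.smoothNear_christoffel _ _ _))).add
        ((SmoothNear.sum fun A => hn.metric.smoothNear_christoffel _ _ _).mul s1)).sub
        ((SmoothNear.const 2).mul (h.smoothNear_waveGauge hq i1)))
    exact hs.hasDerivAt_onC.differentiableAt
  have dH0 : deriv (fun s => Hlow g c i0 s x) r
      = deriv (fun s => c.comp0 D.nu0 s x) r * 𝓗 i1 (onC r x)
        + c.comp0 D.nu0 r x * pd i1 (𝓗 i1) (onC r x) := by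
    rw [(eventuallyEq_fst (P := Hlow g c i0) (Q := fun s x =>
      c.comp0 D.nu0 s x * 𝓗 i1 (onC s x)) hq H0).deriv_eq]
    exact ((h.hasDerivAt_nu0 hq).fun_mul dH1).deriv
  have cA' : ∀ A : Fin m, Γ 𝔤 i1 i1 (inr A) (onC r x) = -(1 / 2) * D.xi c r x A := cA (r, x) hq
  have up : ∀ q ∈ c.coneDom T, ∀ A, ∑ B, (sph 𝔤 q.1 q.2)⁻¹ A B * Γ 𝔤 i1 i1 (inr B) (onC q.1 q.2)
      = -(1 / 2) * D.xiUp c q.1 q.2 A := fun q hq A => by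
    rw [ConeMetric.xiUp, mul_sum, h.sph_eq hq]
    exact sum_ext fun B => by rw [cA q hq]; ring
  have sup : ∀ A, SmoothNear (fun z => ∑ B, (sph 𝔤 r z)⁻¹ A B
      * Γ 𝔤 i1 i1 (inr B) (onC r z)) x := fun A =>
    SmoothNear.sum fun B => (hn.sphere_metric.smoothNear_inv A B).mul
      (hn.metric.smoothNear_christoffel _ _ _).onC_right
  have up' : ∀ A, pd A (fun z => ∑ B, (sph 𝔤 r z)⁻¹ A B * Γ 𝔤 i1 i1 (inr B) (onC r z)) x
      = -(1 / 2) * pd A (fun z => D.xiUp c r z A) x := fun A => by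
    have e := eventuallyEq_snd (P := fun r z => D.xiUp c r z A)
      (Q := fun r z => -2 * ∑ B, (sph 𝔤 r z)⁻¹ A B * Γ 𝔤 i1 i1 (inr B) (onC r z)) hq fun q hq => by
          rw [up q hq A]; ring
    rw [pd_congr A e, pd_const_mul A _ (sup A)]
    ring
  rw [S1, hn.einstein_01 r11 rA1, hn.sum_inv_mul_ricci, eζ.deriv_eq,
    h.transExpansion_eq hq (h.gauge_0_eq_zero h1 hq), c1,
    h.tau_eq hq, scalarCurv_congr (h.eventuallyEq_sphere hq), h.metric_01 hq,
    (dζ.hasDerivAt.fun_add (dH1.const_mul 2)).deriv, L0, H0 (r, x) hq, dH0]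
  simp only [up (r, x) hq, up', christoffel_congr (h.eventuallyEq_sphere hq)]
  have q1 : ∑ A, ∑ B, (sph 𝔤 r x)⁻¹ A B * (Γ 𝔤 i1 i1 (inr A) (onC r x)
        * Γ 𝔤 i1 i1 (inr B) (onC r x)) = 1 / 4 * ∑ A, D.xi c r x A * D.xiUp c r x A := by
    simp only [ConeMetric.xiUp, mul_sum, h.sph_eq hq, cA']
    exact sum_ext₂ fun A B => by ring
  have q2 : ∑ A, -(1 / 2) * pd A (fun z => D.xiUp c r z A) x
      + ∑ A, ∑ B, Γ (c.comp2 D.gt r) A A B x * (-(1 / 2) * D.xiUp c r x B)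
      = -(1 / 2) * (∑ A, pd A (fun z => D.xiUp c r z A) x
        + ∑ A, ∑ B, Γ (c.comp2 D.gt r) A A B x * D.xiUp c r x B) := by
    simp only [mul_add, mul_sum]
    congr 1
    exact sum_ext₂ fun A B => by ring
  have hk : deriv (fun s => c.comp0 D.nu0 s x) r = c.comp0 D.nu0 r x * (D.kappa c r x
      + 1 / 2 * (D.W1 c r x + D.tau c r x)) := by
    rw [ConeMetric.kappa]
    field_simp
    ring
  rw [q1, q2, hk, ConeMetric.C0]
  ring

lemma decomposition (c : SphereChart m) : Decomposition T g D c := by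
  refine ⟨fun x hx r hr hT => ?_, fun h1 x hx r hr hT A => ?_, fun h1 hA hC1 hCA x hx r hr hT => ?_⟩
  · have hq : (r, x) ∈ c.coneDom T := ⟨hx, hr, hT⟩
    change S1 g c i1 r x = D.C1 c r x + L1 g D c r x
    rw [h.S1_11 hq, h.ricci_11 hq, L1]; ring
  · have hq : (r, x) ∈ c.coneDom T := ⟨hx, hr, hT⟩
    rw [h.S1_A1 hq, h.ricci_A1 h1 hq]
  · exact h.einstein_01 h1 hA hC1 hCA ⟨hx, hr, hT⟩

end HasTrace

end Gauge

/-! ### The transport equations -/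

section Transport

variable {U : Set (Spacetime m)} {g : Spacetime m → Form (Spacetime m)} {D : ConeMetric m}
local notation "𝔤" => c.metric g
local notation "𝓗" => waveGauge 𝔤 c.eta
local notation "𝔥" => c.comp2 D.gt r x

namespace HasTrace

lemma ricci_eq_of_reduced (hR : ReducedEinsteinOnCone T g c) (hq : onCone) (a b : Idx m) :
    ricci 𝔤 a b 𝔭 = 1 / 2 * ∑ l, (𝔤 𝔭 a l * covGauge 𝔤 c.eta b l 𝔭
        + 𝔤 𝔭 b l * covGauge 𝔤 c.eta a l 𝔭) := sub_eq_zero.1 (hR x hq.1 r hq.2.1 hq.2.2 a b)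

variable (h : HasTrace T U g D)
include h

lemma metric_1A' (hq : onCone) (A : Fin m) : 𝔤 𝔭 (inr A) i1 = 0 := by
  rw [(h.isNullNear hq).metric.symm_at, h.metric_1A hq]

lemma metric_10 (hq : onCone) : 𝔤 𝔭 i1 i0 = c.comp0 D.nu0 r x := by
  rw [(h.isNullNear hq).metric.symm_at, h.metric_01 hq]

lemma metric_AB (hq : onCone) (A B : Fin m) : 𝔤 𝔭 (inr A) (inr B) = 𝔥 A B := by
  rw [← h.sph_eq hq]; rfl

/-- The component along the generators of the reduced equations. -/
lemma transport_1 (hR : ReducedEinsteinOnCone T g c) (hq : onCone) (hC1 : D.C1 c r x = 0) :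
    covGauge 𝔤 c.eta i1 i0 𝔭 + (1 / 2) * D.tau c r x * 𝓗 i0 𝔭 = 0 := by
  have e := ricci_eq_of_reduced hR hq i1 i1
  rw [h.ricci_11 hq, hC1, h.Hlow_1 hq, sum_idx] at e
  simp only [h.metric_11 hq, h.metric_1A hq, h.metric_10 hq] at e
  simp at e
  have hν := h.nu0_ne hq
  have : c.comp0 D.nu0 r x * (covGauge 𝔤 c.eta i1 i0 𝔭
      + (1 / 2) * D.tau c r x * 𝓗 i0 𝔭) = 0 := by linarith
  exact (mul_eq_zero.1 this).resolve_left hν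

lemma pd_gauge_eq_zero {l : Idx m} (h0 : ∀ q ∈ c.coneDom T, 𝓗 l (onC q.1 q.2) = 0)
    (hq : (r, x) ∈ c.coneDom T) :
    pd i1 (𝓗 l) (onC r x) = 0 ∧ ∀ A : Fin m, pd (inr A) (𝓗 l) (onC r x) = 0 := by
  have hs := h.smoothNear_waveGauge hq l
  refine ⟨?_, fun A => ?_⟩
  · rw [← hs.deriv_onC, (eventuallyEq_fst
      (P := fun s x => 𝓗 l (onC s x)) (Q := fun _ _ => 0) hq h0).deriv_eq]
    simp
  · rw [← hs.pd_onC, pd_congr A (eventuallyEq_snd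
      (P := fun s x => 𝓗 l (onC s x)) (Q := fun _ _ => 0) hq h0)]
    exact pd_const A 0

lemma transport_A (hR : ReducedEinsteinOnCone T g c)
    (h1 : c.OnCone T fun r x => Hlow g c i1 r x = 0) (hq : (r, x) ∈ c.coneDom T)
    (hCA : ∀ A, D.CA c r x A = 0) (A : Fin m) :
    2 * deriv (fun s => Hlow g c (inr A) s x) r
        - 2 * ∑ B, chi (c.comp2 D.gt) r x A B * Hlow g c (inr B) r x
        + (D.tau c r x + 1 / r) * Hlow g c (inr A) r x
        - r * c.comp0 D.nu0 r x * ∑ B, ∑ C, c.round x A B * (c.comp2 D.gt r x)⁻¹ B C *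
            Hlow g c (inr C) r x = 0 := by
  have hn := h.isNullNear hq
  have he := isNullNear_eta (c := c) hq.1 hq.2.1.ne'
  have hr := hq.2.1.ne'
  have z0 : ∀ q ∈ c.coneDom T, 𝓗 i0 (onC q.1 q.2) = 0 := fun q hq => h.gauge_0_eq_zero h1 hq
  have p0 := h.pd_gauge_eq_zero z0 hq
  have z0' : 𝓗 i0 𝔭 = 0 := z0 (r, x) hq
  have c10 : covGauge 𝔤 c.eta i1 i0 𝔭 = 0 := by
    simp only [covGauge, p0.1, sum_idx, he.chris_0_11, he.chris_0_1A, z0']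
    simp
  have cA0 : covGauge 𝔤 c.eta (inr A) i0 𝔭 = -r * ∑ B, c.round x A B * 𝓗 (inr B) 𝔭 := by
    simp only [covGauge, p0.2, sum_idx, he.metric.christoffel_symm i0 (inr A) i1, he.chris_0_1A, z0',
      eta_chris_0_AB hq.1 hr, mul_sum]
    simp [mul_assoc]
  have c1B : ∀ B : Fin m, covGauge 𝔤 c.eta i1 (inr B) 𝔭 = deriv (fun s => 𝓗 (inr B) (onC s x)) r
        + 1 / r * 𝓗 (inr B) 𝔭 := fun B => by
    simp only [covGauge, sum_idx, he.chris_A_11, eta_chris_A_1B hq.1 hr, z0',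
      (h.smoothNear_waveGauge hq (inr B)).deriv_onC]
    simp
  have low : ∀ q ∈ c.coneDom T, ∀ A, ∑ B, c.comp2 D.gt q.1 q.2 A B
      * 𝓗 (inr B) (onC q.1 q.2) = Hlow g c (inr A) q.1 q.2 :=
    fun q hq A => by rw [h.Hlow_A hq, z0 q hq]; ring
  have d := h.sum_gt_mul_deriv hq
    (w := fun s B => 𝓗 (inr B) (onC s x))
    (wl := fun s B => Hlow g c (inr B) s x)
    (fun B => (h.smoothNear_waveGauge hq (inr B)).hasDerivAt_onC.differentiableAt) (by
      filter_upwards [eventually_fst (eventually_coneDom hq)] with s hs A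
      exact low (s, x) hs A) A
  have low' : ∀ A, ∑ B, c.comp2 D.gt r x A B * 𝓗 (inr B) 𝔭 = Hlow g c (inr A) r x := low (r, x) hq
  have up : ∀ B, 𝓗 (inr B) 𝔭 = ∑ C, (c.comp2 D.gt r x)⁻¹ B C * Hlow g c (inr C) r x := fun B => by
    simp only [← low', mul_sum]
    rw [sum_comm]
    have : ∀ A C, ∑ B, (c.comp2 D.gt r x)⁻¹ A B * c.comp2 D.gt r x B C = if A = C then 1 else 0 := by
      intro A C
      rw [← h.sph_eq hq]
      exact hn.sphere_metric.sum_inv_mul A C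
    simp only [← mul_assoc, ← sum_mul, this]
    simp
  have s1 : ∑ B, c.comp2 D.gt r x A B * covGauge 𝔤 c.eta i1 (inr B) 𝔭
      = deriv (fun s => Hlow g c (inr A) s x) r
        - 2 * ∑ C, chi (c.comp2 D.gt) r x A C * Hlow g c (inr C) r x
        + 1 / r * Hlow g c (inr A) r x := by
    simp only [c1B, mul_add, sum_add_distrib]
    rw [d, ← low' A, mul_sum (a := 1 / r)]
    congr 1
    exact sum_ext fun B => by ring
  have e := ricci_eq_of_reduced hR hq (inr A) i1
  rw [h.ricci_A1 h1 hq, hCA A, LA, sum_idx, c10, cA0] at e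
  simp only [h.metric_1A' hq, h.metric_11 hq, h.metric_1A hq, h.metric_10 hq, h.metric_AB hq] at e
  simp only [mul_zero, zero_mul, add_zero, zero_add] at e
  rw [s1] at e
  have e5 : ∑ B, ∑ C, c.round x A B * (c.comp2 D.gt r x)⁻¹ B C * Hlow g c (inr C) r x
      = ∑ B, c.round x A B * 𝓗 (inr B) 𝔭 := by simp only [up, mul_sum, mul_assoc]
  rw [e5]
  linarith

lemma transport_0 (hR : ReducedEinsteinOnCone T g c)
    (h1 : c.OnCone T fun r x => Hlow g c i1 r x = 0)
    (hA : c.OnCone T fun r x => ∀ A, Hlow g c (inr A) r x = 0)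
    (hC1 : c.OnCone T fun r x => D.C1 c r x = 0) (hCA : c.OnCone T fun r x => ∀ A, D.CA c r x A = 0)
    (hC0 : c.OnCone T fun r x => D.C0 c r x = 0) (hq : (r, x) ∈ c.coneDom T) :
    deriv (fun s => Hlow g c i0 s x) r
      = (1 / 2) * (D.W1 c r x - D.tau c r x + m / r) * Hlow g c i0 r x := by
  have hn := h.isNullNear hq
  have he := isNullNear_eta (c := c) hq.1 hq.2.1.ne'
  have hr := hq.2.1.ne'
  have z0 : ∀ q ∈ c.coneDom T, 𝓗 i0 (onC q.1 q.2) = 0 := fun q hq => h.gauge_0_eq_zero h1 hq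
  have zA : ∀ A : Fin m, ∀ q ∈ c.coneDom T, 𝓗 (inr A) (onC q.1 q.2) = 0 :=
    fun A q hq => h.gauge_A_eq_zero h1 hA hq A
  have p0 := h.pd_gauge_eq_zero z0 hq
  have pA := fun A => h.pd_gauge_eq_zero (zA A) hq
  have z0' : 𝓗 i0 𝔭 = 0 := z0 (r, x) hq
  have zA' : ∀ A : Fin m, 𝓗 (inr A) 𝔭 = 0 := fun A => zA A (r, x) hq
  have d0 : ∀ A : Fin m, covGauge 𝔤 c.eta (inr A) i0 𝔭 = 0 := fun A => by
    simp only [covGauge, p0.2, sum_idx, z0', zA', he.metric.christoffel_symm i0 (inr A) i1,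
      he.chris_0_1A]
    simp
  have dB : ∀ A B : Fin m, covGauge 𝔤 c.eta (inr A) (inr B) 𝔭
      = if A = B then 1 / r * 𝓗 i1 𝔭 else 0 := fun A B => by
    simp only [covGauge, (pA B).2, sum_idx, z0', zA', he.metric.christoffel_symm (inr B) (inr A) i1,
      eta_chris_A_1B hq.1 hr]
    by_cases hAB : A = B
    · subst hAB; simp
    · simp [hAB, Ne.symm hAB]
  have rAB : ∀ A B : Fin m, ricci 𝔤 (inr A) (inr B) 𝔭
      = c.comp2 D.gt r x A B * (1 / r * 𝓗 i1 𝔭) := fun A B => by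
    have sy : c.comp2 D.gt r x B A = c.comp2 D.gt r x A B := by
      rw [← h.sph_eq hq]; exact hn.sphere_metric.symm_at B A
    rw [ricci_eq_of_reduced hR hq, sum_idx]
    simp only [h.metric_1A' hq, d0, dB, h.metric_AB hq]
    simp only [sum_add_distrib, mul_ite, mul_zero, sum_ite_eq, mem_univ, if_true, sy]
    ring
  have tr : ∑ A, ∑ B, (sph 𝔤 r x)⁻¹ A B * ricci (transMetric 𝔤) (inr A) (inr B) 𝔭
      = m / r * 𝓗 i1 𝔭 := by
    have e1 : ∀ A B : Fin m, (sph 𝔤 r x)⁻¹ A B * ricci (transMetric 𝔤) (inr A) (inr B) 𝔭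
        = (sph 𝔤 r x)⁻¹ A B * sph 𝔤 r x B A * (1 / r * 𝓗 i1 𝔭) := fun A B => by
      rw [hn.ricci_trans (by simp) (by simp), rAB, ← h.sph_eq hq, hn.sphere_metric.symm_at A B]
      ring
    simp only [e1, ← sum_mul, hn.sphere_metric.sum_inv_mul]
    simp
    ring
  have r11 : ricci 𝔤 i1 i1 𝔭 = 0 := by
    rw [h.ricci_11 hq, hC1 x hq.1 r hq.2.1 hq.2.2, h1 x hq.1 r hq.2.1 hq.2.2]; ring
  have LA0 : ∀ A, LA g D c r x A = 0 := fun A => by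
    have e := eventuallyEq_fst (P := Hlow g c (inr A))
      (Q := fun _ _ => 0) hq fun _ hq => hA _ hq.1 _ hq.2.1 hq.2.2 A
    rw [LA, e.deriv_eq, hA x hq.1 r hq.2.1 hq.2.2 A]
    simp
  have rA1 : ∀ A : Fin m, ricci 𝔤 (inr A) i1 𝔭 = 0 := fun A => by
    rw [h.ricci_A1 h1 hq, hCA x hq.1 r hq.2.1 hq.2.2, LA0]; ring
  have H0 : Hlow g c i0 r x = c.comp0 D.nu0 r x * 𝓗 i1 𝔭 := by
    rw [h.Hlow_0 hq, z0']
    simp [zA']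
  have e := h.einstein_01 h1 hA hC1 hCA hq
  rw [hC0 x hq.1 r hq.2.1 hq.2.2, S1, hn.einstein_01 r11 rA1, tr, h.metric_01 hq, L0] at e
  rw [H0] at e ⊢
  linarith

lemma transport (c : SphereChart m) (hR : ReducedEinsteinOnCone T g c) : Transport T g D c := by
  refine ⟨fun hC1 x hx r hr hT => ?_, fun h1 hCA x hx r hr hT A => ?_,
    fun h1 hA hC1 hCA hC0 x hx r hr hT => ?_⟩
  · exact h.transport_1 hR ⟨hx, hr, hT⟩ (hC1 x hx r hr hT)
  · exact h.transport_A hR h1 ⟨hx, hr, hT⟩ (hCA x hx r hr hT) A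
  · exact h.transport_0 hR h1 hA hC1 hCA hC0 ⟨hx, hr, hT⟩

end HasTrace

end Transport

/-! ### Determinants, differential inequalities and Cartesian components -/

section Determinant

variable {κ : Type} [Fintype κ] [DecidableEq κ]

/-- Jacobi's formula. -/
lemma hasDerivAt_det {M : ℝ → Matrix κ κ ℝ} {M' : Matrix κ κ ℝ}
    (hM : ∀ i j, HasDerivAt (fun s => M s i j) (M' i j) r) :
    HasDerivAt (fun s => (M s).det) ((M r).adjugate * M').trace r := by
  have h1 : HasDerivAt (fun s => (M s).det) (∑ σ : Equiv.Perm κ, (Equiv.Perm.sign σ : ℝ)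
      * ∑ i, (∏ j ∈ univ.erase i, M r (σ j) j) • M' (σ i) i) r := by
    simp only [Matrix.det_apply']
    exact HasDerivAt.fun_sum fun σ _ =>
      (HasDerivAt.fun_finsetProd fun i _ => hM (σ i) i).const_mul _
  convert h1 using 1
  have h2 : ∀ i, ((M r).adjugate * M') i i = ((M r).updateCol i fun k => M' k i).det := by
    intro i
    rw [← Matrix.cramer_apply, Matrix.cramer_eq_adjugate_mulVec]
    rfl
  simp only [Matrix.trace, Matrix.diag, h2, Matrix.det_apply', mul_sum]
  rw [sum_comm]
  refine sum_ext₂ fun σ i => ?_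
  rw [← Finset.mul_prod_erase _ _ (mem_univ i), Matrix.updateCol_self, smul_eq_mul,
    mul_comm (M' _ _)]
  congr 2
  exact Finset.prod_congr rfl fun j hj => Matrix.updateCol_ne (Finset.ne_of_mem_erase hj)

/-- The derivative of the volume density is the mean curvature times the density. -/
lemma hasDerivAt_sqrt_det {h : ℝ → 𝕄 (Fin m)}
    (hd : ∀ A B, DifferentiableAt ℝ (fun s => h s x A B) r) (hp : (h r x).PosDef) :
    HasDerivAt (fun s => √(h s x).det) (meanCurv h r x * √(h r x).det) r := by
  have h0 := hp.det_pos
  have h1 := (hasDerivAt_det (M := fun s => h s x) (M' := of fun A B =>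
    deriv (fun s => h s x A B) r) fun A B => (hd A B).hasDerivAt).sqrt h0.ne'
  convert h1 using 1
  have hs : ∀ A B, (h r x)⁻¹ A B = (h r x)⁻¹ B A := fun A B => by
    have := hp.1.inv
    exact (this.apply A B).symm.trans (by simp)
  have e : ((h r x).adjugate * of fun A B => deriv (fun s => h s x A B) r).trace
      = (h r x).det * (2 * meanCurv h r x) := by
    have : (h r x).adjugate = (h r x).det • (h r x)⁻¹ := by
      rw [Matrix.inv_def, smul_smul, Ring.inverse_eq_inv', mul_inv_cancel₀ h0.ne', one_smul]
    rw [this, smul_mul_assoc, Matrix.trace_smul, smul_eq_mul]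
    congr 1
    simp only [meanCurv, chi, Matrix.trace, Matrix.diag, mul_apply, of_apply, ← mul_sum]
    rw [sum_comm]
    ring_nf
    exact sum_ext₂ fun A B => by rw [hs]
  rw [e]
  have h2 := Real.mul_self_sqrt h0.le
  have h3 : √(h r x).det ≠ 0 := (Real.sqrt_pos.2 h0).ne'
  field_simp
  rw [pow_two, h2]

end Determinant

/-- A nonnegative function with `F' ≤ (K - n / r) F` and `r^n F → 0` at `0` vanishes. -/
lemma eq_zero_of_deriv_le {F F' : ℝ → ℝ} {b K : ℝ} {n : ℕ} (hb : 0 < b)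
    (hF : ∀ r ∈ Ioc 0 b, HasDerivAt F (F' r) r) (h0 : 0 ≤ F b)
    (hle : ∀ r ∈ Ioc 0 b, F' r ≤ (K - n / r) * F r)
    (hlim : Tendsto (fun r => r ^ n * F r) (𝓝[>] 0) (𝓝 0)) : F b = 0 := by
  have hE : ∀ r, HasDerivAt (fun r => Real.exp (-K * r)) (Real.exp (-K * r) * (-K * 1)) r := fun r =>
    ((hasDerivAt_id' r).const_mul (-K)).exp
  have hG := fun r hr => (hE r).fun_mul ((hasDerivAt_pow n r).fun_mul (hF r hr))
  have anti := antitoneOn_of_hasDerivWithinAt_nonpos (convex_Ioc 0 b)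
    (fun r hr => (hG r hr).continuousAt.continuousWithinAt)
    (fun r hr => (hG r (interior_subset hr)).hasDerivWithinAt) fun r hr => by
      have hr := interior_subset hr
      have h1 : (n : ℝ) * r ^ (n - 1) = n / r * r ^ n := by
        have := hr.1.ne'
        rcases n with _ | n
        · simp
        · rw [Nat.add_sub_cancel, pow_succ]; field_simp
      have h2 := mul_le_mul_of_nonneg_left (hle r hr)
        (mul_nonneg (Real.exp_pos (-K * r)).le (pow_nonneg hr.1.le n))
      rw [h1]
      linarith
  have h1 := ((hE 0).continuousAt.tendsto.mono_left nhdsWithin_le_nhds).mul hlim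
  rw [mul_zero] at h1
  have h2 := ge_of_tendsto h1 (by
    filter_upwards [Ioc_mem_nhdsGT hb] with r hr using anti hr ⟨hb, le_rfl⟩ hr.2)
  exact le_antisymm (nonpos_of_mul_nonpos_right (nonpos_of_mul_nonpos_right h2 (Real.exp_pos _))
    (pow_pos hb n)) h0

lemma eq_zero_of_hasDerivAt {d a : ℝ → ℝ} {b : ℝ} (hb : 0 < b)
    (hd : ∀ r ∈ Ioc 0 b, HasDerivAt d (-a r * d r) r) (ha : ∀ r ∈ Ioc 0 b, 0 ≤ a r)
    (hlim : Tendsto d (𝓝[>] 0) (𝓝 0)) : d b = 0 :=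
  pow_eq_zero_iff two_ne_zero |>.1 <| eq_zero_of_deriv_le (F := fun r => d r ^ 2) (K := 0) (n := 0)
    hb (fun r hr => (hd r hr).fun_pow 2) (sq_nonneg _)
    (fun r hr => by
      have := mul_nonneg (ha r hr) (sq_nonneg (d r))
      simp only [Nat.cast_zero, zero_div, sub_zero, zero_mul]
      push_cast; nlinarith)
    (by simpa using hlim.pow 2)

section Cartesian

/-- Components of a spacetime metric in linear coordinates. -/
def linMetric (L : (Idx m → ℝ) ≃L[ℝ] Spacetime m)
    (g : Spacetime m → Form (Spacetime m)) (Z : Idx m → ℝ) : Matrix (Idx m) (Idx m) ℝ :=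
  of fun i j => g (L Z) (L (Pi.single i 1)) (L (Pi.single j 1))

variable {L : (Idx m → ℝ) ≃L[ℝ] Spacetime m} {g : Spacetime m → Form (Spacetime m)}

lemma isMetricNear_linMetric {Z : Idx m → ℝ} (hg : ∀ᶠ p in 𝓝 (L Z), ContDiffAt ℝ ∞ g p)
    (hs : ∀ᶠ p in 𝓝 (L Z), ∀ X Y, g p X Y = g p Y X) (hu : IsUnit (linMetric L g Z).det) :
    IsMetricNear (linMetric L g) Z where
  smooth i j := by
    filter_upwards [L.continuous.continuousAt.eventually hg] with Y hY
    have h1 : ContDiffAt ℝ ∞ (fun Y => g (L Y)) Y := hY.comp Y L.contDiff.contDiffAt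
    exact (h1.clm_apply contDiffAt_const).clm_apply contDiffAt_const
  symm := by filter_upwards [L.continuous.continuousAt.eventually hs] with Y hY i j using hY _ _
  isUnit := hu

lemma jac_adapted {X : Idx m → ℝ} (hX : (fun A => X (inr A)) ∈ c.dom) (i a : Idx m) :
    jac (fun X => L.symm (c.adapted X)) X i a
      = L.symm (fderiv ℝ c.adapted X (Pi.single a 1)) i := by
  have h1 : HasFDerivAt c.adapted (fderiv ℝ c.adapted X) X :=
    ((contDiffAt_adapted hX).differentiableAt (by simp)).hasFDerivAt
  have h2 : HasFDerivAt (fun X => L.symm (c.adapted X)) _ X :=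
    L.symm.toContinuousLinearMap.hasFDerivAt.comp X h1
  have h3 := (hasFDerivAt_pi'.1 h2 i).fderiv
  simp only [jac, of_apply, pd, h3]
  rfl

lemma sum_jac_adapted {X : Idx m → ℝ} (hX : (fun A => X (inr A)) ∈ c.dom) (a : Idx m) :
    ∑ i, jac (fun X => L.symm (c.adapted X)) X i a • L (Pi.single i 1)
      = fderiv ℝ c.adapted X (Pi.single a 1) := by
  simp only [jac_adapted hX, ← map_smul, ← map_sum]
  rw [← L.apply_symm_apply (fderiv ℝ c.adapted X (Pi.single a 1))]
  congr 1
  conv_rhs => rw [pi_eq_sum_univ' (L.symm (fderiv ℝ c.adapted X (Pi.single a 1)))]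
  simp

lemma isPullbackNear_adapted {X : Idx m → ℝ} (hX : (fun A => X (inr A)) ∈ c.dom)
    (hg : ∀ᶠ p in 𝓝 (c.adapted X), ContDiffAt ℝ ∞ g p)
    (hs : ∀ᶠ p in 𝓝 (c.adapted X), ∀ X Y, g p X Y = g p Y X) (hu : IsUnit (c.metric g X).det) :
    IsPullbackNear (c.metric g) (linMetric L g) (fun X => L.symm (c.adapted X)) X := by
  have e : ∀ Y : Idx m → ℝ, (fun A => Y (inr A)) ∈ c.dom → c.metric g Y
      = (jac (fun X => L.symm (c.adapted X)) Y).transpose * linMetric L g (L.symm (c.adapted Y))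
        * jac (fun X => L.symm (c.adapted X)) Y := by
    intro Y hY
    ext a b
    simp only [SphereChart.metric, of_apply, ← sum_jac_adapted (L := L) hY, map_sum, map_smul,
      sum_apply, smul_apply, smul_eq_mul, mul_apply,
      transpose_apply, linMetric, L.apply_symm_apply, sum_mul, mul_sum]
    exact sum_ext₂ fun i j => by ring
  have hu2 := hu
  rw [e X hX, det_mul, det_mul, isUnit_iff_ne_zero] at hu2
  have h1 := right_ne_zero_of_mul hu2
  have h2 := right_ne_zero_of_mul (left_ne_zero_of_mul hu2)
  refine ⟨isMetricNear_linMetric (by simpa using hg) (by simpa using hs) (isUnit_iff_ne_zero.2 h2),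
    fun i => ?_, isUnit_iff_ne_zero.2 h1, ?_⟩
  · filter_upwards [eventually_dom hX] with Y hY
    exact contDiffAt_pi.1 (L.symm.contDiff.contDiffAt.comp Y (contDiffAt_adapted hY)) i
  · filter_upwards [eventually_dom hX] with Y hY using e Y hY

lemma isUnit_det_linMetric_minkowski (Z : Idx m → ℝ) :
    IsUnit (linMetric L (fun _ => minkowski m) Z).det := by
  rw [isUnit_iff_ne_zero]
  intro h0
  obtain ⟨v, hv, h⟩ := Matrix.exists_mulVec_eq_zero_iff.2 h0
  have e : L v = ∑ j, v j • L (Pi.single j 1) := by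
    conv_lhs => rw [pi_eq_sum_univ' v]
    simp
  have h3 : ∀ i, minkowski m (L (Pi.single i 1)) (L v) = 0 := fun i => by
    have := congrFun h i
    simp only [Matrix.mulVec, dotProduct, linMetric, of_apply, Pi.zero_apply] at this
    rw [e, map_sum, ← this]
    exact sum_ext fun j => by rw [map_smul, smul_eq_mul, mul_comm]
  have h1 : ∀ Y : Spacetime m, minkowski m Y (L v) = 0 := by
    intro Y
    rw [← L.apply_symm_apply Y, pi_eq_sum_univ' (L.symm Y)]
    simp only [map_sum, map_smul, sum_apply, smul_apply, h3, smul_zero, sum_const_zero]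
  have h2 : L v = 0 := by
    have a1 := h1 (1, 0)
    have a2 := h1 (0, (L v).2)
    simp only [minkowski_apply, inner_zero_left, zero_mul, one_mul, zero_sub, sub_zero] at a1 a2
    exact Prod.ext (by simpa using a1) (inner_self_eq_zero.1 a2)
  exact hv (by simpa using h2)

/-- Near a point where `g` is the Minkowski metric, the wave-gauge covector is the restriction of a
covector field which is continuous at that point. -/
lemma HasTrace.exists_covector {U : Set (Spacetime m)} {D : ConeMetric m}
    (h : HasTrace T U g D) (h0 : (0 : Spacetime m) ∈ U) (hη : g 0 = minkowski m) :
    ∃ W : Spacetime m → Spacetime m →L[ℝ] ℝ, ContinuousAt W 0 ∧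
      ∀ (c : SphereChart m) (r : ℝ) (x : Fin m → ℝ), (r, x) ∈ c.coneDom T → ∀ a,
        Hlow g c a r x = W (c.adapted (onC r x)) (fderiv ℝ c.adapted (onC r x) (Pi.single a 1)) := by
  have hfr : Module.finrank ℝ (Idx m → ℝ) = Module.finrank ℝ (Spacetime m) := by
    simp [Spacetime]; ring
  set L : (Idx m → ℝ) ≃L[ℝ] Spacetime m := ContinuousLinearEquiv.ofFinrankEq hfr
  have sm : ∀ p ∈ U, ∀ᶠ p in 𝓝 p, ContDiffAt ℝ ∞ g p := fun p hp => by
    filter_upwards [h.isOpen.mem_nhds hp] with q hq using h.smooth.contDiffAt (h.isOpen.mem_nhds hq)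
  have sy : ∀ p ∈ U, ∀ᶠ p in 𝓝 p, ∀ X Y, g p X Y = g p Y X := fun p hp => by
    filter_upwards [h.isOpen.mem_nhds hp] with q hq using h.symm q hq
  have my : ∀ X Y, minkowski m X Y = minkowski m Y X := fun X Y => by
    rw [minkowski_apply, minkowski_apply, real_inner_comm, mul_comm]
  have hg0 : IsMetricNear (linMetric L g) 0 := by
    refine isMetricNear_linMetric (by simpa using sm 0 h0) (by simpa using sy 0 h0) ?_
    have : linMetric L g 0 = linMetric L (fun _ => minkowski m) 0 := by simp [linMetric, hη]
    rw [this]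
    exact isUnit_det_linMetric_minkowski 0
  have hm0 : IsMetricNear (linMetric L fun _ => minkowski m) 0 :=
    isMetricNear_linMetric (.of_forall fun _ => contDiffAt_const) (.of_forall fun _ => my)
      (isUnit_det_linMetric_minkowski 0)
  set w : Idx m → (Idx m → ℝ) → ℝ :=
    waveGaugeLow (linMetric L g) (linMetric L fun _ => minkowski m) with hw
  have ws : ∀ i, SmoothNear (w i) 0 := fun i => SmoothNear.sum fun k => (hg0.smooth i k).mul
    (SmoothNear.sum fun a => SmoothNear.sum fun b => (hg0.smoothNear_inv a b).mul
      ((hg0.smoothNear_christoffel _ _ _).sub (hm0.smoothNear_christoffel _ _ _)))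
  refine ⟨fun p => ∑ i, w i (L.symm p) • (ContinuousLinearMap.proj (R := ℝ)
    (φ := fun _ : Idx m => ℝ) i).comp L.symm.toContinuousLinearMap, ?_, ?_⟩
  · refine tendsto_finsetSum _ fun i _ => Filter.Tendsto.smul ?_ tendsto_const_nhds
    have h1 : ContinuousAt (w i) (L.symm 0) := by
      rw [map_zero]; exact (ws i).contDiffAt.continuousAt
    exact h1.comp L.symm.continuous.continuousAt
  · intro c r x hq a
    have hX : (fun A => onC r x (inr A)) ∈ c.dom := hq.1
    have hU : c.adapted (onC r x) ∈ U := by rw [h.adapted_onC hq]; exact h.subset _ (mem_cone hq)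
    have pb := isPullbackNear_adapted (L := L) hX (sm _ hU) (sy _ hU) (h.isNullNear hq).metric.isUnit
    have pb' : IsPullbackNear c.eta (linMetric L fun _ => minkowski m)
        (fun X => L.symm (c.adapted X)) (onC r x) :=
      isPullbackNear_adapted (L := L) hX (.of_forall fun _ => contDiffAt_const)
      (.of_forall fun _ => my) (isNullNear_eta hq.1 hq.2.1.ne').metric.isUnit
    have e : Hlow g c a r x = ∑ i, jac (fun X => L.symm (c.adapted X)) (onC r x) i a
        * w i (L.symm (c.adapted (onC r x))) := by
      simp only [Hlow, waveGaugeLow, hw, pb.apply_eq, sum_mul]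
      refine sum_swap fun i => ?_
      rw [sum_comm, mul_sum]
      refine sum_ext fun j => ?_
      rw [← pb.sum_jac_mul_waveGauge pb', mul_sum, mul_sum]
      exact sum_ext fun l => by ring
    rw [e]
    simp only [sum_apply, smul_apply, smul_eq_mul, jac_adapted hX]
    exact sum_ext fun i => mul_comm _ _

end Cartesian

/-! ### Limits along the generators -/

section Rays

lemma SphereChart.coneDom_of_le {b : ℝ} (hb : (b, x) ∈ c.coneDom T) (hr : r ∈ Ioc 0 b) : onCone :=
  ⟨hb.1, hr.1, (ENNReal.ofReal_le_ofReal hr.2).trans_lt hb.2.2⟩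

lemma SphereChart.tendsto_adapted : Tendsto (fun r => c.adapted (onC r x)) (𝓝[>] 0) (𝓝 0) := by
  have h1 : Continuous fun r : ℝ => ((r - 0, r • c.θ x) : Spacetime m) := by fun_prop
  have h2 := h1.tendsto 0
  simp only [sub_zero, zero_smul] at h2
  exact (h2.mono_left nhdsWithin_le_nhds).congr fun r => by simp [SphereChart.adapted, onC]

lemma SphereChart.tendsto_apply {W : Spacetime m → (Spacetime m →L[ℝ] ℝ)} (hW : ContinuousAt W 0)
    (v : Spacetime m) : Tendsto (fun r => W (c.adapted (onC r x)) v) (𝓝[>] 0) (𝓝 (W 0 v)) :=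
  ((hW.clm_apply continuousAt_const).tendsto).comp (SphereChart.tendsto_adapted (c := c) (x := x))

end Rays

/-! ### Smooth dependence on parameters of radial integrals and of a singular radial equation -/

section Curry

variable {E F : Type} [NormedAddCommGroup E] [NormedSpace ℝ E] [NormedAddCommGroup F]
  [NormedSpace ℝ F]

/-- The unit interval. -/
abbrev UI : Type := Icc (0 : ℝ) 1

open Classical in
/-- The function `t ↦ G (t, p)` as an element of `C([0,1], F)` (zero if it is not continuous). -/
def curryI (G : ℝ × E → F) (p : E) : C(UI, F) :=
  if h : Continuous fun t : UI => G (t, p) then ⟨_, h⟩ else 0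

lemma curryI_apply {G : ℝ × E → F} {p : E} (h : Continuous fun t : UI => G (t, p)) (t : UI) :
    curryI G p t = G (t, p) := by simp [curryI, h]

/-- Pointwise application as a bilinear map. -/
def flipC : C(UI, E →L[ℝ] F) →L[ℝ] E →L[ℝ] C(UI, F) := LinearMap.mkContinuous₂ (LinearMap.mk₂ ℝ
    (fun (A : C(UI, E →L[ℝ] F)) (v : E) =>
      (⟨fun t => A t v, A.continuous.clm_apply continuous_const⟩ : C(UI, F)))
    (fun _ _ _ => by ext; simp) (fun _ _ _ => by ext; simp) (fun _ _ _ => by ext; simp)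
    (fun _ _ _ => by ext; simp)) 1 fun A v => by
      rw [one_mul]
      exact (ContinuousMap.norm_le _ (by positivity)).2 fun t =>
        (A t).le_of_opNorm_le (A.norm_coe_le_norm t) v

lemma flipC_apply (A : C(UI, E →L[ℝ] F)) (v : E) (t : UI) : flipC A v t = A t v := rfl

variable {O : Set (ℝ × E)} {U : Set E}

lemma continuousOn_curryI {G : ℝ × E → F} (hG : ContinuousOn G O)
    (hU : ∀ p ∈ U, ∀ t : UI, ((t : ℝ), p) ∈ O) : ContinuousOn (curryI G) U := by
  have h1 : Continuous fun q : U × UI => G ((q.2 : ℝ), q.1) :=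
    hG.comp_continuous (by fun_prop) fun q => hU q.1 q.1.2 q.2
  rw [continuousOn_iff_continuous_domRestrict]
  refine ContinuousMap.continuous_of_continuous_uncurry _ (h1.congr fun q => ?_)
  exact (curryI_apply (h1.comp (Continuous.prodMk_right q.1)) q.2).symm

lemma hasFDerivAt_curryI {G : ℝ × E → F} (hO : IsOpen O) (hUo : IsOpen U) (hG : ContDiffOn ℝ 1 G O)
    (hU : ∀ p ∈ U, ∀ t : UI, ((t : ℝ), p) ∈ O) {p : E} (hp : p ∈ U) :
    HasFDerivAt (curryI G)
      (flipC (curryI (fun q => (fderiv ℝ G q).comp (ContinuousLinearMap.inr ℝ ℝ E)) p)) p := by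
  set D : ℝ × E → E →L[ℝ] F := fun q => (fderiv ℝ G q).comp (ContinuousLinearMap.inr ℝ ℝ E)
  have hD : ContinuousOn D O := (hG.continuousOn_fderiv_of_isOpen hO le_rfl).clm_comp
    continuousOn_const
  have ev : ∀ {F' : Type} [NormedAddCommGroup F'] [NormedSpace ℝ F'] {G' : ℝ × E → F'},
      ContinuousOn G' O → ∀ q ∈ U, ∀ t : UI, curryI G' q t = G' (t, q) := fun h q hq t =>
    curryI_apply (h.comp_continuous (by fun_prop) fun t => hU q hq t) t
  rw [hasFDerivAt_iff_isLittleO, Asymptotics.isLittleO_iff]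
  intro ε hε
  have h1 := (continuousOn_curryI hD hU).continuousAt (hUo.mem_nhds hp)
  obtain ⟨δ, hδ, hb⟩ := Metric.eventually_nhds_iff_ball.1
    ((Metric.tendsto_nhds.1 h1 ε hε).and (hUo.mem_nhds hp))
  filter_upwards [Metric.ball_mem_nhds p hδ] with q hq
  refine (ContinuousMap.norm_le _ (by positivity)).2 fun t => ?_
  simp only [ContinuousMap.sub_apply, flipC_apply, ev hG.continuousOn q (hb q hq).2,
    ev hG.continuousOn p hp, ev hD p hp]
  refine (convex_ball p δ).norm_image_sub_le_of_norm_hasFDerivWithin_le'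
    (f := fun q => G (t, q)) (f' := fun q => D (t, q)) (fun z hz => ?_) (fun z hz => ?_)
    (Metric.mem_ball_self hδ) hq
  · have h2 := ((hG.contDiffAt (hO.mem_nhds (hU z (hb z hz).2 t))).differentiableAt
      one_ne_zero).hasFDerivAt
    exact (h2.comp z (hasFDerivAt_prodMk_right (t : ℝ) z)).hasFDerivWithinAt
  · have h3 := (curryI D z - curryI D p).norm_coe_le_norm t
    rw [ContinuousMap.sub_apply, ev hD z (hb z hz).2, ev hD p hp, ← dist_eq_norm (curryI D z)] at h3
    exact h3.trans (hb z hz).1.le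

/-- A jointly smooth function defines a smooth map into `C([0,1], F)`. -/
lemma contDiffOn_curryI {G : ℝ × E → F} (hO : IsOpen O) (hUo : IsOpen U)
    (hU : ∀ p ∈ U, ∀ t : UI, ((t : ℝ), p) ∈ O) (hG : ContDiffOn ℝ ∞ G O) :
    ContDiffOn ℝ ∞ (curryI G) U := by
  refine contDiffOn_infty.2 fun n => ?_
  induction n generalizing F with
  | zero => exact contDiffOn_zero.2 (continuousOn_curryI hG.continuousOn hU)
  | succ n ih =>
    have h1 := fun p (hp : p ∈ U) => hasFDerivAt_curryI hO hUo (hG.of_le (by exact_mod_cast le_top))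
      hU hp
    push_cast
    refine (contDiffOn_succ_iff_fderiv_of_isOpen hUo).2
      ⟨fun p hp => (h1 p hp).differentiableAt.differentiableWithinAt, by simp, ?_⟩
    refine ContDiffOn.congr ?_ fun p hp => (h1 p hp).fderiv
    exact (ContinuousLinearMap.contDiff (E := C(UI, E →L[ℝ] F)) (F := E →L[ℝ] C(UI, F))
      flipC).comp_contDiffOn (ih ((hG.fderiv_of_isOpen hO (by simp)).clm_comp
      contDiffOn_const))

/-- `(avg k z)(t) = ∫₀¹ 2 s^k z(st) ds`. -/
def avg (k : ℕ) : C(UI, ℝ) →L[ℝ] C(UI, ℝ) := LinearMap.mkContinuous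
    { toFun := fun z => ⟨fun t => ∫ s in (0 : ℝ)..1, 2 * s ^ k * Set.IccExtend zero_le_one z (s * t),
        intervalIntegral.continuous_parametric_intervalIntegral_of_continuous' (by
          have := z.continuous.Icc_extend' (h := zero_le_one' ℝ)
          fun_prop) 0 1⟩
      map_add' := fun y z => by
        ext t
        have hy := y.continuous.Icc_extend' (h := zero_le_one' ℝ)
        have hz := z.continuous.Icc_extend' (h := zero_le_one' ℝ)
        simp only [ContinuousMap.coe_mk, ContinuousMap.add_apply]
        rw [← intervalIntegral.integral_add (Continuous.intervalIntegrable (by fun_prop) _ _)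
          (Continuous.intervalIntegrable (by fun_prop) _ _)]
        exact intervalIntegral.integral_congr fun s _ => by simp [Set.IccExtend, mul_add]
      map_smul' := fun a z => by
        ext t
        simp only [ContinuousMap.coe_mk, ContinuousMap.smul_apply, smul_eq_mul, RingHom.id_apply,
          ← intervalIntegral.integral_const_mul]
        exact intervalIntegral.integral_congr fun s _ => by
          simp only [Set.IccExtend, Function.comp_apply, ContinuousMap.smul_apply, smul_eq_mul]; ring }
    2 fun z => (ContinuousMap.norm_le _ (by positivity)).2 fun t => by
      refine (intervalIntegral.norm_integral_le_of_norm_le_const (C := 2 * ‖z‖)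
        fun s hs => ?_).trans (by simp)
      rw [Set.uIoc_of_le zero_le_one] at hs
      rw [norm_mul, norm_mul, Real.norm_eq_abs, Real.norm_eq_abs, abs_of_pos two_pos, abs_pow,
        abs_of_pos hs.1, Set.IccExtend, Function.comp_apply]
      exact mul_le_mul (mul_le_of_le_one_right two_pos.le (pow_le_one₀ hs.1.le hs.2))
        (z.norm_coe_le_norm _) (norm_nonneg _) two_pos.le

lemma avg_apply (k : ℕ) (z : C(UI, ℝ)) (t : UI) {f : ℝ → ℝ} (hf : ∀ s : UI, z s = f s) :
    avg k z t = ∫ s in (0 : ℝ)..1, 2 * s ^ k * f (s * t) := by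
  refine intervalIntegral.integral_congr fun s hs => ?_
  rw [Set.uIcc_of_le zero_le_one] at hs
  have h1 : s * (t : ℝ) ∈ Icc (0 : ℝ) 1 := ⟨mul_nonneg hs.1 t.2.1, mul_le_one₀ hs.2 t.2.1 t.2.2⟩
  simp only [Set.IccExtend_of_mem _ _ h1, hf]

/-- A bound `|z(t)| ≤ C t^n` is improved by the averages. -/
lemma abs_avg_le (k : ℕ) {z : C(UI, ℝ)} {C : ℝ} {n : ℕ} (h : ∀ t : UI, |z t| ≤ C * (t : ℝ) ^ n)
    (t : UI) : |avg k z t| ≤ 2 / (n + k + 1) * C * (t : ℝ) ^ n := by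
  have h1 : ∫ s in (0 : ℝ)..1, 2 * C * (t : ℝ) ^ n * s ^ (n + k)
      = 2 / (n + k + 1) * C * (t : ℝ) ^ n := by
    rw [intervalIntegral.integral_const_mul, integral_pow]
    push_cast
    simp
    ring
  rw [← h1]
  refine intervalIntegral.norm_integral_le_of_norm_le (E := ℝ) (μ := MeasureTheory.volume)
    (g := fun s => 2 * C * (t : ℝ) ^ n * s ^ (n + k)) zero_le_one (.of_forall fun s hs => ?_)
    ((by fun_prop : Continuous fun s : ℝ => 2 * C * (t : ℝ) ^ n * s ^ (n + k)).intervalIntegrable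
      (μ := MeasureTheory.volume) _ _)
  have h2 : s * (t : ℝ) ∈ Icc (0 : ℝ) 1 := ⟨mul_nonneg hs.1.le t.2.1, mul_le_one₀ hs.2 t.2.1 t.2.2⟩
  rw [Set.IccExtend_of_mem _ _ h2, norm_mul, norm_mul, Real.norm_eq_abs, Real.norm_eq_abs,
    abs_of_pos two_pos, abs_pow, abs_of_pos hs.1, Real.norm_eq_abs]
  refine (mul_le_mul_of_nonneg_left (h ⟨_, h2⟩) (by have := hs.1; positivity)).trans (le_of_eq ?_)
  simp only [mul_pow, pow_add]
  ring

end Curry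

section RadialEquation

/-- Multiplication by `b` on `C([0,1], ℝ)`. -/
abbrev mulC : C(UI, ℝ) →L[ℝ] C(UI, ℝ) →L[ℝ] C(UI, ℝ) := ContinuousLinearMap.mul ℝ _

/-- The function `t ↦ t⁴`. -/
def quartic : C(UI, ℝ) := ⟨fun t => (t : ℝ) ^ 4, by fun_prop⟩

/-- The integral operator `z ↦ ∫₀¹ 2s (st)⁴ ∫₀¹ 2s'³ (b z)(s'st) ds' ds` of the radial equation,
as a function of the coefficient `b`. -/
def volterra : C(UI, ℝ) →L[ℝ] C(UI, ℝ) →L[ℝ] C(UI, ℝ) :=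
  (ContinuousLinearMap.compL ℝ _ _ _ ((avg 1).comp ((mulC quartic).comp (avg 3)))).comp mulC

lemma volterra_apply (b z : C(UI, ℝ)) :
    volterra b z = avg 1 (quartic * avg 3 (b * z)) := rfl

/-- The factor `1 / n!` makes the Neumann series of `1 + volterra b` converge. -/
lemma abs_volterra_pow_le (b z : C(UI, ℝ)) (n : ℕ) (t : UI) :
    |(volterra b ^ n) z t| ≤ ‖b‖ ^ n / n.factorial * ‖z‖ * (t : ℝ) ^ (4 * n) := by
  induction n generalizing t with
  | zero => simpa using z.norm_coe_le_norm t
  | succ n ih =>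
    rw [pow_succ', mul_apply_eq_comp, volterra_apply]
    set y := (volterra b ^ n) z
    set C := ‖b‖ ^ n / n.factorial * ‖z‖
    have hC : 0 ≤ C := by positivity
    have h1 := abs_avg_le 3 (z := b * y) (C := ‖b‖ * C) (n := 4 * n) fun s => by
      rw [ContinuousMap.mul_apply, abs_mul, mul_assoc]
      exact mul_le_mul (b.norm_coe_le_norm s) (ih s) (abs_nonneg _) (norm_nonneg _)
    have h2 := abs_avg_le 1 (z := quartic * avg 3 (b * y)) (n := 4 * (n + 1))
      (C := 2 / ((4 * n : ℕ) + 3 + 1) * (‖b‖ * C)) (fun s => by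
      rw [ContinuousMap.mul_apply, abs_mul, mul_comm, mul_add, pow_add, ← mul_assoc]
      refine mul_le_mul (by exact_mod_cast h1 s) (le_of_eq ?_) (abs_nonneg _)
        (by have := s.2.1; positivity)
      exact abs_of_nonneg (pow_nonneg s.2.1 4)) t
    refine h2.trans (mul_le_mul_of_nonneg_right ?_ (pow_nonneg t.2.1 _))
    rw [Nat.factorial_succ, pow_succ]
    have e : ‖b‖ ^ n * ‖b‖ / ((n + 1) * n.factorial : ℕ) * ‖z‖ = (1 / (n + 1)) * (‖b‖ * C) := by
      simp only [C]
      push_cast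
      field_simp
    rw [e, ← mul_assoc]
    refine mul_le_mul_of_nonneg_right ?_ (by positivity)
    push_cast
    rw [div_mul_div_comm, div_le_div_iff₀ (by positivity) (by positivity)]
    nlinarith [Nat.cast_nonneg (α := ℝ) n, mul_nonneg (Nat.cast_nonneg (α := ℝ) n)
      (Nat.cast_nonneg (α := ℝ) n)]

lemma isUnit_one_add_volterra (b : C(UI, ℝ)) : IsUnit (1 + volterra b) := by
  obtain ⟨n, hn⟩ := ((FloorSemiring.tendsto_pow_div_factorial_atTop ‖-b‖).eventually_lt_const
    one_pos).exists
  have h1 : ‖volterra (-b) ^ n‖ < 1 := by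
    refine lt_of_le_of_lt (ContinuousLinearMap.opNorm_le_bound _ (by positivity) fun z => ?_) hn
    refine (ContinuousMap.norm_le _ (by positivity)).2 fun t => (abs_volterra_pow_le _ z n t).trans ?_
    exact mul_le_of_le_one_right (by positivity) (pow_le_one₀ t.2.1 t.2.2)
  have h2 := isUnit_one_sub_of_norm_lt_one (R := C(UI, ℝ) →L[ℝ] C(UI, ℝ)) h1
  rw [← mul_neg_geom_sum] at h2
  have h3 := ((Commute.isUnit_mul_iff (Commute.sum_right _ _ _ fun i _ =>
    ((Commute.one_left _).sub_left (Commute.refl _)).pow_right i)).1 h2).1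
  rwa [map_neg, sub_neg_eq_add] at h3

/-- The solution of `z + volterra b z = 1`. -/
def radialSol (b : C(UI, ℝ)) : C(UI, ℝ) := Ring.inverse (1 + volterra b) 1

lemma radialSol_eq (b : C(UI, ℝ)) : radialSol b = 1 - volterra b (radialSol b) := by
  have h := congrArg (fun A => A 1) (Ring.mul_inverse_cancel _ (isUnit_one_add_volterra b))
  exact eq_sub_of_add_eq h

lemma eq_radialSol {b z : C(UI, ℝ)} (h : z = 1 - volterra b z) : z = radialSol b := by
  have h1 := congrArg (fun A => A z) (Ring.inverse_mul_cancel _ (isUnit_one_add_volterra b))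
  have h2 : (1 + volterra b) z = 1 := eq_sub_iff_add_eq.1 h
  rw [radialSol, ← h2]
  exact h1.symm

lemma contDiff_radialSol : ContDiff ℝ ∞ radialSol := by
  refine contDiff_iff_contDiffAt.2 fun b => ?_
  have h1 : ContDiffAt ℝ ∞ (Ring.inverse : (C(UI, ℝ) →L[ℝ] C(UI, ℝ)) → _) (1 + volterra b) := by
    have := contDiffAt_ringInverse ℝ (R := C(UI, ℝ) →L[ℝ] C(UI, ℝ)) (n := ∞)
      (isUnit_one_add_volterra b).unit
    rwa [IsUnit.unit_spec] at this
  have h0 := ContinuousLinearMap.contDiff (𝕜 := ℝ) (n := ∞) (E := C(UI, ℝ))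
    (F := C(UI, ℝ) →L[ℝ] C(UI, ℝ)) volterra
  have h2 : ContDiffAt ℝ ∞ (fun b => 1 + volterra b) b := contDiffAt_const.add h0.contDiffAt
  exact (h1.comp b h2).clm_apply contDiffAt_const

end RadialEquation

section Star

variable {E : Type} [NormedAddCommGroup E] [NormedSpace ℝ E] {Ω : Set (ℝ × E)}

/-- `∫₀¹ 2 s^k a(sρ, x) ds`. -/
def radInt (k : ℕ) (a : ℝ × E → ℝ) (p : ℝ × E) : ℝ :=
  ∫ s in (0 : ℝ)..1, 2 * s ^ k * a (s * p.1, p.2)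

variable (hΩ : IsOpen Ω) (hs : ∀ p ∈ Ω, ∀ t ∈ Icc (0 : ℝ) 1, (t * p.1, p.2) ∈ Ω) {a : ℝ × E → ℝ}
include hs

lemma continuous_ray (ha : ContinuousOn a Ω) {p : ℝ × E} (hp : p ∈ Ω) :
    Continuous fun t : UI => a (t * p.1, p.2) :=
  ha.comp_continuous (by fun_prop) fun t => hs p hp t t.2

include hΩ

lemma contDiffOn_ray (ha : ContDiffOn ℝ ∞ a Ω) :
    ContDiffOn ℝ ∞ (curryI fun q : ℝ × (ℝ × E) => a (q.1 * q.2.1, q.2.2)) Ω := by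
  have h1 : ContDiff ℝ ∞ fun q : ℝ × (ℝ × E) => ((q.1 * q.2.1, q.2.2) : ℝ × E) := by fun_prop
  exact contDiffOn_curryI (hΩ.preimage h1.continuous) hΩ (fun p hp t => hs p hp t t.2)
    (ha.comp h1.contDiffOn fun q hq => hq)

lemma contDiffOn_radInt (k : ℕ) (ha : ContDiffOn ℝ ∞ a Ω) : ContDiffOn ℝ ∞ (radInt k a) Ω := by
  refine ContDiffOn.congr (((ContinuousMap.evalCLM ℝ (1 : UI)).comp (avg k)).contDiff.comp_contDiffOn
    (contDiffOn_ray hΩ hs ha)) fun p hp => ?_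
  have := avg_apply k (curryI (fun q : ℝ × (ℝ × E) => a (q.1 * q.2.1, q.2.2)) p) 1
    (f := fun t => a (t * p.1, p.2)) fun t => curryI_apply (continuous_ray hs ha.continuousOn hp) t
  simp only [Function.comp_apply, ContinuousLinearMap.comp_apply, ContinuousMap.evalCLM_apply, this,
    radInt, Set.Icc.coe_one, mul_one]

/-- The value at `(ρ, x)` of the solution `w` of
`w = 1 - ∫₀¹ 2s (sρ)⁴ ∫₀¹ 2s'³ (q w)(s'sρ, x) ds' ds`. -/
def radW (q : ℝ × E → ℝ) (p : ℝ × E) : ℝ :=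
  radialSol (p.1 ^ 4 • curryI (fun z : ℝ × (ℝ × E) => q (z.1 * z.2.1, z.2.2)) p) 1

lemma contDiffOn_radW (ha : ContDiffOn ℝ ∞ a Ω) : ContDiffOn ℝ ∞ (radW a) Ω :=
  (ContinuousMap.evalCLM ℝ (M := ℝ) (1 : UI)).contDiff.comp_contDiffOn
    (contDiff_radialSol.comp_contDiffOn
      ((contDiff_fst.pow 4).contDiffOn.smul (contDiffOn_ray hΩ hs ha)))

omit hΩ in
/-- The solution with coefficient `b` restricted to `[0, t]` and rescaled is the solution with the
rescaled coefficient. -/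
lemma radialSol_ray (ha : ContinuousOn a Ω) {p : ℝ × E} (hp : p ∈ Ω) (t : UI) :
    radialSol (p.1 ^ 4 • curryI (fun z : ℝ × (ℝ × E) => a (z.1 * z.2.1, z.2.2)) p) t
      = radW a (t * p.1, p.2) := by
  have hval : ∀ p ∈ Ω, ∀ s : UI,
      (p.1 ^ 4 • curryI (fun z : ℝ × (ℝ × E) => a (z.1 * z.2.1, z.2.2)) p) s
        = p.1 ^ 4 * a (s * p.1, p.2) := fun p hp s => by
    rw [ContinuousMap.smul_apply, smul_eq_mul, curryI_apply (continuous_ray hs ha hp)]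
  set b := p.1 ^ 4 • curryI (fun z : ℝ × (ℝ × E) => a (z.1 * z.2.1, z.2.2)) p with hb
  have hp' := hs p hp t t.2
  have hval' := hval _ hp'
  set b' := ((t : ℝ) * p.1) ^ 4 • curryI (fun z : ℝ × (ℝ × E) => a (z.1 * z.2.1, z.2.2))
    ((t : ℝ) * p.1, p.2) with hb'
  let m : C(UI, UI) := ⟨fun s => ⟨s * t, mul_nonneg s.2.1 t.2.1, mul_le_one₀ s.2.2 t.2.1 t.2.2⟩,
    by fun_prop⟩
  have key : (radialSol b).comp m = radialSol b' := by
    refine eq_radialSol ?_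
    ext s
    have hav : ∀ k (y : C(UI, ℝ)), (avg k y).comp m = avg k (y.comp m) := fun k y => by
      ext s
      refine intervalIntegral.integral_congr fun u hu => ?_
      rw [Set.uIcc_of_le zero_le_one] at hu
      have e1 : u * (s : ℝ) ∈ Icc (0 : ℝ) 1 := ⟨mul_nonneg hu.1 s.2.1, mul_le_one₀ hu.2 s.2.1 s.2.2⟩
      have e2 : u * (m s : ℝ) ∈ Icc (0 : ℝ) 1 :=
        ⟨mul_nonneg hu.1 (m s).2.1, mul_le_one₀ hu.2 (m s).2.1 (m s).2.2⟩
      simp only [Set.IccExtend_of_mem _ _ e1, Set.IccExtend_of_mem _ _ e2]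
      refine congrArg (fun v => 2 * u ^ k * y v) (Subtype.ext ?_)
      exact (mul_assoc u (s : ℝ) (t : ℝ)).symm
    have h1 := congrArg (fun y : C(UI, ℝ) => y.comp m s) (radialSol_eq b)
    refine h1.trans ?_
    change 1 - (volterra b (radialSol b)).comp m s = 1 - volterra b' ((radialSol b).comp m) s
    rw [volterra_apply, volterra_apply, hav]
    congr 3
    ext s
    change (m s : ℝ) ^ 4 * (avg 3 (b * radialSol b)).comp m s = (s : ℝ) ^ 4 * _
    rw [hav]
    have e : b' * (radialSol b).comp m = (t : ℝ) ^ 4 • ((b * radialSol b).comp m) := by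
      ext s
      change b' s * radialSol b (m s) = (t : ℝ) ^ 4 * (b (m s) * radialSol b (m s))
      rw [hval', hval p hp]
      change ((t : ℝ) * p.1) ^ 4 * a (s * ((t : ℝ) * p.1), p.2) * _
        = (t : ℝ) ^ 4 * (p.1 ^ 4 * a (s * t * p.1, p.2) * _)
      rw [← mul_assoc (s : ℝ)]
      ring
    rw [e, map_smul, ContinuousMap.smul_apply, smul_eq_mul]
    change ((s : ℝ) * t) ^ 4 * _ = _
    ring
  have := congrArg (fun y : C(UI, ℝ) => y 1) key
  refine Eq.trans ?_ this
  change _ = radialSol b (m 1)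
  congr 1
  exact Subtype.ext (one_mul _).symm

omit hΩ in
lemma radW_eq (ha : ContinuousOn a Ω) {p : ℝ × E} (hp : p ∈ Ω) :
    radW a p = 1 - radInt 1 (fun z => z.1 ^ 4 * radInt 3 (fun z => a z * radW a z) z) p := by
  have h1 := congrArg (fun y : C(UI, ℝ) => y 1) (radialSol_eq
    (p.1 ^ 4 • curryI (fun z : ℝ × (ℝ × E) => a (z.1 * z.2.1, z.2.2)) p))
  refine h1.trans (congrArg (fun y : ℝ => 1 - y) ?_)
  refine (avg_apply 1 _ 1 (f := fun s => (s * p.1) ^ 4 * radInt 3 (fun z => a z * radW a z)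
    (s * p.1, p.2)) fun s => ?_).trans (intervalIntegral.integral_congr fun s _ => by simp)
  have h2 := avg_apply 3 (p.1 ^ 4 • curryI (fun z : ℝ × (ℝ × E) => a (z.1 * z.2.1, z.2.2)) p
    * radialSol (p.1 ^ 4 • curryI (fun z : ℝ × (ℝ × E) => a (z.1 * z.2.1, z.2.2)) p)) s
    (f := fun s => p.1 ^ 4 * (a (s * p.1, p.2) * radW a (s * p.1, p.2))) fun s => by
      rw [ContinuousMap.mul_apply, radialSol_ray hs ha hp, ContinuousMap.smul_apply, smul_eq_mul,
        curryI_apply (continuous_ray hs ha hp), mul_assoc]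
  refine (congrArg (fun y => (s : ℝ) ^ 4 * y) h2).trans ?_
  simp only [radInt, mul_pow, mul_assoc, ← intervalIntegral.integral_const_mul]
  exact intervalIntegral.integral_congr fun u _ => by ring

end Star

/-! ### Functions on the cone which are smooth up to the vertex -/

section Vertex

/-- The domain `ρ² < T`, `x ∈ dom`, on which `r = ρ²` is used to unfold the boundary `r = 0`. -/
def SphereChart.polDom (c : SphereChart m) (T : ℝ≥0∞) : Set (ConePt m) :=
  {p | p.2 ∈ c.dom ∧ ofReal (p.1 ^ 2) < T}

/-- The function `(ρ, x) ↦ f(ρ², x)`, with the value `f₀(x)` at `ρ = 0`. -/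
def polExt (f : ConeFn m) (f0 : (Fin m → ℝ) → ℝ) (p : ConePt m) : ℝ :=
  if p.1 = 0 then f0 p.2 else f (p.1 ^ 2) p.2

/-- `f(r, x)`, `0 < r < T`, extends smoothly to `r = 0` with the value `f₀(x)`. Smoothness up to the
boundary is expressed as smoothness on an open set of the even function `ρ ↦ f(ρ²)`. -/
def VSmooth (T : ℝ≥0∞) (c : SphereChart m) (f : ConeFn m) (f0 : (Fin m → ℝ) → ℝ) : Prop :=
  ContDiffOn ℝ ∞ (polExt f f0) (c.polDom T)

lemma SphereChart.isOpen_polDom : IsOpen (c.polDom T) :=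
  (c.isOpen_dom.preimage continuous_snd).inter
    (isOpen_Iio.preimage (ENNReal.continuous_ofReal.comp (continuous_fst.pow 2)))

lemma SphereChart.polDom_star :
    ∀ p ∈ c.polDom T, ∀ t ∈ Icc (0 : ℝ) 1, (t * p.1, p.2) ∈ c.polDom T := fun p hp t ht =>
  ⟨hp.1, (ENNReal.ofReal_le_ofReal (by
    rw [mul_pow]; exact mul_le_of_le_one_left (sq_nonneg _) (pow_le_one₀ ht.1 ht.2))).trans_lt hp.2⟩

lemma SphereChart.sq_mem {p : ConePt m} (hp : p ∈ c.polDom T) (h : p.1 ≠ 0) :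
    (p.1 ^ 2, p.2) ∈ c.coneDom T := ⟨hp.1, by positivity, hp.2⟩

lemma SphereChart.sqrt_mem {p : ConePt m} (hp : p ∈ c.coneDom T) :
    (√p.1, p.2) ∈ c.polDom T := ⟨hp.1, by simpa [Real.sq_sqrt hp.2.1.le] using hp.2.2⟩

lemma SphereChart.zero_mem {p : ConePt m} (hp : p ∈ c.polDom T) : (0, p.2) ∈ c.polDom T := by
  simpa using polDom_star p hp 0 ⟨le_rfl, zero_le_one⟩

variable {f g : ConeFn m} {f0 g0 : (Fin m → ℝ) → ℝ}

lemma polExt_sqrt (hr : 0 < r) (x : Fin m → ℝ) : polExt f f0 (√r, x) = f r x := by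
  simp [polExt, (Real.sqrt_pos.2 hr).ne', Real.sq_sqrt hr.le]

namespace VSmooth

lemma congr (hf : VSmooth T c f f0) (h : ∀ r x, (r, x) ∈ c.coneDom T → g r x = f r x)
    (h0 : ∀ x ∈ c.dom, g0 x = f0 x) : VSmooth T c g g0 := by
  refine ContDiffOn.congr hf fun p hp => ?_
  by_cases hz : p.1 = 0
  · simp only [polExt, if_pos hz, h0 _ hp.1]
  · simp only [polExt, if_neg hz, h _ _ (sq_mem hp hz)]

/-- A smooth function of functions smooth up to the vertex is smooth up to the vertex. -/
lemma comp {ι : Type} [Fintype ι] {f : ι → ConeFn m} {f0 : ι → (Fin m → ℝ) → ℝ}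
    (hf : ∀ i, VSmooth T c (f i) (f0 i)) (G : (ι → ℝ) → ℝ)
    (hG : ∀ r x, (r, x) ∈ c.coneDom T → ContDiffAt ℝ ∞ G fun i => f i r x)
    (hG0 : ∀ x ∈ c.dom, ContDiffAt ℝ ∞ G fun i => f0 i x) :
    VSmooth T c (fun r x => G fun i => f i r x) (fun x => G fun i => f0 i x) := by
  intro p hp
  have e : polExt (fun r x => G fun i => f i r x) (fun x => G fun i => f0 i x)
      = fun p => G fun i => polExt (f i) (f0 i) p := by
    funext p
    by_cases hz : p.1 = 0 <;> simp [polExt, hz]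
  rw [e]
  refine ContDiffAt.comp_contDiffWithinAt p (g := G) ?_ (contDiffWithinAt_pi.2 fun i => hf i p hp)
  by_cases hz : p.1 = 0
  · simpa [polExt, hz] using hG0 p.2 hp.1
  · simpa [polExt, hz] using hG _ _ (sq_mem hp hz)

lemma const_x {g : (Fin m → ℝ) → ℝ} (hg : ContDiffOn ℝ ∞ g c.dom) : VSmooth T c (fun _ => g) g :=
  (hg.comp contDiff_snd.contDiffOn fun _ hp => hp.1).congr fun p _ => by simp [polExt]

lemma const (a : ℝ) : VSmooth T c (fun _ _ => a) fun _ => a := const_x contDiffOn_const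

lemma radius : VSmooth T c (fun r _ => r) fun _ => 0 :=
  (contDiff_fst.pow 2).contDiffOn.congr fun p _ => by grind [polExt]

lemma add (hf : VSmooth T c f f0) (hg : VSmooth T c g g0) :
    VSmooth T c (fun r x => f r x + g r x) fun x => f0 x + g0 x :=
  (ContDiffOn.add hf hg).congr fun p _ => by grind [polExt]

lemma mul (hf : VSmooth T c f f0) (hg : VSmooth T c g g0) :
    VSmooth T c (fun r x => f r x * g r x) fun x => f0 x * g0 x :=
  (ContDiffOn.mul hf hg).congr fun p _ => by grind [polExt]

lemma neg (hf : VSmooth T c f f0) : VSmooth T c (fun r x => -f r x) fun x => -f0 x :=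
  (ContDiffOn.neg hf).congr fun p _ => by grind [polExt]

lemma sub (hf : VSmooth T c f f0) (hg : VSmooth T c g g0) :
    VSmooth T c (fun r x => f r x - g r x) fun x => f0 x - g0 x :=
  (ContDiffOn.sub hf hg).congr fun p _ => by grind [polExt]

lemma sum {α : Type} [Fintype α] {F : α → ConeFn m} {F0 : α → (Fin m → ℝ) → ℝ}
    (h : ∀ i, VSmooth T c (F i) (F0 i)) :
    VSmooth T c (fun r x => ∑ i, F i r x) fun x => ∑ i, F0 i x :=
  (ContDiffOn.sum (s := univ) (f := fun i => polExt (F i) (F0 i)) fun i _ => h i).congr fun p _ => by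
    grind [polExt]

lemma comp1 (hf : VSmooth T c f f0) {G : ℝ → ℝ}
    (hG : ∀ r x, (r, x) ∈ c.coneDom T → ContDiffAt ℝ ∞ G (f r x))
    (hG0 : ∀ x ∈ c.dom, ContDiffAt ℝ ∞ G (f0 x)) :
    VSmooth T c (fun r x => G (f r x)) fun x => G (f0 x) :=
  comp (fun _ : Unit => hf) (fun y => G (y ()))
    (fun r x h => (hG r x h).comp (fun _ : Unit => f r x) (contDiff_apply ℝ ℝ ()).contDiffAt)
    fun x h => (hG0 x h).comp (fun _ : Unit => f0 x) (contDiff_apply ℝ ℝ ()).contDiffAt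

lemma inv (hf : VSmooth T c f f0) (h : ∀ r x, (r, x) ∈ c.coneDom T → f r x ≠ 0)
    (h0 : ∀ x ∈ c.dom, f0 x ≠ 0) : VSmooth T c (fun r x => (f r x)⁻¹) fun x => (f0 x)⁻¹ :=
  hf.comp1 (fun r x hq => contDiffAt_inv ℝ (h r x hq)) fun x hx => contDiffAt_inv ℝ (h0 x hx)

lemma matInv {h : ℝ → 𝕄 (Fin m)}
    {h0 : 𝕄 (Fin m)}
    (hh : ∀ A B, VSmooth T c (fun r x => h r x A B) fun x => h0 x A B)
    (hu : ∀ r x, (r, x) ∈ c.coneDom T → (h r x).det ≠ 0) (hu0 : ∀ x ∈ c.dom, (h0 x).det ≠ 0)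
    (A B : Fin m) : VSmooth T c (fun r x => (h r x)⁻¹ A B) fun x => (h0 x)⁻¹ A B := by
  have key : ∀ M : Matrix (Fin m) (Fin m) ℝ, M.det ≠ 0 → ContDiffAt ℝ ∞
      (fun y : Fin m × Fin m → ℝ => (of fun A B => y (A, B))⁻¹ A B) fun i => M i.1 i.2 :=
    fun M hM => (MatSmoothNear.inv (x := fun i : Fin m × Fin m => M i.1 i.2)
      (M := fun y => of fun A B => y (A, B)) (fun A B => SmoothNear.coord (A, B))
      (isUnit_iff_ne_zero.2 hM) A B).contDiffAt
  exact comp (fun i : Fin m × Fin m => hh i.1 i.2) (fun y => (of fun A B => y (A, B))⁻¹ A B)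
    (fun r x hq => key _ (hu r x hq)) fun x hx => key _ (hu0 x hx)

lemma mono {T' : ℝ≥0∞} (hT : T' ≤ T) (hf : VSmooth T c f f0) : VSmooth T' c f f0 :=
  ContDiffOn.mono hf fun _ hp => ⟨hp.1, hp.2.trans_le hT⟩

/-- Restriction to the open cone. -/
lemma contDiffOn (hf : VSmooth T c f f0) :
    ContDiffOn ℝ ∞ (fun p : ConePt m => f p.1 p.2) (c.coneDom T) := by
  intro p hp
  have h1 : ContDiffAt ℝ ∞ (fun p : ConePt m => ((√p.1, p.2) : ConePt m)) p :=
    (contDiffAt_fst.sqrt hp.2.1.ne').prodMk contDiffAt_snd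
  have h2 := (ContDiffOn.contDiffAt hf (isOpen_polDom.mem_nhds
    (sqrt_mem hp))).comp p h1
  refine ContDiffAt.contDiffWithinAt (h2.congr_of_eventuallyEq ?_)
  filter_upwards [isOpen_coneDom.mem_nhds hp] with q hq
  exact (polExt_sqrt hq.2.1 q.2).symm

lemma contDiffAt (hf : VSmooth T c f f0) {p : ConePt m} (hp : p ∈ c.coneDom T) :
    ContDiffAt ℝ ∞ (fun p : ConePt m => f p.1 p.2) p :=
  hf.contDiffOn.contDiffAt (isOpen_coneDom.mem_nhds hp)

lemma hasDerivAt (hf : VSmooth T c f f0) (hp : onCone) :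
    HasDerivAt (fun s => f s x) (deriv (fun s => f s x) r) r :=
  (DifferentiableAt.comp (g := fun p : ConePt m => f p.1 p.2) (f := fun s => (s, x)) r
    ((hf.contDiffAt hp).differentiableAt (by simp))
    (hasFDerivAt_prodMk_left r x).differentiableAt).hasDerivAt

lemma smoothNear (hf : VSmooth T c f f0) (hp : onCone) : SmoothNear (f r) x := by
  have h1 : ContinuousAt (fun y : Fin m → ℝ => (r, y)) x := by fun_prop
  filter_upwards [h1.eventually (eventually_coneDom hp)] with y hy
  exact (hf.contDiffAt hy).comp y (contDiff_prodMk_right r).contDiffAt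

lemma pd (hf : VSmooth T c f f0) (A : Fin m) :
    VSmooth T c (fun r x => pd A (f r) x) (NullCone.pd A f0) := by
  have h1 : ContDiffOn ℝ ∞ (fun p => fderiv ℝ (polExt f f0) p (0, Pi.single A 1)) (c.polDom T) :=
    (ContDiffOn.fderiv_of_isOpen hf isOpen_polDom (by simp)).clm_apply contDiffOn_const
  refine h1.congr fun p hp => ?_
  have h2 := ((ContDiffOn.contDiffAt hf (isOpen_polDom.mem_nhds hp)).differentiableAt
    (by simp)).hasFDerivAt
  have h3 := HasFDerivAt.comp (g := polExt f f0) (f := fun y => (p.1, y)) p.2 h2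
    (hasFDerivAt_prodMk_right p.1 p.2)
  have h4 : polExt f f0 ∘ (fun y => (p.1, y)) = if p.1 = 0 then f0 else f (p.1 ^ 2) := by
    funext y; by_cases hz : p.1 = 0 <;> simp [polExt, hz]
  rw [h4] at h3
  have h5 : polExt (fun r x => NullCone.pd A (f r) x) (NullCone.pd A f0) p
      = NullCone.pd A (if p.1 = 0 then f0 else f (p.1 ^ 2)) p.2 := by
    by_cases hz : p.1 = 0 <;> simp [polExt, hz]
  rw [h5, NullCone.pd, h3.fderiv]
  rfl

/-- The limit at the vertex, locally uniformly in the direction. -/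
lemma tendsto (hf : VSmooth T c f f0) (hT : 0 < T) (hx : x ∈ c.dom) :
    Tendsto (fun p : ConePt m => f p.1 p.2) (𝓝[>] 0 ×ˢ 𝓝 x) (𝓝 (f0 x)) := by
  have h1 : ContinuousAt (polExt f f0) (0, x) := (ContDiffOn.contDiffAt hf
    (isOpen_polDom.mem_nhds ⟨hx, by simpa using hT⟩)).continuousAt
  have h2 : Tendsto (fun p : ConePt m => (√p.1, p.2)) (𝓝[>] 0 ×ˢ 𝓝 x) (𝓝 (0, x)) := by
    refine Filter.Tendsto.prodMk_nhds ?_ Filter.tendsto_snd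
    have := (Real.continuous_sqrt.tendsto 0).mono_left (nhdsWithin_le_nhds (s := Set.Ioi 0))
    rw [Real.sqrt_zero] at this
    exact this.comp Filter.tendsto_fst
  have h3 := h1.tendsto.comp h2
  simp only [polExt, if_true] at h3
  refine h3.congr' ?_
  filter_upwards [Filter.prod_mem_prod self_mem_nhdsWithin Filter.univ_mem] with p hp
  exact polExt_sqrt hp.1 p.2

lemma tendsto_ray (hf : VSmooth T c f f0) (hT : 0 < T) (hx : x ∈ c.dom) :
    Tendsto (fun r => f r x) (𝓝[>] 0) (𝓝 (f0 x)) :=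
  (hf.tendsto hT hx).comp (Filter.tendsto_id.prodMk tendsto_const_nhds)

/-- Functions which are smooth up to the boundary in the sense of one-sided derivatives. -/
lemma of_contDiffOn {F : ConePt m → ℝ}
    (hF : ContDiffOn ℝ ∞ F {p | 0 ≤ p.1 ∧ p.2 ∈ c.dom ∧ ofReal p.1 < T}) :
    VSmooth T c (fun r x => F (r, x)) fun x => F (0, x) := by
  have h1 : ContDiff ℝ ∞ fun p : ConePt m => ((p.1 ^ 2, p.2) : ConePt m) := by fun_prop
  refine (hF.comp h1.contDiffOn fun p (hp : p ∈ c.polDom T) => ⟨sq_nonneg _, hp.1, hp.2⟩).congr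
    fun p hp => ?_
  by_cases hz : p.1 = 0 <;> simp [polExt, hz]

end VSmooth

/-- `∫₀¹ 2 s^k f(s² r, x) ds`, the regular solution `y` of `r ∂_r y + (k + 1) y / 2 = f`. -/
def euler (k : ℕ) (f : ConeFn m) (r : ℝ) (x : Fin m → ℝ) : ℝ :=
  ∫ s in (0 : ℝ)..1, 2 * s ^ k * f (s ^ 2 * r) x

lemma polExt_euler {k : ℕ} {p : ConePt m} :
    polExt (euler k f) (fun x => 2 / (k + 1) * f0 x) p = radInt k (polExt f f0) p := by
  by_cases hz : p.1 = 0
  · simp only [polExt, radInt, hz, mul_zero, if_true]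
    rw [intervalIntegral.integral_mul_const, intervalIntegral.integral_const_mul, integral_pow]
    simp
    left
    ring
  · simp only [polExt, if_neg hz, euler, radInt]
    refine intervalIntegral.integral_congr_ae (.of_forall fun s hs => ?_)
    rw [Set.uIoc_of_le zero_le_one] at hs
    simp only [mul_eq_zero, hs.1.ne', hz, or_self, if_false, mul_pow]

lemma VSmooth.euler (hf : VSmooth T c f f0) (k : ℕ) :
    VSmooth T c (euler k f) fun x => 2 / (k + 1) * f0 x :=
  (contDiffOn_radInt isOpen_polDom polDom_star k hf).congr
    fun _ _ => polExt_euler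

lemma hasDerivAt_radInt {k : ℕ} {a : ConePt m → ℝ} {ρ : ℝ} (hρ : 0 < ρ)
    (h : (ρ, x) ∈ c.polDom T) (ha : ContinuousOn a (c.polDom T)) :
    HasDerivAt (fun ρ => radInt k a (ρ, x)) ((2 * a (ρ, x) - (k + 1) * radInt k a (ρ, x)) / ρ) ρ := by
  have hc : ContinuousOn (fun s => s ^ k * a (s, x)) {s | (s, x) ∈ c.polDom T} :=
    (continuous_pow k).continuousOn.mul (ha.comp (by fun_prop) fun s hs => hs)
  have ho : IsOpen {s : ℝ | (s, x) ∈ c.polDom T} := isOpen_polDom.preimage (by fun_prop)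
  have hsub : Set.uIcc 0 ρ ⊆ {s | (s, x) ∈ c.polDom T} := fun s hs => by
    rw [Set.uIcc_of_le hρ.le] at hs
    have := polDom_star _ h (s / ρ) ⟨div_nonneg hs.1 hρ.le, div_le_one_of_le₀ hs.2 hρ.le⟩
    simpa [div_mul_cancel₀ s hρ.ne'] using this
  have h1 := intervalIntegral.integral_hasDerivAt_right (hc.mono hsub).intervalIntegrable
    (hc.stronglyMeasurableAtFilter ho ρ h) (hc.continuousAt (ho.mem_nhds h))
  have e : ∀ t : ℝ, 0 < t → radInt k a (t, x)
      = 2 * (t ^ (k + 1))⁻¹ * ∫ s in (0 : ℝ)..t, s ^ k * a (s, x) := fun t ht => by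
    have h2 := intervalIntegral.integral_comp_mul_right (a := 0) (b := 1)
      (fun s => s ^ k * a (s, x)) ht.ne'
    rw [zero_mul, one_mul, smul_eq_mul] at h2
    have h3 : radInt k a (t, x) = 2 * (t ^ k)⁻¹ * ∫ s in (0 : ℝ)..1, (s * t) ^ k * a (s * t, x) := by
      rw [radInt, ← intervalIntegral.integral_const_mul]
      refine intervalIntegral.integral_congr fun s _ => ?_
      have := (pow_pos ht k).ne'
      simp only [mul_pow]
      field_simp
    rw [h3, h2, pow_succ]
    have := (pow_pos ht k).ne'
    field_simp
  have h2 := (((hasDerivAt_pow (k + 1) ρ).fun_inv (pow_ne_zero _ hρ.ne')).const_mul 2).fun_mul h1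
  have h3 := h2.congr_of_eventuallyEq (f₁ := fun ρ => radInt k a (ρ, x)) (by
    filter_upwards [lt_mem_nhds hρ] with t ht using e t ht)
  refine h3.congr_deriv ?_
  rw [e ρ hρ]
  have := hρ.ne'
  field_simp
  push_cast
  ring

lemma VSmooth.hasDerivAt_euler (hf : VSmooth T c f f0) (k : ℕ) (hp : onCone) :
    HasDerivAt (fun s => NullCone.euler k f s x)
      ((f r x - (k + 1) / 2 * NullCone.euler k f r x) / r) r := by
  have hr := hp.2.1
  have h1 := (hasDerivAt_radInt (k := k) (Real.sqrt_pos.2 hr) (sqrt_mem hp)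
    hf.continuousOn).comp r (Real.hasDerivAt_sqrt hr.ne')
  have h2 := h1.congr_of_eventuallyEq (f₁ := fun s => NullCone.euler k f s x) (by
    filter_upwards [lt_mem_nhds hr] with s hs
    exact (polExt_sqrt hs x).symm.trans polExt_euler)
  refine h2.congr_deriv ?_
  have e1 : radInt k (polExt f f0) (√r, x) = NullCone.euler k f r x :=
    polExt_euler.symm.trans (polExt_sqrt hr x)
  rw [e1, polExt_sqrt hr]
  have h3 := Real.sqrt_pos.2 hr
  have h4 := Real.mul_self_sqrt hr.le
  rw [div_mul_div_comm, mul_one, mul_left_comm, h4]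
  field_simp

/-- The radial derivative of a function smooth up to the vertex is smooth up to the vertex: it is
`∂_ρ a / 2ρ` for the even function `a(ρ) = f(ρ²)`. -/
lemma VSmooth.deriv (hf : VSmooth T c f f0) :
    ∃ g0, VSmooth T c (fun r x => deriv (fun s => f s x) r) g0 := by
  set a := polExt f f0 with ha
  set a1 : ConePt m → ℝ := fun p => fderiv ℝ a p (1, 0) with ha1
  set a2 : ConePt m → ℝ := fun p => fderiv ℝ a1 p (1, 0) with ha2
  have s1 : ContDiffOn ℝ ∞ a1 (c.polDom T) :=
    (ContDiffOn.fderiv_of_isOpen hf isOpen_polDom (by simp)).clm_apply contDiffOn_const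
  have s2 : ContDiffOn ℝ ∞ a2 (c.polDom T) :=
    (s1.fderiv_of_isOpen isOpen_polDom (by simp)).clm_apply contDiffOn_const
  have d : ∀ {b : ConePt m → ℝ}, ContDiffOn ℝ ∞ b (c.polDom T) → ∀ p ∈ c.polDom T,
      HasDerivAt (fun ρ => b (ρ, p.2)) (fderiv ℝ b p (1, 0)) p.1 := fun {b} hb p hp => by
    have := ((hb.contDiffAt (isOpen_polDom.mem_nhds hp)).differentiableAt
      (by simp)).hasFDerivAt
    exact (HasFDerivAt.comp (g := b) (f := fun ρ => (ρ, p.2)) p.1 this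
      (hasFDerivAt_prodMk_left p.1 p.2)).hasDerivAt
  have z1 : ∀ p ∈ c.polDom T, a1 (0, p.2) = 0 := fun p hp => by
    have h1 := d hf _ (zero_mem hp)
    have h2 : HasDerivAt (fun ρ => a (-ρ, p.2)) (-a1 (0, p.2)) 0 := by
      have h3 : HasDerivAt (fun ρ => a (ρ, p.2)) (a1 (0, p.2)) (-0) := by rw [neg_zero]; exact h1
      exact (HasDerivAt.comp (h₂ := fun ρ => a (ρ, p.2)) (h := fun ρ => -ρ) (0 : ℝ) h3
        (hasDerivAt_neg 0)).congr_deriv (by ring)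
    have h3 : (fun ρ => a (-ρ, p.2)) = fun ρ => a (ρ, p.2) := by funext ρ; simp [ha, polExt]
    rw [h3] at h2
    linarith [h1.unique h2]
  refine ⟨fun x => 1 / 4 * radInt 0 a2 (0, x), ContDiffOn.congr
    (contDiffOn_const.mul (contDiffOn_radInt isOpen_polDom polDom_star 0 s2))
    (f := fun p => 1 / 4 * radInt 0 a2 p) fun p hp => ?_⟩
  by_cases hz : p.1 = 0
  · obtain ⟨ρ, x⟩ := p
    simp only at hz
    subst hz
    simp [polExt]
  · have h1 : a1 p = p.1 * ∫ s in (0 : ℝ)..1, a2 (s * p.1, p.2) := by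
      have h2 : ∀ s ∈ Set.uIcc (0 : ℝ) 1, HasDerivAt (fun s => a1 (s * p.1, p.2))
          (p.1 * a2 (s * p.1, p.2)) s := fun s hs => by
        rw [Set.uIcc_of_le zero_le_one] at hs
        have h3 := d s1 _ (polDom_star p hp s hs)
        exact (HasDerivAt.comp (h₂ := fun ρ => a1 (ρ, p.2)) (h := fun s => s * p.1) s h3
          ((hasDerivAt_id' s).mul_const p.1)).congr_deriv (by rw [one_mul, mul_comm])
      have hc : ContinuousOn (fun s => p.1 * a2 (s * p.1, p.2)) (Set.uIcc 0 1) := by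
        rw [Set.uIcc_of_le zero_le_one]
        exact continuousOn_const.mul (s2.continuousOn.comp (by fun_prop)
          fun s hs => polDom_star p hp s hs)
      have h3 := intervalIntegral.integral_eq_sub_of_hasDerivAt h2 hc.intervalIntegrable
      rw [intervalIntegral.integral_const_mul] at h3
      simp only [one_mul, zero_mul, z1 p hp, sub_zero] at h3
      exact h3.symm
    have h2 := HasDerivAt.comp (h₂ := fun s => f s p.2) (h := fun ρ => ρ ^ 2) p.1
      (hf.hasDerivAt (sq_mem hp hz)) (hasDerivAt_pow 2 p.1)
    have h3 := (d hf p hp).congr_of_eventuallyEq (f₁ := fun ρ => f (ρ ^ 2) p.2) (by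
      filter_upwards [isOpen_ne.mem_nhds hz] with ρ hρ
      simp [polExt, show ρ ≠ 0 from hρ])
    have h4 : _ = a1 p := h2.unique h3
    simp only [polExt, if_neg hz, radInt, pow_zero, mul_one, intervalIntegral.integral_const_mul]
    simp only [Nat.cast_ofNat, Nat.add_one_sub_one, pow_one] at h4
    rw [h1] at h4
    refine mul_left_cancel₀ (mul_ne_zero two_ne_zero hz) ?_
    linarith

lemma eq_of_hasDerivAt_zero {F : ℝ → ℝ} {b L : ℝ} (hb : 0 < b)
    (hF : ∀ r ∈ Ioc 0 b, HasDerivAt F 0 r) (h0 : Tendsto F (𝓝[>] 0) (𝓝 L)) : F b = L := by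
  refine tendsto_nhds_unique (tendsto_const_nhds.congr' ?_) h0
  filter_upwards [Ioc_mem_nhdsGT hb] with r hr
  have h1 : ∀ s ∈ Icc r b, HasDerivAt F 0 s := fun s hs => hF s ⟨hr.1.trans_le hs.1, hs.2⟩
  exact constant_of_derivWithin_zero (fun s hs => (h1 s hs).differentiableAt.differentiableWithinAt)
    (fun s hs => (h1 s ⟨hs.1, hs.2.le⟩).hasDerivWithinAt.derivWithin
      (uniqueDiffOn_Icc (hs.1.trans_lt hs.2) s ⟨hs.1, hs.2.le⟩)) b ⟨hr.2, le_rfl⟩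

/-- A function smooth up to the vertex and vanishing there is divisible by `r`. -/
lemma VSmooth.div_radius (hf : VSmooth T c f f0) (h0 : ∀ x ∈ c.dom, f0 x = 0) :
    ∃ g0, VSmooth T c (fun r x => f r x / r) g0 := by
  obtain ⟨g0, hg⟩ := hf.deriv
  refine ⟨_, (hg.euler 1).congr (fun r x hq => ?_) fun x _ => rfl⟩
  have hT : 0 < T := bot_le.trans_lt hq.2.2
  have hd : ∀ s ∈ Ioc 0 r, HasDerivAt
      (fun s => f s x - s * NullCone.euler 1 (fun r x => _root_.deriv (fun s => f s x) r) s x) 0 s := by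
    intro s hs
    have hq' : (s, x) ∈ c.coneDom T := ⟨hq.1, hs.1, (ENNReal.ofReal_le_ofReal hs.2).trans_lt hq.2.2⟩
    refine ((hf.hasDerivAt hq').fun_sub ((hasDerivAt_id' s).fun_mul (hg.hasDerivAt_euler 1
      hq'))).congr_deriv ?_
    have := hs.1.ne'
    field_simp
    push_cast
    ring
  have h1 := eq_of_hasDerivAt_zero hq.2.1 hd (L := 0) (by
    have := (hf.sub (VSmooth.radius.mul (hg.euler 1))).tendsto_ray hT hq.1
    simpa [h0 x hq.1] using this)
  have := hq.2.1.ne'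
  rw [div_eq_iff this]
  linarith

/-- The regular solution of the linear radial equation `(r w)'' = -q r w`. -/
lemma VSmooth.exists_radialSol (hf : VSmooth T c f f0) :
    ∃ w U : ConeFn m, VSmooth T c w (fun _ => 1) ∧ VSmooth T c U (fun _ => 1) ∧
      ∀ r x, (r, x) ∈ c.coneDom T → HasDerivAt (fun s => s * w s x) (U r x) r ∧
        HasDerivAt (fun s => U s x) (-(f r x * (r * w r x))) r := by
  set a := polExt f f0 with ha
  set w : ConeFn m := fun r x => radW a (√r, x) with hw
  have hs := polDom_star (c := c) (T := T)
  have ho := isOpen_polDom (c := c) (T := T)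
  have hrad : ∀ p ∈ c.polDom T, radW a (-p.1, p.2) = radW a p := by
    intro p hp
    simp only [radW]
    congr 3
    · ring
    · have e : ∀ t : ℝ, a (t * -p.1, p.2) = a (t * p.1, p.2) := fun t => by simp [ha, polExt]
      ext t
      rw [curryI_apply (continuous_ray hs hf.continuousOn (p := (-p.1, p.2)) ⟨hp.1, by
        simpa using hp.2⟩), curryI_apply (continuous_ray hs hf.continuousOn hp)]
      exact e t
  have w0 : ∀ p ∈ c.polDom T, radW a (0, p.2) = 1 := fun p hp => by
    rw [radW_eq hs hf.continuousOn (zero_mem hp)]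
    simp [radInt]
  have hext : ∀ p ∈ c.polDom T, polExt w (fun _ => 1) p = radW a p := fun p hp => by
    by_cases hz : p.1 = 0
    · have := w0 p hp
      rw [← hz] at this
      simp only [polExt, if_pos hz]
      exact this.symm
    · simp only [polExt, if_neg hz, hw, Real.sqrt_sq_eq_abs]
      rcases abs_choice p.1 with h | h <;> rw [h]
      exact hrad p hp
  have hW : VSmooth T c w fun _ => 1 := (contDiffOn_radW ho hs hf).congr hext
  have hP := (hf.mul hW).euler 3
  set P := NullCone.euler 3 fun r x => f r x * w r x with hPdef
  set U : ConeFn m := fun r x => 1 - r ^ 2 * P r x with hU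
  have hUs : VSmooth T c U fun _ => 1 :=
    ((VSmooth.const 1).sub ((VSmooth.radius.mul VSmooth.radius).mul hP)).congr
      (fun r x _ => by simp only [hU, pow_two]) fun x _ => by simp
  have hray : ∀ p ∈ c.polDom T, ∀ {b b' : ConePt m → ℝ} (k : ℕ),
      (∀ q ∈ c.polDom T, b q = b' q) → radInt k b p = radInt k b' p := fun p hp b b' k e =>
    intervalIntegral.integral_congr fun s hs' => by
      rw [Set.uIcc_of_le zero_le_one] at hs'
      simp only [e _ (hs p hp s hs')]
  have hwU : ∀ r x, (r, x) ∈ c.coneDom T → w r x = NullCone.euler 1 U r x := fun r x hq => by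
    have hp := sqrt_mem hq
    have h1 := radW_eq hs hf.continuousOn hp
    have h2 : NullCone.euler 1 U r x = radInt 1 (polExt U fun _ => 1) (√r, x) := by
      rw [← polExt_euler, polExt_sqrt hq.2.1 x]
    set G : ConePt m → ℝ := fun z => z.1 ^ 4 * radInt 3 (fun z => a z * radW a z) z with hG
    have hUG : ∀ p ∈ c.polDom T, polExt U (fun _ => 1) p = 1 - G p := fun p hp => by
      by_cases hz : p.1 = 0
      · simp [polExt, hG, hz]
      · have e1 := hray p hp (b := polExt (fun r x => f r x * w r x) fun x => f0 x * 1)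
          (b' := fun z => a z * radW a z) 3 fun q hq => by
            rw [← hext q hq]
            by_cases hz : q.1 = 0 <;> simp [ha, polExt, hz]
        rw [← polExt_euler] at e1
        simp only [polExt, if_neg hz] at e1 ⊢
        simp only [hG, ← e1, hU]
        ring
    have hGc : ContinuousOn G (c.polDom T) := ((continuousOn_const (c := (1 : ℝ))).sub
      hUs.continuousOn).congr fun p hp => by
        change G p = 1 - polExt U (fun _ => 1) p
        rw [hUG p hp]; ring
    rw [h2, hray _ hp 1 hUG]
    refine h1.trans ?_
    have hi : IntervalIntegrable (fun s => 2 * s ^ 1 * G (s * √r, x)) MeasureTheory.volume 0 1 := by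
      refine ContinuousOn.intervalIntegrable ?_
      rw [Set.uIcc_of_le zero_le_one]
      exact (by fun_prop : Continuous fun s : ℝ => 2 * s ^ 1).continuousOn.mul
        (hGc.comp (by fun_prop) fun s hs' => hs _ hp s hs')
    have h3 : radInt 1 (fun p => 1 - G p) (√r, x) = (∫ s in (0 : ℝ)..1, 2 * s)
        - radInt 1 G (√r, x) := by
      rw [radInt, radInt, ← intervalIntegral.integral_sub
        (Continuous.intervalIntegrable (by fun_prop) _ _) hi]
      exact intervalIntegral.integral_congr fun s _ => by ring
    rw [h3, intervalIntegral.integral_const_mul, integral_id]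
    norm_num
  refine ⟨w, U, hW, hUs, fun r x hq => ⟨?_, ?_⟩⟩
  · have h1 := (hUs.hasDerivAt_euler 1 hq).congr_of_eventuallyEq (f₁ := fun s => w s x) (by
      filter_upwards [(Continuous.prodMk_left x).continuousAt.eventually
        (eventually_coneDom hq)] with s hs using hwU s x hs)
    refine ((hasDerivAt_id' r).fun_mul h1).congr_deriv ?_
    rw [hwU r x hq]
    have := hq.2.1.ne'
    field_simp
    push_cast
    ring
  · refine ((((hasDerivAt_id' r).fun_pow 2).fun_mul ((hf.mul hW).hasDerivAt_euler 3 hq)).const_sub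
      1).congr_deriv ?_
    have := hq.2.1.ne'
    field_simp
    push_cast
    ring

end Vertex

/-! ### Graph charts of the sphere and global fields -/

section GraphChart

variable {e : Space m}

lemma exists_unitBasis (e : Space m) :
    ∃ b : OrthonormalBasis (Fin (m + 1)) ℝ (Space m), ‖e‖ = 1 → b 0 = e := by
  by_cases he : ‖e‖ = 1
  · have ho : Orthonormal ℝ (({0} : Set (Fin (m + 1))).domRestrict fun _ => e) :=
      ⟨fun _ => he, fun i j hij => (hij (Subsingleton.elim i j)).elim⟩
    obtain ⟨b, hb⟩ := ho.exists_orthonormalBasis_extension_of_card_eq (by simp)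
    exact ⟨b, fun _ => hb 0 rfl⟩
  · exact ⟨EuclideanSpace.basisFun _ ℝ, fun h => (he h).elim⟩

/-- An orthonormal basis whose first vector is the unit vector `e`. -/
def unitBasis (e : Space m) : OrthonormalBasis (Fin (m + 1)) ℝ (Space m) :=
  (exists_unitBasis e).choose

lemma unitBasis_zero (he : ‖e‖ = 1) : unitBasis e 0 = e := (exists_unitBasis e).choose_spec he

/-- Coordinates of the projection to the orthogonal complement of `e`. -/
def proj (e : Space m) : Space m →L[ℝ] (Fin m → ℝ) :=
  ContinuousLinearMap.pi fun A => innerSL ℝ (unitBasis e A.succ)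

/-- The chart of the half-sphere around `e` which is inverse to the orthogonal projection. -/
def graphMap (e : Space m) (z : Fin m → ℝ) : Space m :=
  √(1 - ∑ A, z A ^ 2) • unitBasis e 0 + ∑ A, z A • unitBasis e A.succ

lemma proj_graphMap (z : Fin m → ℝ) : proj e (graphMap e z) = z := by
  ext A
  have h := fun i j => orthonormal_iff_ite.1 (unitBasis e).orthonormal i j
  simp [proj, graphMap, inner_add_right, inner_sum, inner_smul_right, h]

lemma inner_graphMap (z : Fin m → ℝ) :
    inner ℝ (unitBasis e 0) (graphMap e z) = √(1 - ∑ A, z A ^ 2) := by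
  have h := fun i j => orthonormal_iff_ite.1 (unitBasis e).orthonormal i j
  have h0 : ∀ A : Fin m, ¬(0 = A.succ) := fun A => (Fin.succ_ne_zero A).symm
  simp [graphMap, inner_add_right, inner_sum, inner_smul_right, h, h0]

lemma norm_sq_eq (y : Space m) : ‖y‖ ^ 2 = inner ℝ (unitBasis e 0) y ^ 2 + ∑ A, proj e y A ^ 2 := by
  rw [← (unitBasis e).sum_sq_inner_right y, Fin.sum_univ_succ]
  rfl

/-- The open unit ball of `ℝ^m`. -/
def graphDom (m : ℕ) : Set (Fin m → ℝ) := {z | ∑ A, z A ^ 2 < 1}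

lemma isOpen_graphDom : IsOpen (graphDom m) := isOpen_lt (by fun_prop) continuous_const

lemma contDiffOn_graphMap : ContDiffOn ℝ ∞ (graphMap e) (graphDom m) := by
  refine ContDiffOn.add (ContDiffOn.smul (ContDiffOn.sqrt (by fun_prop) fun z hz => ?_)
    contDiffOn_const) (by fun_prop)
  exact (sub_pos.2 hz).ne'

lemma norm_graphMap {z : Fin m → ℝ} (hz : z ∈ graphDom m) : ‖graphMap e z‖ = 1 := by
  have h1 := norm_sq_eq (e := e) (graphMap e z)
  rw [proj_graphMap, inner_graphMap, Real.sq_sqrt (sub_pos.2 hz).le, sub_add_cancel] at h1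
  exact (pow_eq_one_iff_of_nonneg (norm_nonneg _) two_ne_zero).1 h1

/-- The graph chart around `e`. -/
def graphChart (e : Space m) : SphereChart m where
  dom := graphDom m
  isOpen_dom := isOpen_graphDom
  θ := graphMap e
  smooth := contDiffOn_graphMap
  norm_eq := fun _ hz => norm_graphMap hz
  injOn := fun z _ z' _ h => by rw [← proj_graphMap (e := e) z, h, proj_graphMap]
  immersion := fun z hz => by
    have h1 := (contDiffOn_graphMap (e := e)).contDiffAt (isOpen_graphDom.mem_nhds hz)
    have h2 := (proj e).hasFDerivAt.comp z (h1.differentiableAt (by simp)).hasFDerivAt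
    have h3 : ⇑(proj e) ∘ graphMap e = id := funext fun z => proj_graphMap z
    rw [h3] at h2
    have h4 := h2.unique (hasFDerivAt_id z)
    exact Function.LeftInverse.injective (g := proj e) fun v => DFunLike.congr_fun h4 v

lemma zero_mem_graphDom : (0 : Fin m → ℝ) ∈ graphDom m := by simp [graphDom]

lemma proj_self (he : ‖e‖ = 1) : proj e e = 0 := by
  ext A
  have h := orthonormal_iff_ite.1 (unitBasis e).orthonormal A.succ 0
  rw [unitBasis_zero he] at h
  simpa [proj, Fin.succ_ne_zero] using h

lemma proj_mem (he : ‖e‖ = 1) {y : Space m} (hy : ‖y‖ = 1) (h : 0 < inner ℝ e y) :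
    proj e y ∈ (graphChart e).dom ∧ (graphChart e).θ (proj e y) = y := by
  have h1 := norm_sq_eq (e := e) y
  rw [hy, unitBasis_zero he, one_pow] at h1
  have h2 : (∑ A, proj e y A ^ 2) < 1 := by nlinarith [pow_pos h 2]
  refine ⟨h2, ?_⟩
  have h3 : √(1 - ∑ A, proj e y A ^ 2) = inner ℝ e y := by
    rw [h1, add_sub_cancel_right, Real.sqrt_sq h.le]
  change graphMap e (proj e y) = y
  have h4 := (unitBasis e).sum_repr' y
  rw [Fin.sum_univ_succ, unitBasis_zero he] at h4
  rw [graphMap, h3, unitBasis_zero he]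
  exact h4

/-- The transition map from the chart `c` to the graph chart around `e`. -/
def transition (c : SphereChart m) (e : Space m) (x : Fin m → ℝ) : Fin m → ℝ := proj e (c.θ x)

/-- The point `x` of the chart `c` lies in the domain of the graph chart around `e`. -/
def Overlap (c : SphereChart m) (e : Space m) (x : Fin m → ℝ) : Prop :=
  ‖e‖ = 1 ∧ x ∈ c.dom ∧ 0 < inner ℝ e (c.θ x)

namespace Overlap

lemma self (hx : x ∈ c.dom) : Overlap c (c.θ x) x :=
  ⟨c.norm_eq x hx, hx, by rw [real_inner_self_eq_norm_sq, c.norm_eq x hx]; norm_num⟩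

variable (h : Overlap c e x)
include h

lemma mem : transition c e x ∈ (graphChart e).dom := (proj_mem h.1 (c.norm_eq x h.2.1) h.2.2).1

lemma θ_eq : (graphChart e).θ (transition c e x) = c.θ x :=
  (proj_mem h.1 (c.norm_eq x h.2.1) h.2.2).2

lemma eventually : ∀ᶠ y in 𝓝 x, Overlap c e y := by
  have h1 : ContinuousAt (fun y => inner ℝ e (c.θ y)) x :=
    continuousAt_const.inner (contDiffAt_θ h.2.1).continuousAt
  filter_upwards [c.isOpen_dom.mem_nhds h.2.1, h1.eventually (lt_mem_nhds h.2.2)] with y h2 h3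
    using ⟨h.1, h2, h3⟩

lemma hasFDerivAt_transition : HasFDerivAt (transition c e) ((proj e).comp (fderiv ℝ c.θ x)) x :=
  (proj e).hasFDerivAt.comp x (hasFDerivAt_θ h.2.1)

lemma jac_apply (A B : Fin m) :
    jac (transition c e) x B A = inner ℝ (unitBasis e B.succ) (c.frame x A) := by
  have h1 := hasFDerivAt_pi'.1 h.hasFDerivAt_transition B
  rw [jac, of_apply, pd, h1.fderiv]
  rfl

/-- The chain rule for coordinate frames. -/
lemma frame_eq (A : Fin m) :
    c.frame x A = ∑ B, jac (transition c e) x B A • (graphChart e).frame (transition c e x) B := by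
  have h1 : c.θ =ᶠ[𝓝 x] (graphChart e).θ ∘ transition c e := by
    filter_upwards [h.eventually] with y hy using hy.θ_eq.symm
  have h2 := (hasFDerivAt_θ h.mem).comp x h.hasFDerivAt_transition
  rw [SphereChart.frame, h1.fderiv_eq, h2.fderiv]
  have h3 : (fun B => jac (transition c e) x B A) = ((proj e).comp (fderiv ℝ c.θ x)) (Pi.single A 1) :=
    funext fun B => h.jac_apply A B
  have := SphereChart.sum_smul_frame (c := graphChart e) (transition c e x)
    (fun B => jac (transition c e) x B A)
  rw [this, h3]
  rfl

lemma smoothNear_transition (i : Fin m) : SmoothNear (fun y => transition c e y i) x := by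
  filter_upwards [c.isOpen_dom.mem_nhds h.2.1] with y hy
  exact contDiffAt_pi.1 ((proj e).contDiff.contDiffAt.comp y (contDiffAt_θ hy)) i

/-- Transformation of the components of bilinear forms. -/
lemma comp2_eq (b : SForm m) (r : ℝ) : c.comp2 b r x
    = (jac (transition c e) x).transpose * (graphChart e).comp2 b r (transition c e x)
      * jac (transition c e) x := by
  ext A B
  simp only [SphereChart.comp2, of_apply, mul_apply, transpose_apply, h.θ_eq]
  rw [h.frame_eq A, h.frame_eq B]
  simp only [smul_sum, map_sum, sum_mul, sum_apply, smul_comm r, map_smul, smul_apply, smul_eq_mul,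
    mul_sum]
  exact sum_ext₂ fun _ _ => by ring

lemma round_eq : c.round x = (jac (transition c e) x).transpose
    * (graphChart e).round (transition c e x) * jac (transition c e) x := by
  have h1 := h.comp2_eq (fun _ => euclid m) 1
  have h2 : ∀ (c : SphereChart m) x, c.comp2 (fun _ => euclid m) 1 x = c.round x := fun c x => by
    ext A B; simp [SphereChart.comp2, SphereChart.round, euclid]; rfl
  simpa only [h2] using h1

lemma isUnit_jac : IsUnit (jac (transition c e) x).det := by
  have h1 := congrArg Matrix.det h.round_eq
  rw [det_mul, det_mul] at h1
  refine isUnit_iff_ne_zero.2 fun h0 => ?_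
  rw [h0, mul_zero] at h1
  exact (posDef_round (c := c) h.2.1).det_pos.ne' h1

lemma isPullbackNear {b : SForm m}
    (hb : IsMetricNear ((graphChart e).comp2 b r) (transition c e x)) :
    IsPullbackNear (c.comp2 b r) ((graphChart e).comp2 b r) (transition c e) x :=
  ⟨hb, h.smoothNear_transition, h.isUnit_jac, h.eventually.mono fun _ hy => hy.comp2_eq b r⟩

lemma isPullbackNear_round : IsPullbackNear c.round (graphChart e).round (transition c e) x :=
  ⟨⟨smoothNear_round h.mem, .of_forall fun y => round_symm y,
    isUnit_iff_ne_zero.2 (posDef_round h.mem).det_pos.ne'⟩, h.smoothNear_transition,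
    h.isUnit_jac, h.eventually.mono fun _ hy => hy.round_eq⟩

end Overlap

end GraphChart

section Glue

variable {G : Type}

/-- Chart representations `a_c(r, x)`, `0 < r < T`, of one function on the cone. -/
def IsInvariant (T : ℝ≥0∞) (a : SphereChart m → ℝ → (Fin m → ℝ) → G) : Prop :=
  ∀ c e x r, Overlap c e x → (r, x) ∈ c.coneDom T → a c r x = a (graphChart e) r (transition c e x)

/-- The function on the cone with the given chart representations. -/
def glue (a : SphereChart m → ℝ → (Fin m → ℝ) → G) (y : Space m) : G :=
  a (graphChart (‖y‖⁻¹ • y)) ‖y‖ 0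

lemma glue_apply {a : SphereChart m → ℝ → (Fin m → ℝ) → G} (ha : IsInvariant T a)
    (hq : onCone) : glue a (r • c.θ x) = a c r x := by
  have h1 := norm_smul_θ hq
  simp only at h1
  rw [glue, h1, inv_smul_smul₀ hq.2.1.ne', ha c (c.θ x) x r (Overlap.self hq.1) hq, transition,
    proj_self (c.norm_eq x hq.1)]

lemma isOpen_cone : IsOpen (cone m T) := isOpen_ne.inter (isOpen_Iio.preimage
    (ENNReal.continuous_ofReal.comp continuous_norm))

lemma SphereChart.tendsto_smul_θ (hb : onCone) :
    Tendsto (fun r : ℝ => r • c.θ x) (𝓝[>] 0) (𝓝[≠] 0) := by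
  refine tendsto_nhdsWithin_iff.2 ⟨?_, ?_⟩
  · have : Tendsto (fun r : ℝ => r • c.θ x) (𝓝 0) (𝓝 ((0 : ℝ) • c.θ x)) :=
      (continuous_id.smul continuous_const).tendsto 0
    rw [zero_smul] at this
    exact this.mono_left nhdsWithin_le_nhds
  · filter_upwards [Ioc_mem_nhdsGT hb.2.1] with r hr using (mem_cone (coneDom_of_le hb hr)).1

lemma hasDerivAt_comp0 {f : Space m → ℝ} (hf : ContDiffOn ℝ ∞ f (cone m T))
    (hq : onCone) :
    HasDerivAt (fun s => c.comp0 f s x) (deriv (fun s => c.comp0 f s x) r) r :=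
  (DifferentiableAt.comp (g := f) (f := fun s : ℝ => s • c.θ x) r
    ((hf.contDiffAt (isOpen_cone.mem_nhds (mem_cone hq))).differentiableAt (by simp))
    (by fun_prop)).hasDerivAt

lemma eventually_mem_cone (hT : 0 < T) : ∀ᶠ y in 𝓝[≠] (0 : Space m), y ∈ cone m T := by
  have h1 : Continuous fun y : Space m => ofReal ‖y‖ :=
    ENNReal.continuous_ofReal.comp continuous_norm
  filter_upwards [self_mem_nhdsWithin, nhdsWithin_le_nhds
    (h1.continuousAt.eventually (gt_mem_nhds (by simpa using hT)))] with y hy hy' using ⟨hy, hy'⟩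

lemma norm_direction {y : Space m} (hy : y ≠ 0) : ‖‖y‖⁻¹ • y‖ = 1 := by
  rw [norm_smul, norm_inv, norm_norm, inv_mul_cancel₀ (norm_ne_zero_iff.2 hy)]

lemma inner_direction_pos {y : Space m} (hy : y ≠ 0) : 0 < inner ℝ (‖y‖⁻¹ • y) y := by
  have := norm_pos_iff.2 hy
  rw [real_inner_smul_left, real_inner_self_eq_norm_sq]; positivity

/-- Polar coordinates, in the graph chart around `e`. -/
def polar (e y : Space m) : ConePt m := (‖y‖, proj e (‖y‖⁻¹ • y))

lemma polar_spec {e : Space m} (he : ‖e‖ = 1) {y : Space m} (hy : y ∈ cone m T)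
    (h : 0 < inner ℝ e y) :
    polar e y ∈ (graphChart e).coneDom T ∧ (polar e y).1 • (graphChart e).θ (polar e y).2 = y := by
  have h1 : 0 < ‖y‖ := norm_pos_iff.2 hy.1
  have h2 := proj_mem he (y := ‖y‖⁻¹ • y) (norm_direction hy.1) (by
    rw [inner_smul_right]; positivity)
  refine ⟨⟨h2.1, h1, hy.2⟩, ?_⟩
  change ‖y‖ • (graphChart e).θ (proj e (‖y‖⁻¹ • y)) = y
  rw [h2.2, smul_inv_smul₀ h1.ne']

lemma contDiffAt_polar {e y : Space m} (hy : y ≠ 0) : ContDiffAt ℝ ∞ (polar e) y := by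
  have h1 : ContDiffAt ℝ ∞ (fun y : Space m => ‖y‖) y := contDiffAt_norm ℝ hy
  exact h1.prodMk ((proj e).contDiff.contDiffAt.comp y ((h1.inv (norm_ne_zero_iff.2 hy)).smul
    contDiffAt_id))

/-- A function on the cone which is smooth up to the vertex with the value `a₀` there, in the
graph charts. -/
def ConeSmooth (T : ℝ≥0∞) (A : Space m → ℝ) (a0 : ℝ) : Prop :=
  ∀ e : Space m, ‖e‖ = 1 → VSmooth T (graphChart e) ((graphChart e).comp0 A) fun _ => a0

namespace ConeSmooth

variable {A : Space m → ℝ} {a0 : ℝ} (hA : ConeSmooth T A a0)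
include hA

lemma eventually_eq {e y : Space m} (he : ‖e‖ = 1) (hy : y ∈ cone m T) (h : 0 < inner ℝ e y) :
    A =ᶠ[𝓝 y] (fun p => (graphChart e).comp0 A p.1 p.2) ∘ polar e := by
  have h2 : Continuous fun y : Space m => inner ℝ e y := by fun_prop
  filter_upwards [isOpen_cone.mem_nhds hy, h2.continuousAt.eventually (lt_mem_nhds h)] with z hz hz'
  rw [Function.comp_apply, SphereChart.comp0, (polar_spec he hz hz').2]

lemma contDiffOn : ContDiffOn ℝ ∞ A (cone m T) := fun y hy => by
  have he := norm_direction hy.1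
  have h0 := inner_direction_pos hy.1
  exact ((((hA _ he).contDiffAt (polar_spec he hy h0).1).comp y
    (contDiffAt_polar hy.1)).congr_of_eventuallyEq (hA.eventually_eq he hy h0)).contDiffWithinAt

end ConeSmooth

/-- Limits at the vertex may be computed in polar coordinates of the graph charts, locally
uniformly in the direction, by compactness of the sphere. -/
lemma tendsto_vertex (hT : 0 < T) {A : Space m → ℝ} {a0 : ℝ} {B : Space m → ConePt m → ℝ}
    (hB : ∀ e, ‖e‖ = 1 → Tendsto (B e) (𝓝[>] 0 ×ˢ 𝓝 0) (𝓝 a0))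
    (hAB : ∀ e, ‖e‖ = 1 → ∀ y ∈ cone m T, 0 < inner ℝ e y → A y = B e (polar e y)) :
    Tendsto A (𝓝[≠] 0) (𝓝 a0) := by
  refine (Filter.tendsto_iff_ultrafilter _ _ _).2 fun u hu => ?_
  have hcone : ∀ᶠ y in (u : Filter (Space m)), y ∈ cone m T := hu (eventually_mem_cone hT)
  obtain ⟨e, he, hue⟩ := isCompact_iff_ultrafilter_le_nhds.1 (isCompact_sphere (0 : Space m) 1)
    (u.map fun y => ‖y‖⁻¹ • y) (Filter.le_principal_iff.2 (hcone.mono fun y hy => by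
      simpa using norm_direction hy.1))
  have he1 : ‖e‖ = 1 := by simpa using he
  have hdir : Tendsto (fun y : Space m => ‖y‖⁻¹ • y) u (𝓝 e) := hue
  have hpos : ∀ᶠ y in (u : Filter (Space m)), 0 < inner ℝ e y := by
    have h1 : Tendsto (fun y : Space m => inner ℝ e (‖y‖⁻¹ • y)) u (𝓝 (inner ℝ e e)) :=
      tendsto_const_nhds.inner hdir
    rw [real_inner_self_eq_norm_sq, he1] at h1
    filter_upwards [h1.eventually (lt_mem_nhds (show (0 : ℝ) < 1 ^ 2 by norm_num)), hcone] with y hy hc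
    rw [inner_smul_right] at hy
    exact pos_of_mul_pos_right hy (inv_nonneg.2 (norm_nonneg y))
  have hpolar : Tendsto (polar e) u (𝓝[>] 0 ×ˢ 𝓝 0) := by
    refine Filter.Tendsto.prodMk (tendsto_nhdsWithin_iff.2 ⟨?_, hcone.mono fun y hy =>
      norm_pos_iff.2 hy.1⟩) ?_
    · have := (continuous_norm (E := Space m)).tendsto 0
      rw [norm_zero] at this
      exact (this.mono_left nhdsWithin_le_nhds).mono_left hu
    · have := ((proj e).continuous.tendsto e).comp hdir
      rwa [proj_self he1] at this
  refine ((hB e he1).comp hpolar).congr' ?_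
  filter_upwards [hcone, hpos] with y h1 h2 using (hAB e he1 y h1 h2).symm

namespace ConeSmooth

variable {A : Space m → ℝ} {a0 : ℝ} (hA : ConeSmooth T A a0) (hT : 0 < T)
include hA hT

lemma tendsto : Tendsto A (𝓝[≠] 0) (𝓝 a0) :=
  tendsto_vertex hT (fun e he => (hA e he).tendsto hT zero_mem_graphDom) fun _ he _ hy h =>
    (hA.eventually_eq he hy h).self_of_nhds

/-- The radial derivative `r ∂₁ A` tends to zero at the vertex. -/
lemma tendsto_radial : Tendsto (fun y => fderiv ℝ A y y) (𝓝[≠] 0) (𝓝 0) := by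
  refine tendsto_vertex hT (B := fun e p => p.1 * deriv (fun s => (graphChart e).comp0 A s p.2) p.1)
    (fun e he => ?_) fun e he y hy h => ?_
  · obtain ⟨g0, hg⟩ := (hA e he).deriv
    have := (VSmooth.radius.mul hg).tendsto hT (x := 0) zero_mem_graphDom
    simpa using this
  · have hs := polar_spec he hy h
    have hd := ((hA.contDiffOn y hy).differentiableWithinAt (by simp)).differentiableAt
      (isOpen_cone.mem_nhds hy)
    have h1 : HasDerivAt (fun s => (graphChart e).comp0 A s (polar e y).2)
        (fderiv ℝ A y ((graphChart e).θ (polar e y).2)) (polar e y).1 := by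
      refine HasFDerivAt.comp_hasDerivAt (l := A) (f := fun s : ℝ => s • (graphChart e).θ (polar e y).2)
        (polar e y).1 ?_ (by simpa using (hasDerivAt_id (polar e y).1).smul_const _)
      rw [hs.2]
      exact hd.hasFDerivAt
    rw [h1.deriv, ← smul_eq_mul, ← map_smul, hs.2]

end ConeSmooth

end Glue

/-! ### Invariance of the geometric quantities of a family of metrics on the spheres -/

section Operators

variable {ι : Type} [Fintype ι] [DecidableEq ι]

/-- The divergence `∇_B M^B_A`; the first index of the matrix is the upper one. -/
def matDiv (g : 𝕄 ι) (M : 𝕄 ι) (A : ι)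
    (x : ι → ℝ) : ℝ := ∑ B, (pdMat B M x + connMat g B x * M x - M x * connMat g B x) B A

/-- The divergence `g^{ab} (∂_a w_b - Γ^c_{ab} w_c)` of a covector field. -/
def covDiv (g : 𝕄 ι) (w : ι → (ι → ℝ) → ℝ) (x : ι → ℝ) : ℝ :=
  ∑ a, ∑ b, (g x)⁻¹ a b * (pd a (w b) x - ∑ c, Γ g c a b x * w c x)

variable {g g' : 𝕄 ι} {Φ : (ι → ℝ) → ι → ℝ} {x : ι → ℝ}

lemma IsPullbackNear.matDiv_eq (h : IsPullbackNear g' g Φ x) {M' M : 𝕄 ι}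
    (hM' : MatSmoothNear M' x) (hM : MatSmoothNear M (Φ x))
    (hMM : ∀ᶠ y in 𝓝 x, jac Φ y * M' y = M (Φ y) * jac Φ y) (A : ι) :
    matDiv g' M' A x = ∑ B, jac Φ x B A * matDiv g M B (Φ x) := by
  have hJ := nonsing_inv_mul _ h.isUnit
  set J := jac Φ x with hJd
  set N' := fun B => pdMat B M' x + connMat g' B x * M' x - M' x * connMat g' B x with hN'
  set N := fun B => pdMat B M (Φ x) + connMat g B (Φ x) * M (Φ x) - M (Φ x) * connMat g B (Φ x)
    with hN
  have h1 : ∀ B, N' B = J⁻¹ * ((∑ j, J j B • N j) * J) := fun B => by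
    have e : J * N' B = (∑ j, J j B • N j) * J := h.jac_mul_covDeriv hM' hM hMM B
    rw [← e, ← mul_assoc, hJ, one_mul]
  have h2 : ∀ i j, ∑ B, J j B * J⁻¹ B i = if j = i then 1 else 0 := fun i j => h.sum_jac_mul_inv j i
  calc ∑ B, N' B B A = ∑ B, ∑ i, ∑ j, (J j B * J⁻¹ B i) * (N j * J) i A := by
        refine sum_ext fun B => ?_
        rw [h1, mul_apply]
        refine sum_ext fun i => ?_
        simp only [sum_mul, Matrix.sum_apply, mul_sum, smul_mul_assoc, Matrix.smul_apply,
          smul_eq_mul]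
        exact sum_ext fun j => by ring
    _ = ∑ i, (N i * J) i A := by
        refine sum_swap fun i => ?_
        rw [sum_comm]
        simp only [← sum_mul, h2, ite_mul, one_mul, zero_mul, Finset.sum_ite_eq', mem_univ, if_true]
    _ = ∑ B, J B A * ∑ i, N i i B := by
        simp only [mul_apply, mul_sum]
        rw [sum_comm]
        exact sum_ext₂ fun j i => mul_comm _ _

lemma IsPullbackNear.covDiv_eq (h : IsPullbackNear g' g Φ x) {w' w : ι → (ι → ℝ) → ℝ}
    (hw : ∀ a, SmoothNear (w a) (Φ x))
    (e : ∀ᶠ y in 𝓝 x, ∀ a, w' a y = ∑ i, jac Φ y i a * w i (Φ y)) :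
    covDiv g' w' x = covDiv g w (Φ x) := by
  refine h.sum_inv_mul_tensor (t' := fun a b => pd a (w' b) x - ∑ c, Γ g' c a b x * w' c x)
    (t := fun a b => pd a (w b) (Φ x) - ∑ c, Γ g c a b (Φ x) * w c (Φ x)) fun a b => ?_
  have h1 : pd a (w' b) x = ∑ i, (pd a (fun y => jac Φ y i b) x * w i (Φ x)
      + jac Φ x i b * ∑ j, pd j (w i) (Φ x) * jac Φ x j a) := by
    rw [pd_congr a (e.mono fun y hy => hy b), pd_sum a fun i =>
      (h.smoothNear_jac i b).mul ((hw i).comp h.smooth)]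
    refine sum_ext fun i => ?_
    rw [pd_mul a (h.smoothNear_jac i b) ((hw i).comp h.smooth), pd_comp a (hw i) h.smooth]
    rfl
  have h2 : ∑ c, Γ g' c a b x * w' c x = ∑ i, (∑ j, ∑ k,
      Γ g i j k (Φ x) * jac Φ x j a * jac Φ x k b + pd a (fun y => jac Φ y i b) x) * w i (Φ x) := by
    simp only [← h.sum_jac_mul_christoffel, e.self_of_nhds, mul_sum, sum_mul]
    rw [sum_comm]
    exact sum_ext₂ fun _ _ => by ring
  rw [h1, h2, ← sum_sub_distrib]
  simp only [add_mul, mul_sub, mul_sum, sum_mul]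
  have h3 : ∑ i, ∑ j, jac Φ x i a * jac Φ x j b * pd i (w j) (Φ x)
      = ∑ i, ∑ j, jac Φ x i b * (pd j (w i) (Φ x) * jac Φ x j a) := by
    rw [sum_comm]
    exact sum_ext₂ fun _ _ => by ring
  have h4 : ∑ i, ∑ j, ∑ k, jac Φ x i a * jac Φ x j b * (Γ g k i j (Φ x) * w k (Φ x))
      = ∑ k, ∑ i, ∑ j, Γ g k i j (Φ x) * jac Φ x i a * jac Φ x j b * w k (Φ x) := by
    rw [sum_ext fun i => sum_comm, sum_comm]
    exact sum_ext₂ fun _ _ => sum_ext fun _ => by ring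
  simp only [sum_sub_distrib, h3, h4, sum_add_distrib]
  ring

lemma inv_smul_matrix {k : ℝ} (hk : k ≠ 0) (M : Matrix ι ι ℝ) : (k • M)⁻¹ = k⁻¹ • M⁻¹ := by
  by_cases hu : IsUnit M.det
  · have := invertibleOfNonzero hk
    rw [Matrix.inv_smul _ _ hu, invOf_eq_inv]
  · have hu' : ¬IsUnit (k • M).det := by simpa [Matrix.det_smul, hk] using hu
    rw [Matrix.nonsing_inv_apply_not_isUnit _ hu, Matrix.nonsing_inv_apply_not_isUnit _ hu', smul_zero]

lemma christoffel_smul {k : ℝ} (hk : k ≠ 0) (l a b : ι) :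
    Γ (fun y => k • g y) l a b x = Γ g l a b x := by
  have h1 : ∀ c i j : ι, pd c (fun z => k * g z i j) x = k * pd c (fun z => g z i j) x :=
    fun c i j => by
      rw [pd, show (fun z => k * g z i j) = k • fun z => g z i j from rfl, fderiv_const_smul_field]
      rfl
  simp only [christoffel, inv_smul_matrix hk, Matrix.smul_apply, smul_eq_mul, h1]
  congr 1
  refine sum_ext fun j => ?_
  field_simp

lemma scalarCurv_smul {k : ℝ} (hk : k ≠ 0) :
    scalarCurv (fun y => k • g y) x = k⁻¹ * scalarCurv g x := by
  have h1 : ∀ l a b, Γ (fun y => k • g y) l a b = Γ g l a b := fun l a b =>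
    funext fun _ => christoffel_smul hk l a b
  simp only [scalarCurv, ricci, h1, inv_smul_matrix hk, Matrix.smul_apply, smul_eq_mul, mul_assoc,
    mul_sum]

end Operators

section Invariance

variable {e : Space m}

/-- `χ^B_A`, the upper index being the first one. -/
def chiMat (h : ℝ → 𝕄 (Fin m)) (r : ℝ) (x : Fin m → ℝ) :
    Matrix (Fin m) (Fin m) ℝ := of fun B A => chi h r x A B

lemma chiMat_eq (h : ℝ → 𝕄 (Fin m)) : chiMat h r x
    = (1 / 2 : ℝ) • ((h r x)⁻¹ * (of fun A B => deriv (fun s => h s x A B) r).transpose) := by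
  ext A B; simp [chiMat, chi, mul_apply]

lemma trace_chiMat (h : ℝ → 𝕄 (Fin m)) :
    (chiMat h r x).trace = meanCurv h r x := rfl

lemma shearSq_eq_trace (h : ℝ → 𝕄 (Fin m)) :
    shearSq h r x = (chiMat h r x * chiMat h r x).trace - (chiMat h r x).trace ^ 2 / m := by
  rw [trace_chiMat, eq_sub_iff_add_eq, ← HasTrace.sum_chi_sq]
  simp only [Matrix.trace, Matrix.diag_apply, mul_apply, chiMat, of_apply]
  exact sum_ext₂ fun _ _ => mul_comm _ _

namespace Overlap

variable (h : Overlap c e x) {b : SForm m}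
include h

lemma jac_mul_chiMat (hb : IsMetricNear ((graphChart e).comp2 b r) (transition c e x))
    (hd : ∀ A B, DifferentiableAt ℝ (fun s => (graphChart e).comp2 b s (transition c e x) A B) r) :
    jac (transition c e) x * chiMat (c.comp2 b) r x
      = chiMat ((graphChart e).comp2 b) r (transition c e x) * jac (transition c e) x := by
  set J := jac (transition c e) x
  have h1 : (of fun A B => deriv (fun s => c.comp2 b s x A B) r) = J.transpose
      * (of fun A B => deriv (fun s => (graphChart e).comp2 b s (transition c e x) A B) r) * J := by
    ext A B
    have h2 : (fun s => c.comp2 b s x A B) = fun s => ∑ j, (∑ i, J i A *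
        (graphChart e).comp2 b s (transition c e x) i j) * J j B := by
      funext s; rw [h.comp2_eq]; rfl
    rw [of_apply, h2]
    refine HasDerivAt.deriv (HasDerivAt.fun_sum fun j _ => HasDerivAt.mul_const
      (HasDerivAt.fun_sum fun i _ => HasDerivAt.const_mul _ (hd i j).hasDerivAt) _)
  have h3 := mul_nonsing_inv J h.isUnit_jac
  have h4 : J⁻¹.transpose * J.transpose = 1 := by rw [← Matrix.transpose_mul, h3, Matrix.transpose_one]
  rw [chiMat_eq, chiMat_eq, h1, (h.isPullbackNear hb).inv_eq]
  simp only [Matrix.transpose_mul, Matrix.transpose_transpose, mul_smul_comm, smul_mul_assoc]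
  congr 1
  set K := ((graphChart e).comp2 b r (transition c e x))⁻¹
  set P := (of fun A B =>
    deriv (fun s => (graphChart e).comp2 b s (transition c e x) A B) r).transpose
  calc J * (J⁻¹ * K * J⁻¹.transpose * (J.transpose * (P * J)))
      = J * J⁻¹ * K * (J⁻¹.transpose * J.transpose) * (P * J) := by noncomm_ring
    _ = K * P * J := by rw [h3, h4, one_mul, mul_one, mul_assoc]

lemma shearSq_eq (hb : IsMetricNear ((graphChart e).comp2 b r) (transition c e x))
    (hd : ∀ A B, DifferentiableAt ℝ (fun s => (graphChart e).comp2 b s (transition c e x) A B) r) :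
    shearSq (c.comp2 b) r x = shearSq ((graphChart e).comp2 b) r (transition c e x) := by
  have h1 := h.jac_mul_chiMat hb hd
  set J := jac (transition c e) x
  set X := chiMat (c.comp2 b) r x
  set Y := chiMat ((graphChart e).comp2 b) r (transition c e x)
  have h3 : X = J⁻¹ * (Y * J) := by rw [← h1, ← mul_assoc, nonsing_inv_mul J h.isUnit_jac, one_mul]
  have h4 : ∀ Z : Matrix (Fin m) (Fin m) ℝ, (J⁻¹ * (Z * J)).trace = Z.trace := fun Z => by
    rw [Matrix.trace_mul_comm, mul_assoc, mul_nonsing_inv J h.isUnit_jac, mul_one]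
  have h5 : X * X = J⁻¹ * (Y * Y * J) := by
    calc X * X = J⁻¹ * Y * (J * X) := by nth_rw 1 [h3]; noncomm_ring
      _ = _ := by rw [h1]; noncomm_ring
  have h6 : X.trace = Y.trace := by rw [h3, h4]
  rw [shearSq_eq_trace, shearSq_eq_trace]
  change (X * X).trace - X.trace ^ 2 / m = (Y * Y).trace - Y.trace ^ 2 / m
  rw [h5, h4, h6]

end Overlap

end Invariance

/-! ### Metrics on the cone which are smooth up to the vertex -/

section VMetric

/-- The rescaled components `h_{AB} / r²`. -/
def resc (b : SForm m) (c : SphereChart m) (r : ℝ) (x : Fin m → ℝ) :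
    Matrix (Fin m) (Fin m) ℝ := (r ^ 2)⁻¹ • c.comp2 b r x

/-- The field `b` restricts to Riemannian metrics on the spheres, and `b / r²` is smooth up to the
vertex, where it is the round metric. -/
structure IsVMetric (T : ℝ≥0∞) (b : SForm m) : Prop where
  vs : ∀ (c : SphereChart m) A B, VSmooth T c (fun r x => resc b c r x A B) fun x => c.round x A B
  pos : ∀ (c : SphereChart m) r x, (r, x) ∈ c.coneDom T → (c.comp2 b r x).PosDef

lemma comp2_eq_smul_resc (b : SForm m) (hr : 0 < r) :
    c.comp2 b r x = r ^ 2 • resc b c r x := by rw [resc, smul_inv_smul₀ (by positivity)]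

lemma inv_comp2_eq (b : SForm m) (hr : 0 < r) (A B : Fin m) :
    (c.comp2 b r x)⁻¹ A B = (r ^ 2)⁻¹ * (resc b c r x)⁻¹ A B := by
  rw [comp2_eq_smul_resc b hr, inv_smul_matrix (by positivity)]; rfl

lemma christoffel_comp2_eq (b : SForm m) (hr : 0 < r) (i j k : Fin m) :
    Γ (c.comp2 b r) i j k x = Γ (resc b c r) i j k x := by
  rw [show c.comp2 b r = fun y => r ^ 2 • resc b c r y from
    funext fun y => comp2_eq_smul_resc b hr, christoffel_smul (by positivity)]

lemma scalarCurv_comp2_eq (b : SForm m) (hr : 0 < r) :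
    r ^ 2 * scalarCurv (c.comp2 b r) x = scalarCurv (resc b c r) x := by
  rw [show c.comp2 b r = fun y => r ^ 2 • resc b c r y from
    funext fun y => comp2_eq_smul_resc b hr, scalarCurv_smul (by positivity),
    mul_inv_cancel_left₀ (by positivity)]

/-- `χ` of conformal families of metrics, the factor being independent of `x^A`. -/
lemma chi_smul {k : ℝ → 𝕄 (Fin m)} {a : ℝ → ℝ} {a' : ℝ}
    (ha : HasDerivAt a a' r) (h0 : a r ≠ 0) (hk : ∀ A B, DifferentiableAt ℝ (fun s => k s x A B) r)
    (hs : (k r x).PosDef) (A B : Fin m) :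
    chi (fun s x => a s • k s x) r x A B = chi k r x A B + if A = B then a' / (2 * a r) else 0 := by
  have h1 : ∀ C, deriv (fun s => (a s • k s x) A C) r
      = a' * k r x A C + a r * deriv (fun s => k s x A C) r := fun C =>
    (ha.fun_mul (hk A C).hasDerivAt).deriv
  have h2 : ∑ C, (k r x)⁻¹ B C * k r x A C = if A = B then 1 else 0 := by
    have h3 := congrFun (congrFun (nonsing_inv_mul (k r x) (isUnit_iff_ne_zero.2 hs.det_pos.ne')) B) A
    rw [mul_apply, one_apply] at h3
    simp only [eq_comm (a := A), ← h3]
    exact sum_ext fun C => by rw [show k r x A C = k r x C A from (hs.1.apply A C).symm]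
  have h4 : ∀ C, ((a r • k r x)⁻¹ B C) * (a' * k r x A C + a r * deriv (fun s => k s x A C) r)
      = a' / a r * ((k r x)⁻¹ B C * k r x A C) + (k r x)⁻¹ B C * deriv (fun s => k s x A C) r := by
    intro C
    rw [inv_smul_matrix h0, Matrix.smul_apply, smul_eq_mul]
    field_simp
  simp only [chi, h1, h4, sum_add_distrib, ← mul_sum, h2]
  split_ifs
  · field_simp; ring
  · simp

lemma meanCurv_smul {k : ℝ → 𝕄 (Fin m)} {a : ℝ → ℝ} {a' : ℝ}
    (ha : HasDerivAt a a' r) (h0 : a r ≠ 0) (hk : ∀ A B, DifferentiableAt ℝ (fun s => k s x A B) r)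
    (hs : (k r x).PosDef) :
    meanCurv (fun s x => a s • k s x) r x = meanCurv k r x + m * (a' / (2 * a r)) := by
  simp [meanCurv, chi_smul ha h0 hk hs, sum_add_distrib]

lemma shearSq_smul {k : ℝ → 𝕄 (Fin m)} {a : ℝ → ℝ} {a' : ℝ}
    (ha : HasDerivAt a a' r) (h0 : a r ≠ 0) (hk : ∀ A B, DifferentiableAt ℝ (fun s => k s x A B) r)
    (hs : (k r x).PosDef) : shearSq (fun s x => a s • k s x) r x = shearSq k r x := by
  have h1 : ∀ A B, shear (fun s x => a s • k s x) r x A B = shear k r x A B := fun A B => by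
    have hm : (m : ℝ) ≠ 0 := Nat.cast_ne_zero.2 (Fin.pos A).ne'
    rw [shear, shear, chi_smul ha h0 hk hs, meanCurv_smul ha h0 hk hs, add_div,
      mul_div_cancel_left₀ _ hm]
    split_ifs <;> ring
  simp only [shearSq, h1]

namespace IsVMetric

variable {b : SForm m} (hb : IsVMetric T b)
include hb

lemma mono {T' : ℝ≥0∞} (hT : T' ≤ T) : IsVMetric T' b where
  vs := fun c A B => (hb.vs c A B).mono hT
  pos := fun c r x hq => hb.pos c r x ⟨hq.1, hq.2.1, hq.2.2.trans_le hT⟩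

lemma resc_pos (hq : onCone) : (resc b c r x).PosDef :=
  (hb.pos c r x hq).smul (inv_pos.2 (pow_pos hq.2.1 2))

lemma vs_comp2 (A B : Fin m) : VSmooth T c (fun r x => c.comp2 b r x A B) fun _ => 0 :=
  ((VSmooth.radius.mul VSmooth.radius).mul (hb.vs c A B)).congr (fun r x hq => by
    rw [comp2_eq_smul_resc b hq.2.1, pow_two]; rfl) fun _ _ => by ring

lemma metricNear (hq : onCone) : IsMetricNear (c.comp2 b r) x where
  smooth := fun A B => (hb.vs_comp2 A B).smoothNear hq
  symm := (eventually_snd (eventually_coneDom hq)).mono fun _ hy A B =>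
    ((hb.pos c r _ hy).1.apply A B).symm
  isUnit := isUnit_iff_ne_zero.2 (hb.pos c r x hq).det_pos.ne'

lemma differentiableAt (hq : onCone) (A B : Fin m) :
    DifferentiableAt ℝ (fun s => c.comp2 b s x A B) r :=
  ((hb.vs_comp2 A B).hasDerivAt hq).differentiableAt

lemma vs_inv (A B : Fin m) :
    VSmooth T c (fun r x => (resc b c r x)⁻¹ A B) fun x => (c.round x)⁻¹ A B :=
  VSmooth.matInv (hb.vs c) (fun _ _ hq => (hb.resc_pos hq).det_pos.ne')
    (fun _ hx => (posDef_round hx).det_pos.ne') A B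

lemma vs_christoffel' (i j k : Fin m) :
    VSmooth T c (fun r x => Γ (resc b c r) i j k x) (Γ c.round i j k) :=
  (VSmooth.const _).mul (VSmooth.sum fun l => (hb.vs_inv i l).mul
    ((((hb.vs c l k).pd j).add ((hb.vs c l j).pd k)).sub ((hb.vs c j k).pd l)))

lemma vs_christoffel (i j k : Fin m) :
    VSmooth T c (fun r x => Γ (c.comp2 b r) i j k x) (Γ c.round i j k) :=
  (hb.vs_christoffel' i j k).congr (fun _ _ hq => christoffel_comp2_eq b hq.2.1 i j k) fun _ _ => rfl

lemma vs_scalarCurv :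
    VSmooth T c (fun r x => r ^ 2 * scalarCurv (c.comp2 b r) x) (scalarCurv c.round) := by
  refine VSmooth.congr (f := fun r x => scalarCurv (resc b c r) x) ?_
    (fun _ _ hq => scalarCurv_comp2_eq b hq.2.1) fun _ _ => rfl
  have h := hb.vs_christoffel' (c := c)
  exact VSmooth.sum fun i => VSmooth.sum fun j => (hb.vs_inv i j).mul
    ((VSmooth.sum fun l => ((h l i j).pd l).sub ((h l i l).pd j)).add
      (VSmooth.sum fun l => VSmooth.sum fun k =>
        ((h l l k).mul (h k i j)).sub ((h l j k).mul (h k i l))))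

omit hb in
lemma eventually_comp2 (hq : onCone) :
    ∀ᶠ q in 𝓝 (r, x), c.comp2 b q.1 q.2 = (fun s y => s ^ 2 • resc b c s y) q.1 q.2 :=
  (eventually_coneDom hq).mono fun _ hq' => comp2_eq_smul_resc b hq'.2.1

lemma chi_eq (hq : onCone) (A B : Fin m) :
    chi (c.comp2 b) r x A B = chi (resc b c) r x A B + if A = B then 1 / r else 0 := by
  have hr := hq.2.1
  rw [chi_congr (h' := fun s y => s ^ 2 • resc b c s y) (eventually_comp2 hq),
    chi_smul (a := fun s => s ^ 2) (by simpa using hasDerivAt_pow 2 r) (pow_pos hr 2).ne' (fun A B =>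
    ((hb.vs c A B).hasDerivAt hq).differentiableAt) (hb.resc_pos hq)]
  congr 2
  have : r ≠ 0 := hr.ne'
  field_simp

lemma meanCurv_eq (hq : onCone) : meanCurv (c.comp2 b) r x = meanCurv (resc b c) r x + m / r := by
  simp [meanCurv, hb.chi_eq hq, sum_add_distrib, div_eq_mul_inv]

lemma shearSq_eq (hq : onCone) : shearSq (c.comp2 b) r x = shearSq (resc b c) r x := by
  rw [shearSq_congr (h' := fun s y => s ^ 2 • resc b c s y) (eventually_comp2 hq),
    shearSq_smul (a := fun s => s ^ 2) (hasDerivAt_pow 2 r) (pow_pos hq.2.1 2).ne' (fun A B =>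
    ((hb.vs c A B).hasDerivAt hq).differentiableAt) (hb.resc_pos hq)]

lemma vs_chi (A B : Fin m) : ∃ f0, VSmooth T c (fun r x => chi (resc b c) r x A B) f0 := by
  choose g0 hg using fun C => (hb.vs c A C).deriv
  exact ⟨_, (VSmooth.const _).mul (VSmooth.sum fun C => (hb.vs_inv B C).mul (hg C))⟩

lemma vs_shearSq : ∃ f0, VSmooth T c (shearSq (c.comp2 b)) f0 := by
  choose k0 hk using fun A B => hb.vs_chi (c := c) A B
  have h1 : VSmooth T c (fun r x => shearSq (resc b c) r x) _ :=
    ((VSmooth.sum fun A => VSmooth.sum fun B =>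
      (hk A B).mul (hk B A)).sub ((VSmooth.const (1 / (m : ℝ))).mul
        ((VSmooth.sum fun A => hk A A).mul (VSmooth.sum fun A => hk A A)))).congr (fun r x hq => by
      rw [← sub_eq_iff_eq_add.2 (HasTrace.sum_chi_sq (k := resc b c)), meanCurv]; ring) fun _ _ => rfl
  exact ⟨_, h1.congr (fun r x hq => hb.shearSq_eq hq) fun _ _ => rfl⟩

lemma smoothNear_chi (hq : onCone) (A B : Fin m) :
    SmoothNear (fun z => chi (c.comp2 b) r z A B) x := by
  obtain ⟨f0, hf⟩ := hb.vs_chi (c := c) A B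
  exact ((hf.smoothNear hq).add (.const _)).congr
    ((eventually_snd (eventually_coneDom hq)).mono fun y hy => hb.chi_eq hy A B)

/-- A conformal change which is trivial at the vertex. -/
lemma conformal {φ : Space m → ℝ} (hφ : ∀ c : SphereChart m, VSmooth T c (c.comp0 φ) fun _ => 1)
    (hp : ∀ y ∈ cone m T, 0 < φ y) : IsVMetric T fun y => φ y ^ 2 • b y where
  vs := fun c A B => (((hφ c).mul (hφ c)).mul (hb.vs c A B)).congr (fun r x _ => by
    simp [resc, SphereChart.comp2, SphereChart.comp0]; ring) fun _ _ => by ring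
  pos := fun c r x hq => by
    have h1 : c.comp2 (fun y => φ y ^ 2 • b y) r x = φ (r • c.θ x) ^ 2 • c.comp2 b r x := rfl
    rw [h1]
    exact (hb.pos c r x hq).smul (pow_pos (hp _ (mem_cone hq)) 2)

end IsVMetric

lemma IsFreeData.isVMetric {γ : SForm m} (hγ : IsFreeData T γ) :
    IsVMetric T γ where
  vs := fun c A B => by
    obtain ⟨F, hF, hFr, hF0⟩ := hγ.vertex
    have hf : ∀ A, ContDiffOn ℝ ∞ (fun p : ConePt m => c.frame p.2 A)
        {p | 0 ≤ p.1 ∧ p.2 ∈ c.dom ∧ ofReal p.1 < T} := fun A =>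
      ((c.smooth.fderiv_of_isOpen c.isOpen_dom (by simp)).clm_apply contDiffOn_const).comp
        contDiff_snd.contDiffOn fun _ hp => hp.2.1
    have h1 : ContDiffOn ℝ ∞ (fun p : ConePt m => F (p.1, c.θ p.2) (c.frame p.2 A) (c.frame p.2 B))
        {p | 0 ≤ p.1 ∧ p.2 ∈ c.dom ∧ ofReal p.1 < T} := by
      refine ((hF.comp (contDiffOn_fst.prodMk (c.smooth.comp contDiff_snd.contDiffOn
        fun _ hp => hp.2.1)) fun p hp => ?_).clm_apply (hf A)).clm_apply (hf B)
      have hn := c.norm_eq _ hp.2.1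
      exact ⟨hp.1, fun h0 => by simp [show c.θ p.2 = 0 from h0] at hn, by
        change ofReal (p.1 * ‖c.θ p.2‖) < T
        rw [hn, mul_one]; exact hp.2.2⟩
    refine (VSmooth.of_contDiffOn h1).congr (fun r x hq => ?_) fun x hx => ?_
    · rw [hFr r _ hq.2.1 (mem_cone hq)]
      have hr := hq.2.1.ne'
      simp only at hr
      simp [resc, SphereChart.comp2]
      field_simp
    · have hn := c.norm_eq _ hx
      exact (hF0 _ (fun h0 => by simp [h0] at hn) _ _ (inner_θ_frame hx A)
        (inner_θ_frame hx B)).symm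
  pos := fun c r x hq => posDef_of_pos hq.1 hq.2.1.ne'
    (hγ.symm _ (mem_cone hq)) fun v hv h0 =>
      hγ.pos _ (mem_cone hq) v hv (by rw [real_inner_smul_left, h0, mul_zero])

end VMetric

/-! ### The scalar curvature of the round sphere -/

section Round

lemma ricci_eta (hx : x ∈ c.dom) (hr : r ≠ 0) (a b : Idx m) : ricci c.eta a b 𝔭 = 0 := by
  have hfr : Module.finrank ℝ (Idx m → ℝ) = Module.finrank ℝ (Spacetime m) := by
    simp [Spacetime]; ring
  obtain ⟨L⟩ : Nonempty ((Idx m → ℝ) ≃L[ℝ] Spacetime m) := ⟨ContinuousLinearEquiv.ofFinrankEq hfr⟩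
  have hX : (fun A => onC r x (inr A)) ∈ c.dom := hx
  have hs : ∀ X Y, minkowski m X Y = minkowski m Y X := fun X Y => by
    rw [minkowski_apply, minkowski_apply, real_inner_comm, mul_comm]
  have pb : IsPullbackNear c.eta (linMetric L fun _ => minkowski m)
      (fun X => L.symm (c.adapted X)) 𝔭 :=
    isPullbackNear_adapted (L := L) (g := fun _ => minkowski m) hX (.of_forall fun _ => contDiffAt_const)
      (.of_forall fun _ => hs)
      (isNullNear_eta hx hr).metric.isUnit
  have h1 : ∀ i j k, Γ (linMetric L fun _ => minkowski m) i j k = fun _ => 0 :=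
    fun i j k => funext fun z => by simp [christoffel, linMetric, pd]
  rw [pb.ricci_eq]
  simp only [ricci, h1, pd_const, mul_zero, sub_zero, add_zero, sum_const_zero]

/-- The trace of the Minkowski metric on the cone. -/
def minkowskiCone (m : ℕ) : ConeMetric m where
  gt y := euclid m - (‖y‖ ^ 2)⁻¹ •
    (ContinuousLinearMap.mul ℝ ℝ).bilinearComp (innerSL ℝ y) (innerSL ℝ y)
  nu0 _ := 1
  nu _ := 0
  g00 _ := -1

lemma minkowskiCone_gt (y v w : Space m) : (minkowskiCone m).gt y v w
    = inner ℝ v w - (‖y‖ ^ 2)⁻¹ * (inner ℝ y v * inner ℝ y w) := rfl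

lemma hasTrace_minkowski :
    HasTrace ⊤ Set.univ (fun _ => minkowski m) (minkowskiCone m) where
  isMetric :=
    { symm := fun y _ v w => by rw [minkowskiCone_gt, minkowskiCone_gt, real_inner_comm]; ring
      radial := fun y hy => by
        ext v
        have h0 := norm_ne_zero_iff.2 hy.1
        rw [minkowskiCone_gt, real_inner_self_eq_norm_sq, zero_apply]
        field_simp
        simp
      pos := fun y _ v hv h0 => by
        rw [minkowskiCone_gt, h0, zero_mul, mul_zero, sub_zero]
        exact real_inner_self_pos.2 hv
      nu0_pos := fun _ _ => one_pos
      nu_radial := fun _ _ => rfl }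
  isOpen := isOpen_univ
  subset := fun _ _ => trivial
  smooth := contDiffOn_const
  symm := fun _ _ X Y => by rw [minkowski_apply, minkowski_apply, real_inner_comm, mul_comm]
  trace := fun y hy X Y => by
    have h0 := norm_ne_zero_iff.2 hy.1
    rw [minkowski_apply, ConeMetric.form, minkowskiCone_gt]
    simp only [minkowskiCone, ConeMetric.dx0, ConeMetric.dx1, zero_apply]
    field_simp
    ring

lemma comp2_minkowskiCone (hx : x ∈ c.dom) :
    c.comp2 (minkowskiCone m).gt r x = r ^ 2 • c.round x := by
  ext A B
  simp only [SphereChart.comp2, of_apply, minkowskiCone_gt, inner_smul_left, inner_smul_right,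
    inner_θ_frame hx, Matrix.smul_apply, smul_eq_mul, SphereChart.round]
  simp
  ring

lemma isVMetric_minkowski : IsVMetric ⊤ (minkowskiCone m).gt where
  vs := fun c A B => (VSmooth.const_x (g := fun x => c.round x A B) fun x hx =>
    (smoothNear_round hx A B).contDiffAt.contDiffWithinAt).congr (fun r x hq => by
      rw [resc, comp2_minkowskiCone hq.1, inv_smul_smul₀ (pow_pos hq.2.1 2).ne'])
      fun _ _ => rfl
  pos := fun c r x hq => by
    rw [comp2_minkowskiCone hq.1]
    exact (posDef_round hq.1).smul (pow_pos hq.2.1 2)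

/-- The scalar curvature of the unit sphere `S^m` is `m (m - 1)`: this is the constraint `𝒞₀ = 0` for
the trace of the Minkowski metric. -/
lemma scalarCurv_round (hx : x ∈ c.dom) : scalarCurv c.round x = m * (m - 1) := by
  set D := minkowskiCone m
  have hcone : ∀ r, 0 < r → (r, x) ∈ c.coneDom ⊤ := fun r hr => ⟨hx, hr, by simp⟩
  have hH : ∀ a r x, Hlow (fun _ => minkowski m) c a r x = 0 := fun a r x => by
    have e : c.eta = c.metric fun _ => minkowski m := rfl
    simp only [Hlow, waveGaugeLow, waveGauge, e, sub_self, mul_zero, sum_const_zero]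
  have hS : ∀ a, ∀ x ∈ c.dom, ∀ r : ℝ, 0 < r → S1 (fun _ => minkowski m) c a r x = 0 :=
    fun a x hx r hr => by
      have h1 : ∀ a b, ricci (c.metric fun _ => minkowski m) a b (onC r x) = 0 := ricci_eta hx hr.ne'
      simp only [S1, einstein, scalarCurv, h1, mul_zero, sum_const_zero, sub_zero]
  obtain ⟨d1, dA, d0⟩ := hasTrace_minkowski.decomposition c
  have h1 : c.OnCone ⊤ fun r x => D.C1 c r x = 0 := fun x hx r hr ht => by
    have h := d1 x hx r hr ht
    simp only [hS i1 x hx r hr, L1, hH, mul_zero, add_zero] at h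
    exact h.symm
  have hA : c.OnCone ⊤ fun r x => ∀ A, D.CA c r x A = 0 := fun x hx r hr ht A => by
    have h := dA (fun x _ r _ _ => hH _ r x) x hx r hr ht A
    simp only [hS _ x hx r hr, LA, hH, mul_zero, add_zero, deriv_const] at h
    exact h.symm
  have h0 : D.C0 c 1 x = 0 := by
    have h := d0 (fun x _ r _ _ => hH _ r x) (fun x _ r _ _ A => hH _ r x) h1 hA x hx 1 one_pos
      (by simp)
    simp only [hS _ x hx 1 one_pos, L0, hH, mul_zero, add_zero, deriv_const, neg_zero] at h
    exact h.symm
  have hchi : ∀ r y, (r, y) ∈ c.coneDom ⊤ → ∀ A B, chi (c.comp2 D.gt) r y A B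
      = if A = B then 1 / r else 0 := fun r y hq A B => by
    have hr := hq.2.1
    rw [isVMetric_minkowski.chi_eq hq, chi_congr (h' := fun _ => c.round)
      ((eventually_coneDom hq).mono fun q hq' => by
        rw [resc, comp2_minkowskiCone hq'.1, inv_smul_smul₀ (pow_pos hq'.2.1 2).ne'])]
    simp [chi]
  have htau : ∀ r, 0 < r → D.tau c r x = m / r := fun r hr => by
    simp [ConeMetric.tau, meanCurv, hchi r x (hcone r hr), div_eq_mul_inv]
  have hW : ∀ r, 0 < r → D.W0 c r x = -m / r := fun r hr => by
    have h2 := IsMetricNear.sum_inv_mul (g := c.round) (x := x) ⟨smoothNear_round hx,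
      .of_forall fun y => round_symm y, isUnit_iff_ne_zero.2 (posDef_round hx).det_pos.ne'⟩
    have h3 : ∀ A, ∑ B, (c.round x)⁻¹ A B * c.round x A B = 1 := fun A => by
      simp only [round_symm x A, h2, if_true]
    rw [ConeMetric.W0, comp2_minkowskiCone hx, inv_smul_matrix (by positivity)]
    simp only [Matrix.smul_apply, smul_eq_mul, mul_assoc, ← mul_sum, h3]
    simp
    field_simp
  have hk : ∀ r, 0 < r → D.kappa c r x = 0 := fun r hr => by
    have : ∀ s, c.comp0 D.nu0 s x = 1 := fun s => rfl
    simp [ConeMetric.kappa, ConeMetric.W1, this, hW r hr, htau r hr]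
    ring
  have hxi : ∀ y ∈ c.dom, ∀ A, D.xi c 1 y A = 0 := fun y hy A => by
    have h2 : c.comp2 D.gt 1 =ᶠ[𝓝 y] c.round := by
      filter_upwards [c.isOpen_dom.mem_nhds hy] with z hz
      rw [comp2_minkowskiCone hz]; simp
    have h3 : ∀ s B, c.comp1 D.nu s y B = 0 := fun _ _ => rfl
    simp [ConeMetric.xi, christoffel_congr h2, h3]
  have hz : ∀ r, 0 < r → D.zeta c r x = -m / r := fun r hr => by
    have h2 : ∀ s, D.g11 c s x = 1 := fun s => by
      have h3 : ∀ s B, c.comp1 D.nu s x B = 0 := fun _ _ => rfl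
      have h4 : ∀ s, c.comp0 D.nu0 s x = 1 := fun s => rfl
      have h5 : ∀ s, c.comp0 D.g00 s x = -1 := fun s => rfl
      simp [ConeMetric.g11, h3, h4, h5]
    simp [ConeMetric.zeta, h2, hk r hr, htau r hr, hW r hr]
    ring
  have hup : ∀ y ∈ c.dom, ∀ A, D.xiUp c 1 y A = 0 := fun y hy A => by
    simp [ConeMetric.xiUp, hxi y hy]
  have hdz : deriv (fun s => D.zeta c s x) 1 = m := by
    have h2 : (fun s => D.zeta c s x) =ᶠ[𝓝 1] fun s => -(m : ℝ) / s :=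
      (eventually_gt_nhds one_pos).mono fun s hs => hz s hs
    rw [h2.deriv_eq]
    simp [div_eq_mul_inv]
  have hpd : ∀ A, pd A (fun z => D.xiUp c 1 z A) x = 0 := fun A => by
    rw [pd_congr A (g := fun _ => 0) (by
      filter_upwards [c.isOpen_dom.mem_nhds hx] with y hy using hup y hy A), pd_const]
  have hR : scalarCurv (c.comp2 D.gt 1) x = scalarCurv c.round x := scalarCurv_congr (by
    filter_upwards [c.isOpen_dom.mem_nhds hx] with z hz
    rw [comp2_minkowskiCone hz]; simp)
  have h4 : c.comp0 D.nu0 1 x = 1 := rfl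
  rw [ConeMetric.C0, hdz, htau 1 one_pos, hk 1 one_pos, hz 1 one_pos, hR, h4] at h0
  simp only [hxi x hx, hup x hx, hpd, mul_zero, sum_const_zero] at h0
  linarith

end Round

/-! ### Tensor fields on the cone given in charts -/

section Tensors

variable {e : Space m}

lemma euler_congr {k : ℕ} {f g : ConeFn m} {y : Fin m → ℝ} (hr : 0 < r)
    (h : ∀ s ∈ Ioc 0 r, f s x = g s y) : euler k f r x = euler k g r y := by
  refine intervalIntegral.integral_congr_ae (.of_forall fun s hs => ?_)
  rw [Set.uIoc_of_le zero_le_one] at hs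
  rw [h _ ⟨mul_pos (pow_pos hs.1 2) hr, mul_le_of_le_one_left hr.le (pow_le_one₀ hs.1.le hs.2)⟩]

lemma euler_eq_integral {k : ℕ} {f : ConeFn m} (f0 : (Fin m → ℝ) → ℝ) (hr : 0 < r) :
    euler k f r x = ∫ s in (0 : ℝ)..1, 2 * s ^ k * polExt f f0 (s * √r, x) := by
  rw [← polExt_sqrt hr x (f := euler k f) (f0 := fun x => 2 / (k + 1) * f0 x), polExt_euler]; rfl

lemma VSmooth.intervalIntegrable {k : ℕ} {f : ConeFn m} {f0 : (Fin m → ℝ) → ℝ} (hf : VSmooth T c f f0)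
    (hq : onCone) :
    IntervalIntegrable (fun s => 2 * s ^ k * polExt f f0 (s * √r, x)) MeasureTheory.volume 0 1 := by
  refine ContinuousOn.intervalIntegrable ?_
  rw [Set.uIcc_of_le zero_le_one]
  have h2 : ContinuousOn (fun s : ℝ => polExt f f0 (s * √r, x)) (Icc 0 1) :=
    ContinuousOn.comp (ContDiffOn.continuousOn hf) (by fun_prop)
      fun s hs => polDom_star _ (sqrt_mem hq) s hs
  exact ((continuousOn_const).mul (continuousOn_pow k)).mul h2

lemma euler_sum {k : ℕ} {f : Fin m → ConeFn m} {f0 : Fin m → (Fin m → ℝ) → ℝ}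
    (hf : ∀ A, VSmooth T c (f A) (f0 A)) (a : Fin m → ℝ) (hq : (r, x) ∈ c.coneDom T) :
    euler k (fun r x => ∑ A, a A * f A r x) r x = ∑ A, a A * euler k (f A) r x := by
  have hr : 0 < r := hq.2.1
  rw [euler_eq_integral (fun x => ∑ A, a A * f0 A x) hr]
  simp only [fun A => euler_eq_integral (f := f A) (k := k) (x := x) (f0 A) hr,
    ← intervalIntegral.integral_const_mul]
  rw [← intervalIntegral.integral_finsetSum fun A _ => ((hf A).intervalIntegrable hq).const_mul _]
  refine intervalIntegral.integral_congr fun s _ => ?_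
  by_cases hz : s * √r = 0
  · simp only [polExt, hz, if_true, mul_sum]
    exact sum_ext fun _ => by ring
  · simp only [polExt, hz, if_false, mul_sum]
    exact sum_ext fun _ => by ring

lemma VSmooth.euler_pos {k : ℕ} {f : ConeFn m} {f0 : (Fin m → ℝ) → ℝ} (hf : VSmooth T c f f0)
    (hq : (r, x) ∈ c.coneDom T) (hp : ∀ r x, (r, x) ∈ c.coneDom T → 0 < f r x) :
    0 < NullCone.euler k f r x := by
  have hr := hq.2.1
  simp only at hr
  rw [euler_eq_integral f0 hr]
  refine intervalIntegral.intervalIntegral_pos_of_pos_on (hf.intervalIntegrable hq) (fun s hs => ?_)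
    one_pos
  have h1 : 0 < s * √r := mul_pos hs.1 (Real.sqrt_pos.2 hr)
  rw [polExt, if_neg h1.ne']
  exact mul_pos (mul_pos two_pos (pow_pos hs.1 k)) (hp _ _ (sq_mem
    (polDom_star _ (sqrt_mem hq) s ⟨hs.1.le, hs.2.le⟩) h1.ne'))

/-- Chart representations `w_A` of a covector field on the spheres. -/
def IsCov (T : ℝ≥0∞) (w : SphereChart m → Fin m → ConeFn m) : Prop :=
  ∀ c e x r, Overlap c e x → (r, x) ∈ c.coneDom T → ∀ A, w c A r x
    = ∑ B, jac (transition c e) x B A * w (graphChart e) B r (transition c e x)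

/-- Chart representations `v^A` of a vector field on the spheres. -/
def IsVec (T : ℝ≥0∞) (v : SphereChart m → Fin m → ConeFn m) : Prop :=
  ∀ c e x r, Overlap c e x → (r, x) ∈ c.coneDom T → ∀ B,
    ∑ A, jac (transition c e) x B A * v c A r x = v (graphChart e) B r (transition c e x)

/-- Chart representations of a field of bilinear forms on the spheres. -/
def IsForm (T : ℝ≥0∞) (h : SphereChart m → ℝ → 𝕄 (Fin m)) : Prop :=
  ∀ c e x r, Overlap c e x → (r, x) ∈ c.coneDom T → h c r x = (jac (transition c e) x).transpose
    * h (graphChart e) r (transition c e x) * jac (transition c e) x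

lemma Overlap.mem_coneDom (h : Overlap c e x) (hq : onCone) :
    (r, transition c e x) ∈ (graphChart e).coneDom T := ⟨h.mem, hq.2⟩

variable {v w : SphereChart m → Fin m → ConeFn m}
  {f0 : SphereChart m → Fin m → (Fin m → ℝ) → ℝ} {a : SphereChart m → ConeFn m}

lemma isInvariant_comp0 {G : Type} (f : Space m → G) :
    IsInvariant T fun (c : SphereChart m) r x => f (r • c.θ x) := fun _ _ _ _ h _ => by
  simp only [h.θ_eq]

lemma IsInvariant.euler (ha : IsInvariant T a) (k : ℕ) :
    IsInvariant T fun c => NullCone.euler k (a c) := fun c e x _ h hq =>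
  euler_congr hq.2.1 fun s hs => ha c e x s h (coneDom_of_le hq hs)

lemma IsCov.euler (hw : IsCov T w) (hs : ∀ c A, VSmooth T c (w c A) (f0 c A)) (k : ℕ) :
    IsCov T fun c A => NullCone.euler k (w c A) := fun c e x r h hq A => by
  rw [← euler_sum (hs (graphChart e)) _ (h.mem_coneDom hq)]
  exact euler_congr hq.2.1 fun s hs => hw c e x s h (coneDom_of_le hq hs) A

lemma IsVec.euler (hv : IsVec T v) (hs : ∀ c A, VSmooth T c (v c A) (f0 c A)) (k : ℕ) :
    IsVec T fun c A => NullCone.euler k (v c A) := fun c e x r h hq B => by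
  rw [← euler_sum (hs c) _ hq]
  exact euler_congr hq.2.1 fun s hs => hv c e x s h (coneDom_of_le hq hs) B

lemma IsCov.smul (ha : IsInvariant T a) (hw : IsCov T w) :
    IsCov T fun c A r x => a c r x * w c A r x := fun c e x r h hq A => by
  beta_reduce
  rw [ha c e x r h hq, hw c e x r h hq, mul_sum]
  exact sum_ext fun _ => by ring

lemma IsVec.smul (ha : IsInvariant T a) (hv : IsVec T v) :
    IsVec T fun c A r x => a c r x * v c A r x := fun c e x r h hq B => by
  beta_reduce
  rw [← ha c e x r h hq, ← hv c e x r h hq, mul_sum]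
  exact sum_ext fun _ => by ring

lemma IsCov.sub {w' : SphereChart m → Fin m → ConeFn m} (hw : IsCov T w) (hw' : IsCov T w') :
    IsCov T fun c A r x => w c A r x - w' c A r x := fun c e x r h hq A => by
  beta_reduce
  rw [hw c e x r h hq, hw' c e x r h hq, ← sum_sub_distrib]
  exact sum_ext fun _ => by ring

lemma IsCov.pair (hw : IsCov T w) (hv : IsVec T v) :
    IsInvariant T fun c r x => ∑ A, w c A r x * v c A r x := fun c e x r h hq => by
  simp only [hw c e x r h hq, ← hv c e x r h hq, sum_mul, mul_sum]
  rw [sum_comm]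
  exact sum_ext₂ fun _ _ => by ring

lemma isForm_comp2 (b : SForm m) : IsForm T fun c => c.comp2 b := fun _ _ _ _ h _ => h.comp2_eq b _

lemma isForm_resc (b : SForm m) : IsForm T (resc b) := fun c e x r h _ => by
  rw [resc, h.comp2_eq b r, resc, mul_smul_comm, smul_mul_assoc]

lemma isForm_round : IsForm T fun (c : SphereChart m) _ x => c.round x :=
  fun _ _ _ _ h _ => h.round_eq

variable {h k : SphereChart m → ℝ → 𝕄 (Fin m)}

lemma IsForm.lower (hh : IsForm T h) (hv : IsVec T v) :
    IsCov T fun c A r x => ∑ B, h c r x A B * v c B r x := fun c e x r ho hq A => by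
  have h1 := hh c e x r ho hq
  set J := jac (transition c e) x
  have h2 : J.mulVec (fun B => v c B r x) = fun B => v (graphChart e) B r (transition c e x) :=
    funext fun B => hv c e x r ho hq B
  have h3 : (h c r x).mulVec (fun B => v c B r x) = J.transpose.mulVec ((h (graphChart e) r
      (transition c e x)).mulVec fun B => v (graphChart e) B r (transition c e x)) := by
    rw [h1, ← h2, mulVec_mulVec, mulVec_mulVec]
  exact congrFun h3 A

lemma IsForm.inv_eq (hh : IsForm T h) (ho : Overlap c e x) (hq : onCone) :
    jac (transition c e) x * (h c r x)⁻¹ * (jac (transition c e) x).transpose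
      = (h (graphChart e) r (transition c e x))⁻¹ := by
  rw [hh c e x r ho hq]
  set J := jac (transition c e) x
  have h3 := mul_nonsing_inv J ho.isUnit_jac
  have h4 : J.transpose⁻¹ * J.transpose = 1 :=
    nonsing_inv_mul _ (by rw [Matrix.det_transpose]; exact ho.isUnit_jac)
  rw [Matrix.mul_inv_rev, Matrix.mul_inv_rev, ← mul_assoc, h3, one_mul, mul_assoc, h4, mul_one]

lemma IsForm.raise (hh : IsForm T h) (hw : IsCov T w) :
    IsVec T fun c A r x => ∑ B, (h c r x)⁻¹ A B * w c B r x := fun c e x r ho hq A => by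
  have h1 := hh.inv_eq ho hq
  set J := jac (transition c e) x
  have h2 : (fun B => w c B r x) = J.transpose.mulVec fun B => w (graphChart e) B r (transition c e x) :=
    funext fun B => hw c e x r ho hq B
  have h3 : J.mulVec ((h c r x)⁻¹.mulVec fun B => w c B r x) = ((h (graphChart e) r
      (transition c e x))⁻¹).mulVec fun B => w (graphChart e) B r (transition c e x) := by
    rw [h2, mulVec_mulVec, mulVec_mulVec, h1]
  exact congrFun h3 A

lemma IsForm.trace (hh : IsForm T h) (hk : IsForm T k) :
    IsInvariant T fun c r x => ∑ A, ∑ B, (h c r x)⁻¹ A B * k c r x A B := fun c e x r ho hq => by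
  have h1 := hh.inv_eq ho hq
  have h2 := hk c e x r ho hq
  have h3 : ∀ M N : Matrix (Fin m) (Fin m) ℝ, ∑ A, ∑ B, M A B * N A B = (M * N.transpose).trace :=
    fun M N => rfl
  simp only [h3]
  rw [← h1, h2, Matrix.transpose_mul, Matrix.transpose_mul, Matrix.transpose_transpose, mul_assoc,
    mul_assoc, Matrix.trace_mul_comm (jac (transition c e) x)]
  simp only [mul_assoc]

lemma exists_chart {y : Space m} (hy : y ∈ cone m T) :
    ∃ e : Space m, ‖e‖ = 1 ∧ ∃ r x, (r, x) ∈ (graphChart e).coneDom T ∧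
      r • (graphChart e).θ x = y :=
  have he := norm_direction hy.1
  ⟨_, he, _, _, polar_spec he hy (inner_direction_pos hy.1)⟩

/-- A scalar field, from its chart representations. -/
lemma coneSmooth_glue {a0 : ℝ} (ha : IsInvariant T a) (hs : ∀ c, VSmooth T c (a c) fun _ => a0) :
    ConeSmooth T (glue a) a0 := fun e _ =>
  (hs (graphChart e)).congr (fun _ _ hq => glue_apply ha hq) fun _ _ => rfl

/-- A covector field `r² w_A dx^A` on the cone, from its chart representations. Its Cartesian
components tend to zero at the vertex. -/
lemma exists_covectorField (hT : 0 < T) (hw : IsCov T w)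
    (hs : ∀ c A, ∃ w0, VSmooth T c (w c A) w0) :
    ∃ ν : Space m → (Space m →L[ℝ] ℝ), ContDiffOn ℝ ∞ ν (cone m T) ∧
      Tendsto ν (𝓝[≠] 0) (𝓝 0) ∧ Tendsto (fun y => fderiv ℝ ν y y) (𝓝[≠] 0) (𝓝 0) ∧
      (∀ y ∈ cone m T, ν y y = 0) ∧
      ∀ (c : SphereChart m) r x, (r, x) ∈ c.coneDom T → ∀ A, c.comp1 ν r x A = r ^ 2 * w c A r x := by
  choose w0 hw0 using hs
  have hu := isForm_round.raise hw
  set u : SphereChart m → Fin m → ConeFn m :=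
    fun c A r x => ∑ B, (c.round x)⁻¹ A B * w c B r x with hud
  set a : Fin (m + 1) → SphereChart m → ConeFn m :=
    fun i c r x => r * ∑ A, u c A r x * c.frame x A i with had
  have ha : ∀ i, IsInvariant T (a i) := fun i c e x r ho hq => by
    have h1 : ∑ A, u c A r x • c.frame x A
        = ∑ B, u (graphChart e) B r (transition c e x) • (graphChart e).frame (transition c e x) B := by
      simp only [← hu c e x r ho hq, ho.frame_eq, smul_sum, Finset.sum_smul, smul_smul]
      rw [sum_comm]
      exact sum_ext₂ fun _ _ => by rw [mul_comm]
    have h2 := congrArg (EuclideanSpace.proj i : Space m →L[ℝ] ℝ) h1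
    simp only [map_sum, map_smul, smul_eq_mul] at h2
    exact congrArg (r * ·) h2
  have hsm : ∀ i c, VSmooth T c (a i c) fun _ => 0 := fun i c =>
    (VSmooth.radius.mul (VSmooth.sum fun A => VSmooth.mul
      (VSmooth.sum fun B => VSmooth.mul (VSmooth.const_x
        (g := fun x => (c.round x)⁻¹ A B) fun x hx => (MatSmoothNear.inv
          (fun A B => smoothNear_round hx A B)
          (isUnit_iff_ne_zero.2 (posDef_round hx).det_pos.ne') A B).contDiffAt.contDiffWithinAt)
        (hw0 c B)) (VSmooth.const_x (g := fun x => c.frame x A i) fun x hx => by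
          have h3 : ContDiffAt ℝ ∞ (fun x => c.frame x A) x :=
            ((contDiffAt_θ hx).fderiv_right (by simp)).clm_apply contDiffAt_const
          exact ((EuclideanSpace.proj i).contDiff.contDiffAt.comp x h3).contDiffWithinAt))).congr
      (fun _ _ _ => rfl) fun _ _ => (zero_mul _).symm
  have hcs := fun i => coneSmooth_glue (ha i) (hsm i)
  set P : Fin (m + 1) → (Space m →L[ℝ] ℝ) := fun i => EuclideanSpace.proj i
  have hval : ∀ (c : SphereChart m) r x, (r, x) ∈ c.coneDom T → ∀ z : Space m,
      (∑ i, glue (a i) (r • c.θ x) • P i) z = r * ∑ A, u c A r x * inner ℝ (c.frame x A) z := by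
    intro c r x hq z
    have hg : ∀ i, glue (a i) (r • c.θ x) = r * ∑ A, u c A r x * c.frame x A i := fun i =>
      glue_apply (ha i) hq
    simp only [sum_apply, smul_apply, smul_eq_mul, hg, PiLp.inner_apply, mul_sum, sum_mul]
    rw [sum_comm]
    refine sum_ext₂ fun A i => ?_
    simp [P]; ring
  refine ⟨fun y => ∑ i, glue (a i) y • P i, ContDiffOn.sum fun i _ =>
    (hcs i).contDiffOn.smul contDiffOn_const, ?_, ?_, fun y hy => ?_, fun c r x hq A => ?_⟩
  · simpa using tendsto_finsetSum univ fun i _ => ((hcs i).tendsto hT).smul_const (P i)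
  · have h1 : Tendsto (fun y => ∑ i, fderiv ℝ (glue (a i)) y y • P i) (𝓝[≠] 0) (𝓝 0) := by
      simpa using tendsto_finsetSum univ fun i _ => ((hcs i).tendsto_radial hT).smul_const (P i)
    refine h1.congr' ((eventually_mem_cone hT).mono fun y hy => ?_)
    have h2 : HasFDerivAt (fun y => ∑ i, glue (a i) y • P i) _ y := HasFDerivAt.fun_sum fun i _ =>
      ((((hcs i).contDiffOn.contDiffAt (isOpen_cone.mem_nhds hy)).differentiableAt
        (by simp)).hasFDerivAt).smul_const
        (P i)
    change _ = fderiv ℝ (fun y => ∑ i, glue (a i) y • P i) y y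
    rw [h2.fderiv]
    simp
  · obtain ⟨e, he, r, x, hq, rfl⟩ := exists_chart hy
    rw [hval _ r x hq]
    have h0 : ∀ A, inner ℝ ((graphChart e).frame x A) ((graphChart e).θ x) = 0 := fun A => by
      rw [real_inner_comm, inner_θ_frame hq.1]
    simp [inner_smul_right, h0]
  · rw [SphereChart.comp1, hval c r x hq]
    have h1 := IsMetricNear.sum_mul_inv (g := c.round) (x := x) ⟨smoothNear_round hq.1,
      .of_forall fun y => round_symm y, isUnit_iff_ne_zero.2 (posDef_round hq.1).det_pos.ne'⟩
    have h2 : ∑ B, u c B r x * c.round x B A = w c A r x := by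
      simp only [hud, sum_mul]
      rw [sum_comm]
      calc _ = ∑ C, (∑ B, c.round x A B * (c.round x)⁻¹ B C) * w c C r x := by
            simp only [sum_mul, round_symm x A]
            exact sum_ext₂ fun _ _ => by ring
        _ = _ := by simp [h1]
    have h3 : ∀ B, inner ℝ (c.frame x B) (r • c.frame x A) = r * c.round x B A := fun B =>
      inner_smul_right _ _ _
    simp only [h3, ← h2, mul_sum]
    exact sum_ext fun B => by ring

end Tensors

/-! ### Linear equations along the generators -/

section LinearODE

variable {t F : ConeFn m} {t0 F0 : (Fin m → ℝ) → ℝ} {l : ℝ} {k : ℕ}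

/-- The integrating factor `exp (l ∫₀^r t)`. -/
def expInt (l : ℝ) (t : ConeFn m) (r : ℝ) (x : Fin m → ℝ) : ℝ := Real.exp (l * (r * euler 1 t r x))

lemma expInt_pos : 0 < expInt l t r x := Real.exp_pos _

lemma VSmooth.expInt (ht : VSmooth T c t t0) (l : ℝ) :
    VSmooth T c (NullCone.expInt l t) fun _ => 1 :=
  (((VSmooth.const l).mul (VSmooth.radius.mul (ht.euler 1))).comp1 (G := Real.exp)
    (fun _ _ _ => Real.contDiff_exp.contDiffAt) fun _ _ => Real.contDiff_exp.contDiffAt).congr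
    (fun _ _ _ => rfl) fun _ _ => by simp

lemma VSmooth.hasDerivAt_expInt (ht : VSmooth T c t t0) (l : ℝ) (hq : onCone) :
    HasDerivAt (fun s => NullCone.expInt l t s x) (l * t r x * NullCone.expInt l t r x) r := by
  have hr : r ≠ 0 := hq.2.1.ne'
  refine ((((hasDerivAt_id' r).fun_mul (ht.hasDerivAt_euler 1 hq)).const_mul l).exp).congr_deriv ?_
  rw [NullCone.expInt]
  push_cast
  field_simp
  ring

/-- The solution, regular at the vertex, of `r y' + (k + 1) / 2 y + l r t y = F`. -/
def linSol (l : ℝ) (k : ℕ) (t F : ConeFn m) (r : ℝ) (x : Fin m → ℝ) : ℝ :=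
  (expInt l t r x)⁻¹ * euler k (fun r x => expInt l t r x * F r x) r x

lemma VSmooth.linSol (ht : VSmooth T c t t0) (hF : VSmooth T c F F0) (l : ℝ) (k : ℕ) :
    VSmooth T c (NullCone.linSol l k t F) fun x => 2 / (k + 1) * F0 x :=
  (((ht.expInt l).inv (fun _ _ _ => expInt_pos.ne') fun _ _ => one_ne_zero).mul
    (((ht.expInt l).mul hF).euler k)).congr (fun _ _ _ => rfl) fun _ _ => by ring

lemma VSmooth.hasDerivAt_linSol (ht : VSmooth T c t t0) (hF : VSmooth T c F F0) (l : ℝ) (k : ℕ)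
    (hq : onCone) : HasDerivAt (fun s => NullCone.linSol l k t F s x)
      ((F r x - (k + 1) / 2 * NullCone.linSol l k t F r x) / r
        - l * t r x * NullCone.linSol l k t F r x) r := by
  have hr : r ≠ 0 := hq.2.1.ne'
  have h0 := (expInt_pos (l := l) (t := t) (r := r) (x := x)).ne'
  refine (((ht.hasDerivAt_expInt l hq).fun_inv h0).fun_mul
    (((ht.expInt l).mul hF).hasDerivAt_euler k hq)).congr_deriv ?_
  simp only [NullCone.linSol]
  field_simp
  ring

lemma VSmooth.linSol_pos (ht : VSmooth T c t t0) (hF : VSmooth T c F F0)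
    (hp : ∀ r x, (r, x) ∈ c.coneDom T → 0 < F r x) (hq : (r, x) ∈ c.coneDom T) :
    0 < NullCone.linSol l k t F r x :=
  mul_pos (inv_pos.2 expInt_pos) (VSmooth.euler_pos ((ht.expInt l).mul hF) hq fun r x hq =>
    mul_pos expInt_pos (hp r x hq))

variable {a t' : SphereChart m → ConeFn m} {t0' : SphereChart m → (Fin m → ℝ) → ℝ}
  {v w : SphereChart m → Fin m → ConeFn m} {f0 : SphereChart m → Fin m → (Fin m → ℝ) → ℝ}

lemma IsInvariant.mul {a a' : SphereChart m → ConeFn m} (ha : IsInvariant T a)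
    (ha' : IsInvariant T a') : IsInvariant T fun c r x => a c r x * a' c r x :=
  fun c e x r h hq => congrArg₂ _ (ha c e x r h hq) (ha' c e x r h hq)

lemma IsInvariant.sub {a a' : SphereChart m → ConeFn m} (ha : IsInvariant T a)
    (ha' : IsInvariant T a') : IsInvariant T fun c r x => a c r x - a' c r x :=
  fun c e x r h hq => congrArg₂ _ (ha c e x r h hq) (ha' c e x r h hq)

lemma IsInvariant.radial (f : ℝ → ℝ) : IsInvariant T fun (_ : SphereChart m) r _ => f r :=
  fun _ _ _ _ _ _ => rfl

lemma IsInvariant.comp1 (ha : IsInvariant T a) (f : ℝ → ℝ) :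
    IsInvariant T fun (c : SphereChart m) r x => f (a c r x) :=
  fun c e x r h hq => congrArg f (ha c e x r h hq)

lemma IsInvariant.expInt (ht : IsInvariant T t') (l : ℝ) :
    IsInvariant T fun c => NullCone.expInt l (t' c) :=
  (((IsInvariant.radial fun _ => l).mul ((IsInvariant.radial fun r => r).mul (ht.euler 1))).comp1
    Real.exp)

lemma IsInvariant.linSol (ht : IsInvariant T t') (ha : IsInvariant T a) (l : ℝ) (k : ℕ) :
    IsInvariant T fun c => NullCone.linSol l k (t' c) (a c) :=
  ((ht.expInt l).comp1 fun y => y⁻¹).mul (((ht.expInt l).mul ha).euler k)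

lemma IsCov.linSol (ht : IsInvariant T t') (hts : ∀ c, VSmooth T c (t' c) (t0' c)) (hw : IsCov T w)
    (hs : ∀ c A, VSmooth T c (w c A) (f0 c A)) (l : ℝ) (k : ℕ) :
    IsCov T fun c A => NullCone.linSol l k (t' c) (w c A) :=
  (((hw.smul (ht.expInt l)).euler (fun c A => ((hts c).expInt l).mul (hs c A)) k)).smul
    ((ht.expInt l).comp1 fun y => y⁻¹)

lemma IsVec.linSol (ht : IsInvariant T t') (hts : ∀ c, VSmooth T c (t' c) (t0' c)) (hv : IsVec T v)
    (hs : ∀ c A, VSmooth T c (v c A) (f0 c A)) (l : ℝ) (k : ℕ) :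
    IsVec T fun c A => NullCone.linSol l k (t' c) (v c A) :=
  (((hv.smul (ht.expInt l)).euler (fun c A => ((hts c).expInt l).mul (hs c A)) k)).smul
    ((ht.expInt l).comp1 fun y => y⁻¹)

end LinearODE

/-! ### The conformal factor -/

section ConformalFactor

variable {γ : SForm m} {τ : Space m → ℝ}

/-- `τ - m / r`. -/
def tauReg (τ : Space m → ℝ) (c : SphereChart m) (r : ℝ) (x : Fin m → ℝ) : ℝ :=
  c.comp0 τ r x - m / r

lemma isInvariant_tauReg : IsInvariant T (tauReg τ) :=
  (isInvariant_comp0 τ).sub (IsInvariant.radial fun r => m / r)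

/-- `τ - m / r` is smooth up to the vertex: `u τ / m = u'`, with the smooth solution `u = r w` of
`u'' = - |σ|² u / m`, `u' = 1` at the vertex. -/
lemma IsExpansion.vs_tauReg (hm : 1 ≤ m) (hT : 0 < T) (hγ : IsVMetric T γ) (hτ : IsExpansion T γ τ)
    (c : SphereChart m) : ∃ t0, VSmooth T c (tauReg τ c) t0 := by
  have hm0 : (m : ℝ) ≠ 0 := by positivity
  obtain ⟨f0, hf⟩ := hγ.vs_shearSq (c := c)
  obtain ⟨w, U, hw, hU, hode⟩ := ((VSmooth.const (1 / (m : ℝ))).mul hf).exists_radialSol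
  have hτd : ∀ r x, (r, x) ∈ c.coneDom T →
      HasDerivAt (fun s => c.comp0 τ s x) (-(c.comp0 τ r x ^ 2 / m) - shearSq (c.comp2 γ) r x) r :=
    fun r x hq => (hasDerivAt_comp0 hτ.smooth hq).congr_deriv (by
      linarith [hτ.eqn c x hq.1 r hq.2.1 hq.2.2])
  have key : ∀ b x, (b, x) ∈ c.coneDom T → b * w b x * c.comp0 τ b x / m = U b x := by
    intro b x hb
    have hray : ∀ r ∈ Ioc 0 b, (r, x) ∈ c.coneDom T := fun r hr => coneDom_of_le hb hr
    set v : ℝ → ℝ := fun r => r * w r x * c.comp0 τ r x / m - U r x with hv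
    have hvd : ∀ r ∈ Ioc 0 b, HasDerivAt v (-(c.comp0 τ r x / m) * v r) r := fun r hr => by
      obtain ⟨h1, h2⟩ := hode r x (hray r hr)
      refine (((h1.fun_mul (hτd r x (hray r hr))).div_const (m : ℝ)).fun_sub h2).congr_deriv ?_
      simp only [hv]
      field_simp
      ring
    have hrτ : Tendsto (fun r => r * c.comp0 τ r x) (𝓝[>] 0) (𝓝 m) := by
      have h2 := (Filter.tendsto_id (x := 𝓝[>] (0 : ℝ))).mono_right nhdsWithin_le_nhds
      have h3 := (h2.mul (hτ.vertex.comp (tendsto_smul_θ hb))).const_sub (m : ℝ)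
      simp only [mul_zero, sub_zero] at h3
      refine h3.congr' ?_
      filter_upwards [Ioc_mem_nhdsGT hb.2.1] with r hr
      have hn := norm_smul_θ (hray r hr)
      have hr0 : r ≠ 0 := hr.1.ne'
      simp only [id, Function.comp_apply] at hn ⊢
      rw [hn, SphereChart.comp0]
      field_simp
      ring
    have hwl := hw.tendsto_ray hT hb.1
    have hv0 : Tendsto v (𝓝[>] 0) (𝓝 0) := by
      have h1 := ((hrτ.mul hwl).div_const (m : ℝ)).sub (hU.tendsto_ray hT hb.1)
      rw [mul_one, div_self hm0, sub_self] at h1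
      exact h1.congr fun r => by simp only [hv]; ring
    exact sub_eq_zero.1 (eq_zero_of_hasDerivAt (d := v) hb.2.1 hvd
      (fun r hr => div_nonneg (hτ.pos _ (mem_cone (hray r hr))).le (Nat.cast_nonneg m)) hv0)
  -- `u²` is nondecreasing, and positive near the vertex.
  have hw0 : ∀ b x, (b, x) ∈ c.coneDom T → w b x ≠ 0 := by
    intro b x hb hwb
    have hray : ∀ r ∈ Ioc 0 b, (r, x) ∈ c.coneDom T := fun r hr => coneDom_of_le hb hr
    have hd : ∀ r ∈ Ioc 0 b, HasDerivAt (fun s => (s * w s x) ^ 2) (2 * (r * w r x) * U r x) r :=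
      fun r hr => ((hode r x (hray r hr)).1.fun_pow 2).congr_deriv (by push_cast; ring)
    have hmono : MonotoneOn (fun s => (s * w s x) ^ 2) (Ioc 0 b) := by
      refine monotoneOn_of_hasDerivWithinAt_nonneg (convex_Ioc 0 b)
        (fun r hr => (hd r hr).continuousAt.continuousWithinAt)
        (fun r hr => (hd r (interior_subset hr)).hasDerivWithinAt) fun r hr => ?_
      have hr' := interior_subset hr
      rw [← key r x (hray r hr')]
      have h1 := mul_nonneg (sq_nonneg (r * w r x)) (div_nonneg
        (hτ.pos _ (mem_cone (hray r hr'))).le (Nat.cast_nonneg m))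
      change 0 ≤ 2 * (r * w r x) * (r * w r x * τ (r • c.θ x) / m)
      calc (0 : ℝ) ≤ 2 * _ := mul_nonneg two_pos.le h1
        _ = _ := by ring
    have h0 : ∀ᶠ r in 𝓝[>] 0, w r x = 0 := by
      filter_upwards [Ioc_mem_nhdsGT hb.2.1] with r hr
      have h1 := hmono hr ⟨hb.2.1, le_rfl⟩ hr.2
      simp only [hwb, mul_zero, ne_eq, OfNat.ofNat_ne_zero, not_false_eq_true, zero_pow] at h1
      have h2 := pow_eq_zero_iff two_ne_zero |>.1 (le_antisymm h1 (sq_nonneg _))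
      exact (mul_eq_zero.1 h2).resolve_left hr.1.ne'
    have h1 := tendsto_nhds_unique (hw.tendsto_ray hT hb.1) (tendsto_const_nhds.congr'
      (h0.mono fun _ h => h.symm))
    exact one_ne_zero h1
  obtain ⟨g0, hg⟩ := (hU.sub hw).div_radius fun _ _ => sub_self 1
  refine ⟨_, (((VSmooth.const (m : ℝ)).mul hg).mul (hw.inv hw0
    fun _ _ => one_ne_zero)).congr (fun r x hq => ?_) fun _ _ => rfl⟩
  have h2 := hw0 r x hq
  have hr : r ≠ 0 := hq.2.1.ne'
  rw [← key r x hq, tauReg]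
  field_simp

lemma IsVMetric.isInvariant_meanCurv (hγ : IsVMetric T γ) :
    IsInvariant T fun (c : SphereChart m) => meanCurv (c.comp2 γ) := fun c e x r h hq => by
  have hq' := h.mem_coneDom hq
  have h1 := congrArg (fun M => (M * (jac (transition c e) x)⁻¹).trace)
    (h.jac_mul_chiMat (hγ.metricNear hq') (hγ.differentiableAt hq'))
  rwa [Matrix.trace_mul_comm, ← mul_assoc, nonsing_inv_mul _ h.isUnit_jac, one_mul, mul_assoc,
    mul_nonsing_inv _ h.isUnit_jac, mul_one] at h1

lemma IsVMetric.conformal_eq (hγ : IsVMetric T γ) (hq : onCone) {φ : Space m → ℝ} {l : ℝ}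
    (hd : HasDerivAt (fun s => c.comp0 φ s x) (l * c.comp0 φ r x) r) (h0 : c.comp0 φ r x ≠ 0) :
    meanCurv (c.comp2 fun y => φ y ^ 2 • γ y) r x = meanCurv (c.comp2 γ) r x + m * l ∧
      shearSq (c.comp2 fun y => φ y ^ 2 • γ y) r x = shearSq (c.comp2 γ) r x := by
  have h1 := hd.fun_pow 2
  have h2 : ∀ A B, chi (c.comp2 fun y => φ y ^ 2 • γ y) r x A B
      = chi (fun s y => (c.comp0 φ s x) ^ 2 • c.comp2 γ s y) r x A B := fun _ _ => rfl
  have h3 := hγ.differentiableAt hq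
  have h4 := hγ.pos c r x hq
  constructor
  · rw [show meanCurv (c.comp2 fun y => φ y ^ 2 • γ y) r x
      = meanCurv (fun s y => (c.comp0 φ s x) ^ 2 • c.comp2 γ s y) r x by simp only [meanCurv, h2],
      meanCurv_smul h1 (pow_ne_zero 2 h0) h3 h4]
    field_simp
    push_cast
    ring
  · rw [show shearSq (c.comp2 fun y => φ y ^ 2 • γ y) r x
      = shearSq (fun s y => (c.comp0 φ s x) ^ 2 • c.comp2 γ s y) r x by
        simp only [shearSq, shear, meanCurv, h2], shearSq_smul h1 (pow_ne_zero 2 h0) h3 h4]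

/-- The conformal factor exists; it makes `τ` the mean curvature of `φ² γ`. -/
lemma IsExpansion.exists_conformalFactor (hm : 1 ≤ m) (hT : 0 < T) (hγ : IsVMetric T γ)
    (hτ : IsExpansion T γ τ) : ∃ φ : Space m → ℝ, IsConformalFactor T γ τ φ ∧
      IsVMetric T (fun y => φ y ^ 2 • γ y) ∧ ∀ (c : SphereChart m) r x, (r, x) ∈ c.coneDom T →
        meanCurv (c.comp2 fun y => φ y ^ 2 • γ y) r x = c.comp0 τ r x ∧
        shearSq (c.comp2 fun y => φ y ^ 2 • γ y) r x = shearSq (c.comp2 γ) r x := by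
  have hm0 : (m : ℝ) ≠ 0 := by positivity
  set a : SphereChart m → ConeFn m := fun c r x => c.comp0 τ r x - meanCurv (c.comp2 γ) r x with had
  have ha : IsInvariant T a := (isInvariant_comp0 τ).sub hγ.isInvariant_meanCurv
  have has : ∀ c, ∃ a0, VSmooth T c (a c) a0 := fun c => by
    obtain ⟨t0, ht⟩ := hτ.vs_tauReg hm hT hγ c
    choose k0 hk using fun A => hγ.vs_chi (c := c) A A
    refine ⟨_, (ht.sub (VSmooth.sum fun A => hk A)).congr (fun r x hq => ?_)
      fun _ _ => rfl⟩
    change c.comp0 τ r x - meanCurv (c.comp2 γ) r x = tauReg τ c r x - meanCurv (resc γ c) r x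
    rw [hγ.meanCurv_eq hq, tauReg]
    ring
  choose a0 has using has
  have hE := fun c => (has c).expInt (1 / (m : ℝ))
  set φ : Space m → ℝ := glue fun c => expInt (1 / (m : ℝ)) (a c)
  have hcs : ConeSmooth T φ 1 := coneSmooth_glue (ha.expInt _) hE
  have hφ : ∀ (c : SphereChart m) r x, (r, x) ∈ c.coneDom T →
      c.comp0 φ r x = expInt (1 / (m : ℝ)) (a c) r x := fun c r x hq => glue_apply (ha.expInt _) hq
  have hpos : ∀ y ∈ cone m T, 0 < φ y := fun y hy => by
    obtain ⟨e, -, r, x, hq, rfl⟩ := exists_chart hy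
    exact expInt_pos.trans_eq (hφ _ r x hq).symm
  have hd : ∀ (c : SphereChart m) r x, (r, x) ∈ c.coneDom T → HasDerivAt (fun s => c.comp0 φ s x)
      (1 / (m : ℝ) * a c r x * c.comp0 φ r x) r := fun c r x hq => by
    rw [hφ c r x hq]
    exact ((has c).hasDerivAt_expInt _ hq).congr_of_eventuallyEq
      ((eventually_fst (eventually_coneDom hq)).mono fun s hs => hφ c s x hs)
  refine ⟨φ, ⟨hcs.contDiffOn, hpos, hcs.tendsto hT, fun c x hx r hr ht => ?_⟩,
    hγ.conformal (fun c => (hE c).congr (hφ c) fun _ _ => rfl) hpos, fun c r x hq => ?_⟩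
  · have hq : (r, x) ∈ c.coneDom T := ⟨hx, hr, ht⟩
    have h0 := (hpos _ (mem_cone hq)).ne'
    have h1 := hasDerivAt_sqrt_det (hγ.differentiableAt hq) (hγ.pos c r x hq)
    have h2 := (Real.sqrt_pos.2 (hγ.pos c r x hq).det_pos).ne'
    beta_reduce
    rw [((hd c r x hq).log h0).deriv, (h1.log h2).deriv, mul_div_cancel_right₀ _ h2]
    exact mul_div_cancel_right₀ _ h0
  · have h0 := (hpos _ (mem_cone hq)).ne'
    have h1 := hγ.conformal_eq hq (hd c r x hq) h0
    refine ⟨h1.1.trans ?_, h1.2⟩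
    simp only [had]
    field_simp
    ring

end ConformalFactor

/-! ### The sources of the hierarchy -/

section Sources

variable {b : SForm m} {τ : Space m → ℝ} {ξ : SphereChart m → Fin m → ConeFn m}

/-- `r² g^{AB} s_{AB}`. -/
def traceRound (b : SForm m) (c : SphereChart m) (r : ℝ)
    (x : Fin m → ℝ) : ℝ := ∑ A, ∑ B, (resc b c r x)⁻¹ A B * c.round x A B

/-- `∇_B χ_A^B - ∂_A τ`. -/
def xiSource (b : SForm m) (τ : Space m → ℝ) (c : SphereChart m)
    (A : Fin m) (r : ℝ) (x : Fin m → ℝ) : ℝ :=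
  matDiv (c.comp2 b r) (chiMat (c.comp2 b) r) A x - pd A (c.comp0 τ r) x

/-- `g_{AB} g^{CE} (Ŝ^B_{CE} - Γ^B_{CE})`. -/
def sphereGauge (b : SForm m) (c : SphereChart m) (A : Fin m) (r : ℝ)
    (x : Fin m → ℝ) : ℝ := -waveGaugeLow (c.comp2 b r) c.round A x

/-- `r² (R - ξ_A ξ^A / 2 + ∇_A ξ^A)`. -/
def zetaSource (b : SForm m)
    (ξ : SphereChart m → Fin m → ConeFn m) (c : SphereChart m) (r : ℝ)
    (x : Fin m → ℝ) : ℝ := r ^ 2 * scalarCurv (c.comp2 b r) x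
    - 1 / 2 * ∑ A, ξ c A r x * ∑ B, (resc b c r x)⁻¹ A B * ξ c B r x
    + r ^ 2 * covDiv (c.comp2 b r) (fun A => ξ c A r) x

lemma metricNear_round (hx : x ∈ c.dom) : IsMetricNear c.round x :=
  ⟨smoothNear_round hx, .of_forall fun y => round_symm y,
    isUnit_iff_ne_zero.2 (posDef_round hx).det_pos.ne'⟩

lemma matDiv_apply {ι : Type} [Fintype ι] [DecidableEq ι] (g M : 𝕄 ι) (A : ι)
    (x : ι → ℝ) : matDiv g M A x = ∑ B, pd B (fun z => M z B A) x
      + ∑ B, ∑ C, (Γ g B B C x * M x C A - Γ g C B A x * M x B C) := by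
  rw [← sum_add_distrib]
  refine sum_ext fun B => ?_
  simp only [Matrix.sub_apply, Matrix.add_apply, mul_apply, pdMat, of_apply, connMat,
    sum_sub_distrib, mul_comm (M x B _)]
  ring

/-- A multiple of the identity which is constant on the spheres is divergence free. -/
lemma matDiv_congr {ι : Type} [Fintype ι] [DecidableEq ι] {g M N : 𝕄 ι}
    {x : ι → ℝ} (a : ℝ) (h : ∀ᶠ y in 𝓝 x, ∀ A B, M y A B = N y A B + if A = B then a else 0)
    (hN : MatSmoothNear N x) (A : ι) : matDiv g M A x = matDiv g N A x := by
  have h1 : ∀ B, pd B (fun z => M z B A) x = pd B (fun z => N z B A) x := fun B => by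
    rw [pd_congr B (h.mono fun y hy => hy B A), pd_add B (hN B A) (.const _), pd_const, add_zero]
  have h2 := h.self_of_nhds
  simp only [matDiv_apply, h1, h2, mul_add, mul_ite, mul_zero, add_sub_add_comm]
  simp only [sum_add_distrib, sum_sub_distrib, sum_ite_eq, Finset.sum_ite_eq', mem_univ,
    if_true, sub_self, add_zero]

lemma W0_eq (D : ConeMetric m) (hr : 0 < r) : D.W0 c r x = -(traceRound D.gt c r x / r) := by
  simp only [ConeMetric.W0, traceRound, inv_comp2_eq D.gt hr, mul_assoc, ← mul_sum]
  field_simp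

namespace IsVMetric

variable (hb : IsVMetric T b)
include hb

lemma vs_traceRound (c : SphereChart m) : VSmooth T c (traceRound b c) fun _ => m :=
  (VSmooth.sum fun A => VSmooth.sum fun B =>
    (hb.vs_inv A B).mul (VSmooth.const_x (g := fun x => c.round x A B) fun x hx =>
      (smoothNear_round hx A B).contDiffAt.contDiffWithinAt)).congr
    (fun _ _ _ => rfl) fun x hx => by
      have h3 : ∀ A, ∑ B, (c.round x)⁻¹ A B * c.round x A B = 1 := fun A => by
        simp only [round_symm x A, (metricNear_round hx).sum_inv_mul, if_true]
      simp [h3]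

lemma isInvariant_traceRound : IsInvariant T (traceRound b) := (isForm_resc b).trace isForm_round

/-- Schur's product theorem. -/
lemma traceRound_pos (hm : 1 ≤ m) (hq : onCone) : 0 < traceRound b c r x := by
  have : Nonempty (Fin m) := ⟨⟨0, hm⟩⟩
  have := ((hb.resc_pos hq).inv.hadamard (posDef_round (c := c) hq.1)
    ).dotProduct_mulVec_pos (x := 1) one_ne_zero
  simp [dotProduct, Matrix.mulVec] at this
  exact this

lemma vs_xiSource {t0 : (Fin m → ℝ) → ℝ} (ht : VSmooth T c (tauReg τ c) t0) (A : Fin m) :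
    ∃ f0, VSmooth T c (xiSource b τ c A) f0 := by
  choose k0 hk using fun A B => hb.vs_chi (c := c) A B
  have h1 := hb.vs_christoffel (c := c)
  refine ⟨_, (((VSmooth.sum fun B => (hk A B).pd B).add
    (VSmooth.sum fun B => VSmooth.sum fun C =>
      ((h1 B B C).mul (hk A C)).sub ((h1 C B A).mul (hk C B)))).sub (ht.pd A)).congr
    (fun r x hq => ?_) fun _ _ => rfl⟩
  have h2 : matDiv (c.comp2 b r) (chiMat (c.comp2 b) r) A x
      = matDiv (c.comp2 b r) (chiMat (resc b c) r) A x :=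
    matDiv_congr (1 / r) ((eventually_snd (eventually_coneDom hq)).mono fun y hy A B => by
      simp only [chiMat, of_apply, hb.chi_eq hy, eq_comm (a := A)])
      (fun A B => (hk B A).smoothNear hq) A
  have h3 : pd A (c.comp0 τ r) x = pd A (tauReg τ c r) x := by
    rw [show c.comp0 τ r = fun y => tauReg τ c r y + m / r from funext fun y => by simp [tauReg],
      pd_add A (ht.smoothNear hq) (.const _), pd_const, add_zero]
  rw [xiSource, h2, h3, matDiv_apply]
  rfl

lemma isCov_xiSource {t0 : SphereChart m → (Fin m → ℝ) → ℝ}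
    (ht : ∀ c, VSmooth T c (tauReg τ c) (t0 c)) : IsCov T (xiSource b τ) := fun c e x r h hq A => by
  have hq' := h.mem_coneDom hq
  have pb := h.isPullbackNear (hb.metricNear hq')
  have hev := (h.eventually.and (eventually_snd (eventually_coneDom hq)))
  have h1 := pb.matDiv_eq (M' := chiMat (c.comp2 b) r) (M := chiMat ((graphChart e).comp2 b) r)
    (fun A B => hb.smoothNear_chi hq B A) (fun A B => hb.smoothNear_chi hq' B A)
    (hev.mono fun y hy => hy.1.jac_mul_chiMat (hb.metricNear (hy.1.mem_coneDom hy.2))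
      (hb.differentiableAt (hy.1.mem_coneDom hy.2))) A
  have h2 : c.comp0 τ r =ᶠ[𝓝 x] fun y => (graphChart e).comp0 τ r (transition c e y) :=
    hev.mono fun y hy => by simp only [SphereChart.comp0, hy.1.θ_eq]
  have h3 : SmoothNear ((graphChart e).comp0 τ r) (transition c e x) :=
    (((ht (graphChart e)).smoothNear hq').add (.const (m / r))).congr
      (.of_forall fun y => by simp [tauReg])
  simp only [xiSource, h1, pd_congr A h2, pd_comp A h3 h.smoothNear_transition, mul_sub,
    sum_sub_distrib]
  congr 1
  exact sum_ext fun B => mul_comm _ _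

lemma vs_sphereGauge (A : Fin m) : VSmooth T c (sphereGauge b c A) fun _ => 0 := by
  refine (VSmooth.sum fun k => (hb.vs c A k).mul
    (VSmooth.sum fun i => VSmooth.sum fun j =>
      (hb.vs_inv i j).mul ((hb.vs_christoffel k i j).sub (VSmooth.const_x
        (g := Γ c.round k i j) fun x hx => ((metricNear_round hx).smoothNear_christoffel
          k i j).contDiffAt.contDiffWithinAt)))).neg.congr (fun r x hq => ?_) fun x _ => by simp
  have hr : 0 < r := hq.2.1
  have h1 : ∀ k, c.comp2 b r x A k = r ^ 2 * resc b c r x A k := fun k => by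
    rw [comp2_eq_smul_resc b hr, Matrix.smul_apply, smul_eq_mul]
  simp only [sphereGauge, waveGaugeLow, waveGauge, inv_comp2_eq b hr, mul_assoc, ← mul_sum]
  refine congrArg Neg.neg (sum_ext fun k => ?_)
  rw [h1, mul_assoc, mul_left_comm (resc b c r x A k), mul_inv_cancel_left₀ (pow_ne_zero 2 hr.ne')]

lemma isCov_sphereGauge : IsCov T (sphereGauge b) := by
  have h1 : IsVec T fun c A r x => waveGauge (c.comp2 b r) c.round A x := fun c e x r h hq B =>
    (h.isPullbackNear (hb.metricNear (h.mem_coneDom hq))).sum_jac_mul_waveGauge h.isPullbackNear_round B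
  intro c e x r h hq A
  have h2 := ((isForm_comp2 b).lower h1).smul (IsInvariant.radial fun _ => -1) c e x r h hq A
  simpa only [neg_one_mul, sphereGauge, waveGaugeLow] using h2

lemma vs_zetaSource (hξ : ∀ A, VSmooth T c (ξ c A) fun _ => 0) :
    VSmooth T c (zetaSource b ξ c) fun _ => m * (m - 1) := by
  have h1 := hb.vs_christoffel (c := c)
  refine ((hb.vs_scalarCurv.sub ((VSmooth.const (1 / 2)).mul (VSmooth.sum fun A =>
    (hξ A).mul (VSmooth.sum fun B => (hb.vs_inv A B).mul (hξ B))))).add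
    (VSmooth.sum fun i => VSmooth.sum fun j =>
      (hb.vs_inv i j).mul (((hξ j).pd i).sub (VSmooth.sum fun k =>
        (h1 k i j).mul (hξ k))))).congr (fun r x hq => ?_) fun x hx => ?_
  · have hr : r ≠ 0 := hq.2.1.ne'
    simp only [zetaSource, covDiv, inv_comp2_eq b hq.2.1, mul_assoc, ← mul_sum]
    rw [mul_inv_cancel_left₀ (pow_ne_zero 2 hr)]
  · simp [pd_const, scalarCurv_round hx]

lemma isInvariant_zetaSource (hc : IsCov T ξ) (hξ : ∀ c A, VSmooth T c (ξ c A) fun _ => 0) :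
    IsInvariant T (zetaSource b ξ) := by
  have h1 := hc.pair ((isForm_resc b).raise hc)
  intro c e x r h hq
  have hq' := h.mem_coneDom hq
  have pb := h.isPullbackNear (hb.metricNear hq')
  have h2 := pb.covDiv_eq (w' := fun A => ξ c A r) (w := fun A => ξ (graphChart e) A r)
    (fun A => (hξ _ A).smoothNear hq')
    ((h.eventually.and (eventually_snd (eventually_coneDom hq))).mono fun y hy A =>
      hc c e y r hy.1 hy.2 A)
  have h3 := h1 c e x r h hq
  beta_reduce at h3
  rw [zetaSource, zetaSource, h2, pb.scalarCurv_eq, h3]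

end IsVMetric

end Sources

/-! ### Solution of the hierarchy -/

section Hierarchy

variable {b : SForm m} {τ : Space m → ℝ}
  {ξ p : SphereChart m → Fin m → ConeFn m}
  {n z : SphereChart m → ConeFn m} {t0 : SphereChart m → (Fin m → ℝ) → ℝ}

lemma hasDerivAt_linSol_tauReg {F : ConeFn m} {t0 F0 : (Fin m → ℝ) → ℝ}
    (ht : VSmooth T c (tauReg τ c) t0) (hF : VSmooth T c F F0) {l : ℝ} {k : ℕ} (j : ℝ)
    (hk : (k : ℝ) + 1 = 2 * l * m + j) (hq : onCone) :
    HasDerivAt (fun s => linSol l k (tauReg τ c) F s x)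
      ((F r x - j / 2 * linSol l k (tauReg τ c) F r x) / r
        - l * c.comp0 τ r x * linSol l k (tauReg τ c) F r x) r := by
  have hr : r ≠ 0 := hq.2.1.ne'
  refine (ht.hasDerivAt_linSol hF l k hq).congr_deriv ?_
  rw [hk, tauReg]
  field_simp
  ring

namespace IsVMetric

variable (hb : IsVMetric T b) (hm : 1 ≤ m) (ht : ∀ c, VSmooth T c (tauReg τ c) (t0 c))
include hb hm ht

/-- The function `1 / ν₀`. -/
lemma exists_nuInv : ∃ n : SphereChart m → ConeFn m, IsInvariant T n ∧
    (∀ c, VSmooth T c (n c) fun _ => 1) ∧ ∀ c r x, (r, x) ∈ c.coneDom T → 0 < n c r x ∧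
      HasDerivAt (fun s => n c s x)
        (1 / 2 * traceRound b c r x / r - 1 / 2 * c.comp0 τ r x * n c r x) r := by
  have hF : ∀ c, VSmooth T c _ _ := fun c => (VSmooth.const (1 / 2)).mul (hb.vs_traceRound c)
  have hk : ((m - 1 : ℕ) : ℝ) + 1 = m := by exact_mod_cast Nat.sub_add_cancel hm
  have hm0 : (m : ℝ) ≠ 0 := by positivity
  refine ⟨_, isInvariant_tauReg.linSol ((IsInvariant.radial fun _ => 1 / 2).mul
    hb.isInvariant_traceRound) (1 / 2) (m - 1), fun c => ((ht c).linSol (hF c) _ _).congr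
    (fun _ _ _ => rfl) fun _ _ => ?_, fun c r x hq => ⟨?_, ?_⟩⟩
  · rw [hk]; field_simp
  · exact (ht c).linSol_pos (hF c) (fun r x hq => mul_pos one_half_pos (hb.traceRound_pos hm hq)) hq
  · refine (hasDerivAt_linSol_tauReg (ht c) (hF c) 0 (by rw [hk]; ring) hq).congr_deriv ?_
    ring

/-- The covector field `ξ`. -/
lemma exists_xi : ∃ ξ : SphereChart m → Fin m → ConeFn m, IsCov T ξ ∧
    (∀ c A, VSmooth T c (ξ c A) fun _ => 0) ∧ ∀ c A r x, (r, x) ∈ c.coneDom T →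
      HasDerivAt (fun s => ξ c A s x)
        (2 * xiSource b τ c A r x - c.comp0 τ r x * ξ c A r x) r := by
  choose s0 hs using fun c A => hb.vs_xiSource (ht c) A
  have hF : ∀ c A, VSmooth T c _ _ := fun c A => ((VSmooth.const 2).mul VSmooth.radius).mul (hs c A)
  have hk : ((2 * m - 1 : ℕ) : ℝ) + 1 = 2 * m := by
    exact_mod_cast Nat.sub_add_cancel (by omega : 1 ≤ 2 * m)
  refine ⟨_, IsCov.linSol isInvariant_tauReg ht ((hb.isCov_xiSource ht).smul
    (IsInvariant.radial fun r => 2 * r)) hF 1 (2 * m - 1), fun c A =>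
    ((ht c).linSol (hF c A) _ _).congr (fun _ _ _ => rfl) fun _ _ => by simp, fun c A r x hq => ?_⟩
  have hr : r ≠ 0 := hq.2.1.ne'
  refine (hasDerivAt_linSol_tauReg (ht c) (hF c A) 0 (by rw [hk]; ring) hq).congr_deriv ?_
  field_simp
  ring

/-- The vector field `ν^A / ν₀`. -/
lemma exists_shift (hξ : IsCov T ξ) (hs : ∀ c A, VSmooth T c (ξ c A) fun _ => 0) :
    ∃ p : SphereChart m → Fin m → ConeFn m, IsVec T p ∧
    (∀ c A, ∃ p0, VSmooth T c (p c A) p0) ∧ ∀ c A r x, (r, x) ∈ c.coneDom T →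
      HasDerivAt (fun s => p c A s x)
        (1 / 2 * (∑ B, (resc b c r x)⁻¹ A B * ((sphereGauge b c B r x - ξ c B r x) / r)) / r
          - p c A r x / r - 1 / 2 * c.comp0 τ r x * p c A r x) r := by
  choose y0 hy using fun c A => ((hb.vs_sphereGauge (c := c) A).sub (hs c A)).div_radius
    fun _ _ => sub_self 0
  have hF : ∀ c A, VSmooth T c _ _ := fun c A => (VSmooth.const (1 / 2)).mul (VSmooth.sum
    fun B => (hb.vs_inv (c := c) A B).mul (hy c B))
  have h1 : IsCov T fun c A r x => (sphereGauge b c A r x - ξ c A r x) / r := fun c e x r h hq A => by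
    have h2 := ((hb.isCov_sphereGauge.sub hξ).smul (IsInvariant.radial fun r => r⁻¹)) c e x r h hq A
    simpa only [div_eq_inv_mul] using h2
  refine ⟨_, IsVec.linSol isInvariant_tauReg ht (((isForm_resc b).raise h1).smul
    (IsInvariant.radial fun _ => 1 / 2)) hF (1 / 2) (m + 1), fun c A =>
    ⟨_, (ht c).linSol (hF c A) _ _⟩, fun c A r x hq => ?_⟩
  refine (hasDerivAt_linSol_tauReg (ht c) (hF c A) 2 (by push_cast; ring) hq).congr_deriv ?_
  ring

/-- The function `-r ζ`. -/
lemma exists_zeta (hξ : IsCov T ξ) (hs : ∀ c A, VSmooth T c (ξ c A) fun _ => 0) :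
    ∃ z : SphereChart m → ConeFn m, IsInvariant T z ∧ (∀ c, VSmooth T c (z c) fun _ => m) ∧
    ∀ c r x, (r, x) ∈ c.coneDom T → HasDerivAt (fun s => z c s x)
      ((zetaSource b ξ c r x + z c r x) / r - c.comp0 τ r x * z c r x) r := by
  have hE := fun c => (ht c).expInt 1
  choose y0 hy using fun c => (((hE c).mul (hb.vs_zetaSource (hs c))).sub
    (VSmooth.const ((m : ℝ) * (m - 1)))).div_radius fun _ _ => by ring
  have hk : ((2 * m - 1 : ℕ) : ℝ) + 1 = 2 * m := by
    exact_mod_cast Nat.sub_add_cancel (by omega : 1 ≤ 2 * m)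
  have hEi := (isInvariant_tauReg (T := T) (τ := τ)).expInt 1
  have hi : IsInvariant T fun c r x => (expInt 1 (tauReg τ c) r x * zetaSource b ξ c r x
      - m * (m - 1)) / r := by
    have h2 := (((hEi.mul (hb.isInvariant_zetaSource hξ hs)).sub
      (IsInvariant.radial fun _ => (m : ℝ) * (m - 1))).mul (IsInvariant.radial fun r => r⁻¹))
    simpa only [div_eq_mul_inv] using h2
  refine ⟨fun c r x => (expInt 1 (tauReg τ c) r x)⁻¹ * (m - (-r) * euler (2 * m - 1) _ r x),
    (hEi.comp1 fun y => y⁻¹).mul ((IsInvariant.radial fun _ => (m : ℝ)).sub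
      ((IsInvariant.radial fun r => -r).mul (hi.euler (2 * m - 1)))), fun c =>
    (((hE c).inv (fun _ _ _ => expInt_pos.ne') fun _ _ => one_ne_zero).mul ((VSmooth.const (m : ℝ)).sub
      (VSmooth.radius.neg.mul ((hy c).euler _)))).congr (fun _ _ _ => rfl) fun _ _ => by simp,
    fun c r x hq => ?_⟩
  have hr : r ≠ 0 := hq.2.1.ne'
  have h0 := (expInt_pos (l := 1) (t := tauReg τ c) (r := r) (x := x)).ne'
  refine (((ht c).hasDerivAt_expInt 1 hq).fun_inv h0 |>.fun_mul ((hasDerivAt_const r (m : ℝ)).fun_sub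
    ((hasDerivAt_id' r).fun_neg.fun_mul ((hy c).hasDerivAt_euler (2 * m - 1) hq)))).congr_deriv ?_
  rw [hk, tauReg]
  field_simp
  ring

/-- The function `g¹¹`. -/
lemma exists_g11 (hz : IsInvariant T z) (hs : ∀ c, VSmooth T c (z c) fun _ => m) :
    ∃ g : SphereChart m → ConeFn m, IsInvariant T g ∧ (∀ c, VSmooth T c (g c) fun _ => 1) ∧
    ∀ c r x, (r, x) ∈ c.coneDom T → HasDerivAt (fun s => g c s x)
      (1 / 2 * (2 * traceRound b c r x - z c r x) / r - 1 / 2 * c.comp0 τ r x * g c r x) r := by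
  have hF : ∀ c, VSmooth T c _ _ := fun c => (VSmooth.const (1 / 2)).mul
    (((VSmooth.const 2).mul (hb.vs_traceRound c)).sub (hs c))
  have hk : ((m - 1 : ℕ) : ℝ) + 1 = m := by exact_mod_cast Nat.sub_add_cancel hm
  have hm0 : (m : ℝ) ≠ 0 := by positivity
  refine ⟨_, isInvariant_tauReg.linSol ((IsInvariant.radial fun _ => 1 / 2).mul
    (((IsInvariant.radial fun _ => 2).mul hb.isInvariant_traceRound).sub hz)) (1 / 2) (m - 1),
    fun c => ((ht c).linSol (hF c) _ _).congr (fun _ _ _ => rfl) fun _ _ => ?_, fun c r x hq => ?_⟩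
  · rw [hk]; field_simp; ring
  · refine (hasDerivAt_linSol_tauReg (ht c) (hF c) 0 (by rw [hk]; ring) hq).congr_deriv ?_
    ring

end IsVMetric

/-- A trace of the given form is Lorentzian. A vector `u` with `dx⁰(u) = 1`, `dx¹(u)` very negative
and without component along the spheres is timelike, and `ḡ` is positive on its complement. -/
lemma ConeMetric.IsMetric.isLorentz {D : ConeMetric m} (hD : D.IsMetric T) {y : Space m}
    (hy : y ∈ cone m T) : IsLorentz (D.form y) := by
  have hy0 : 0 < ‖y‖ := norm_pos_iff.2 hy.1
  have hn := hD.nu0_pos y hy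
  have hyy : inner ℝ y y = ‖y‖ ^ 2 := real_inner_self_eq_norm_sq y
  have hg1 : ∀ v, D.gt y y v = 0 := fun v => by rw [hD.radial y hy]; rfl
  have hg2 : ∀ v, D.gt y v y = 0 := fun v => by rw [hD.symm y hy, hg1]
  obtain ⟨β, hβ⟩ : ∃ β : ℝ, D.g00 y + 2 * D.nu0 y * β < 0 := by
    refine ⟨-(|D.g00 y| + 1) / (2 * D.nu0 y), ?_⟩
    rw [mul_div_cancel₀ _ (by positivity)]
    linarith [le_abs_self (D.g00 y)]
  have h1 : dx1 y (β - 1, (β / ‖y‖) • y) = β := by rw [dx1, real_inner_smul_right, hyy]; field_simp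
  have h2 : dx0 y (β - 1, (β / ‖y‖) • y) = 1 := by rw [dx0, h1]; ring
  have hform : ∀ v : Spacetime m, D.form y (β - 1, (β / ‖y‖) • y) v
      = D.g00 y * dx0 y v + D.nu0 y * (dx1 y v + β * dx0 y v) + D.nu y v.2 := fun v => by
    rw [form, h1, h2, map_smul, hD.nu_radial y hy, map_smul, smul_apply, hg1]
    simp
  refine ⟨(β - 1, (β / ‖y‖) • y), ?_, fun v hv h => ?_⟩
  · rw [hform, h1, h2, map_smul, hD.nu_radial y hy, smul_zero]; linarith
  rw [hform] at h
  set w := v.2 - (dx1 y v / ‖y‖) • y with hw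
  have hw1 : inner ℝ y w = 0 := by
    rw [hw, inner_sub_right, real_inner_smul_right, hyy, dx1]; field_simp; ring
  have hw2 : D.gt y v.2 v.2 = D.gt y w w := by
    rw [show v.2 = w + (dx1 y v / ‖y‖) • y by rw [hw]; abel]
    simp [hg1, hg2]
  have h3 : D.form y v v = -(D.g00 y + 2 * D.nu0 y * β) * dx0 y v ^ 2 + D.gt y w w := by
    rw [form, hw2]; linear_combination 2 * dx0 y v * h
  rw [h3]
  have h4 := sq_nonneg (dx0 y v)
  by_cases hw0 : w = 0
  · have h5 : dx0 y v ≠ 0 := fun h5 => by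
      have hv2 : v.2 = (dx1 y v / ‖y‖) • y := sub_eq_zero.1 hw0
      have h6 : dx1 y v = 0 := by
        rw [h5, hv2, map_smul, hD.nu_radial y hy] at h
        simpa [hn.ne', ← hv2] using h
      refine hv (Prod.ext ?_ (by rw [hv2, h6]; simp))
      rw [dx0, h6] at h5
      simpa using h5
    rw [hw0]
    simpa using mul_pos (neg_pos.2 hβ) (sq_pos_of_ne_zero h5)
  · have := hD.pos y hy w hw0 hw1
    nlinarith [mul_nonneg (neg_pos.2 hβ).le h4]

end Hierarchy

/-! ### The constraint operators of the solution -/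

section Constraints

variable {τ : Space m → ℝ} {D : ConeMetric m} {ξ p : SphereChart m → Fin m → ConeFn m}
  {n z g : SphereChart m → ConeFn m}
local notation "𝔥" => c.comp2 D.gt r x

lemma IsVMetric.deriv_comp2 {b : SForm m} (hb : IsVMetric T b) (hq : onCone)
    (A B : Fin m) : deriv (fun s => c.comp2 b s x A B) r
      = 2 * ∑ C, c.comp2 b r x B C * chi (c.comp2 b) r x A C := by
  have h1 : c.comp2 b r x * chiMat (c.comp2 b) r x = (1 / 2 : ℝ) •
      (of fun A B => deriv (fun s => c.comp2 b s x A B) r).transpose := by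
    rw [chiMat_eq, mul_smul_comm, ← mul_assoc, mul_nonsing_inv _ (hb.metricNear hq).isUnit, one_mul]
  have h2 : ∑ C, c.comp2 b r x B C * chi (c.comp2 b) r x A C
      = 1 / 2 * deriv (fun s => c.comp2 b s x A B) r := congrFun (congrFun h1 B) A
  rw [h2]; ring

variable (hb : IsVMetric T D.gt)
  (hτ : ∀ (c : SphereChart m) r x, (r, x) ∈ c.coneDom T → D.tau c r x = c.comp0 τ r x)
  (h0 : ∀ (c : SphereChart m) r x, (r, x) ∈ c.coneDom T → c.comp0 D.nu0 r x = (n c r x)⁻¹)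
  (hn : ∀ (c : SphereChart m) r x, (r, x) ∈ c.coneDom T → 0 < n c r x ∧
  HasDerivAt (fun s => n c s x)
  (1 / 2 * traceRound D.gt c r x / r - 1 / 2 * c.comp0 τ r x * n c r x) r)
include hτ h0 hn

lemma hasDerivAt_nu0 (hq : (r, x) ∈ c.coneDom T) : HasDerivAt (fun s => c.comp0 D.nu0 s x)
    (1 / 2 * (D.W1 c r x + c.comp0 τ r x) * c.comp0 D.nu0 r x) r := by
  have hr : 0 < r := hq.2.1
  obtain ⟨h1, h2⟩ := hn c r x hq
  refine ((h2.fun_inv h1.ne').congr_of_eventuallyEq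
    ((eventually_fst (eventually_coneDom hq)).mono fun s hs => h0 c s x hs)).congr_deriv ?_
  rw [ConeMetric.W1, W0_eq D hr, h0 c r x hq]
  field_simp
  ring

lemma kappa_eq_zero (hq : (r, x) ∈ c.coneDom T) : D.kappa c r x = 0 := by
  have h1 : c.comp0 D.nu0 r x ≠ 0 := by rw [h0 c r x hq]; exact (inv_pos.2 (hn c r x hq).1).ne'
  rw [ConeMetric.kappa, (hasDerivAt_nu0 hτ h0 hn hq).deriv, hτ c r x hq]
  field_simp
  ring

variable (hν : ∀ (c : SphereChart m) r x, (r, x) ∈ c.coneDom T → ∀ A,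
  c.comp1 D.nu r x A = ∑ B, c.comp2 D.gt r x A B * (p c B r x * (n c r x)⁻¹))
  (hp : ∀ c A r x, (r, x) ∈ c.coneDom T → HasDerivAt (fun s => p c A s x)
  (1 / 2 * (∑ B, (resc D.gt c r x)⁻¹ A B * ((sphereGauge D.gt c B r x - ξ c B r x) / r)) / r
  - p c A r x / r - 1 / 2 * c.comp0 τ r x * p c A r x) r)
include hb hν hp

lemma xi_eq (hq : (r, x) ∈ c.coneDom T) (A : Fin m) : D.xi c r x A = ξ c A r x := by
  have hr : 0 < r := hq.2.1
  have hr0 := hr.ne'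
  obtain ⟨h1, h2⟩ := hn c r x hq
  have hn0 := h1.ne'
  set Y : Fin m → ℝ := fun B => (sphereGauge D.gt c B r x - ξ c B r x) / r with hY
  set Z : Fin m → ℝ := fun A => ∑ B, (resc D.gt c r x)⁻¹ A B * Y B with hZ
  set N := n c r x with hN
  have hdh := hb.deriv_comp2 hq
  have hd : HasDerivAt (fun s => c.comp1 D.nu s x A) (∑ B, ((2 * ∑ C, 𝔥 B C * chi (c.comp2 D.gt) r x A C)
      * (p c B r x * N⁻¹) + 𝔥 A B * (((1 / 2 * Z B / r - p c B r x / r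
        - 1 / 2 * c.comp0 τ r x * p c B r x)) * N⁻¹ + p c B r x *
        (-(1 / 2 * traceRound D.gt c r x / r - 1 / 2 * c.comp0 τ r x * N) / N ^ 2)))) r := by
    refine (HasDerivAt.fun_sum fun B _ => ((hb.differentiableAt hq A B).hasDerivAt.congr_deriv
      (hdh A B)).fun_mul ((hp c B r x hq).fun_mul (h2.fun_inv hn0))).congr_of_eventuallyEq
      ((eventually_fst (eventually_coneDom hq)).mono fun s hs => hν c s x hs A)
  have hchi : ∑ B, (2 * ∑ C, 𝔥 B C * chi (c.comp2 D.gt) r x A C) * (p c B r x * N⁻¹)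
      = 2 * ∑ B, c.comp1 D.nu r x B * chi (c.comp2 D.gt) r x A B := by
    simp only [hν c r x hq, sum_mul, mul_sum]
    rw [sum_comm]
    refine sum_ext₂ fun B C => ?_
    rw [(hb.metricNear hq).symm_at C B]; ring
  have hYA : ∑ B, 𝔥 A B * Z B = r ^ 2 * Y A := by
    have h3 : (resc D.gt c r x).mulVec ((resc D.gt c r x)⁻¹.mulVec Y) = Y := by
      rw [mulVec_mulVec, mul_nonsing_inv _
        (isUnit_iff_ne_zero.2 (hb.resc_pos hq).det_pos.ne'), Matrix.one_mulVec]
    have h4 : ∑ B, resc D.gt c r x A B * Z B = Y A := congrFun h3 A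
    simp only [comp2_eq_smul_resc D.gt hr, Matrix.smul_apply, smul_eq_mul, mul_assoc, ← mul_sum, h4]
  have hsum : ∑ B, 𝔥 A B * (((1 / 2 * Z B / r - p c B r x / r - 1 / 2 * c.comp0 τ r x * p c B r x)) * N⁻¹
        + p c B r x * (-(1 / 2 * traceRound D.gt c r x / r - 1 / 2 * c.comp0 τ r x * N) / N ^ 2))
      = 1 / 2 * N⁻¹ / r * (∑ B, 𝔥 A B * Z B)
        - (1 / r + 1 / 2 * traceRound D.gt c r x / r * N⁻¹) * ∑ B, 𝔥 A B * (p c B r x * N⁻¹) := by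
    simp only [mul_sum, ← sum_sub_distrib]
    refine sum_ext fun B => ?_
    field_simp
    ring
  have hG : ∑ B, ∑ C, ∑ E, 𝔥 A B * 𝔥⁻¹ C E * (Γ c.round B C E x
      - Γ (c.comp2 D.gt r) B C E x) = sphereGauge D.gt c A r x := by
    simp only [sphereGauge, waveGaugeLow, waveGauge, mul_sum, ← sum_neg_distrib]
    refine sum_ext₂ fun B C => sum_ext fun E => ?_
    ring
  rw [ConeMetric.xi, hd.deriv, sum_add_distrib, hchi, hsum, hYA, ← hν c r x hq A, hG, W0_eq D hr,
    h0 c r x hq, inv_inv, hY]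
  field_simp
  ring

variable (hξ : ∀ c A r x, (r, x) ∈ c.coneDom T → HasDerivAt (fun s => ξ c A s x)
  (2 * xiSource D.gt τ c A r x - c.comp0 τ r x * ξ c A r x) r)

include hξ in
lemma CA_eq_zero (hq : (r, x) ∈ c.coneDom T) (A : Fin m) : D.CA c r x A = 0 := by
  have hev := eventually_coneDom hq
  have h1 : deriv (fun s => D.xi c s x A) r = 2 * xiSource D.gt τ c A r x - c.comp0 τ r x * ξ c A r x :=
    (((hξ c A r x hq).congr_of_eventuallyEq ((eventually_fst hev).mono fun s hs =>
      xi_eq hb hτ h0 hn hν hp hs A))).deriv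
  have h2 : pd A (fun z => D.tau c r z + D.kappa c r z) x = pd A (c.comp0 τ r) x :=
    pd_congr A ((eventually_snd hev).mono fun y hy => by
      beta_reduce; rw [kappa_eq_zero hτ h0 hn hy, hτ c r y hy, add_zero])
  have h3 := matDiv_apply (c.comp2 D.gt r) (chiMat (c.comp2 D.gt) r) A x
  simp only [chiMat, of_apply] at h3
  rw [ConeMetric.CA, h1, h2, ← h3, xi_eq hb hτ h0 hn hν hp hq, hτ c r x hq]
  rw [xiSource]
  ring

variable (hg : ∀ (c : SphereChart m) r x, (r, x) ∈ c.coneDom T → c.comp0 D.g00 r x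
  = ∑ A, c.comp1 D.nu r x A * (p c A r x * (n c r x)⁻¹) - (n c r x)⁻¹ ^ 2 * g c r x)
  (hgd : ∀ c r x, (r, x) ∈ c.coneDom T → HasDerivAt (fun s => g c s x)
  (1 / 2 * (2 * traceRound D.gt c r x - z c r x) / r - 1 / 2 * c.comp0 τ r x * g c r x) r)

include hg in
lemma g11_eq (hq : (r, x) ∈ c.coneDom T) : D.g11 c r x = g c r x := by
  have hn0 := (hn c r x hq).1.ne'
  have h1 : ∑ A, ∑ B, 𝔥⁻¹ A B * c.comp1 D.nu r x A * c.comp1 D.nu r x B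
      = ∑ A, c.comp1 D.nu r x A * (p c A r x * (n c r x)⁻¹) := by
    have h2 : 𝔥⁻¹.mulVec (c.comp1 D.nu r x) = fun A => p c A r x * (n c r x)⁻¹ := by
      rw [show c.comp1 D.nu r x = (𝔥).mulVec fun A => p c A r x * (n c r x)⁻¹ from
        funext fun A => hν c r x hq A, mulVec_mulVec,
        nonsing_inv_mul _ (hb.metricNear hq).isUnit, Matrix.one_mulVec]
    refine sum_ext fun A => ?_
    rw [← congrFun h2 A, Matrix.mulVec, dotProduct, mul_sum]
    exact sum_ext fun B => by ring
  rw [ConeMetric.g11, h1, hg c r x hq, h0 c r x hq]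
  field_simp
  ring

include hg hgd in
lemma zeta_eq (hq : (r, x) ∈ c.coneDom T) : D.zeta c r x = -(z c r x / r) := by
  have hr : 0 < r := hq.2.1
  have h1 := ((hgd c r x hq).congr_of_eventuallyEq ((eventually_fst (eventually_coneDom
    hq)).mono fun s hs => g11_eq hb hτ h0 hn hν hp hg hs)).deriv
  rw [ConeMetric.zeta, h1, kappa_eq_zero hτ h0 hn hq, hτ c r x hq, W0_eq D hr,
    g11_eq hb hτ h0 hn hν hp hg hq]
  field_simp
  ring

variable (hs : ∀ c A, VSmooth T c (ξ c A) fun _ => 0)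
  (hzd : ∀ c r x, (r, x) ∈ c.coneDom T → HasDerivAt (fun s => z c s x)
  ((zetaSource D.gt ξ c r x + z c r x) / r - c.comp0 τ r x * z c r x) r)

include hg hgd hs hzd in
lemma C0_eq_zero (hq : (r, x) ∈ c.coneDom T) : D.C0 c r x = 0 := by
  have hr : 0 < r := hq.2.1
  have hev := eventually_coneDom hq
  have h1 := (((hzd c r x hq).fun_div (hasDerivAt_id' r) hr.ne').fun_neg.congr_of_eventuallyEq
    ((eventually_fst hev).mono fun s hs => zeta_eq hb hτ h0 hn hν hp hg hgd hs)).deriv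
  have hxi := fun A => xi_eq hb hτ h0 hn hν hp hq A
  have h2 : ∀ A, pd A (fun z => D.xiUp c r z A) x
      = pd A (fun z => ∑ B, (c.comp2 D.gt r z)⁻¹ A B * ξ c B r z) x := fun A =>
    pd_congr A ((eventually_snd hev).mono fun y hy => by
      simp only [ConeMetric.xiUp, xi_eq hb hτ h0 hn hν hp hy])
  have h3 := (hb.metricNear hq).div_eq (w := fun A => ξ c A r) fun A => (hs c A).smoothNear hq
  have h4 : ∑ A, ξ c A r x * ∑ B, 𝔥⁻¹ A B * ξ c B r x
      = (r ^ 2)⁻¹ * ∑ A, ξ c A r x * ∑ B, (resc D.gt c r x)⁻¹ A B * ξ c B r x := by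
    simp only [inv_comp2_eq D.gt hr, mul_sum]
    exact sum_ext₂ fun A B => by ring
  simp only [ConeMetric.C0, h1, kappa_eq_zero hτ h0 hn hq, hτ c r x hq, h2,
    zeta_eq hb hτ h0 hn hν hp hg hgd hq]
  simp only [ConeMetric.xiUp, hxi, h3, h4]
  rw [zetaSource, covDiv]
  field_simp
  ring

end Constraints

/-! ### Solvability of the hierarchy, and uniqueness of `ν₀` -/

section Solvability

variable {T T' : ℝ≥0∞} {γ : SForm m} {τ φ : Space m → ℝ}

/-- Invariant chart representations, smooth up to the vertex, come from a function on the cone. -/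
lemma exists_scalarField {a : SphereChart m → ConeFn m} {a0 : ℝ} (ha : IsInvariant T a)
    (hs : ∀ c, VSmooth T c (a c) fun _ => a0) : ∃ f : Space m → ℝ, ConeSmooth T f a0 ∧
      ∀ (c : SphereChart m) r x, (r, x) ∈ c.coneDom T → c.comp0 f r x = a c r x :=
  ⟨glue a, coneSmooth_glue ha hs, fun _ _ _ hq => glue_apply ha hq⟩

/-- The regular solutions of the hierarchy, glued; they have the required limits at the vertex. -/
lemma IsExpansion.exists_solution (hm : 1 ≤ m) (hT : 0 < T') (hTT : T' ≤ T) (hγ : IsFreeData T γ)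
    (hτ : IsExpansion T' γ τ) : ∃ (φ : Space m → ℝ) (D : ConeMetric m), IsSolution T' γ τ φ D := by
  have hv := hγ.isVMetric.mono hTT
  obtain ⟨φ, hφ, hb, hmean⟩ := hτ.exists_conformalFactor hm hT hv
  choose t0 ht using fun c => hτ.vs_tauReg hm hT hv c
  obtain ⟨n, hni, hns, hn⟩ := hb.exists_nuInv hm ht
  obtain ⟨ξ, hξc, hξs, hξ⟩ := hb.exists_xi hm ht
  obtain ⟨p, hpv, hps, hp⟩ := hb.exists_shift hm ht hξc hξs
  obtain ⟨z, hzi, hzs, hz⟩ := hb.exists_zeta hm ht hξc hξs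
  obtain ⟨g, hgi, hgs, hg⟩ := hb.exists_g11 hm ht hzi hzs
  choose p0 hps using hps
  have hNi := hni.comp1 fun y => y⁻¹
  have hNs := fun c => (hns c).inv (fun r x hq => (hn c r x hq).1.ne') fun _ _ => one_ne_zero
  have hqv := hpv.smul hNi
  have hqs := fun c A => (hNs c).mul (hps c A)
  have hμ := (isForm_resc fun y => φ y ^ 2 • γ y).lower hqv
  have hμs := fun c A => VSmooth.sum fun B => (hb.vs c A B).mul (hqs c B)
  obtain ⟨nu0, hnu0s, hnu0⟩ := exists_scalarField hNi fun c => (hNs c).congr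
    (fun _ _ _ => rfl) fun _ _ => inv_one.symm
  obtain ⟨ν, hνs, hν0, hν0', hνr, hν⟩ := exists_covectorField hT hμ fun c A => ⟨_, hμs c A⟩
  obtain ⟨g00, hg00s, hg00⟩ := exists_scalarField (a0 := -1)
    (((IsInvariant.radial fun r => r * r).mul (hμ.pair hqv)).sub ((hNi.mul hNi).mul hgi))
    fun c => (((VSmooth.radius.mul VSmooth.radius).mul (VSmooth.sum fun A =>
      (hμs c A).mul (hqs c A))).sub (((hNs c).mul (hNs c)).mul (hgs c))).congr
      (fun _ _ _ => rfl) fun _ _ => by norm_num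
  set D : ConeMetric m := ⟨fun y => φ y ^ 2 • γ y, nu0, ν, g00⟩
  have htau : ∀ (c : SphereChart m) r x, (r, x) ∈ c.coneDom T' → D.tau c r x = c.comp0 τ r x :=
    fun c r x hq => (hmean c r x hq).1
  have hν' : ∀ (c : SphereChart m) r x, (r, x) ∈ c.coneDom T' → ∀ A,
      c.comp1 D.nu r x A = ∑ B, c.comp2 D.gt r x A B * (p c B r x * (n c r x)⁻¹) :=
    fun c r x hq A => by
      have hr : 0 < r := hq.2.1
      rw [hν c r x hq A, mul_sum]
      refine sum_ext fun B => ?_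
      rw [show c.comp2 D.gt r x A B = r ^ 2 * resc D.gt c r x A B by
        rw [comp2_eq_smul_resc D.gt hr, Matrix.smul_apply, smul_eq_mul]]
      ring
  have hg' : ∀ (c : SphereChart m) r x, (r, x) ∈ c.coneDom T' → c.comp0 D.g00 r x
      = ∑ A, c.comp1 D.nu r x A * (p c A r x * (n c r x)⁻¹) - (n c r x)⁻¹ ^ 2 * g c r x :=
    fun c r x hq => by
      have h1 : ∀ A, c.comp1 D.nu r x A = _ := hν c r x hq
      rw [show c.comp0 D.g00 r x = _ from hg00 c r x hq]
      simp only [h1, mul_assoc, ← mul_sum, pow_two, mul_comm (p c _ r x)]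
  have hpos : ∀ y ∈ cone m T', 0 < nu0 y := fun y hy => by
    obtain ⟨e, -, r, x, hq, rfl⟩ := exists_chart hy
    exact (inv_pos.2 (hn _ r x hq).1).trans_eq (hnu0 _ r x hq).symm
  have hsub : ∀ y ∈ cone m T', y ∈ cone m T := fun y hy => ⟨hy.1, hy.2.trans_le hTT⟩
  have hmet : D.IsMetric T' :=
    { symm := fun y hy v w => congrArg (φ y ^ 2 * ·) (hγ.symm y (hsub y hy) v w)
      radial := fun y hy => by
        change φ y ^ 2 • γ y y = 0
        rw [hγ.radial y (hsub y hy), smul_zero]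
      pos := fun y hy v hv h0 => mul_pos (pow_pos (hφ.pos y hy) 2) (hγ.pos y (hsub y hy) v hv h0)
      nu0_pos := hpos
      nu_radial := hνr }
  refine ⟨φ, D, hτ, hφ, fun _ _ => rfl, ⟨hnu0s.contDiffOn, fun y hy => (hpos y hy).ne',
    hnu0s.tendsto hT, fun c x hx r hr ht => ?_⟩, hνs, hν0, hν0', hg00s.contDiffOn, ?_,
    hg00s.tendsto_radial hT, hmet, fun y hy => hmet.isLorentz hy, fun c =>
    ⟨fun x hx r hr ht => ?_, fun x hx r hr ht A =>
      CA_eq_zero hb htau hnu0 hn hν' hp hξ (T := T') ⟨hx, hr, ht⟩ A, fun x hx r hr ht =>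
      C0_eq_zero hb htau hnu0 hn hν' hp hg' hg hξs hz (T := T') ⟨hx, hr, ht⟩⟩⟩
  · have hq : (r, x) ∈ c.coneDom T' := ⟨hx, hr, ht⟩
    have h0 : c.comp0 D.nu0 r x ≠ 0 := (hpos _ (mem_cone hq)).ne'
    beta_reduce
    rw [(hasDerivAt_nu0 htau hnu0 hn hq).deriv]
    field_simp
    ring
  · simpa using (hg00s.tendsto hT).add_const 1
  · have hq : (r, x) ∈ c.coneDom T' := ⟨hx, hr, ht⟩
    have h1 : deriv (fun s => D.tau c s x) r = deriv (fun s => c.comp0 τ s x) r :=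
      Filter.EventuallyEq.deriv_eq ((eventually_fst (eventually_coneDom hq)).mono
        fun s hs => htau c s x hs)
    have h2 := hτ.eqn c x hx r hr ht
    have h3 : shearSq (c.comp2 D.gt) r x = shearSq (c.comp2 γ) r x := (hmean c r x hq).2
    beta_reduce
    rw [ConeMetric.C1, h1, htau c r x hq, kappa_eq_zero htau hnu0 hn hq, h3]
    linarith

lemma comp2_congr {h h' : SForm m} (hh : ∀ y ∈ cone m T, h y = h' y)
    (hq : (r, x) ∈ c.coneDom T) : c.comp2 h r x = c.comp2 h' r x := by
  ext A B
  simp only [SphereChart.comp2, of_apply, hh _ (mem_cone hq)]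

lemma IsNuZero.hasDerivAt_inv {D : ConeMetric m} (hD : IsNuZero T τ D) (hq : (r, x) ∈ c.coneDom T) :
    HasDerivAt (fun s => (c.comp0 D.nu0 s x)⁻¹)
      (-(1 / 2) * (D.W0 c r x + c.comp0 τ r x * (c.comp0 D.nu0 r x)⁻¹)) r := by
  have h0 : c.comp0 D.nu0 r x ≠ 0 := hD.ne_zero _ (mem_cone hq)
  have h1 := hD.eqn c x hq.1 r hq.2.1 hq.2.2
  refine ((hasDerivAt_comp0 hD.smooth hq).fun_inv h0).congr_deriv ?_
  beta_reduce at h1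
  rw [ConeMetric.W1] at h1
  set d := deriv (fun s => c.comp0 D.nu0 s x) r
  have h2 : d = c.comp0 D.nu0 r x * ((1 / 2) * (c.comp0 D.nu0 r x * D.W0 c r x + c.comp0 τ r x)) := by
    rw [← sub_eq_zero.1 h1, mul_inv_cancel_left₀ h0]
  rw [h2]
  field_simp

/-- The difference `d` of two solutions `1 / ν₀` satisfies `d' = -τ d / 2`, so that `d²` is
nonincreasing. -/
lemma IsNuZero.unique {D D' : ConeMetric m} (hτ : ∀ y ∈ cone m T, 0 < τ y)
    (hDD : ∀ y ∈ cone m T, D.gt y = D'.gt y) (hD : IsNuZero T τ D) (hD' : IsNuZero T τ D') :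
    ∀ y ∈ cone m T, D.nu0 y = D'.nu0 y := fun y hy => by
  obtain ⟨e, -, b, x, hb, rfl⟩ := exists_chart hy
  set c := graphChart e
  have hray : ∀ r ∈ Ioc 0 b, (r, x) ∈ c.coneDom T := fun r hr => coneDom_of_le hb hr
  set d : ℝ → ℝ := fun r => (c.comp0 D.nu0 r x)⁻¹ - (c.comp0 D'.nu0 r x)⁻¹ with hd
  have hdd : ∀ r ∈ Ioc 0 b, HasDerivAt d (-(c.comp0 τ r x / 2) * d r) r := fun r hr => by
    refine ((hD.hasDerivAt_inv (hray r hr)).fun_sub (hD'.hasDerivAt_inv (hray r hr))).congr_deriv ?_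
    have h1 : D.W0 c r x = D'.W0 c r x := by
      rw [ConeMetric.W0, ConeMetric.W0, comp2_congr hDD (hray r hr)]
    rw [h1]
    simp only [hd]
    ring
  have hlim : Tendsto d (𝓝[>] 0) (𝓝 0) := by
    have h1 := tendsto_smul_θ hb
    have h2 := ((hD.vertex.comp h1).inv₀ one_ne_zero).sub ((hD'.vertex.comp h1).inv₀ one_ne_zero)
    rwa [sub_self] at h2
  exact inv_injective (sub_eq_zero.1 (eq_zero_of_hasDerivAt (d := d) hb.2.1 hdd
    (fun r hr => div_nonneg (hτ _ (mem_cone (hray r hr))).le zero_le_two) hlim))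

end Solvability

/-! ### Existence of the expansion -/

lemma le_of_hasDerivAt_nonneg {F F' : ℝ → ℝ} {b L : ℝ} (hF : ∀ r ∈ Ioc 0 b, HasDerivAt F (F' r) r)
    (h : ∀ r ∈ Set.Ioo 0 b, 0 ≤ F' r) (hl : Tendsto F (𝓝[>] 0) (𝓝 L)) :
    ∀ r ∈ Ioc 0 b, L ≤ F r := fun r hr => by
  have hmono : MonotoneOn F (Ioc 0 b) := monotoneOn_of_hasDerivWithinAt_nonneg (convex_Ioc 0 b)
    (fun r hr => (hF r hr).continuousAt.continuousWithinAt)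
    (fun r hr => (hF r (interior_subset hr)).hasDerivWithinAt) fun r hr => h r (by simpa using hr)
  refine le_of_tendsto hl ?_
  filter_upwards [Ioc_mem_nhdsGT hr.1] with s hs using hmono ⟨hs.1, hs.2.trans hr.2⟩ hr hs.2

/-- If `u'' = -q u` with `u = 0`, `u' = 1` at the origin and `q ≥ 0`, then `u' ≥ 1 - ∫ s q`; here
`J` is the integral. -/
lemma radialSol_pos {u U q J : ℝ → ℝ} {b : ℝ} (hb : 0 < b)
    (hu : ∀ r ∈ Ioc 0 b, HasDerivAt u (U r) r) (hU : ∀ r ∈ Ioc 0 b, HasDerivAt U (-(q r * u r)) r)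
    (hJ : ∀ r ∈ Ioc 0 b, HasDerivAt J (r * q r) r) (hq : ∀ r ∈ Ioc 0 b, 0 ≤ q r)
    (u0 : Tendsto u (𝓝[>] 0) (𝓝 0)) (U0 : Tendsto U (𝓝[>] 0) (𝓝 1)) (J0 : Tendsto J (𝓝[>] 0) (𝓝 0))
    (hJb : ∀ r ∈ Ioc 0 b, J r < 1) : 0 < u b ∧ 0 < U b := by
  have key : ∀ r ∈ Ioc 0 b, 0 < U r := by
    by_contra! hc
    obtain ⟨r0, hr0, hUr0⟩ := hc
    obtain ⟨d, hd, hdU⟩ := mem_nhdsGT_iff_exists_Ioc_subset.1 (U0.eventually (lt_mem_nhds one_pos))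
    have hmem : ∀ r ∈ Icc d b, r ∈ Ioc 0 b := fun r hr => ⟨lt_of_lt_of_le hd hr.1, hr.2⟩
    have hK : IsCompact (Icc d b ∩ U ⁻¹' Set.Iic 0) :=
      isCompact_Icc.of_isClosed_subset (ContinuousOn.preimage_isClosed_of_isClosed
        (fun r hr => (hU r (hmem r hr)).continuousAt.continuousWithinAt) isClosed_Icc isClosed_Iic)
        Set.inter_subset_left
    have hne : r0 ∈ Icc d b ∩ U ⁻¹' Set.Iic 0 := ⟨⟨(not_le.1 fun h =>
      absurd (hdU ⟨hr0.1, h⟩) (not_lt.2 hUr0)).le, hr0.2⟩, hUr0⟩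
    -- the first zero of `U`
    obtain ⟨a, ⟨ha, hUa⟩, hmin⟩ := hK.exists_isLeast ⟨r0, hne⟩
    have ha0 := hmem a ha
    have hsub : ∀ r ∈ Ioc 0 a, r ∈ Ioc 0 b := fun r hr => ⟨hr.1, hr.2.trans ha.2⟩
    have hpos : ∀ r ∈ Set.Ioo 0 a, 0 ≤ U r := fun r hr => by
      by_contra! hr'
      rcases le_total r d with h | h
      · exact absurd (hdU ⟨hr.1, h⟩) (not_lt.2 hr'.le)
      · exact absurd (hmin ⟨⟨h, hr.2.le.trans ha.2⟩, hr'.le⟩) (not_le.2 hr.2)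
    have h1 := le_of_hasDerivAt_nonneg (fun r hr => hu r (hsub r hr)) hpos u0
    have h2 : ∀ r ∈ Ioc 0 a, -1 ≤ -U r := le_of_hasDerivAt_nonneg
      (fun r hr => (hU r (hsub r hr)).fun_neg) (fun r hr => by
        have hr' : r ∈ Ioc 0 a := ⟨hr.1, hr.2.le⟩
        linarith [mul_nonneg (hq r (hsub r hr')) (h1 r hr')]) U0.neg
    have h0 : Tendsto (fun r : ℝ => r) (𝓝[>] 0) (𝓝 0) := nhdsWithin_le_nhds
    have h3 := le_of_hasDerivAt_nonneg (F := fun r => r - u r) (b := a) (L := 0 - 0)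
      (fun r hr => (hasDerivAt_id' r).fun_sub (hu r (hsub r hr)))
      (fun r hr => by linarith [h2 r ⟨hr.1, hr.2.le⟩]) (h0.sub u0)
    have h4 := le_of_hasDerivAt_nonneg (F := fun r => U r + J r) (b := a) (L := 1 + 0)
      (fun r hr => (hU r (hsub r hr)).fun_add (hJ r (hsub r hr)))
      (fun r hr => by
        have hr' : r ∈ Ioc 0 a := ⟨hr.1, hr.2.le⟩
        nlinarith [mul_nonneg (hq r (hsub r hr')) (show 0 ≤ r - u r by linarith [h3 r hr'])])
      (U0.add J0) a ⟨ha0.1, le_rfl⟩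
    have h5 := hJb a ha0
    have h6 : U a ≤ 0 := hUa
    linarith
  refine ⟨?_, key b ⟨hb, le_rfl⟩⟩
  have h1 := le_of_hasDerivAt_nonneg hu (fun r hr => (key r ⟨hr.1, hr.2.le⟩).le) u0
  have h2 : StrictMonoOn u (Ioc 0 b) := strictMonoOn_of_hasDerivWithinAt_pos (convex_Ioc 0 b)
    (fun r hr => (hu r hr).continuousAt.continuousWithinAt)
    (fun r hr => (hu r (interior_subset hr)).hasDerivWithinAt) fun r hr => key r (interior_subset hr)
  exact (h1 (b / 2) ⟨by positivity, by linarith⟩).trans_lt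
    (h2 ⟨by positivity, by linarith⟩ ⟨hb, le_rfl⟩ (by linarith))

section Expansion

variable {γ : SForm m} {f : ConeFn m} {f0 : (Fin m → ℝ) → ℝ}

/-- `tr (h⁻¹ S h⁻¹ S) ≥ 0` for symmetric `S` and positive `h`. -/
lemma trace_inv_mul_sq_nonneg {h S : Matrix (Fin m) (Fin m) ℝ} (hh : h.PosDef)
    (hS : S.transpose = S) : 0 ≤ (h⁻¹ * S * (h⁻¹ * S)).trace := by
  have h1 := hh.inv.posSemidef.mul_mul_conjTranspose_same S
  rw [Matrix.conjTranspose_eq_transpose_of_trivial, hS] at h1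
  have h2 := (hh.inv.posSemidef.hadamard h1.transpose).dotProduct_mulVec_nonneg 1
  rw [mul_assoc, ← mul_assoc S]
  generalize S * h⁻¹ * S = M at *
  simpa [dotProduct, Matrix.mulVec, Matrix.trace, mul_apply] using h2

lemma IsVMetric.shearSq_nonneg (hγ : IsVMetric T γ) (hq : onCone) :
    0 ≤ shearSq (c.comp2 γ) r x := by
  set h := c.comp2 γ r x with hh
  set P : Matrix (Fin m) (Fin m) ℝ := of fun A B => deriv (fun s => c.comp2 γ s x A B) r with hP
  have hPs : P.transpose = P := by
    ext A B
    exact Filter.EventuallyEq.deriv_eq ((eventually_fst (eventually_coneDom hq)).mono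
      fun s hs => (hγ.pos c s x hs).1.apply A B)
  have hhs : h.transpose = h := (hγ.pos c r x hq).1
  set S : Matrix (Fin m) (Fin m) ℝ := (1 / 2 : ℝ) • P - (meanCurv (c.comp2 γ) r x / m) • h with hS
  have h1 : h⁻¹ * S = of fun B A => shear (c.comp2 γ) r x A B := by
    have h2 := chiMat_eq (r := r) (x := x) (c.comp2 γ)
    rw [← hP, hPs, ← hh] at h2
    rw [hS, mul_sub, mul_smul_comm, ← h2, mul_smul_comm,
      nonsing_inv_mul _ (hγ.metricNear hq).isUnit]
    ext B A
    simp [shear, chiMat, one_apply, eq_comm]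
  have h3 := trace_inv_mul_sq_nonneg (S := S) (hγ.pos c r x hq)
    (by rw [hS, Matrix.transpose_sub, Matrix.transpose_smul, Matrix.transpose_smul, hPs, hhs])
  rw [← hh, h1] at h3
  refine h3.trans_eq ?_
  simp only [Matrix.trace, Matrix.diag_apply, mul_apply, of_apply, shearSq]
  exact sum_ext₂ fun A B => mul_comm _ _

/-- `r² euler 3 f r` is the integral `∫₀^r s f`. -/
lemma VSmooth.hasDerivAt_moment (hf : VSmooth T c f f0) (hq : onCone) :
    HasDerivAt (fun s => s ^ 2 * NullCone.euler 3 f s x) (r * f r x) r := by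
  have hr : r ≠ 0 := hq.2.1.ne'
  refine ((hasDerivAt_pow 2 r).fun_mul (hf.hasDerivAt_euler 3 hq)).congr_deriv ?_
  push_cast
  field_simp
  ring

lemma VSmooth.tendsto_moment (hf : VSmooth T c f f0) (hq : onCone) :
    Tendsto (fun s => s ^ 2 * NullCone.euler 3 f s x) (𝓝[>] 0) (𝓝 0) := by
  have h1 := ((VSmooth.radius.mul VSmooth.radius).mul (hf.euler 3)).tendsto_ray
    (bot_le.trans_lt hq.2.2) hq.1
  simpa [pow_two] using h1

lemma contDiffOn_div_norm (a : ℝ) : ContDiffOn ℝ ∞ (fun y : Space m => a / ‖y‖) (cone m T) :=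
  fun _ hy => (contDiffAt_const.div (contDiffAt_norm ℝ hy.1) (norm_ne_zero_iff.2 hy.1)).contDiffWithinAt

/-- The expansion exists if `∫ s |σ|² ds < n - 1` along every generator: `τ = (n - 1) u' / u` with the
solution `u` of `u'' = -|σ|² u / (n - 1)`, `u' = 1` at the vertex. -/
lemma IsVMetric.exists_expansion (hm : 1 ≤ m) (hT : 0 < T) (hγ : IsVMetric T γ)
    (hJ : ∀ (c : SphereChart m) r x, (r, x) ∈ c.coneDom T →
      r ^ 2 * euler 3 (shearSq (c.comp2 γ)) r x < m) : ∃ τ, IsExpansion T γ τ := by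
  have hm0 : (0 : ℝ) < m := by positivity
  choose q0 hq0 using fun c => hγ.vs_shearSq (c := c)
  have hf := fun c => (VSmooth.const (1 / (m : ℝ))).mul (hq0 c)
  choose w U hw hU hode using fun c => (hf c).exists_radialSol
  have hQ := fun c => (hf c).mul (hw c)
  set E : SphereChart m → ConeFn m := fun c =>
    euler 3 (fun r x => 1 / (m : ℝ) * shearSq (c.comp2 γ) r x * w c r x) with hE
  have hEs : ∀ c, VSmooth T c (E c) _ := fun c => (hQ c).euler 3
  have hUE : ∀ c r x, (r, x) ∈ c.coneDom T → U c r x = 1 - r ^ 2 * E c r x := fun c r x hq => by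
    have h1 := eq_of_hasDerivAt_zero (F := fun r => U c r x + r ^ 2 * E c r x) (L := 1 + 0) hq.2.1
      (fun s hs => by
        have hs' := coneDom_of_le hq hs
        exact ((hode c s x hs').2.fun_add ((hQ c).hasDerivAt_moment hs')).congr_deriv (by ring))
      (((hU c).tendsto_ray hT hq.1).add ((hQ c).tendsto_moment hq))
    linarith
  have hwE : ∀ c r x, (r, x) ∈ c.coneDom T → w c r x = 1 - r ^ 2 * euler 5 (E c) r x :=
    fun c r x hq => by
      have hr : 0 < r := hq.2.1
      have h1 := eq_of_hasDerivAt_zero (F := fun r => r * w c r x - r + r * (r * (r * euler 5 (E c) r x)))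
        (L := 0 * 1 - 0 + 0 * (0 * (0 * _))) hr (fun s hs => by
          have hs' := coneDom_of_le hq hs
          have hs0 : s ≠ 0 := hs.1.ne'
          refine (((hode c s x hs').1.fun_sub (hasDerivAt_id' s)).fun_add ((hasDerivAt_id' s).fun_mul
            ((hasDerivAt_id' s).fun_mul ((hasDerivAt_id' s).fun_mul
            ((hEs c).hasDerivAt_euler 5 hs'))))).congr_deriv ?_
          rw [hUE c s x hs']
          push_cast
          field_simp
          ring)
        ((((VSmooth.radius.mul (hw c)).sub VSmooth.radius).add (VSmooth.radius.mul (VSmooth.radius.mul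
          (VSmooth.radius.mul ((hEs c).euler 5))))).tendsto_ray hT hq.1)
      have h2 : r * (w c r x - 1 + r ^ 2 * euler 5 (E c) r x) = 0 := by linarith
      linarith [(mul_eq_zero.1 h2).resolve_left hr.ne']
  have hpos : ∀ c b x, (b, x) ∈ c.coneDom T → 0 < b * w c b x ∧ 0 < U c b x := fun c b x hb => by
    have hray : ∀ r ∈ Ioc 0 b, (r, x) ∈ c.coneDom T := fun r hr => coneDom_of_le hb hr
    refine radialSol_pos (u := fun r => r * w c r x) (U := fun r => U c r x)
      (q := fun r => 1 / m * shearSq (c.comp2 γ) r x)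
      (J := fun r => 1 / m * (r ^ 2 * euler 3 (shearSq (c.comp2 γ)) r x)) hb.2.1
      (fun r hr => (hode c r x (hray r hr)).1) (fun r hr => (hode c r x (hray r hr)).2)
      (fun r hr => (((hq0 c).hasDerivAt_moment (hray r hr)).const_mul (1 / (m : ℝ))).congr_deriv (by ring))
      (fun r hr => mul_nonneg (by positivity) (hγ.shearSq_nonneg (hray r hr)))
      (by simpa using (VSmooth.radius.mul (hw c)).tendsto_ray hT hb.1) ((hU c).tendsto_ray hT hb.1)
      (by simpa using ((hq0 c).tendsto_moment hb).const_mul (1 / (m : ℝ))) fun r hr => ?_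
    rw [one_div, inv_mul_lt_iff₀ hm0, mul_one]
    exact hJ c r x (hray r hr)
  -- `m / r - τ`
  set β : SphereChart m → ConeFn m := fun c r x =>
    m * (r * (E c r x - euler 5 (E c) r x)) * (w c r x)⁻¹ with hβ
  have hβτ : ∀ c r x, (r, x) ∈ c.coneDom T → β c r x = m / r - m * U c r x / (r * w c r x) :=
    fun c r x hq => by
      have hr : r ≠ 0 := hq.2.1.ne'
      have h1 : w c r x ≠ 0 := fun h => by simpa [h] using (hpos c r x hq).1
      have h2 := hwE c r x hq
      simp only [hβ]
      rw [hUE c r x hq]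
      field_simp
      linear_combination (-1 : ℝ) * h2
  have hβi : IsInvariant T β := fun c e x b h hb => by
    have hb' := h.mem_coneDom hb
    rw [hβτ c b x hb, hβτ _ b _ hb']
    set c' := graphChart e
    set x' := transition c e x
    have hray : ∀ r ∈ Ioc 0 b, (r, x) ∈ c.coneDom T := fun r hr => coneDom_of_le hb hr
    have hray' : ∀ r ∈ Ioc 0 b, (r, x') ∈ c'.coneDom T := fun r hr => coneDom_of_le hb' hr
    have h1 := eq_of_hasDerivAt_zero (F := fun r => r * w c r x * U c' r x' - r * w c' r x' * U c r x)
      (L := 0 * 1 * 1 - 0 * 1 * 1) hb.2.1 (fun r hr => by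
        obtain ⟨d1, d2⟩ := hode c r x (hray r hr)
        obtain ⟨d3, d4⟩ := hode c' r x' (hray' r hr)
        refine ((d1.fun_mul d4).fun_sub (d3.fun_mul d2)).congr_deriv ?_
        rw [h.shearSq_eq (hγ.metricNear (hray' r hr)) (hγ.differentiableAt (hray' r hr))]
        ring)
      ((((VSmooth.radius.mul (hw c)).tendsto_ray hT hb.1).mul ((hU c').tendsto_ray hT hb'.1)).sub
        (((VSmooth.radius.mul (hw c')).tendsto_ray hT hb'.1).mul ((hU c).tendsto_ray hT hb.1)))
    have h2 := (hpos c b x hb).1.ne'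
    have h3 := (hpos c' b x' hb').1.ne'
    rw [sub_right_inj, div_eq_div_iff h2 h3]
    linear_combination (-(m : ℝ)) * h1
  have hβs : ∀ c, VSmooth T c (β c) fun _ => 0 := fun c =>
    (((VSmooth.const (m : ℝ)).mul (VSmooth.radius.mul ((hEs c).sub ((hEs c).euler 5)))).mul
      ((hw c).inv (fun r x hq h => by simpa [h] using (hpos c r x hq).1) fun _ _ => one_ne_zero)).congr
      (fun _ _ _ => rfl) fun _ _ => by simp
  obtain ⟨B, hBs, hB⟩ := exists_scalarField hβi hβs
  have hc1 : ContDiffOn ℝ ∞ (fun y => m / ‖y‖ - B y) (cone m T) :=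
    (contDiffOn_div_norm m).sub hBs.contDiffOn
  have hc2 : Tendsto (fun y => m / ‖y‖ - (m / ‖y‖ - B y)) (𝓝[≠] 0) (𝓝 0) := by
    simpa only [sub_sub_cancel] using hBs.tendsto hT
  have hτ : ∀ (c : SphereChart m) r x, (r, x) ∈ c.coneDom T →
      c.comp0 (fun y => m / ‖y‖ - B y) r x = m * U c r x / (r * w c r x) := fun c r x hq => by
    have h1 := norm_smul_θ hq
    simp only at h1
    have h2 : B (r • c.θ x) = β c r x := hB c r x hq
    rw [SphereChart.comp0, h1, h2, hβτ c r x hq, sub_sub_cancel]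
  refine ⟨fun y => m / ‖y‖ - B y, ⟨hc1, fun y hy => ?_, hc2, fun c x hx r hr ht => ?_⟩⟩
  · obtain ⟨e, -, r, x, hq, rfl⟩ := exists_chart hy
    obtain ⟨h1, h2⟩ := hpos _ r x hq
    exact (div_pos (mul_pos hm0 h2) h1).trans_eq (hτ _ r x hq).symm
  · have hq : (r, x) ∈ c.coneDom T := ⟨hx, hr, ht⟩
    have h1 := (hpos c r x hq).1.ne'
    obtain ⟨d1, d2⟩ := hode c r x hq
    have h2 := ((d2.const_mul (m : ℝ)).fun_div d1 h1).congr_of_eventuallyEq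
      ((eventually_fst (eventually_coneDom hq)).mono fun s hs => hτ c s x hs)
    beta_reduce
    rw [h2.deriv, hτ c r x hq]
    obtain ⟨h3, h4⟩ := mul_ne_zero_iff.1 h1
    field_simp
    ring

end Expansion

/-! ### Local and global solvability -/

section Global

open MeasureTheory

variable {γ : SForm m} {b : ℝ} {f : ConeFn m} {f0 : (Fin m → ℝ) → ℝ}

/-- Near the vertex `r |σ|² ≤ 1`, as `r |σ|²` tends to zero uniformly in the direction. -/
lemma IsVMetric.exists_expansion_local (hm : 1 ≤ m) (hT : 0 < T) (hγ : IsVMetric T γ) :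
    ∃ T₀ : ℝ≥0∞, 0 < T₀ ∧ T₀ ≤ T ∧ ∃ τ, IsExpansion T₀ γ τ := by
  choose q0 hq0 using fun c => hγ.vs_shearSq (c := c)
  have hi : IsInvariant T fun (c : SphereChart m) => shearSq (c.comp2 γ) := fun c e x r h hq =>
    h.shearSq_eq (hγ.metricNear (h.mem_coneDom hq)) (hγ.differentiableAt (h.mem_coneDom hq))
  obtain ⟨B, hBs, hB⟩ := exists_scalarField (a0 := 0) ((IsInvariant.radial fun r => r).mul hi)
    fun c => (VSmooth.radius.mul (hq0 c)).congr (fun _ _ _ => rfl) fun _ _ => (zero_mul _).symm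
  obtain ⟨d, hd, hdB⟩ := Metric.eventually_nhds_iff.1 (eventually_nhdsWithin_iff.1
    ((hBs.tendsto hT).eventually (gt_mem_nhds one_pos)))
  have hd' : 0 < min d (1 / 2) := lt_min hd one_half_pos
  refine ⟨min T (ofReal (min d (1 / 2))), lt_min hT (ENNReal.ofReal_pos.2 hd'), min_le_left _ _,
    (hγ.mono (min_le_left _ _)).exists_expansion hm (lt_min hT (ENNReal.ofReal_pos.2 hd'))
      fun c b x hb => ?_⟩
  have hb2 : b < min d (1 / 2) := (ENNReal.ofReal_lt_ofReal_iff hd').1 (hb.2.2.trans_le (min_le_right _ _))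
  have hb' : (b, x) ∈ c.coneDom T := ⟨hb.1, hb.2.1, hb.2.2.trans_le (min_le_left _ _)⟩
  have h0 : Tendsto (fun r : ℝ => r) (𝓝[>] 0) (𝓝 0) := nhdsWithin_le_nhds
  have h1 := le_of_hasDerivAt_nonneg (b := b)
    (F := fun r => r - r ^ 2 * euler 3 (shearSq (c.comp2 γ)) r x) (L := 0 - 0)
    (fun r hr => (hasDerivAt_id' r).fun_sub ((hq0 c).hasDerivAt_moment (coneDom_of_le hb' hr)))
    (fun r hr => by
      have hr' := coneDom_of_le hb' ⟨hr.1, hr.2.le⟩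
      have h2 := hdB (y := r • c.θ x) (by
        have := norm_smul_θ hr'
        simp only at this
        rw [dist_zero_right, this]
        exact hr.2.trans (hb2.trans_le (min_le_left _ _))) (mem_cone hr').1
      have h3 : B (r • c.θ x) = _ := hB c r x hr'
      linarith)
    (h0.sub ((hq0 c).tendsto_moment hb')) b ⟨hb.2.1, le_rfl⟩
  have h4 : (1 : ℝ) ≤ m := by exact_mod_cast hm
  linarith [min_le_right d (1 / 2)]

lemma VSmooth.ofReal_moment (hf : VSmooth T c f f0) (hb : (b, x) ∈ c.coneDom T)
    (hp : ∀ r ∈ Ioc 0 b, 0 ≤ f r x) : ofReal (b ^ 2 * NullCone.euler 3 f b x)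
      = ∫⁻ s in Ioc 0 b, ofReal (s * f s x) := by
  have hb0 : 0 < b := hb.2.1
  have hd : ∀ r ∈ Ioc 0 b, HasDerivAt (fun s => s ^ 2 * NullCone.euler 3 f s x) (r * f r x) r :=
    fun r hr => hf.hasDerivAt_moment (coneDom_of_le hb hr)
  have hc : ContinuousOn (fun s => s ^ 2 * NullCone.euler 3 f s x) (Icc 0 b) := fun r hr => by
    rcases hr.1.eq_or_lt with rfl | h
    · refine (continuousWithinAt_Ioi_iff_Ici.1 ?_).mono Set.Icc_subset_Ici_self
      simpa [ContinuousWithinAt] using hf.tendsto_moment hb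
    · exact (hd r ⟨h, hr.2⟩).continuousAt.continuousWithinAt
  have hd' : ∀ r ∈ Set.Ioo 0 b, _ := fun r hr => hd r ⟨hr.1, hr.2.le⟩
  have hint := intervalIntegral.integrableOn_deriv_of_nonneg hc hd' fun r hr =>
    mul_nonneg hr.1.le (hp r ⟨hr.1, hr.2.le⟩)
  have h1 := intervalIntegral.integral_eq_sub_of_hasDerivAt_of_le hb0.le hc hd'
    ((intervalIntegrable_iff_integrableOn_Ioc_of_le hb0.le).2 hint)
  rw [intervalIntegral.integral_of_le hb0.le, zero_pow two_ne_zero, zero_mul, sub_zero] at h1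
  rw [← h1, ofReal_integral_eq_lintegral_ofReal hint]
  exact (ae_restrict_mem measurableSet_Ioc).mono fun r hr => mul_nonneg hr.1.le (hp r hr)

/-- `∫ s q ≤ K δ² + (1/δ) ∫ s² q` if `q ≤ K` on `s < δ`. -/
lemma VSmooth.moment_le (hf : VSmooth T c f f0) (hb : (b, x) ∈ c.coneDom T)
    (hp : ∀ r ∈ Ioc 0 b, 0 ≤ f r x) {K δ ε : ℝ} (hδ : 0 < δ) (hK : 0 ≤ K) (hε : 0 ≤ ε)
    (hfK : ∀ r ∈ Ioc 0 b, r < δ → f r x ≤ K)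
    (hi : ∫⁻ r in Set.Ioi (0 : ℝ), ofReal (r ^ 2 * f r x) ≤ ofReal ε) :
    b ^ 2 * NullCone.euler 3 f b x ≤ K * δ ^ 2 + 1 / δ * ε := by
  have h1 : ∀ s ∈ Ioc 0 b, ofReal (s * f s x)
      ≤ (Set.Ioo 0 δ).indicator (fun _ => ofReal (K * δ)) s
        + ofReal (1 / δ) * ofReal (s ^ 2 * f s x) := fun s hs => by
    by_cases h : s < δ
    · rw [Set.indicator_of_mem (show s ∈ Set.Ioo 0 δ from ⟨hs.1, h⟩)]
      exact (ENNReal.ofReal_le_ofReal (by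
        nlinarith [mul_le_mul_of_nonneg_left (hfK s hs h) hs.1.le])).trans le_self_add
    · rw [Set.indicator_of_notMem fun h' => h h'.2, zero_add, ← ENNReal.ofReal_mul (by positivity)]
      refine ENNReal.ofReal_le_ofReal ?_
      rw [one_div, ← div_eq_inv_mul, le_div_iff₀ hδ]
      nlinarith [mul_nonneg hs.1.le (hp s hs), not_lt.1 h]
  have h2 : ofReal (b ^ 2 * NullCone.euler 3 f b x)
      ≤ ofReal (K * δ ^ 2 + 1 / δ * ε) := by
    rw [hf.ofReal_moment hb hp, ENNReal.ofReal_add (by positivity) (by positivity)]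
    refine (setLIntegral_mono' measurableSet_Ioc h1).trans ?_
    rw [lintegral_add_left (measurable_const.indicator measurableSet_Ioo),
      lintegral_const_mul' _ _ ENNReal.ofReal_ne_top]
    refine add_le_add ?_ ?_
    · refine (setLIntegral_le_lintegral _ _).trans ?_
      rw [lintegral_indicator measurableSet_Ioo, setLIntegral_const, Real.volume_Ioo, sub_zero,
        ← ENNReal.ofReal_mul (by positivity)]
      exact (congrArg _ (by ring)).le
    · rw [ENNReal.ofReal_mul (by positivity)]
      exact mul_le_mul_right ((lintegral_mono_set Set.Ioc_subset_Ioi_self).trans hi) _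
  exact (ENNReal.ofReal_le_ofReal_iff (by positivity)).1 h2

/-- With `δ` small, `∫ s |σ|² ≤ K δ² + ε / δ < 1`. -/
lemma exists_expansion_global (hm : 1 ≤ m) (K r₀ : ℝ) (hr₀ : 0 < r₀) : ∃ ε : ℝ, 0 < ε ∧
    ∀ γ : SForm m, IsVMetric ⊤ γ →
      (∀ c : SphereChart m, c.OnCone (ofReal r₀) fun r x => shearSq (c.comp2 γ) r x ≤ K) →
      (∀ c : SphereChart m, ∀ x ∈ c.dom,
        ∫⁻ r in Set.Ioi (0 : ℝ), ofReal (r ^ 2 * shearSq (c.comp2 γ) r x)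
          ≤ ofReal ε) → ∃ τ, IsExpansion ⊤ γ τ := by
  set L := |K| + 1 with hL
  have hL0 : 0 < L := by positivity
  set δ := min (min 1 r₀) (1 / (4 * L)) with hδ
  have hδ0 : 0 < δ := lt_min (lt_min one_pos hr₀) (by positivity)
  have hδ1 : δ ≤ 1 := (min_le_left _ _).trans (min_le_left _ _)
  have hδr : δ ≤ r₀ := (min_le_left _ _).trans (min_le_right _ _)
  have hδL : L * δ ≤ 1 / 4 := by
    have h1 : L * δ ≤ L * (1 / (4 * L)) := mul_le_mul_of_nonneg_left (min_le_right _ _) hL0.le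
    exact h1.trans_eq (by field_simp)
  refine ⟨δ / 4, by positivity, fun γ hγ hK hi => hγ.exists_expansion hm (by simp) fun c b x hb => ?_⟩
  obtain ⟨q0, hq0⟩ := hγ.vs_shearSq (c := c)
  have h1 := hq0.moment_le hb (fun r hr => hγ.shearSq_nonneg (coneDom_of_le hb hr)) hδ0
    hL0.le (by positivity) (fun r hr hrδ => (hK c x hb.1 r hr.1
      ((ENNReal.ofReal_lt_ofReal_iff hr₀).2 (hrδ.trans_le hδr))).trans
      ((le_abs_self K).trans (by linarith))) (hi c x hb.1)
  have h2 : 1 / δ * (δ / 4) = 1 / 4 := by field_simp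
  have h3 : (1 : ℝ) ≤ m := by exact_mod_cast hm
  nlinarith [mul_le_mul hδL hδ1 hδ0.le (by norm_num)]

end Global

/-! ### The wave-gauge vector vanishes -/

section Vanishing

variable {U : Set (Spacetime m)} {g : Spacetime m → Form (Spacetime m)} {D : ConeMetric m} {r b : ℝ}

lemma VSmooth.exists_bound {f : ConeFn m} {f0 : (Fin m → ℝ) → ℝ} (hf : VSmooth T c f f0)
    (hb : (b, x) ∈ c.coneDom T) : ∃ K, ∀ r ∈ Ioc 0 b, |f r x| ≤ K := by
  obtain ⟨K, hK⟩ := (isCompact_Icc (a := 0) (b := √b)).exists_bound_of_continuousOn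
    (f := fun s => polExt f f0 (s, x)) (ContDiffOn.continuousOn hf |>.comp (by fun_prop) fun s hs =>
      ⟨hb.1, (ENNReal.ofReal_le_ofReal ((Real.le_sqrt hs.1 hb.2.1.le).1 hs.2)).trans_lt hb.2.2⟩)
  exact ⟨K, fun r hr => by
    simpa [polExt_sqrt hr.1] using hK √r ⟨Real.sqrt_nonneg r, Real.sqrt_le_sqrt hr.2⟩⟩

/-- A solution of the singular linear system `w' = N w - m w / 2r` with bounded `N` vanishes if it
has a limit at `0`. -/
lemma eq_zero_of_linear {ι : Type} [Fintype ι] {w : ι → ℝ → ℝ} {N : ι → ι → ℝ → ℝ} {L : ι → ℝ}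
    (hb : 0 < b) (hm : 1 ≤ m) (hN : ∀ i j, ∃ K, ∀ r ∈ Ioc 0 b, |N i j r| ≤ K)
    (hw : ∀ i, ∀ r ∈ Ioc 0 b, HasDerivAt (w i) (∑ j, N i j r * w j r - m / (2 * r) * w i r) r)
    (hl : ∀ i, Tendsto (w i) (𝓝[>] 0) (𝓝 (L i))) (i : ι) : w i b = 0 := by
  choose K hK using hN
  have key := eq_zero_of_deriv_le (F := fun r => ∑ i, w i r ^ 2) (K := ∑ i, ∑ j, 2 * K i j) (n := m) hb
    (fun r hr => HasDerivAt.fun_sum fun i _ => (hw i r hr).fun_pow 2)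
    (Finset.sum_nonneg fun i _ => sq_nonneg _) (fun r hr => ?_) ?_
  · exact pow_eq_zero_iff two_ne_zero |>.1
      ((Finset.sum_eq_zero_iff_of_nonneg fun i _ => sq_nonneg _).1 key i (mem_univ i))
  · have h1 : ∀ i, w i r ^ 2 ≤ ∑ i, w i r ^ 2 := fun i =>
      Finset.single_le_sum (f := fun i => w i r ^ 2) (fun i _ => sq_nonneg _) (mem_univ i)
    rw [sub_mul, sum_mul, mul_sum, ← sum_sub_distrib]
    refine Finset.sum_le_sum fun i _ => ?_
    have h2 : 2 * w i r * ∑ j, N i j r * w j r ≤ (∑ j, 2 * K i j) * ∑ i, w i r ^ 2 := by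
      rw [mul_sum, sum_mul]
      refine Finset.sum_le_sum fun j _ => ?_
      have h3 := abs_le.1 (hK i j r hr)
      have h4 := h1 i
      have h5 := h1 j
      have h6 := (abs_nonneg _).trans (hK i j r hr)
      calc _ ≤ |N i j r| * (2 * |w i r| * |w j r|) := by
            rw [← abs_two, ← abs_mul, ← abs_mul, ← abs_mul, abs_two]
            exact (le_of_eq (by ring)).trans (le_abs_self _)
        _ ≤ K i j * (2 * ∑ i, w i r ^ 2) := mul_le_mul (hK i j r hr) (by
            nlinarith [sq_nonneg (|w i r| - |w j r|), sq_abs (w i r), sq_abs (w j r)])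
            (by positivity) h6
        _ = _ := by ring
    have := hr.1.ne'
    push_cast
    calc _ = 2 * w i r * ∑ j, N i j r * w j r - m / r * w i r ^ 2 := by field_simp
      _ ≤ _ := by linarith
  · have h1 := (((continuous_pow m).tendsto (0 : ℝ)).mono_left nhdsWithin_le_nhds).mul
      (tendsto_finsetSum (f := fun i r => w i r ^ 2) univ fun i _ => (hl i).pow 2)
    rwa [zero_pow (by omega), zero_mul] at h1

namespace HasTrace

variable (h : HasTrace T U g D) (h0 : (0 : Spacetime m) ∈ U) (hη : g 0 = minkowski m)
include h h0 hη

/-- The components of the metric on the cone with respect to vectors depending on the generator only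
are smooth up to the vertex. -/
lemma vs_apply {X Y : (Fin m → ℝ) → Spacetime m} (hX : ContDiffOn ℝ ∞ X c.dom)
    (hY : ContDiffOn ℝ ∞ Y c.dom) : VSmooth T c (fun r x => g (c.adapted (onC r x)) (X x) (Y x))
      fun x => minkowski m (X x) (Y x) := by
  have hs : ∀ {Z : (Fin m → ℝ) → Spacetime m}, ContDiffOn ℝ ∞ Z c.dom → ContDiffOn ℝ ∞
      (fun p : ConePt m => Z p.2) {p | 0 ≤ p.1 ∧ p.2 ∈ c.dom ∧ ofReal p.1 < T} :=
    fun hZ => hZ.comp contDiff_snd.contDiffOn fun _ hp => hp.2.1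
  refine (VSmooth.of_contDiffOn (F := fun p => g (p.1, p.1 • c.θ p.2) (X p.2) (Y p.2))
    (((h.smooth.comp (contDiffOn_fst.prodMk (contDiffOn_fst.smul (c.smooth.comp
      contDiff_snd.contDiffOn fun _ hp => hp.2.1))) fun p hp => ?_).clm_apply (hs hX)).clm_apply
        (hs hY))).congr (fun r x _ => by simp [SphereChart.adapted, onC]) fun x _ => by
          simp [hη, ← Prod.zero_eq_mk]
  rcases hp.1.eq_or_lt with hz | hz
  · simpa [← hz, ← Prod.zero_eq_mk] using h0
  · have hq : p ∈ c.coneDom T := ⟨hp.2.1, hz, hp.2.2⟩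
    simpa [norm_smul_θ hq] using h.subset _ (mem_cone hq)

lemma vs_nu0 : VSmooth T c (c.comp0 D.nu0) fun _ => 1 :=
  (h.vs_apply h0 hη (X := fun _ => (-1, 0)) (Y := fun x => (1, c.θ x)) contDiffOn_const
    (contDiffOn_const.prodMk c.smooth)).congr (fun r x hq => by
      rw [← h.metric_01 hq, SphereChart.metric, of_apply, fderiv_adapted_0 (X := onC r x) hq.1,
        fderiv_adapted_1 (X := onC r x) hq.1]
      rfl) fun x _ => by simp [minkowski_apply]

omit h h0 hη in
lemma frame_eq (x : Fin m → ℝ) (A : Fin m) :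
    ((0, onC r x i1 • c.frame (fun A => onC r x (inr A)) A) : Spacetime m)
      = r • (0, c.frame x A) := by simp [onC_inr, onC_one]

lemma isVMetric : IsVMetric T D.gt where
  vs := fun c A B => by
    have hs : ∀ A, ContDiffOn ℝ ∞ (fun x => ((0, c.frame x A) : Spacetime m)) c.dom := fun A =>
      contDiffOn_const.prodMk ((c.smooth.fderiv_of_isOpen c.isOpen_dom (by simp)).clm_apply
        contDiffOn_const)
    refine (h.vs_apply h0 hη (hs A) (hs B)).congr (fun r x hq => ?_) fun x _ => by
      simp [minkowski_apply, SphereChart.round]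
    have hr := hq.2.1.ne'
    simp only [ne_eq] at hr
    rw [resc, Matrix.smul_apply, ← h.metric_AB hq, SphereChart.metric, of_apply,
      fderiv_adapted_A (X := onC r x) hq.1,
      fderiv_adapted_A (X := onC r x) hq.1, frame_eq, frame_eq, map_smul, map_smul, smul_apply]
    simp only [smul_eq_mul]
    field_simp
  pos := fun c r x hq => h.isMetric.posDef_gt hq

/-- The wave-gauge vector of a solution of the reduced equations whose trace satisfies the
constraints vanishes on the cone: the transport equations are singular linear systems to which
`eq_zero_of_linear` applies. -/
lemma waveGauge_eq_zero (hm : 1 ≤ m) (hC : D.SatisfiesConstraints T) (c : SphereChart m)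
    (hR : ReducedEinsteinOnCone T g c) :
    c.OnCone T fun r x => ∀ α, waveGauge (c.metric g) c.eta α (onC r x) = 0 := by
  obtain ⟨hC1, hCA, hC0⟩ := hC c
  obtain ⟨W, hW, hH⟩ := h.exists_covector h0 hη
  have hV := h.isVMetric h0 hη
  have hν := h.vs_nu0 h0 hη (c := c)
  obtain ⟨t0, ht⟩ : ∃ t0, VSmooth T c (meanCurv (resc D.gt c)) t0 := by
    choose k0 hk using fun A => hV.vs_chi (c := c) A A
    exact ⟨_, VSmooth.sum fun A => hk A⟩
  have hτ : ∀ r x, (r, x) ∈ c.coneDom T → D.tau c r x = meanCurv (resc D.gt c) r x + m / r :=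
    fun r x hq => hV.meanCurv_eq hq
  have z1 : c.OnCone T fun r x => Hlow g c i1 r x = 0 := fun x hx b hb0 hT => by
    have hb : (b, x) ∈ c.coneDom T := ⟨hx, hb0, hT⟩
    have key := eq_zero_of_linear (ι := Unit) (m := m)
      (w := fun _ r => waveGauge (c.metric g) c.eta i0 (onC r x))
      (N := fun _ _ r => -(1 / 2) * meanCurv (resc D.gt c) r x) (L := fun _ => 1⁻¹ * W 0 (1, c.θ x)) hb0 hm
      (fun _ _ => ((VSmooth.const _).mul ht).exists_bound hb) (fun _ r hr => ?_) (fun _ => ?_) ()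
    · exact (h.Hlow_1 hb).trans (mul_eq_zero_of_right _ key)
    · have hq := coneDom_of_le hb hr
      have he := isNullNear_eta (c := c) hq.1 hq.2.1.ne'
      have t := h.transport_1 hR hq (hC1 x hx r hq.2.1 hq.2.2)
      simp only [covGauge, sum_idx, he.chris_0_11, he.chris_0_1A, he.metric.christoffel_symm i0 i1 i0,
        eta_chris_time hq.1 hq.2.1.ne', zero_mul, sum_const_zero, add_zero, hτ r x hq] at t
      refine (h.smoothNear_waveGauge hq i0).hasDerivAt_onC.congr_deriv ?_
      simp only [Finset.univ_unique, Finset.sum_singleton]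
      have := hr.1.ne'
      linear_combination t
    · refine ((((hν.inv (fun r x hq => h.nu0_ne hq) fun _ _ => one_ne_zero).tendsto_ray
        (bot_le.trans_lt hT) hx).mul (tendsto_apply (c := c) (x := x) hW _))).congr' ?_
      filter_upwards [Ioc_mem_nhdsGT hb0] with r hr
      have hq := coneDom_of_le hb hr
      have e := hH c r x hq i1
      rw [h.Hlow_1 hq, fderiv_adapted_1 (X := onC r x) hq.1] at e
      simp only [onC_inr] at e
      rw [← e, inv_mul_cancel_left₀ (h.nu0_ne hq)]
  have zA : c.OnCone T fun r x => ∀ A, Hlow g c (inr A) r x = 0 := fun x hx b hb0 hT A => by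
    have hb : (b, x) ∈ c.coneDom T := ⟨hx, hb0, hT⟩
    have hd : ∀ A C, ∃ f0, VSmooth T c (fun r x => (c.comp0 D.nu0 r x * (∑ B, c.round x A B *
        (resc D.gt c r x)⁻¹ B C) - if A = C then 1 else 0) / r) f0 := fun A C => by
      refine ((hν.mul (VSmooth.sum fun B => (VSmooth.const_x
        (g := fun x => c.round x A B) fun x hx => (smoothNear_round hx A B
          ).contDiffAt.contDiffWithinAt).mul (hV.vs_inv B C))).sub (.const _)).div_radius fun x hx => ?_
      simp only [← mul_apply, mul_nonsing_inv _ (metricNear_round hx).isUnit,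
        one_apply, one_mul, sub_self]
    let N := fun A C r => chi (resc D.gt c) r x A C + (-(1 / 2) * meanCurv (resc D.gt c) r x *
      (if A = C then 1 else 0) + 1 / 2 * ((c.comp0 D.nu0 r x * (∑ B, c.round x A B *
      (resc D.gt c r x)⁻¹ B C) - if A = C then 1 else 0) / r))
    have key := eq_zero_of_linear (m := m) (w := fun A r => Hlow g c (inr A) r x / r)
      (N := N) (L := fun A => W 0 (0, c.frame x A)) hb0 hm
      (fun A C => ?_) (fun A r hr => ?_) (fun A => ?_) A
    · exact (div_eq_zero_iff.1 key).resolve_right hb0.ne'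
    · obtain ⟨k0, hk⟩ := hV.vs_chi (c := c) A C
      obtain ⟨d0, hd⟩ := hd A C
      exact (hk.add ((((VSmooth.const _).mul ht).mul (.const _)).add ((VSmooth.const _).mul hd))
        ).exists_bound hb
    · have hq := coneDom_of_le hb hr
      have t := h.transport_A hR z1 hq (hCA x hx r hq.2.1 hq.2.2) A
      have hr0 := hr.1.ne'
      refine ((h.hasDerivAt_Hlow hq (inr A)).fun_div (hasDerivAt_id' r) hr0).congr_deriv ?_
      simp only [hV.chi_eq hq, hτ r x hq, inv_comp2_eq D.gt hr.1, add_mul, ite_mul, zero_mul,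
        sum_add_distrib, sum_ite_eq, mem_univ, if_true] at t
      rw [sum_comm] at t
      have e : ∀ C, N A C r * (Hlow g c (inr C) r x / r)
          = r⁻¹ * (chi (resc D.gt c) r x A C * Hlow g c (inr C) r x)
            + (if A = C then -(meanCurv (resc D.gt c) r x * r + 1) * Hlow g c (inr C) r x
              / (2 * r ^ 2) else 0)
            + c.comp0 D.nu0 r x / 2 * ∑ B, c.round x A B * ((r ^ 2)⁻¹ * (resc D.gt c r x)⁻¹ B C)
              * Hlow g c (inr C) r x := fun C => by
        simp only [N, ← sum_mul, mul_left_comm _ (r ^ 2)⁻¹, ← mul_sum]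
        split_ifs <;> field_simp <;> ring
      simp only [e, sum_add_distrib, sum_ite_eq, mem_univ, if_true, ← mul_sum]
      field_simp at t ⊢
      linear_combination t
    · refine (tendsto_apply (c := c) (x := x) hW _).congr' ?_
      filter_upwards [Ioc_mem_nhdsGT hb0] with r hr
      have hq := coneDom_of_le hb hr
      rw [hH c r x hq (inr A), fderiv_adapted_A (X := onC r x) hq.1, frame_eq, map_smul,
        smul_eq_mul, mul_div_cancel_left₀ _ hr.1.ne']
  intro x hx b hb0 hT
  have hb : (b, x) ∈ c.coneDom T := ⟨hx, hb0, hT⟩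
  have z0 : Hlow g c i0 b x = 0 := by
    obtain ⟨d0, hd⟩ := (((VSmooth.const (m : ℝ)).sub (hν.mul (hV.vs_traceRound c)))).div_radius
      fun _ _ => by ring
    refine eq_zero_of_linear (ι := Unit) (m := m) (w := fun _ r => Hlow g c i0 r x)
      (N := fun _ _ r => 1 / 2 * ((m - c.comp0 D.nu0 r x * traceRound D.gt c r x) / r -
        meanCurv (resc D.gt c) r x)) (L := fun _ => W 0 (-1, 0)) hb0 hm
      (fun _ _ => ((VSmooth.const _).mul (hd.sub ht)).exists_bound hb) (fun _ r hr => ?_) (fun _ => ?_) ()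
    · have hq := coneDom_of_le hb hr
      refine (h.hasDerivAt_Hlow hq i0).congr_deriv ?_
      rw [h.transport_0 hR z1 zA hC1 hCA hC0 hq, hτ r x hq, ConeMetric.W1, W0_eq D hr.1]
      simp only [Finset.univ_unique, Finset.sum_singleton]
      have := hr.1.ne'
      field_simp
      ring
    · refine (tendsto_apply (c := c) (x := x) hW _).congr' ?_
      filter_upwards [Ioc_mem_nhdsGT hb0] with r hr
      have hq := coneDom_of_le hb hr
      rw [hH c r x hq i0, fderiv_adapted_0 (X := onC r x) hq.1]
  have e0 := h.gauge_0_eq_zero z1 hb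
  have eA := h.gauge_A_eq_zero z1 zA hb
  rintro (α | A)
  · fin_cases α
    · exact e0
    · rw [h.Hlow_0 hb, e0] at z0
      simp only [eA, mul_zero, sum_const_zero, zero_add, add_zero] at z0
      exact (mul_eq_zero.1 z0).resolve_left (h.nu0_ne hb)
  · exact eA A

end HasTrace

end Vanishing

end

end NullCone

theorem mainTheorem4 (m : ℕ) (hm : 1 ≤ m) :
    -- Local solvability of the constraints.
    (∀ (T : ℝ≥0∞) (γ : Space m → Form (Space m)), 0 < T → IsFreeData T γ →
      ∃ T₀ : ℝ≥0∞, 0 < T₀ ∧ T₀ ≤ T ∧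
        ∃ (τ φ : Space m → ℝ) (D : ConeMetric m), IsSolution T₀ γ τ φ D) ∧
    -- Global solvability if the integral of `r² |σ|²` along the generators is small.
    (∀ K r₀ : ℝ, 0 < r₀ → ∃ ε : ℝ, 0 < ε ∧
      ∀ γ : Space m → Form (Space m), IsFreeData ⊤ γ →
        (∀ c : SphereChart m, c.OnCone (ENNReal.ofReal r₀) fun r x =>
          shearSq (c.comp2 γ) r x ≤ K) →
        (∀ c : SphereChart m, ∀ x ∈ c.dom,
          ∫⁻ r in Set.Ioi (0 : ℝ), ENNReal.ofReal (r ^ 2 * shearSq (c.comp2 γ) r x)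
            ≤ ENNReal.ofReal ε) →
        ∃ (τ φ : Space m → ℝ) (D : ConeMetric m), IsSolution ⊤ γ τ φ D) ∧
    -- The remaining equations are solvable as long as `τ > 0`.
    (∀ (T T' : ℝ≥0∞) (γ : Space m → Form (Space m)) (τ : Space m → ℝ),
      0 < T' → T' ≤ T → IsFreeData T γ → IsExpansion T' γ τ →
        ∃ (φ : Space m → ℝ) (D : ConeMetric m), IsSolution T' γ τ φ D) ∧
    -- Uniqueness of `ν₀`, when `τ`, `φ`, `g̃ = φ² γ` are known.
    (∀ (T T' : ℝ≥0∞) (γ : Space m → Form (Space m)) (τ φ : Space m → ℝ) (D D' : ConeMetric m),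
      0 < T' → T' ≤ T → IsFreeData T γ →
        IsExpansion T' γ τ → IsConformalFactor T' γ τ φ →
        (∀ y ∈ cone m T', D.gt y = φ y ^ 2 • γ y) → (∀ y ∈ cone m T', D'.gt y = φ y ^ 2 • γ y) →
        IsNuZero T' τ D → IsNuZero T' τ D' → ∀ y ∈ cone m T', D.nu0 y = D'.nu0 y) ∧
    -- The constraint operators are those of the Einstein tensor, and the wave-gauge vector of a
    -- solution of the reduced equations satisfies homogeneous linear transport equations.
    (∀ (T : ℝ≥0∞) (U : Set (Spacetime m)) (g : Spacetime m → Form (Spacetime m))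
      (D : ConeMetric m), HasTrace T U g D → ∀ c : SphereChart m,
        Decomposition T g D c ∧ (ReducedEinsteinOnCone T g c → Transport T g D c)) ∧
    -- It vanishes on the cone when the constraints hold.
    (∀ (T : ℝ≥0∞) (U : Set (Spacetime m)) (g : Spacetime m → Form (Spacetime m))
      (D : ConeMetric m), HasTrace T U g D → (0 : Spacetime m) ∈ U → g 0 = minkowski m →
        D.SatisfiesConstraints T → (∀ c : SphereChart m, ReducedEinsteinOnCone T g c) →
        ∀ c : SphereChart m, c.OnCone T fun r x =>
          ∀ α, waveGauge (c.metric g) c.eta α (onC r x) = 0) := by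
  refine ⟨fun T γ hT hγ => ?_, fun K r₀ hr₀ => ?_, fun T T' γ τ hT hTT hγ hτ =>
    hτ.exists_solution hm hT hTT hγ, fun T T' γ τ φ D D' _ _ _ hτ _ hD hD' h h' =>
    h.unique hτ.pos (fun y hy => (hD y hy).trans (hD' y hy).symm) h',
    fun T U g D h c => ⟨h.decomposition c, h.transport c⟩,
    fun T U g D h h0 hη hC hR c => h.waveGauge_eq_zero h0 hη hm hC c (hR c)⟩
  · obtain ⟨T₀, h0, h1, τ, hτ⟩ := hγ.isVMetric.exists_expansion_local hm hT
    exact ⟨T₀, h0, h1, τ, hτ.exists_solution hm h0 h1 hγ⟩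
  · obtain ⟨ε, hε, h⟩ := exists_expansion_global hm K r₀ hr₀
    refine ⟨ε, hε, fun γ hγ hK hi => ?_⟩
    obtain ⟨τ, hτ⟩ := h γ hγ.isVMetric hK hi
    exact ⟨τ, hτ.exists_solution hm (by simp) le_rfl hγ⟩
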